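/- **Setting.** Let $\mathcal X\subset\mathbb R^d$ be finite with $|\mathcal X|\ge 2$. In rounds $t=1,\dots,T$ an environment generates a loss vector $(\ell_{t,x})_{x\in\mathcal X}\in[-1,1]^{\mathcal X}$, which may depend arbitrarily on the past, with $\mathbb E[\ell_{t,x}\mid\text{past}]=\langle x,\theta_t\rangle$ for some $\theta_t\in\mathbb R^d$ determined by the past. The learner draws $A_t\in\mathcal X$, with fresh randomness, and observes only $\ell_{t,A_t}$. The pseudo-regret against $u\in\mathcal X$ is $\mathrm{Reg}(u)=\mathbb E\big[\sum_{t=1}^T(\ell_{t,A_t}-\ell_{t,u})\big]$. The *corrupted stochastic regime* with $x^\star\in\mathcal X$, $\Delta>0$, $C_t\ge0$ and $C=\sum_{t\le T} C_t$ means that $\mathbb E[\ell_{t,x}-\ell_{t,x^\star}\mid\text{past}]\ge\Delta-C_t$ for all $t\le T$ and all $x\ne x^\star$. **EXP2** over a finite $\mathcal Y\subset\mathbb R^d$. A John exploration over $\mathcal Y$ is a distribution $\nu$ on $\mathcal Y$ with $a^\top(\mathbb E_{b\sim\nu}[bb^\top])^{-1}a\le\dim\operatorname{span}\mathcal Y$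 for all $a\in\mathcal Y$ (inverses are taken on $\operatorname{span}\mathcal Y$). In round $t$, given $q_t\in(0,1]$, put $$\eta_t=\min\Big\{\sqrt{\tfrac{\ln|\mathcal Y|}{d\sum_{\tau\le t}1/q_\tau}},\ \tfrac1{2d}\min_{\tau\le t}q_\tau\Big\},\quad P_t(a)\propto e^{-\eta_t\sum_{\tau<t}\hat\ell_\tau(a)},\quad p_t=\big(1-\tfrac{d\eta_t}{q_t}\big)P_t+\tfrac{d\eta_t}{q_t}\nu .$$ Draw $a_t\sim p_t$; with probability $q_t$ its loss $\ell_{t,a_t}$ is observed, and then $\hat\ell_t(a)=\frac1{q_t}a^\top(\mathbb E_{b\sim p_t}[bb^\top])^{-1}a_t\,\ell_{t,a_t}$; otherwise $\hat\ell_t=0$. An algorithm over $\mathcal Y$ is *$\frac12$-iw-stable* with constants $c_1,c_2$ if, for all such environments, all adaptively chosen $q_t\in(0,1]$, all bounded stopping times $t'$ and all $u\in\mathcal Y$, $\mathbb E\sum_{t\le t'}(\ell_{t,a_t}-\ell_{t,u})\le\mathbb E\big[\sqrt{c_1\sum_{t\le t'}1/q_t}+c_2/\min_{t\le t'}q_t\big]$.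 **Algorithm 2** (candidate $\hat x$, base algorithm $\mathcal B$ over $\mathcal X\setminus\{\hat x\}$, constants $c_1,c_2$). In its round $t$ let $\bar q_t$ minimize $\big\langle q,\sum_{\tau<t}z_\tau-(0,B_{t-1})\big\rangle-\frac2{\eta_t}\sum_{i=1}^2\sqrt{q_i}+\frac1\beta\sum_{i=1}^2\ln\frac1{q_i}$ over the two-point simplex, with $\eta_t=\frac1{\sqrt t+8\sqrt{c_1}}$ and $\beta=\frac1{8c_2}$, and let $q_t=(1-\frac1{2t^2})\bar q_t+\frac1{4t^2}\mathbf 1$. Draw $i_t\sim q_t$. If $i_t=1$, play $A_t=\hat x$; if $i_t=2$, play $A_t$ as drawn by $\mathcal B$. The base algorithm works under the weights $q_{t,2}$ and observes its loss exactly when $i_t=2$. Then $z_{t,i}=\frac{(\ell_{t,A_t}+1)\mathbb I\{i_t=i\}}{q_{t,i}}-1$, $B_0=0$, and $B_t=\sqrt{c_1\sum_{\tau\le t}1/q_{\tau,2}}+c_2/\min_{\tau\le t}q_{\tau,2}$. **Algorithm 1** (base algorithm $\mathcal A$ taking a candidate, constant $c_2'$). Let $T_1=0$, $T_0=-c_2'\log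 T$, and $\hat x_1$ uniform on $\mathcal X$. Epoch $k$ starts $\mathcal A$ afresh with candidate $\hat x_k$ and follows it in rounds $t=T_k+1,T_k+2,\dots$. As soon as $t-T_k\ge2(T_k-T_{k-1})$ and some $x\ne\hat x_k$ has been played in at least $\frac{t-T_k}2$ rounds of the epoch, set $\hat x_{k+1}=x$ (ties are broken by any fixed rule), $T_{k+1}=t$, and start epoch $k+1$. **Corollary.** There are universal constants $\kappa,\kappa',K>0$ such that for all $d$ and all finite $\mathcal X\subset\mathbb R^d$ with $|\mathcal X|\ge2$ the following holds. John explorations over $\mathcal X\setminus\{\hat x\}$ exist for every $\hat x\in\mathcal X$. For any choice of them, EXP2 over $\mathcal X\setminus\{\hat x\}$ is $\frac12$-iw-stable with constants $c_1=c_2=\kappa d\log|\mathcal X|$. For every horizon $T$, Algorithm 1 (with $c_2'=\kappa'd\log|\mathcal X|$) run on Algorithm 2 (with these $c_1,c_2$) run on EXP2 satisfies, in every environment as above and for all $u\in\mathcal X$, $$\mathrm{Reg}(u)\le K\sqrt{dT\log|\mathcal X|},$$ and, if $T\ge2$, simultaneously in every corrupted stochastic regime, $$\mathrm{Reg}(u)\le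 K\bigg(\frac{d\log|\mathcal X|\log T}{\Delta}+\sqrt{\frac{d\log|\mathcal X|\log T}{\Delta}\,C}\bigg).$$ -/

import Mathlib

open MeasureTheory
open scoped Classical

universe u

namespace BestOfBoth

noncomputable section

/-- The space `ℝ^d` of actions, with the Euclidean inner product. -/
abbrev Vec (d : ℕ) : Type := EuclideanSpace ℝ (Fin d)

/-! ### Algorithms as state machines -/

/-- A (randomized) algorithm working under importance weights. In each round it receives the update
probability `q`, proposes the distribution `dist s q` over actions, and then gets the feedback
`some (a, y)` (its action and the loss of that action), or `none` when nothing is observed. -/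
structure IWAlgorithm (α : Type) where
  State : Type
  start : State
  dist : State → ℝ → α → ℝ
  update : State → ℝ → Option (α × ℝ) → State

/-- A (randomized) bandit algorithm that in each round draws a pair consisting of an internal symbol
in `ι` and an action in `α` with probabilities `dist s i a`, and observes the loss of the action. -/
structure BanditAlgorithm (ι α : Type) where
  State : Type
  start : State
  dist : State → ι → α → ℝ
  update : State → ι → α → ℝ → State

/-- The state before round `t` (rounds are numbered `0, 1, 2, …`), given the sequences of weights
and of feedbacks. -/
def IWAlgorithm.stateAt {α : Type} (B : IWAlgorithm α) (q : ℕ → ℝ) (fb : ℕ → Option (α × ℝ)) :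
    ℕ → B.State
  | 0 => B.start
  | t + 1 => B.update (B.stateAt q fb t) (q t) (fb t)

/-- The state before round `t` (rounds are numbered `0, 1, 2, …`), given the sequences of internal
symbols, of actions, and of observed losses. -/
def BanditAlgorithm.stateAt {ι α : Type} (A : BanditAlgorithm ι α)
    (i : ℕ → ι) (a : ℕ → α) (y : ℕ → ℝ) : ℕ → A.State
  | 0 => A.start
  | t + 1 => A.update (A.stateAt i a y t) (i t) (a t) (y t)

/-! ### John's exploration and the EXP2 algorithm -/

/-- `ν` is a John exploration over the finite set `Y`: a probability distribution on `Y` such that,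
with `r` the dimension of the span of `Y` and `G = 𝔼_{b ∼ ν}[b bᵀ]`, the set `Y` lies in the
ellipsoid `{x | xᵀ G⁻¹ x ≤ r}` of `span Y`. (In terms of the support function `v ↦ √(r vᵀ G v)` of
the ellipsoid, `x` lies in it iff `⟨x, v⟩² ≤ r vᵀ G v` for all `v`. As the `ν`-average of `bᵀ G⁻¹ b`
is `r`, the distribution `ν` then lives on contact points: this is John's decomposition for the
smallest origin-centred ellipsoid containing `Y`.) -/
def IsJohnExploration {d : ℕ} (Y : Finset (Vec d)) (ν : Vec d → ℝ) : Prop :=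
  (∀ b ∈ Y, 0 ≤ ν b) ∧ (∀ b, b ∉ Y → ν b = 0) ∧ ∑ b ∈ Y, ν b = 1 ∧
    ∀ a ∈ Y, ∀ v : Vec d, inner ℝ a v ^ 2 ≤
      (Module.finrank ℝ (Submodule.span ℝ (Y : Set (Vec d))) : ℝ) *
        ∑ b ∈ Y, ν b * inner ℝ b v ^ 2

/-- The vector `𝔼_{b ∼ p}[b bᵀ] w`. -/
def secondMoment {d : ℕ} (Y : Finset (Vec d)) (p : Vec d → ℝ) (w : Vec d) : Vec d :=
  ∑ b ∈ Y, (p b * inner ℝ b w) • b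

/-- The number `aᵀ (𝔼_{b ∼ p}[b bᵀ])⁻¹ a'`, computed as `⟨a, w⟩` with `w` a solution of
`𝔼_{b ∼ p}[b bᵀ] w = a'`, so that it also makes sense when `Y` spans a proper subspace of `ℝ^d`
(the inverse is then taken on that subspace; see `invForm_eq`). -/
def invForm {d : ℕ} (Y : Finset (Vec d)) (p : Vec d → ℝ) (a a' : Vec d) : ℝ :=
  if h : ∃ w, secondMoment Y p w = a' then inner ℝ a h.choose else 0

lemma inner_secondMoment_comm {d : ℕ} (Y : Finset (Vec d)) (p : Vec d → ℝ) (v w : Vec d) :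
    inner ℝ (secondMoment Y p v) w = inner ℝ v (secondMoment Y p w) := by
  simp only [secondMoment, sum_inner, inner_sum, real_inner_smul_left, real_inner_smul_right]
  refine Finset.sum_congr rfl fun b _ => ?_
  rw [real_inner_comm v b]
  ring

/-- The value of `invForm` does not depend on the solution that is used. -/
lemma invForm_eq {d : ℕ} (Y : Finset (Vec d)) (p : Vec d → ℝ) (a a' v w : Vec d)
    (hv : secondMoment Y p v = a) (hw : secondMoment Y p w = a') :
    invForm Y p a a' = inner ℝ a w := by
  have h : ∃ w, secondMoment Y p w = a' := ⟨w, hw⟩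
  rw [invForm, dif_pos h, ← hv, inner_secondMoment_comm, inner_secondMoment_comm, h.choose_spec, hw]

/-- Memory of EXP2 before a round: the sum of the loss estimators, the sum of `1 / q`, and the
minimum of `q`, over the previous rounds. -/
structure Exp2State (d : ℕ) where
  est : Vec d → ℝ
  invSum : ℝ
  minQ : ℝ

/-- The adaptive learning rate `η_t` of EXP2, where `q` is the weight of the current round. -/
def exp2Rate {d : ℕ} (Y : Finset (Vec d)) (s : Exp2State d) (q : ℝ) : ℝ :=
  min (Real.sqrt (Real.log Y.card / (d * (s.invSum + 1 / q)))) (1 / (2 * d) * min s.minQ q)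

/-- The exponential weights `P_t`. -/
def exp2Weights {d : ℕ} (Y : Finset (Vec d)) (s : Exp2State d) (q : ℝ) (a : Vec d) : ℝ :=
  if a ∈ Y then
    Real.exp (-exp2Rate Y s q * s.est a) / ∑ b ∈ Y, Real.exp (-exp2Rate Y s q * s.est b)
  else 0

/-- The sampling distribution `p_t = (1 - d η_t / q_t) P_t + (d η_t / q_t) ν`. -/
def exp2Dist {d : ℕ} (Y : Finset (Vec d)) (ν : Vec d → ℝ) (s : Exp2State d) (q : ℝ)
    (a : Vec d) : ℝ :=
  (1 - d * exp2Rate Y s q / q) * exp2Weights Y s q a + d * exp2Rate Y s q / q * ν a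

/-- The loss estimator `ℓ̂_t`. -/
def exp2Estimator {d : ℕ} (Y : Finset (Vec d)) (ν : Vec d → ℝ) (s : Exp2State d) (q : ℝ)
    (fb : Option (Vec d × ℝ)) (a : Vec d) : ℝ :=
  match fb with
  | none => 0
  | some (a', y) => 1 / q * invForm Y (exp2Dist Y ν s q) a a' * y

/-- EXP2 with adaptive learning rate over the action set `Y`, with exploration distribution `ν`. -/
def exp2 {d : ℕ} (Y : Finset (Vec d)) (ν : Vec d → ℝ) : IWAlgorithm (Vec d) where
  State := Exp2State d
  start := { est := fun _ => 0, invSum := 0, minQ := 1 }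
  dist := exp2Dist Y ν
  update s q fb :=
    { est := fun a => s.est a + exp2Estimator Y ν s q fb a
      invSum := s.invSum + 1 / q
      minQ := min s.minQ q }

/-! ### The Corral-type algorithm, run on a candidate action and a base algorithm -/

/-- Memory of the Corral-type algorithm before a round: the number of previous rounds, the sum of
the vectors `z`, the sum of `1 / q₂` and the minimum of `q₂` over the previous rounds, and the state
of the base algorithm. The two arms are `0` (the candidate) and `1` (the base algorithm). -/
structure CorralState {α : Type} (B : IWAlgorithm α) where
  n : ℕ
  Z : Fin 2 → ℝ
  invSum : ℝ
  minQ : ℝ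
  base : B.State

/-- The bonus `B_{t-1}`, which is `0` before the first round. -/
def CorralState.bonus {α : Type} {B : IWAlgorithm α} (c₁ c₂ : ℝ) (s : CorralState B) : ℝ :=
  if s.n = 0 then 0 else Real.sqrt (c₁ * s.invSum) + c₂ / s.minQ

/-- The objective of the FTRL step of the current round `t = s.n + 1`, with
`η_t = 1 / (√t + 8 √c₁)` and `β = 1 / (8 c₂)`. -/
def CorralState.objective {α : Type} {B : IWAlgorithm α} (c₁ c₂ : ℝ) (s : CorralState B)
    (q : Fin 2 → ℝ) : ℝ :=
  let η : ℝ := 1 / (Real.sqrt (s.n + 1) + 8 * Real.sqrt c₁)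
  let β : ℝ := 1 / (8 * c₂)
  q 0 * s.Z 0 + q 1 * (s.Z 1 - s.bonus c₁ c₂)
    + (-(2 / η) * ∑ i, Real.sqrt (q i) + 1 / β * ∑ i, Real.log (1 / q i))

/-- The two-point simplex, without its end points, where the log-barrier is infinite. -/
def openSimplex : Set (Fin 2 → ℝ) := {q | q ∈ stdSimplex ℝ (Fin 2) ∧ ∀ i, 0 < q i}

/-- The minimizer `q̄_t` of the FTRL objective. -/
def CorralState.qbar {α : Type} {B : IWAlgorithm α} (c₁ c₂ : ℝ) (s : CorralState B) : Fin 2 → ℝ :=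
  Classical.epsilon fun q => q ∈ openSimplex ∧ IsMinOn (s.objective c₁ c₂) openSimplex q

/-- The sampling distribution `q_t = (1 - 1 / (2 t²)) q̄_t + 1 / (4 t²)`, with `t = s.n + 1`. -/
def CorralState.q {α : Type} {B : IWAlgorithm α} (c₁ c₂ : ℝ) (s : CorralState B) (i : Fin 2) : ℝ :=
  (1 - 1 / (2 * ((s.n : ℝ) + 1) ^ 2)) * s.qbar c₁ c₂ i + 1 / (4 * ((s.n : ℝ) + 1) ^ 2)

/-- The Corral-type algorithm with candidate action `x`, base algorithm `B` and constants
`c₁, c₂`. The arm is drawn from `q_t`; arm `0` plays `x`, and arm `1` plays an action drawn by the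
base algorithm, which works under the weights `q_{t,2}` and observes the loss of its action exactly
when arm `1` is drawn. -/
def corral {α : Type} (x : α) (B : IWAlgorithm α) (c₁ c₂ : ℝ) : BanditAlgorithm (Fin 2) α where
  State := CorralState B
  start := { n := 0, Z := fun _ => 0, invSum := 0, minQ := 1, base := B.start }
  dist s i a :=
    if i = 0 then (if a = x then s.q c₁ c₂ 0 else 0)
    else s.q c₁ c₂ 1 * B.dist s.base (s.q c₁ c₂ 1) a
  update s i a y :=
    { n := s.n + 1
      Z := fun j => s.Z j + ((y + 1) * (if i = j then 1 else 0) / s.q c₁ c₂ j - 1)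
      invSum := s.invSum + 1 / s.q c₁ c₂ 1
      minQ := min s.minQ (s.q c₁ c₂ 1)
      base := B.update s.base (s.q c₁ c₂ 1) (if i = 1 then some (a, y) else none) }

/-! ### The epoch algorithm, which restarts a base algorithm with new candidate actions -/

/-- Memory of the epoch algorithm before a round: the candidate of the current epoch, the length of
the previous epoch, the number of rounds played and the counts of the actions in the current epoch,
and the state of the base algorithm. -/
structure EpochState {ι α : Type} (A : α → BanditAlgorithm ι α) where
  cand : α
  prevLen : ℝ
  n : ℕ
  count : α → ℕ
  base : (A cand).State

/-- The beginning of an epoch. -/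
def EpochState.fresh {ι α : Type} (A : α → BanditAlgorithm ι α) (x : α) (prevLen : ℝ) :
    EpochState A :=
  { cand := x, prevLen := prevLen, n := 0, count := fun _ => 0, base := (A x).start }

/-- One more round in the current epoch. -/
def EpochState.advance {ι α : Type} {A : α → BanditAlgorithm ι α} (s : EpochState A)
    (i : ι) (a : α) (y : ℝ) : EpochState A :=
  { cand := s.cand
    prevLen := s.prevLen
    n := s.n + 1
    count := fun x => s.count x + (if a = x then 1 else 0)
    base := (A s.cand).update s.base i a y }

/-- The actions, other than the candidate, that were played in at least half of the rounds of the
current epoch. -/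
def EpochState.frequent {ι α : Type} {A : α → BanditAlgorithm ι α} (X : Finset α)
    (s : EpochState A) : Finset α :=
  (X.erase s.cand).filter fun x => (s.n : ℝ) / 2 ≤ (s.count x : ℝ)

/-- The epoch algorithm over the action set `X` with base algorithm `A`, first candidate `x₁` and
`T₁ - T₀ = len₀`; the function `sel` picks the new candidate among the actions that qualify. -/
def epochAlgorithm {ι α : Type} (X : Finset α) (A : α → BanditAlgorithm ι α) (sel : Finset α → α)
    (len₀ : ℝ) (x₁ : α) : BanditAlgorithm ι α where
  State := EpochState A
  start := EpochState.fresh A x₁ len₀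
  dist s i a := (A s.cand).dist s.base i a
  update s i a y :=
    let s' := s.advance i a y
    if 2 * s'.prevLen ≤ (s'.n : ℝ) ∧ (s'.frequent X).Nonempty then
      EpochState.fresh A (sel (s'.frequent X)) (s'.n : ℝ)
    else s'

/-- The cascade of the three algorithms over the action set `X ⊆ ℝ^d` with first candidate `x₁`: the
epoch algorithm, run on the Corral-type algorithm with constants `c₁ = c₂ = c`, run on EXP2 over
`X \ {x̂}`. Here `ν x̂` is the exploration distribution over `X \ {x̂}` and `len₀ = -T₀`. -/
def cascade {d : ℕ} (X : Finset (Vec d)) (ν : Vec d → Vec d → ℝ) (c len₀ : ℝ)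
    (sel : Finset (Vec d) → Vec d) (x₁ : Vec d) : BanditAlgorithm (Fin 2) (Vec d) :=
  epochAlgorithm X (fun x => corral x (exp2 (X.erase x) (ν x)) c c) sel len₀ x₁

/-! ### Environments and interaction -/

/-- A linear bandit environment over `X` for `T` rounds, numbered `0, …, T - 1`. The σ-algebra `ℱ t`
is the history before round `t`, and `𝒢 t` also contains the loss vector of round `t` (but not the
action of that round). Losses lie in `[-1, 1]` and are linear in the action in conditional mean
given the history; they may depend on the history in an arbitrary way. -/
structure IsLinearEnvironment {d : ℕ} {Ω : Type u} [mΩ : MeasurableSpace Ω] (μ : Measure Ω)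
    (X : Finset (Vec d)) (T : ℕ) (ℱ 𝒢 : Filtration ℕ mΩ) (loss : ℕ → Ω → Vec d → ℝ) : Prop where
  le_env : ∀ t, ℱ t ≤ 𝒢 t
  env_le : ∀ t, 𝒢 t ≤ ℱ (t + 1)
  measurable : ∀ t < T, ∀ x ∈ X, Measurable[𝒢 t] fun ω => loss t ω x
  bounded : ∀ t < T, ∀ x ∈ X, ∀ ω, loss t ω x ∈ Set.Icc (-1 : ℝ) 1
  linear : ∀ t < T, ∃ θ : Ω → Vec d, ∀ x ∈ X,
    μ[fun ω => loss t ω x | ℱ t] =ᵐ[μ] fun ω => inner ℝ x (θ ω)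

/-- The interaction of a bandit algorithm with an environment for `T` rounds. The algorithm `alg x₁`
depends on a uniformly distributed first candidate `x₁ ∈ X`; in round `t` the internal symbol `i t`
and the action `a t` are drawn with the probabilities prescribed by the algorithm, given
everything that happened before, including the choice of the loss vector of that round. -/
structure IsInteraction {d : ℕ} {ι : Type} {Ω : Type u} [mΩ : MeasurableSpace Ω] (μ : Measure Ω)
    (X : Finset (Vec d)) (T : ℕ) (ℱ 𝒢 : Filtration ℕ mΩ) (loss : ℕ → Ω → Vec d → ℝ)
    (alg : Vec d → BanditAlgorithm ι (Vec d)) (x₁ : Ω → Vec d) (i : ℕ → Ω → ι)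
    (a : ℕ → Ω → Vec d) : Prop where
  first_measurable : Measurable[ℱ 0] x₁
  first_uniform : ∀ x ∈ X, μ {ω | x₁ ω = x} = (X.card : ENNReal)⁻¹
  first_mem : ∀ ω, x₁ ω ∈ X
  symbol_measurable : ∀ t < T, ∀ j, MeasurableSet[ℱ (t + 1)] {ω | i t ω = j}
  action_measurable : ∀ t < T, Measurable[ℱ (t + 1)] (a t)
  action_mem : ∀ t < T, ∀ ω, a t ω ∈ X
  law : ∀ t < T, ∀ j : ι, ∀ x ∈ X,
    μ[Set.indicator {ω | i t ω = j ∧ a t ω = x} (fun _ => (1 : ℝ)) | 𝒢 t] =ᵐ[μ] fun ω =>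
      (alg (x₁ ω)).dist
        ((alg (x₁ ω)).stateAt (fun s => i s ω) (fun s => a s ω) (fun s => loss s ω (a s ω)) t) j x

/-- The pseudo-regret after `T` rounds against the fixed action `u`. -/
def pseudoRegret {d : ℕ} {Ω : Type u} [MeasurableSpace Ω] (μ : Measure Ω) (T : ℕ)
    (loss : ℕ → Ω → Vec d → ℝ) (a : ℕ → Ω → Vec d) (u : Vec d) : ℝ :=
  ∫ ω, ∑ t ∈ Finset.range T, (loss t ω (a t ω) - loss t ω u) ∂μ

/-- The corrupted stochastic regime with best action `xs`, gap `Δ` and corruptions `C t`. -/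
def IsCorruptedStochastic {d : ℕ} {Ω : Type u} [mΩ : MeasurableSpace Ω] (μ : Measure Ω)
    (X : Finset (Vec d)) (T : ℕ) (ℱ : Filtration ℕ mΩ) (loss : ℕ → Ω → Vec d → ℝ)
    (xs : Vec d) (Δ : ℝ) (C : ℕ → ℝ) : Prop :=
  xs ∈ X ∧ 0 < Δ ∧ (∀ t < T, 0 ≤ C t) ∧
    ∀ t < T, ∀ x ∈ X, x ≠ xs →
      (fun _ => Δ - C t) ≤ᵐ[μ] μ[fun ω => loss t ω x - loss t ω xs | ℱ t]

/-- The interaction of an algorithm `B` over `Y` with an environment under adaptive weights `q t`: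
`q t ∈ (0, 1]` may depend on the history, the action `a t` is drawn from the distribution of the
algorithm, and independently of it the feedback is observed (`upd t = true`) with probability
`q t`. -/
structure IsWeightedInteraction {d : ℕ} {Ω : Type u} [mΩ : MeasurableSpace Ω] (μ : Measure Ω)
    (Y : Finset (Vec d)) (T : ℕ) (ℱ 𝒢 : Filtration ℕ mΩ) (loss : ℕ → Ω → Vec d → ℝ)
    (B : IWAlgorithm (Vec d)) (q : ℕ → Ω → ℝ) (upd : ℕ → Ω → Bool) (a : ℕ → Ω → Vec d) :
    Prop where
  weight_measurable : ∀ t < T, Measurable[ℱ t] (q t)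
  weight_mem : ∀ t < T, ∀ ω, q t ω ∈ Set.Ioc (0 : ℝ) 1
  upd_measurable : ∀ t < T, Measurable[ℱ (t + 1)] (upd t)
  action_measurable : ∀ t < T, Measurable[ℱ (t + 1)] (a t)
  action_mem : ∀ t < T, ∀ ω, a t ω ∈ Y
  law : ∀ t < T, ∀ b : Bool, ∀ x ∈ Y,
    μ[Set.indicator {ω | upd t ω = b ∧ a t ω = x} (fun _ => (1 : ℝ)) | 𝒢 t] =ᵐ[μ] fun ω =>
      (if b then q t ω else 1 - q t ω) *
        B.dist
          (B.stateAt (fun s => q s ω)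
            (fun s => if upd s ω then some (a s ω, loss s ω (a s ω)) else none) t)
          (q t ω) x

/-- `B` is `1/2`-iw-stable over `Y` (for linear bandits) with constants `c₁, c₂`: for adaptive
weights, its pseudo-regret up to any (bounded) stopping time `τ` is at most
`𝔼[√(c₁ ∑_{t ≤ τ} 1 / q_t) + c₂ / min_{t ≤ τ} q_t]`. The right-hand side may be infinite. With
rounds numbered from `0`, the rounds up to `τ` are those with index smaller than `τ`. -/
def IWStable {d : ℕ} (Y : Finset (Vec d)) (B : IWAlgorithm (Vec d)) (c₁ c₂ : ℝ) : Prop :=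
  ∀ (Ω : Type u) [mΩ : MeasurableSpace Ω] (μ : Measure Ω) [IsProbabilityMeasure μ]
    (T : ℕ) (ℱ 𝒢 : Filtration ℕ mΩ) (loss : ℕ → Ω → Vec d → ℝ)
    (q : ℕ → Ω → ℝ) (upd : ℕ → Ω → Bool) (a : ℕ → Ω → Vec d),
    IsLinearEnvironment μ Y T ℱ 𝒢 loss →
    IsWeightedInteraction μ Y T ℱ 𝒢 loss B q upd a →
    ∀ τ : Ω → ℕ, (∀ ω, τ ω ≤ T) → (∀ n, MeasurableSet[ℱ n] {ω | τ ω ≤ n}) →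
    ∀ u ∈ Y,
      ENNReal.ofReal (∫ ω, ∑ t ∈ Finset.range (τ ω), (loss t ω (a t ω) - loss t ω u) ∂μ) ≤
        ∫⁻ ω, ENNReal.ofReal
          (Real.sqrt (c₁ * ∑ t ∈ Finset.range (τ ω), 1 / q t ω) +
            c₂ / ⨅ t : Fin (τ ω), q t ω) ∂μ

end

end BestOfBoth

open BestOfBoth

/-!
Three facts combine.

*EXP2 is stable under importance weights.* A design that maximises the determinant of the second
moment is a John exploration (`exists_isJohnExploration`). The exponential weights potential with
learning rates `η_t` that decrease along the history bounds the regret pathwise by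
`log |Y| / η + ∑ η_t 𝔼 ℓ̂_t²`; the exploration keeps `η_t |ℓ̂_t|` at most one, and the conditional
second moment of the estimators is at most `d / q_t`, a trace. This gives
`StoppedExp2Run.regret_le` as long as the weights stay away from `0`. General weights are reached by
stopping when they first fall below a threshold, and letting the threshold tend to `0`
(`iwStable_exp2`).

*The Corral-type algorithm.* As there are two arms, the FTRL step minimises a function of one
variable, the probability `p` of the base algorithm. Comparing with the minimiser round by round
(Tsallis entropy for the random losses, logarithmic barrier for the bonuses) yields pathwise
bounds. Against a comparator that follows the base algorithm, the bonus collected by the algorithm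
cancels the stability bound of EXP2, so that a run of `L` rounds has regret of order `√(c L) + c`
against every action (`StoppedCorralRun.regret_le`). Against the candidate itself, the regret
is only of order `√(c Q log T) + c log T`, with `Q` the total probability with which the base
algorithm is followed (`StoppedCorralRun.regret_cand_le`). Both bounds are stated as sums of costs
of rounds up to a stopping time, because the epochs have random lengths.

*The epochs.* The candidates and the lengths of the epochs are functions of the first candidate and
of the actions alone. For each starting time `s` and candidate `x`, the epoch with these data is a
run of the Corral-type algorithm up to a stopping time (`IsCascadeRun.toCorralRun`), so that
regrets can be added up over all pairs `(s, x)` (`IsCascadeRun.integral_le_of_epochs`). As lengths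
at least double from one complete epoch to the next, the costs `√(length)` of all epochs add up to
order `√(c T)` (`epoch_cost_le`), which is the first bound. For the second one, let `N` be the
number of rounds in which `xs` is not played, and `Γ = c log T`. An epoch with another candidate
either misses `xs` in half of its rounds or ends soon, so that its length is of order `N + Γ`; an
epoch with candidate `xs` misses it exactly when the base algorithm is followed. Hence the regret
is of order `Γ + √(Γ (Γ + 𝔼 N))` (`sum_roundCost_le`, `IsCascadeRun.pseudoRegret_le_misses`).
Conversely the regret against `xs` is at least `Δ 𝔼 N - C` (`IsCascadeRun.gap_mul_misses_le`), and
the two inequalities bound it by the order of `Γ / Δ + √(Γ C / Δ)` (`self_bounding`).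
-/

namespace BestOfBoth

noncomputable section

/-! ### Second-moment operators -/

/-- `w ↦ 𝔼_{b ∼ p}[b bᵀ] w` as a linear map. -/
def momentMap {d : ℕ} (Y : Finset (Vec d)) (p : Vec d → ℝ) : Vec d →ₗ[ℝ] Vec d where
  toFun := secondMoment Y p
  map_add' v w := by
    simp only [secondMoment, inner_add_right, mul_add, add_smul, Finset.sum_add_distrib]
  map_smul' c w := by
    simp only [secondMoment, inner_smul_right, Finset.smul_sum, smul_smul, RingHom.id_apply]
    exact Finset.sum_congr rfl fun _ _ => by congr 1; ring

lemma momentMap_eq_sum {d : ℕ} (Y : Finset (Vec d)) (p : Vec d → ℝ) :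
    momentMap Y p = ∑ b ∈ Y, p b • momentMap {b} 1 := by
  ext1 w
  rw [LinearMap.sum_apply]
  refine Finset.sum_congr rfl fun b _ => ?_
  change _ = p b • secondMoment _ _ _
  simp [secondMoment, smul_smul]

/-- The orthogonal projection onto the complement of `span Y`. -/
def coProj {d : ℕ} (Y : Finset (Vec d)) : Vec d →ₗ[ℝ] Vec d :=
  ((Submodule.span ℝ (Y : Set (Vec d)))ᗮ.starProjection : Vec d →L[ℝ] Vec d)

/-- The second-moment operator, made invertible on all of `ℝ^d` by adding the orthogonal projection
onto the complement of `span Y`. Its inverse agrees with the inverse of the second moment on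
`span Y`. -/
def regMoment {d : ℕ} (Y : Finset (Vec d)) (p : Vec d → ℝ) : Vec d →ₗ[ℝ] Vec d :=
  momentMap Y p + coProj Y

lemma regMoment_apply {d : ℕ} (Y : Finset (Vec d)) (p : Vec d → ℝ) (w : Vec d) :
    regMoment Y p w = secondMoment Y p w + coProj Y w := rfl

lemma secondMoment_mem_span {d : ℕ} (Y : Finset (Vec d)) (p : Vec d → ℝ) (w : Vec d) :
    secondMoment Y p w ∈ Submodule.span ℝ (Y : Set (Vec d)) :=
  Submodule.sum_mem _ fun _ hb => Submodule.smul_mem _ _ (Submodule.subset_span hb)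

lemma inner_secondMoment {d : ℕ} (Y : Finset (Vec d)) (p : Vec d → ℝ) (v w : Vec d) :
    inner ℝ v (secondMoment Y p w) = ∑ b ∈ Y, p b * inner ℝ b v * inner ℝ b w := by
  simp only [secondMoment, inner_sum, real_inner_smul_right]
  refine Finset.sum_congr rfl fun b _ => ?_
  rw [real_inner_comm v b]
  ring

lemma coProj_eq_zero {d : ℕ} {Y : Finset (Vec d)} {w : Vec d}
    (hw : w ∈ Submodule.span ℝ (Y : Set (Vec d))) : coProj Y w = 0 := by
  simp only [coProj, ContinuousLinearMap.coe_coe]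
  rw [Submodule.starProjection_apply_eq_zero_iff]
  exact Submodule.le_orthogonal_orthogonal _ hw

lemma coProj_idem {d : ℕ} (Y : Finset (Vec d)) (w : Vec d) :
    coProj Y (coProj Y w) = coProj Y w := by
  simp only [coProj, ContinuousLinearMap.coe_coe]
  exact Submodule.starProjection_eq_self_iff.2 (Submodule.starProjection_apply_mem _ _)

lemma secondMoment_of_regMoment {d : ℕ} {Y : Finset (Vec d)} {p : Vec d → ℝ} {a w : Vec d}
    (ha : a ∈ Submodule.span ℝ (Y : Set (Vec d))) (hw : regMoment Y p w = a) :
    secondMoment Y p w = a := by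
  have h := congrArg (coProj Y) hw
  rw [regMoment_apply, map_add, coProj_eq_zero (secondMoment_mem_span Y p w), coProj_idem,
    coProj_eq_zero ha, zero_add] at h
  rw [regMoment_apply, h, add_zero] at hw
  exact hw

lemma regMoment_injective {d : ℕ} {Y : Finset (Vec d)} {p : Vec d → ℝ} (hp : ∀ b ∈ Y, 0 < p b) :
    Function.Injective (regMoment Y p) := by
  rw [← LinearMap.ker_eq_bot, LinearMap.ker_eq_bot']
  intro w hw
  have h0 : secondMoment Y p w = 0 :=
    secondMoment_of_regMoment (Submodule.zero_mem _) hw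
  have h1 : coProj Y w = 0 := by rw [regMoment_apply, h0, zero_add] at hw; exact hw
  have h2 : ∑ b ∈ Y, p b * inner ℝ b w * inner ℝ b w = 0 := by
    rw [← inner_secondMoment, h0, inner_zero_right]
  rw [Finset.sum_eq_zero_iff_of_nonneg
    (fun b hb => by rw [mul_assoc]; exact mul_nonneg (hp b hb).le (mul_self_nonneg _))] at h2
  have h3 : w ∈ (Submodule.span ℝ (Y : Set (Vec d)))ᗮ := by
    rw [Submodule.mem_orthogonal]
    intro v hv
    induction hv using Submodule.span_induction with
    | mem b hb =>
      have := h2 b hb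
      rw [mul_assoc, mul_eq_zero, mul_self_eq_zero] at this
      exact this.resolve_left (hp b hb).ne'
    | zero => exact inner_zero_left _
    | add x y _ _ hx hy => rw [inner_add_left, hx, hy, add_zero]
    | smul c x _ hx => rw [inner_smul_left, hx, mul_zero]
  have h4 : coProj Y w = w := by
    simp only [coProj, ContinuousLinearMap.coe_coe]
    exact Submodule.starProjection_eq_self_iff.2 h3
  rw [← h4, h1]

/-- The inverse of the regularised second-moment operator (junk if it is not injective). -/
def regInv {d : ℕ} (Y : Finset (Vec d)) (p : Vec d → ℝ) : Vec d →ₗ[ℝ] Vec d :=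
  Matrix.toLin (EuclideanSpace.basisFun (Fin d) ℝ).toBasis
    (EuclideanSpace.basisFun (Fin d) ℝ).toBasis
    (LinearMap.toMatrix (EuclideanSpace.basisFun (Fin d) ℝ).toBasis
      (EuclideanSpace.basisFun (Fin d) ℝ).toBasis (regMoment Y p))⁻¹

lemma regMoment_comp_regInv {d : ℕ} {Y : Finset (Vec d)} {p : Vec d → ℝ}
    (h : Function.Injective (regMoment Y p)) : regMoment Y p ∘ₗ regInv Y p = LinearMap.id := by
  set B := (EuclideanSpace.basisFun (Fin d) ℝ).toBasis
  have hu : IsUnit (LinearMap.toMatrix B B (regMoment Y p)).det := by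
    rw [LinearMap.det_toMatrix]
    exact LinearMap.isUnit_det _ ((LinearMap.isUnit_iff_ker_eq_bot _).2 (LinearMap.ker_eq_bot.2 h))
  have : regMoment Y p = Matrix.toLin B B (LinearMap.toMatrix B B (regMoment Y p)) :=
    (Matrix.toLin_toMatrix _ _ _).symm
  rw [regInv]
  nth_rewrite 1 [this]
  rw [← Matrix.toLin_mul, Matrix.mul_nonsing_inv _ hu, Matrix.toLin_one]

lemma regInv_comp_regMoment {d : ℕ} {Y : Finset (Vec d)} {p : Vec d → ℝ}
    (h : Function.Injective (regMoment Y p)) : regInv Y p ∘ₗ regMoment Y p = LinearMap.id :=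
  by
  have h1 := regMoment_comp_regInv h
  rw [← Module.End.mul_eq_comp] at h1 ⊢
  exact mul_eq_one_comm.1 h1

lemma secondMoment_regInv {d : ℕ} {Y : Finset (Vec d)} {p : Vec d → ℝ}
    (h : Function.Injective (regMoment Y p)) {a : Vec d}
    (ha : a ∈ Submodule.span ℝ (Y : Set (Vec d))) : secondMoment Y p (regInv Y p a) = a :=
  secondMoment_of_regMoment ha (LinearMap.congr_fun (regMoment_comp_regInv h) a)

lemma invForm_eq_regInv {d : ℕ} {Y : Finset (Vec d)} {p : Vec d → ℝ}
    (h : Function.Injective (regMoment Y p)) {a a' : Vec d}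
    (ha : a ∈ Submodule.span ℝ (Y : Set (Vec d))) (ha' : a' ∈ Submodule.span ℝ (Y : Set (Vec d))) :
    invForm Y p a a' = inner ℝ a (regInv Y p a') :=
  invForm_eq Y p a a' _ _ (secondMoment_regInv h ha) (secondMoment_regInv h ha')

lemma invForm_eq_inner_left {d : ℕ} {Y : Finset (Vec d)} {p : Vec d → ℝ}
    (h : Function.Injective (regMoment Y p)) {a a' : Vec d}
    (ha : a ∈ Submodule.span ℝ (Y : Set (Vec d))) (ha' : a' ∈ Submodule.span ℝ (Y : Set (Vec d))) :
    invForm Y p a a' = inner ℝ a' (regInv Y p a) := by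
  rw [invForm_eq_regInv h ha ha']
  conv_lhs => rw [← secondMoment_regInv h ha]
  rw [inner_secondMoment_comm, secondMoment_regInv h ha', real_inner_comm]

lemma mem_span_of_mem {d : ℕ} {Y : Finset (Vec d)} {a : Vec d} (ha : a ∈ Y) :
    a ∈ Submodule.span ℝ (Y : Set (Vec d)) := Submodule.subset_span ha

/-- The estimator built from `invForm` is unbiased for linear functions. -/
lemma sum_mul_invForm_mul_inner {d : ℕ} {Y : Finset (Vec d)} {p : Vec d → ℝ}
    (h : Function.Injective (regMoment Y p)) {a : Vec d} (ha : a ∈ Y) (θ : Vec d) :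
    ∑ b ∈ Y, p b * invForm Y p a b * inner ℝ b θ = inner ℝ a θ := by
  have h1 := inner_secondMoment Y p (regInv Y p a) θ
  rw [← inner_secondMoment_comm, secondMoment_regInv h (mem_span_of_mem ha)] at h1
  rw [h1]
  exact Finset.sum_congr rfl fun b hb => by
    rw [invForm_eq_inner_left h (mem_span_of_mem ha) (mem_span_of_mem hb)]

lemma sum_mul_invForm_sq {d : ℕ} {Y : Finset (Vec d)} {p : Vec d → ℝ}
    (h : Function.Injective (regMoment Y p)) {a : Vec d} (ha : a ∈ Y) :
    ∑ b ∈ Y, p b * invForm Y p a b ^ 2 = invForm Y p a a := by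
  rw [invForm_eq_inner_left h (mem_span_of_mem ha) (mem_span_of_mem ha),
    ← sum_mul_invForm_mul_inner h ha]
  exact Finset.sum_congr rfl fun b hb => by
    rw [invForm_eq_inner_left h (mem_span_of_mem ha) (mem_span_of_mem hb)]; ring

lemma trace_coProj {d : ℕ} (Y : Finset (Vec d)) :
    LinearMap.trace ℝ (Vec d) (coProj Y) =
      d - Module.finrank ℝ (Submodule.span ℝ (Y : Set (Vec d))) := by
  have h : LinearMap.IsProj (Submodule.span ℝ (Y : Set (Vec d)))ᗮ (coProj Y) :=
    ⟨fun x => Submodule.starProjection_apply_mem _ _,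
      fun x hx => Submodule.starProjection_eq_self_iff.2 hx⟩
  rw [LinearMap.IsProj.trace h]
  have := Submodule.finrank_add_finrank_orthogonal (Submodule.span ℝ (Y : Set (Vec d)))
  rw [finrank_euclideanSpace_fin] at this
  have h2 : (Module.finrank ℝ (Submodule.span ℝ (Y : Set (Vec d))) : ℝ) +
      Module.finrank ℝ (Submodule.span ℝ (Y : Set (Vec d)))ᗮ = d := by exact_mod_cast this
  linarith

lemma trace_comp_momentMap {d : ℕ} (Y : Finset (Vec d)) (p : Vec d → ℝ) (H : Vec d →ₗ[ℝ] Vec d) :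
    LinearMap.trace ℝ (Vec d) (H ∘ₗ momentMap Y p) = ∑ b ∈ Y, p b * inner ℝ b (H b) := by
  rw [LinearMap.trace_eq_sum_inner _ (EuclideanSpace.basisFun (Fin d) ℝ)]
  simp only [LinearMap.comp_apply]
  have : ∀ w, momentMap Y p w = ∑ b ∈ Y, (p b * inner ℝ b w) • b := fun w => rfl
  simp only [this, map_sum, map_smul, inner_sum, inner_smul_right]
  rw [Finset.sum_comm]
  refine Finset.sum_congr rfl fun b _ => ?_
  rw [← OrthonormalBasis.sum_inner_mul_inner (EuclideanSpace.basisFun (Fin d) ℝ) b (H b),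
    Finset.mul_sum]
  exact Finset.sum_congr rfl fun i _ => by ring

/-- The trace identity `𝔼_{a ∼ p}[aᵀ G⁻¹ a] = dim span Y`. -/
lemma sum_mul_invForm_self {d : ℕ} {Y : Finset (Vec d)} {p : Vec d → ℝ}
    (h : Function.Injective (regMoment Y p)) :
    ∑ a ∈ Y, p a * invForm Y p a a =
      Module.finrank ℝ (Submodule.span ℝ (Y : Set (Vec d))) := by
  have h1 : regInv Y p ∘ₗ coProj Y = coProj Y := by
    ext1 w
    have h2 : regMoment Y p (coProj Y w) = coProj Y w := by
      rw [regMoment_apply, coProj_idem, add_eq_right]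
      refine Finset.sum_eq_zero fun b hb => ?_
      have : inner ℝ b (coProj Y w) = 0 :=
        (Submodule.mem_orthogonal _ _).1
          (Submodule.starProjection_apply_mem (Submodule.span ℝ (Y : Set (Vec d)))ᗮ w) b
          (Submodule.subset_span hb)
      rw [this, mul_zero, zero_smul]
    have h3 := LinearMap.congr_fun (regInv_comp_regMoment h) (coProj Y w)
    simp only [LinearMap.comp_apply, h2, LinearMap.id_apply] at h3 ⊢
    exact h3
  have h2 : regInv Y p ∘ₗ momentMap Y p = LinearMap.id - coProj Y := by
    rw [eq_sub_iff_add_eq, ← regInv_comp_regMoment h]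
    conv_lhs => arg 2; rw [← h1]
    rw [← LinearMap.comp_add]; rfl
  have h3 := trace_comp_momentMap Y p (regInv Y p)
  rw [h2, map_sub, trace_coProj, LinearMap.trace_id, finrank_euclideanSpace_fin] at h3
  rw [show (Module.finrank ℝ (Submodule.span ℝ (Y : Set (Vec d))) : ℝ) = (d : ℝ) -
    (d - Module.finrank ℝ (Submodule.span ℝ (Y : Set (Vec d)))) by ring, h3]
  exact Finset.sum_congr rfl fun a ha => by
    rw [invForm_eq_regInv h (mem_span_of_mem ha) (mem_span_of_mem ha)]

lemma finrank_span_le {d : ℕ} (Y : Finset (Vec d)) :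
    (Module.finrank ℝ (Submodule.span ℝ (Y : Set (Vec d))) : ℝ) ≤ d := by
  have := Submodule.finrank_le (Submodule.span ℝ (Y : Set (Vec d)))
  rw [finrank_euclideanSpace_fin] at this
  exact_mod_cast this

lemma invForm_self_nonneg {d : ℕ} {Y : Finset (Vec d)} {p : Vec d → ℝ}
    (h : Function.Injective (regMoment Y p)) (hp : ∀ b ∈ Y, 0 ≤ p b) {a : Vec d} (ha : a ∈ Y) :
    0 ≤ invForm Y p a a := by
  rw [← sum_mul_invForm_sq h ha]
  exact Finset.sum_nonneg fun b hb => mul_nonneg (hp b hb) (sq_nonneg _)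

/-- If `p` dominates `lam` times a John exploration, then the leverage scores are at most
`d / lam`. -/
lemma invForm_self_le {d : ℕ} {Y : Finset (Vec d)} {p ν : Vec d → ℝ} {lam : ℝ}
    (h : Function.Injective (regMoment Y p)) (hν : IsJohnExploration Y ν) (hlam : 0 < lam)
    (hp : ∀ b ∈ Y, lam * ν b ≤ p b) {a : Vec d} (ha : a ∈ Y) :
    invForm Y p a a ≤ d / lam := by
  set w := regInv Y p a
  have hw : invForm Y p a a = inner ℝ a w :=
    invForm_eq_regInv h (mem_span_of_mem ha) (mem_span_of_mem ha)
  have hw' : inner ℝ a w = ∑ b ∈ Y, p b * inner ℝ b w ^ 2 := by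
    conv_lhs => rw [← secondMoment_regInv h (mem_span_of_mem ha)]
    rw [inner_secondMoment_comm, inner_secondMoment]
    exact Finset.sum_congr rfl fun b _ => by ring
  have h1 := hν.2.2.2 a ha w
  have h2 : ∑ b ∈ Y, ν b * inner ℝ b w ^ 2 ≤ inner ℝ a w / lam := by
    rw [le_div_iff₀ hlam, hw', Finset.sum_mul]
    exact Finset.sum_le_sum fun b hb => by nlinarith [hp b hb, sq_nonneg (inner ℝ b w)]
  have h3 : 0 ≤ ∑ b ∈ Y, ν b * inner ℝ b w ^ 2 :=
    Finset.sum_nonneg fun b hb => mul_nonneg (hν.1 b hb) (sq_nonneg _)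
  have h4 : 0 ≤ inner ℝ a w := by
    have := h3.trans h2
    rwa [le_div_iff₀ hlam, zero_mul] at this
  have h5 : (inner ℝ a w) ^ 2 ≤ d * (inner ℝ a w / lam) :=
    h1.trans ((mul_le_mul_of_nonneg_right (finrank_span_le Y) h3).trans
      (mul_le_mul_of_nonneg_left h2 (Nat.cast_nonneg d)))
  rw [hw]
  rcases h4.eq_or_lt with h6 | h6
  · rw [← h6]; positivity
  · rw [← mul_le_mul_iff_left₀ h6]
    calc inner ℝ a w * inner ℝ a w = (inner ℝ a w) ^ 2 := by ring
      _ ≤ _ := h5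
      _ = _ := by ring

lemma abs_invForm_le {d : ℕ} {Y : Finset (Vec d)} {p : Vec d → ℝ} {C : ℝ}
    (h : Function.Injective (regMoment Y p)) (hp : ∀ b ∈ Y, 0 ≤ p b)
    (hC : ∀ a ∈ Y, invForm Y p a a ≤ C) {a a' : Vec d} (ha : a ∈ Y) (ha' : a' ∈ Y) :
    |invForm Y p a a'| ≤ C := by
  have key : ∀ x ∈ Y, ∀ y ∈ Y, invForm Y p x y =
      ∑ b ∈ Y, p b * invForm Y p x b * invForm Y p y b := by
    intro x hx y hy
    rw [invForm_eq_inner_left h (mem_span_of_mem hx) (mem_span_of_mem hy),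
      ← sum_mul_invForm_mul_inner h hy]
    exact Finset.sum_congr rfl fun b hb => by
      rw [← invForm_eq_inner_left h (mem_span_of_mem hx) (mem_span_of_mem hb)]; ring
  have h1 := hC a ha
  have h2 := hC a' ha'
  rw [← sum_mul_invForm_sq h ha] at h1
  rw [← sum_mul_invForm_sq h ha'] at h2
  have h3 : |invForm Y p a a'| ≤
      ∑ b ∈ Y, (p b * invForm Y p a b ^ 2 / 2 + p b * invForm Y p a' b ^ 2 / 2) := by
    rw [key a ha a' ha']
    refine (Finset.abs_sum_le_sum_abs _ _).trans (Finset.sum_le_sum fun b hb => ?_)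
    have hb := hp b hb
    rw [abs_le]
    constructor <;>
    nlinarith [mul_nonneg hb (sq_nonneg (invForm Y p a b + invForm Y p a' b)),
      mul_nonneg hb (sq_nonneg (invForm Y p a b - invForm Y p a' b))]
  rw [Finset.sum_add_distrib, ← Finset.sum_div, ← Finset.sum_div] at h3
  linarith

/-! ### Existence of John explorations -/

/-- John explorations exist: a distribution that maximises the determinant of the second moment
is one, since moving mass towards a point `a ∈ Y` changes the logarithm of the determinant at rate
`aᵀ G⁻¹ a - dim span Y`. -/
theorem exists_isJohnExploration {d : ℕ} {Y : Finset (Vec d)} (hY : Y.Nonempty) :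
    ∃ ν, IsJohnExploration Y ν := by
  set B := (EuclideanSpace.basisFun (Fin d) ℝ).toBasis with hB
  -- a distribution on `Y`, extended by zero
  let ext : (Y → ℝ) → Vec d → ℝ := fun x b => if h : b ∈ Y then x ⟨b, h⟩ else 0
  have ext_mem : ∀ x (b : Y), ext x b = x b := fun x b => by simp [ext]
  let f : (Y → ℝ) → ℝ := fun x => |LinearMap.det (regMoment Y (ext x))|
  have hmat : ∀ x, LinearMap.toMatrix B B (regMoment Y (ext x)) =
      ∑ b : Y, x b • LinearMap.toMatrix B B (momentMap {(b : Vec d)} 1) +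
        LinearMap.toMatrix B B (coProj Y) := by
    intro x
    rw [regMoment, map_add, momentMap_eq_sum, ← Finset.sum_coe_sort Y, map_sum]
    simp only [map_smul, ext_mem]
  have hcont : Continuous f := by
    have : f = fun x => |(∑ b : Y, x b • LinearMap.toMatrix B B (momentMap {(b : Vec d)} 1) +
        LinearMap.toMatrix B B (coProj Y)).det| := by
      funext x
      rw [← hmat, LinearMap.det_toMatrix]
    rw [this]
    exact (Continuous.matrix_det (by fun_prop)).abs
  have : Nonempty Y := hY.to_subtype
  have hc : (fun _ => (Fintype.card Y : ℝ)⁻¹) ∈ stdSimplex ℝ Y :=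
    ⟨fun _ => by positivity, by
      rw [Finset.sum_const, nsmul_eq_mul, Finset.card_univ]
      exact mul_inv_cancel₀ (Nat.cast_ne_zero.2 Fintype.card_ne_zero)⟩
  obtain ⟨x, hx, hmax⟩ := (isCompact_stdSimplex ℝ Y).exists_isMaxOn
    ⟨_, hc⟩ hcont.continuousOn
  have hpos : 0 < f x := by
    refine lt_of_lt_of_le ?_ (hmax hc)
    refine abs_pos.2 (LinearMap.isUnit_det _ ((LinearMap.isUnit_iff_ker_eq_bot _).2
      (LinearMap.ker_eq_bot.2 (regMoment_injective fun b hb => ?_)))).ne_zero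
    simp only [ext, dif_pos hb]
    positivity
  set ν := ext x with hν
  have hdet : LinearMap.det (regMoment Y ν) ≠ 0 := abs_pos.1 hpos
  have hinj : Function.Injective (regMoment Y ν) := by
    rw [← LinearMap.ker_eq_bot]
    by_contra hk
    refine hdet ?_
    by_contra hd
    exact hk ((LinearMap.isUnit_iff_ker_eq_bot _).1 ((LinearMap.isUnit_iff_isUnit_det _).2
      (isUnit_iff_ne_zero.2 hd)))
  have hν0 : ∀ b ∈ Y, 0 ≤ ν b := fun b hb => by
    have := hx.1 ⟨b, hb⟩
    rwa [← ext_mem x ⟨b, hb⟩] at this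
  have key : ∀ a ∈ Y, invForm Y ν a a ≤
      Module.finrank ℝ (Submodule.span ℝ (Y : Set (Vec d))) := by
    intro a ha
    set M : Vec d →ₗ[ℝ] Vec d := regInv Y ν ∘ₗ (momentMap {a} 1 - momentMap Y ν) with hM
    have htr : LinearMap.trace ℝ (Vec d) M = invForm Y ν a a -
        Module.finrank ℝ (Submodule.span ℝ (Y : Set (Vec d))) := by
      rw [hM, LinearMap.comp_sub, map_sub, trace_comp_momentMap, trace_comp_momentMap,
        ← sum_mul_invForm_self hinj]
      congr 1
      · simp [invForm_eq_regInv hinj (mem_span_of_mem ha) (mem_span_of_mem ha)]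
      · exact Finset.sum_congr rfl fun b hb => by
          rw [invForm_eq_regInv hinj (mem_span_of_mem hb) (mem_span_of_mem hb)]
    obtain ⟨P, hP⟩ : ∃ P : Polynomial ℝ, ∀ t : ℝ,
        LinearMap.det (1 + t • M) = 1 + LinearMap.trace ℝ (Vec d) M * t + P.eval t * t ^ 2 := by
      refine ⟨(Matrix.det (1 + (Polynomial.X : Polynomial ℝ) •
        (LinearMap.toMatrix B B M).map Polynomial.C)).divX.divX, fun t => ?_⟩
      rw [← LinearMap.det_toMatrix B, map_add, map_smul, LinearMap.toMatrix_one,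
        Matrix.det_one_add_smul, LinearMap.trace_eq_matrix_trace ℝ B]
    have hle : ∀ t ∈ Set.Ioc (0 : ℝ) 1, LinearMap.trace ℝ (Vec d) M + P.eval t * t ≤ 0 := by
      intro t ht
      let xt : Y → ℝ := (1 - t) • x + t • Pi.single ⟨a, ha⟩ 1
      have hxt : xt ∈ stdSimplex ℝ Y :=
        convex_stdSimplex ℝ Y hx (single_mem_stdSimplex ℝ _) (by linarith [ht.2]) ht.1.le (by ring)
      have hN : regMoment Y (ext xt) = regMoment Y ν ∘ₗ (1 + t • M) := by
        have h1 : regMoment Y ν ∘ₗ M = momentMap {a} 1 - momentMap Y ν := by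
          rw [hM, ← LinearMap.comp_assoc, regMoment_comp_regInv hinj, LinearMap.id_comp]
        have h2 : regMoment Y ν ∘ₗ (1 + t • M) =
            regMoment Y ν + t • (momentMap {a} 1 - momentMap Y ν) := by
          rw [LinearMap.comp_add, LinearMap.comp_smul, h1]; rfl
        rw [h2]
        apply (LinearMap.toMatrix B B).injective
        rw [map_add, map_smul, map_sub, hν, hmat, hmat]
        have h3 : LinearMap.toMatrix B B (momentMap Y (ext x)) =
            ∑ b : Y, x b • LinearMap.toMatrix B B (momentMap {(b : Vec d)} 1) := by
          have := hmat x
          rwa [regMoment, map_add, add_left_inj] at this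
        rw [h3]
        have h4 : ∀ b, xt b = x b - t * x b + t * (Pi.single ⟨a, ha⟩ 1 : Y → ℝ) b := fun b => by
          simp only [xt, Pi.add_apply, Pi.smul_apply, smul_eq_mul]; ring
        simp only [h4, add_smul, Finset.sum_add_distrib, sub_smul, Finset.sum_sub_distrib, smul_sub,
          Finset.smul_sum, smul_smul]
        rw [Finset.sum_eq_single (a := (⟨a, ha⟩ : Y))
          (f := fun b : Y => (t * (Pi.single ⟨a, ha⟩ 1 : Y → ℝ) b) •
            LinearMap.toMatrix B B (momentMap {(b : Vec d)} 1))
          (fun b _ hb => by rw [Pi.single_eq_of_ne hb, mul_zero, zero_smul]) (by simp)]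
        simp only [Pi.single_eq_same, mul_one]
        abel
      have h4 : f xt ≤ f x := hmax hxt
      simp only [f] at h4 hpos
      rw [hN, LinearMap.det_comp, abs_mul, mul_le_iff_le_one_right hpos, hP] at h4
      have h5 := (abs_le.1 h4).2
      have h6 : (LinearMap.trace ℝ (Vec d) M + P.eval t * t) * t ≤ 0 := by nlinarith
      exact nonpos_of_mul_nonpos_left h6 ht.1
    have hlim : Filter.Tendsto (fun t : ℝ => LinearMap.trace ℝ (Vec d) M + P.eval t * t)
        (nhdsWithin 0 (Set.Ioi 0)) (nhds (LinearMap.trace ℝ (Vec d) M + P.eval 0 * 0)) :=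
      ((continuous_const.add (P.continuous.mul continuous_id)).tendsto 0).mono_left
        nhdsWithin_le_nhds
    have := le_of_tendsto hlim
      (Filter.mem_of_superset (Ioc_mem_nhdsGT one_pos) fun t ht => hle t ht)
    rw [mul_zero, add_zero, htr] at this
    linarith
  refine ⟨ν, hν0, fun b hb => by simp [hν, ext, hb], ?_, fun a ha v => ?_⟩
  · rw [← Finset.sum_coe_sort Y, ← hx.2]
    exact Finset.sum_congr rfl fun b _ => ext_mem x b
  · set w := regInv Y ν a
    have h1 : inner ℝ a v = ∑ b ∈ Y, ν b * inner ℝ b w * inner ℝ b v := by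
      conv_lhs => rw [← secondMoment_regInv hinj (mem_span_of_mem ha)]
      rw [inner_secondMoment_comm, inner_secondMoment]
    have h2 : invForm Y ν a a = ∑ b ∈ Y, ν b * inner ℝ b w ^ 2 := by
      rw [← sum_mul_invForm_sq hinj ha]
      exact Finset.sum_congr rfl fun b hb => by
        rw [invForm_eq_inner_left hinj (mem_span_of_mem ha) (mem_span_of_mem hb)]
    have h3 : (inner ℝ a v) ^ 2 ≤ (∑ b ∈ Y, ν b * inner ℝ b w ^ 2) *
        ∑ b ∈ Y, ν b * inner ℝ b v ^ 2 := by
      rw [h1]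
      refine Finset.sum_sq_le_sum_mul_sum_of_sq_le_mul Y
        (fun b hb => mul_nonneg (hν0 b hb) (sq_nonneg _))
        (fun b hb => mul_nonneg (hν0 b hb) (sq_nonneg _)) fun b _ => le_of_eq (by ring)
    refine h3.trans (mul_le_mul_of_nonneg_right (h2 ▸ key a ha)
      (Finset.sum_nonneg fun b hb => mul_nonneg (hν0 b hb) (sq_nonneg _)))

/-- `invForm` depends measurably on the weights. -/
lemma measurable_invForm {d : ℕ} {Ω : Type u} {m : MeasurableSpace Ω} {Y : Finset (Vec d)}
    {p : Ω → Vec d → ℝ} (hp : ∀ ω, ∀ b ∈ Y, 0 < p ω b) (hm : ∀ b ∈ Y, Measurable fun ω => p ω b)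
    {a : Vec d} (ha : a ∈ Y) (a' : Vec d) : Measurable fun ω => invForm Y (p ω) a a' := by
  by_cases ha' : a' ∈ Submodule.span ℝ (Y : Set (Vec d))
  · set B := (EuclideanSpace.basisFun (Fin d) ℝ).toBasis with hB
    have h1 : ∀ ω, invForm Y (p ω) a a' = ∑ i, a i *
        ((LinearMap.toMatrix B B (regMoment Y (p ω)))⁻¹.mulVec a') i := by
      intro ω
      rw [invForm_eq_regInv (regMoment_injective (hp ω)) (mem_span_of_mem ha) ha', regInv,
        PiLp.inner_apply]
      refine Finset.sum_congr rfl fun i _ => ?_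
      rw [RCLike.inner_apply, conj_trivial, mul_comm]
      congr 1
    have h2 : ∀ i j, Measurable fun ω => LinearMap.toMatrix B B (regMoment Y (p ω)) i j := by
      intro i j
      have : ∀ ω, LinearMap.toMatrix B B (regMoment Y (p ω)) i j =
          ∑ b ∈ Y, p ω b * LinearMap.toMatrix B B (momentMap {b} 1) i j +
            LinearMap.toMatrix B B (coProj Y) i j := fun ω => by
        rw [regMoment, map_add, momentMap_eq_sum, map_sum, Matrix.add_apply, Matrix.sum_apply]
        simp only [map_smul, Matrix.smul_apply, smul_eq_mul]
      simp only [this]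
      exact (Finset.measurable_fun_sum _ fun b hb => (hm b hb).mul_const _).add_const _
    have hdet : ∀ N : Ω → Matrix (Fin d) (Fin d) ℝ, (∀ i j, Measurable fun ω => N ω i j) →
        Measurable fun ω => (N ω).det := by
      intro N hN
      simp only [Matrix.det_apply]
      exact Finset.measurable_fun_sum _ fun σ _ =>
        (Finset.measurable_fun_prod _ fun i _ => hN _ _).const_smul _
    simp only [h1, Matrix.inv_def, Ring.inverse_eq_inv', Matrix.mulVec, dotProduct,
      Matrix.smul_apply, smul_eq_mul, Matrix.adjugate_apply]
    refine Finset.measurable_fun_sum _ fun i _ => Measurable.const_mul ?_ _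
    refine Finset.measurable_fun_sum _ fun j _ => Measurable.mul_const ?_ _
    refine (hdet _ h2).inv.mul (hdet _ fun k l => ?_)
    by_cases hk : k = j
    · subst hk
      simp only [Matrix.updateRow_self, measurable_const]
    · simp only [Matrix.updateRow_ne hk]
      exact h2 k l
  · have h1 : ∀ ω, invForm Y (p ω) a a' = 0 := fun ω => by
      rw [invForm, dif_neg]
      rintro ⟨w, hw⟩
      exact ha' (hw ▸ secondMoment_mem_span _ _ _)
    simp only [h1, measurable_const]

/-! ### Exponential weights with decreasing learning rates -/

/-- The normalised log-partition function, the potential of exponential weights. -/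
def expPotential {α : Type*} (Y : Finset α) (η : ℝ) (L : α → ℝ) : ℝ :=
  1 / η * Real.log ((∑ a ∈ Y, Real.exp (-η * L a)) / Y.card)

lemma sum_exp_pos {α : Type*} {Y : Finset α} (hY : Y.Nonempty) (f : α → ℝ) :
    0 < ∑ a ∈ Y, Real.exp (f a) :=
  Finset.sum_pos (fun _ _ => Real.exp_pos _) hY

/-- Monotonicity in the learning rate: this is the power mean inequality. -/
lemma expPotential_mono {α : Type*} {Y : Finset α} (hY : Y.Nonempty) {η' η : ℝ} (h' : 0 < η')
    (h : η' ≤ η) (L : α → ℝ) : expPotential Y η' L ≤ expPotential Y η L := by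
  have hc : (0 : ℝ) < Y.card := by exact_mod_cast hY.card_pos
  have hη : 0 < η := h'.trans_le h
  have h1 := Real.rpow_arith_mean_le_arith_mean_rpow Y (fun _ => (Y.card : ℝ)⁻¹)
    (fun a => Real.exp (-η' * L a)) (fun _ _ => by positivity)
    (by rw [Finset.sum_const, nsmul_eq_mul, mul_inv_cancel₀ hc.ne'])
    (fun _ _ => (Real.exp_pos _).le) (p := η / η') ((one_le_div h').2 h)
  have h2 : ∀ a, Real.exp (-η' * L a) ^ (η / η') = Real.exp (-η * L a) := fun a => by
    rw [← Real.exp_mul]; congr 1; field_simp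
  simp only [h2, ← Finset.mul_sum] at h1
  have hS' := sum_exp_pos hY fun a => -η' * L a
  have hS := sum_exp_pos hY fun a => -η * L a
  have h3 := Real.log_le_log (by positivity) h1
  rw [Real.log_rpow (by positivity)] at h3
  unfold expPotential
  have hdiv : ∀ S : ℝ, S / Y.card = (Y.card : ℝ)⁻¹ * S := fun S => div_eq_inv_mul _ _
  rw [hdiv, hdiv]
  calc 1 / η' * Real.log ((Y.card : ℝ)⁻¹ * ∑ a ∈ Y, Real.exp (-η' * L a))
      = 1 / η * (η / η' * Real.log ((Y.card : ℝ)⁻¹ * ∑ a ∈ Y, Real.exp (-η' * L a))) := by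
        field_simp
    _ ≤ _ := mul_le_mul_of_nonneg_left h3 (by positivity)

/-- One step of exponential weights, by `e^{-z} ≤ 1 - z + z²` for `|z| ≤ 1`. -/
lemma expPotential_step {α : Type*} {Y : Finset α} (hY : Y.Nonempty) {η : ℝ} (hη : 0 < η)
    (L g : α → ℝ) (hg : ∀ a ∈ Y, |η * g a| ≤ 1) :
    expPotential Y η (fun a => L a + g a) ≤ expPotential Y η L -
      ∑ a ∈ Y, Real.exp (-η * L a) / (∑ b ∈ Y, Real.exp (-η * L b)) * g a +
      η * ∑ a ∈ Y, Real.exp (-η * L a) / (∑ b ∈ Y, Real.exp (-η * L b)) * g a ^ 2 := by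
  set S := ∑ b ∈ Y, Real.exp (-η * L b) with hSdef
  have hS : 0 < S := sum_exp_pos hY _
  have hc : (0 : ℝ) < Y.card := by exact_mod_cast hY.card_pos
  set m := ∑ a ∈ Y, Real.exp (-η * L a) / S * g a with hm
  set v := ∑ a ∈ Y, Real.exp (-η * L a) / S * g a ^ 2 with hv
  have h1 : ∑ a ∈ Y, Real.exp (-η * (L a + g a)) ≤ S * (1 + (-η * m + η ^ 2 * v)) := by
    have : S * (1 + (-η * m + η ^ 2 * v)) =
        ∑ a ∈ Y, Real.exp (-η * L a) * (1 + -(η * g a) + (η * g a) ^ 2) := by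
      have e1 : S * m = ∑ a ∈ Y, Real.exp (-η * L a) * g a := by
        rw [hm, Finset.mul_sum]
        exact Finset.sum_congr rfl fun a _ => by field_simp
      have e2 : S * v = ∑ a ∈ Y, Real.exp (-η * L a) * g a ^ 2 := by
        rw [hv, Finset.mul_sum]
        exact Finset.sum_congr rfl fun a _ => by field_simp
      calc S * (1 + (-η * m + η ^ 2 * v)) = S - η * (S * m) + η ^ 2 * (S * v) := by ring
        _ = _ := by
          rw [e1, e2, hSdef, Finset.mul_sum, Finset.mul_sum, ← Finset.sum_sub_distrib,
            ← Finset.sum_add_distrib]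
          exact Finset.sum_congr rfl fun a _ => by ring
    rw [this]
    refine Finset.sum_le_sum fun a ha => ?_
    rw [mul_add, Real.exp_add]
    refine mul_le_mul_of_nonneg_left ?_ (Real.exp_pos _).le
    have h2 := Real.abs_exp_sub_one_sub_id_le (x := -(η * g a)) (by rw [abs_neg]; exact hg a ha)
    have h3 := (abs_le.1 h2).2
    rw [neg_mul]
    nlinarith
  have h2 : ∑ a ∈ Y, Real.exp (-η * (L a + g a)) ≤ S * Real.exp (-η * m + η ^ 2 * v) :=
    h1.trans (mul_le_mul_of_nonneg_left
      (by linarith [Real.add_one_le_exp (-η * m + η ^ 2 * v)]) hS.le)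
  have hS2 := sum_exp_pos hY fun a => -η * (L a + g a)
  have h3 := Real.log_le_log (div_pos hS2 hc) (div_le_div_of_nonneg_right h2 hc.le)
  rw [mul_div_right_comm, Real.log_mul (by positivity) (Real.exp_ne_zero _), Real.log_exp] at h3
  change 1 / η * _ ≤ 1 / η * Real.log (S / Y.card) - m + η * v
  have h4 := mul_le_mul_of_nonneg_left h3 (show 0 ≤ 1 / η by positivity)
  refine h4.trans (le_of_eq ?_)
  field_simp
  ring

/-- The regret bound of exponential weights with nonincreasing learning rates. -/
lemma expWeights_regret {α : Type*} {Y : Finset α} (η : ℕ → ℝ) (L g : ℕ → α → ℝ) (n : ℕ)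
    (hη : ∀ t ≤ n, 0 < η t) (hanti : ∀ t < n, η (t + 1) ≤ η t)
    (hL0 : ∀ a, L 0 a = 0) (hL : ∀ t ≤ n, ∀ a, L (t + 1) a = L t a + g t a)
    (hg : ∀ t ≤ n, ∀ a ∈ Y, |η t * g t a| ≤ 1) {u : α} (hu : u ∈ Y) :
    ∑ t ∈ Finset.range (n + 1),
      (∑ a ∈ Y, Real.exp (-η t * L t a) / (∑ b ∈ Y, Real.exp (-η t * L t b)) * g t a - g t u -
        η t * ∑ a ∈ Y, Real.exp (-η t * L t a) / (∑ b ∈ Y, Real.exp (-η t * L t b)) * g t a ^ 2)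
      ≤ Real.log Y.card / η n := by
  have hY : Y.Nonempty := ⟨u, hu⟩
  have hc : (0 : ℝ) < Y.card := by exact_mod_cast hY.card_pos
  have hLu : ∀ m ≤ n + 1, L m u = ∑ t ∈ Finset.range m, g t u := by
    intro m
    induction m with
    | zero => intro _; simp [hL0]
    | succ k ih => intro hk; rw [hL k (by omega), Finset.sum_range_succ, ih (by omega)]
  have key : ∀ m ≤ n, ∑ t ∈ Finset.range (m + 1),
      (∑ a ∈ Y, Real.exp (-η t * L t a) / (∑ b ∈ Y, Real.exp (-η t * L t b)) * g t a -
        η t * ∑ a ∈ Y, Real.exp (-η t * L t a) / (∑ b ∈ Y, Real.exp (-η t * L t b)) * g t a ^ 2)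
      ≤ -expPotential Y (η m) (L (m + 1)) := by
    intro m
    induction m with
    | zero =>
      intro _
      have h1 := expPotential_step hY (hη 0 (by omega)) (L 0) (g 0) (hg 0 (by omega))
      have h2 : expPotential Y (η 0) (L 0) = 0 := by
        simp [expPotential, hL0, hc.ne']
      have h3 : L (0 + 1) = fun a => L 0 a + g 0 a := funext fun a => hL 0 (by omega) a
      rw [Finset.sum_range_one, h3]
      linarith
    | succ k ih =>
      intro hk
      have h1 := expPotential_step hY (hη (k + 1) hk) (L (k + 1)) (g (k + 1)) (hg (k + 1) hk)
      have h2 := expPotential_mono hY (hη (k + 1) hk) (hanti k (by omega)) (L (k + 1))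
      have h3 : L (k + 1 + 1) = fun a => L (k + 1) a + g (k + 1) a :=
        funext fun a => hL (k + 1) (by omega) a
      have h4 := ih (by omega)
      rw [Finset.sum_range_succ, h3]
      linarith
  have h1 := key n le_rfl
  have h2 : -expPotential Y (η n) (L (n + 1)) ≤ L (n + 1) u + Real.log Y.card / η n := by
    have h3 : Real.exp (-η n * L (n + 1) u) / Y.card ≤
        (∑ a ∈ Y, Real.exp (-η n * L (n + 1) a)) / Y.card :=
      div_le_div_of_nonneg_right (Finset.single_le_sum (f := fun a => Real.exp (-η n * L (n + 1) a))
        (fun _ _ => (Real.exp_pos _).le) hu) hc.le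
    have h4 := Real.log_le_log (by positivity) h3
    rw [Real.log_div (Real.exp_ne_zero _) hc.ne', Real.log_exp] at h4
    have hn := hη n le_rfl
    have h5 := mul_le_mul_of_nonneg_left h4 (show 0 ≤ 1 / η n by positivity)
    have h6 : 1 / η n * (-η n * L (n + 1) u - Real.log Y.card) =
        -(L (n + 1) u) - Real.log Y.card / η n := by field_simp
    rw [h6] at h5
    unfold expPotential
    linarith
  rw [hLu (n + 1) le_rfl] at h2
  have h7 : ∀ t, ∑ a ∈ Y, Real.exp (-η t * L t a) / (∑ b ∈ Y, Real.exp (-η t * L t b)) * g t a -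
      g t u - η t * ∑ a ∈ Y,
        Real.exp (-η t * L t a) / (∑ b ∈ Y, Real.exp (-η t * L t b)) * g t a ^ 2 =
      (∑ a ∈ Y, Real.exp (-η t * L t a) / (∑ b ∈ Y, Real.exp (-η t * L t b)) * g t a -
        η t * ∑ a ∈ Y,
          Real.exp (-η t * L t a) / (∑ b ∈ Y, Real.exp (-η t * L t b)) * g t a ^ 2) - g t u :=
    fun t => by ring
  rw [Finset.sum_congr rfl fun t _ => h7 t, Finset.sum_sub_distrib]
  linarith

/-- The increment of the square root, from below. -/
lemma div_sqrt_add_le {S x : ℝ} (hS : 0 ≤ S) (hx : 0 ≤ x) :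
    x / Real.sqrt (S + x) ≤ 2 * (Real.sqrt (S + x) - Real.sqrt S) := by
  rcases hx.eq_or_lt with rfl | hx
  · simp
  have h1 : 0 < Real.sqrt (S + x) := Real.sqrt_pos.2 (by linarith)
  rw [div_le_iff₀ h1]
  have h2 := Real.mul_self_sqrt (show 0 ≤ S + x by linarith)
  have h3 := Real.mul_self_sqrt hS
  nlinarith [sq_nonneg (Real.sqrt (S + x) - Real.sqrt S)]

/-! ### EXP2 along a fixed sequence of weights and feedbacks -/

/-- The invariants of the EXP2 memory: `1 / q`-sums are nonnegative, minima lie in `(0, 1]`. -/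
def Exp2State.Valid {d : ℕ} (s : Exp2State d) : Prop := 0 ≤ s.invSum ∧ 0 < s.minQ ∧ s.minQ ≤ 1

lemma exp2_stateAt_valid {d : ℕ} (Y : Finset (Vec d)) (ν : Vec d → ℝ) (q : ℕ → ℝ)
    (fb : ℕ → Option (Vec d × ℝ)) (n : ℕ) (hq : ∀ t < n, q t ∈ Set.Ioc (0 : ℝ) 1) :
    Exp2State.Valid ((exp2 Y ν).stateAt q fb n : Exp2State d) := by
  induction n with
  | zero => exact ⟨le_rfl, one_pos, le_rfl⟩
  | succ n ih =>
    obtain ⟨h1, h2, h3⟩ := ih fun t ht => hq t (by omega)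
    have := hq n (by omega)
    exact ⟨add_nonneg h1 (one_div_nonneg.2 this.1.le), lt_min h2 this.1, (min_le_left _ _).trans h3⟩

section Rate

variable {d : ℕ} {Y : Finset (Vec d)} {ν : Vec d → ℝ} {s : Exp2State d} {q : ℝ}

lemma dim_pos_of_two_le_card (hY : 2 ≤ Y.card) : 0 < d := by
  rcases Nat.eq_zero_or_pos d with rfl | h
  · have : Y.card ≤ 1 := Finset.card_le_one_of_subsingleton Y
    omega
  · exact h

lemma log_card_pos {α : Type*} {Y : Finset α} (hY : 2 ≤ Y.card) : 0 < Real.log Y.card :=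
  Real.log_pos (by exact_mod_cast hY)

lemma exp2Rate_pos (hY : 2 ≤ Y.card) (hs : s.Valid) (hq : 0 < q) : 0 < exp2Rate Y s q := by
  have hd : (0 : ℝ) < d := by exact_mod_cast dim_pos_of_two_le_card hY
  have h1 := log_card_pos hY
  have h2 := hs.1
  have h3 : 0 < min s.minQ q := lt_min hs.2.1 hq
  unfold exp2Rate
  refine lt_min (Real.sqrt_pos.2 ?_) ?_ <;> positivity

lemma exp2Rate_nonneg (hs : s.Valid) (hq : 0 < q) : 0 ≤ exp2Rate Y s q := by
  have h3 : 0 < min s.minQ q := lt_min hs.2.1 hq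
  exact le_min (Real.sqrt_nonneg _) (by positivity)

/-- The exploration probability `d η / q` is at most one half. -/
lemma exp2_mix_le (hq : 0 < q) : d * exp2Rate Y s q / q ≤ 1 / 2 := by
  rw [div_le_iff₀ hq]
  rcases Nat.eq_zero_or_pos d with h | hd
  · have h' : (d : ℝ) = 0 := by exact_mod_cast h
    rw [h', zero_mul]; positivity
  have hd : (0 : ℝ) < d := by exact_mod_cast hd
  have h1 : exp2Rate Y s q ≤ 1 / (2 * d) * q :=
    (min_le_right _ _).trans (mul_le_mul_of_nonneg_left (min_le_right _ _) (by positivity))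
  calc d * exp2Rate Y s q ≤ d * (1 / (2 * d) * q) := mul_le_mul_of_nonneg_left h1 hd.le
    _ = 1 / 2 * q := by field_simp

lemma exp2_mix_nonneg (hs : s.Valid) (hq : 0 < q) : 0 ≤ d * exp2Rate Y s q / q := by
  have := exp2Rate_nonneg (Y := Y) hs hq
  positivity

/-- By the first term of the minimum that defines the learning rate, the exploration
probabilities are dominated by the increments of a root. -/
lemma exp2_mix_le_sqrt (hY : 2 ≤ Y.card) (hs : s.Valid) (hq : 0 < q) :
    d * exp2Rate Y s q / q ≤ 2 * (Real.sqrt (d * Real.log Y.card * (s.invSum + 1 / q)) -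
      Real.sqrt (d * Real.log Y.card * s.invSum)) := by
  have hd : (0 : ℝ) < d := by exact_mod_cast dim_pos_of_two_le_card hY
  have hl := log_card_pos hY
  have hS : 0 < s.invSum + 1 / q := by have := hs.1; positivity
  have h1 : exp2Rate Y s q ≤ Real.sqrt (Real.log Y.card / (d * (s.invSum + 1 / q))) :=
    min_le_left _ _
  have h2 : d * Real.sqrt (Real.log Y.card / (d * (s.invSum + 1 / q))) =
      Real.sqrt (d * Real.log Y.card) / Real.sqrt (s.invSum + 1 / q) := by
    rw [← Real.sqrt_div (by positivity)]
    nth_rewrite 1 [← Real.sqrt_sq hd.le]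
    rw [← Real.sqrt_mul (by positivity)]
    congr 1
    field_simp
  have hD : 0 ≤ d * Real.log Y.card := by positivity
  rw [Real.sqrt_mul hD, Real.sqrt_mul hD]
  calc d * exp2Rate Y s q / q
      ≤ d * Real.sqrt (Real.log Y.card / (d * (s.invSum + 1 / q))) / q := by gcongr
    _ = Real.sqrt (d * Real.log Y.card) * (1 / q / Real.sqrt (s.invSum + 1 / q)) := by
        rw [h2]; field_simp
    _ ≤ Real.sqrt (d * Real.log Y.card) *
        (2 * (Real.sqrt (s.invSum + 1 / q) - Real.sqrt s.invSum)) :=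
        mul_le_mul_of_nonneg_left (div_sqrt_add_le hs.1 (by positivity)) (Real.sqrt_nonneg _)
    _ = _ := by ring

lemma log_card_div_exp2Rate_le (hY : 2 ≤ Y.card) (hs : s.Valid) (hq : 0 < q) :
    Real.log Y.card / exp2Rate Y s q ≤
      Real.sqrt (d * Real.log Y.card * (s.invSum + 1 / q)) +
        2 * (d * Real.log Y.card) / min s.minQ q := by
  have hd : (0 : ℝ) < d := by exact_mod_cast dim_pos_of_two_le_card hY
  have hl := log_card_pos hY
  have hS : 0 < s.invSum + 1 / q := by have := hs.1; positivity
  have hm : 0 < min s.minQ q := lt_min hs.2.1 hq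
  rcases min_choice (Real.sqrt (Real.log Y.card / (d * (s.invSum + 1 / q))))
    (1 / (2 * d) * min s.minQ q) with h | h
  · rw [exp2Rate, h]
    have : Real.log Y.card / Real.sqrt (Real.log Y.card / (d * (s.invSum + 1 / q))) =
        Real.sqrt (d * Real.log Y.card * (s.invSum + 1 / q)) := by
      nth_rewrite 1 [← Real.sqrt_sq hl.le]
      rw [← Real.sqrt_div (by positivity)]
      congr 1
      field_simp
    rw [this]
    linarith [show 0 ≤ 2 * (d * Real.log Y.card) / min s.minQ q by positivity]
  · rw [exp2Rate, h]
    have : Real.log Y.card / (1 / (2 * d) * min s.minQ q) =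
        2 * (d * Real.log Y.card) / min s.minQ q := by field_simp
    rw [this]
    linarith [Real.sqrt_nonneg (d * Real.log Y.card * (s.invSum + 1 / q))]

lemma exp2Weights_pos {a : Vec d} (ha : a ∈ Y) : 0 < exp2Weights Y s q a := by
  rw [exp2Weights, if_pos ha]
  exact div_pos (Real.exp_pos _) (sum_exp_pos ⟨a, ha⟩ _)

lemma sum_exp2Weights (hY : Y.Nonempty) : ∑ a ∈ Y, exp2Weights Y s q a = 1 := by
  rw [Finset.sum_congr rfl fun a ha => by rw [exp2Weights, if_pos ha], ← Finset.sum_div]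
  exact div_self (sum_exp_pos hY _).ne'

lemma exp2Dist_ge (hν : IsJohnExploration Y ν) (hs : s.Valid) (hq : 0 < q) {a : Vec d}
    (ha : a ∈ Y) : exp2Weights Y s q a / 2 ≤ exp2Dist Y ν s q a := by
  have h1 := exp2_mix_le (Y := Y) (s := s) hq
  have h2 := mul_nonneg (exp2_mix_nonneg (Y := Y) hs hq) (hν.1 a ha)
  have h3 := exp2Weights_pos (s := s) (q := q) ha
  unfold exp2Dist
  nlinarith

lemma exp2Dist_pos (hν : IsJohnExploration Y ν) (hs : s.Valid) (hq : 0 < q) {a : Vec d}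
    (ha : a ∈ Y) : 0 < exp2Dist Y ν s q a :=
  lt_of_lt_of_le (half_pos (exp2Weights_pos ha)) (exp2Dist_ge hν hs hq ha)

lemma exp2Dist_eq_zero (hν : IsJohnExploration Y ν) {a : Vec d} (ha : a ∉ Y) :
    exp2Dist Y ν s q a = 0 := by
  rw [exp2Dist, exp2Weights, if_neg ha, hν.2.1 a ha]; ring

lemma sum_exp2Dist (hY : Y.Nonempty) (hν : IsJohnExploration Y ν) :
    ∑ a ∈ Y, exp2Dist Y ν s q a = 1 := by
  simp only [exp2Dist, Finset.sum_add_distrib, ← Finset.mul_sum, sum_exp2Weights hY, hν.2.2.1]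
  ring

lemma exp2_moment_injective (hν : IsJohnExploration Y ν) (hs : s.Valid) (hq : 0 < q) :
    Function.Injective (regMoment Y (exp2Dist Y ν s q)) :=
  regMoment_injective fun _ hb => exp2Dist_pos hν hs hq hb

/-- The mixing with the John exploration keeps the estimators below the inverse learning rate. -/
lemma abs_invForm_exp2Dist_le (hY : 2 ≤ Y.card) (hν : IsJohnExploration Y ν) (hs : s.Valid)
    (hq : 0 < q) {a a' : Vec d} (ha : a ∈ Y) (ha' : a' ∈ Y) :
    |invForm Y (exp2Dist Y ν s q) a a'| ≤ q / exp2Rate Y s q := by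
  have hd : (0 : ℝ) < d := by exact_mod_cast dim_pos_of_two_le_card hY
  have hη := exp2Rate_pos hY hs hq
  have hlam : 0 < d * exp2Rate Y s q / q := by positivity
  have h1 : ∀ b ∈ Y, d * exp2Rate Y s q / q * ν b ≤ exp2Dist Y ν s q b := fun b hb => by
    have h2 := exp2_mix_le (Y := Y) (s := s) hq
    have h3 := exp2Weights_pos (s := s) (q := q) hb
    unfold exp2Dist
    nlinarith
  refine abs_invForm_le (exp2_moment_injective hν hs hq)
    (fun b hb => (exp2Dist_pos hν hs hq hb).le) (fun b hb => ?_) ha ha'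
  refine (invForm_self_le (exp2_moment_injective hν hs hq) hν hlam h1 hb).trans (le_of_eq ?_)
  field_simp

lemma abs_rate_mul_exp2Estimator_le (hY : 2 ≤ Y.card) (hν : IsJohnExploration Y ν) (hs : s.Valid)
    (hq : 0 < q) {fb : Option (Vec d × ℝ)} (hfb : ∀ x ∈ fb, x.1 ∈ Y ∧ |x.2| ≤ 1)
    {a : Vec d} (ha : a ∈ Y) : |exp2Rate Y s q * exp2Estimator Y ν s q fb a| ≤ 1 := by
  have hη := exp2Rate_pos hY hs hq
  rcases fb with _ | ⟨b, y⟩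
  · simp [exp2Estimator]
  · obtain ⟨hb, hy⟩ := hfb _ rfl
    have h1 := abs_invForm_exp2Dist_le hY hν hs hq ha hb
    simp only [exp2Estimator]
    rw [abs_mul, abs_mul, abs_mul, abs_of_pos hη, abs_of_pos (by positivity : 0 < 1 / q)]
    calc exp2Rate Y s q * (1 / q * |invForm Y (exp2Dist Y ν s q) a b| * |y|)
        ≤ exp2Rate Y s q * (1 / q * (q / exp2Rate Y s q) * 1) := by gcongr
      _ = 1 := by field_simp

end Rate

/-- The regret bound of EXP2 along a fixed run, in terms of its own loss estimators. -/
lemma exp2_pathwise {d : ℕ} {Y : Finset (Vec d)} {ν : Vec d → ℝ} (hY : 2 ≤ Y.card)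
    (hν : IsJohnExploration Y ν) (q : ℕ → ℝ) (fb : ℕ → Option (Vec d × ℝ)) (n : ℕ)
    (hq : ∀ t ≤ n, q t ∈ Set.Ioc (0 : ℝ) 1)
    (hfb : ∀ t ≤ n, ∀ x ∈ fb t, x.1 ∈ Y ∧ |x.2| ≤ 1) (s : ℕ → Exp2State d)
    (hs : ∀ t, s t = (exp2 Y ν).stateAt q fb t) {u : Vec d} (hu : u ∈ Y) :
    ∑ t ∈ Finset.range (n + 1),
      (∑ a ∈ Y, exp2Weights Y (s t) (q t) a * exp2Estimator Y ν (s t) (q t) (fb t) a -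
        exp2Estimator Y ν (s t) (q t) (fb t) u -
        exp2Rate Y (s t) (q t) * ∑ a ∈ Y,
          exp2Weights Y (s t) (q t) a * exp2Estimator Y ν (s t) (q t) (fb t) a ^ 2 +
        4 * (d * exp2Rate Y (s t) (q t) / q t)) ≤
      9 * Real.sqrt (d * Real.log Y.card * (s (n + 1)).invSum) +
        2 * (d * Real.log Y.card) / (s (n + 1)).minQ := by
  have hsucc : ∀ t, s (t + 1) =
      { est := fun a => (s t).est a + exp2Estimator Y ν (s t) (q t) (fb t) a
        invSum := (s t).invSum + 1 / q t
        minQ := min (s t).minQ (q t) } := fun t => by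
    rw [hs, hs]; rfl
  have hv : ∀ t ≤ n + 1, (s t).Valid := fun t ht => by
    rw [hs]
    exact exp2_stateAt_valid Y ν q fb t fun i hi => hq i (by omega)
  have h1 := expWeights_regret (Y := Y) (fun t => exp2Rate Y (s t) (q t)) (fun t => (s t).est)
    (fun t => exp2Estimator Y ν (s t) (q t) (fb t)) n
    (fun t ht => exp2Rate_pos hY (hv t (by omega)) (hq t ht).1)
    (fun t ht => by
      have hd : (0 : ℝ) < d := by exact_mod_cast dim_pos_of_two_le_card hY
      have hl := log_card_pos hY
      have h0 := (hv t (by omega)).1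
      have hq1 := (hq (t + 1) (by omega)).1
      have hq0 := (hq t (by omega)).1
      unfold exp2Rate
      rw [hsucc t]
      refine min_le_min (Real.sqrt_le_sqrt ?_) (mul_le_mul_of_nonneg_left ?_ (by positivity))
      · exact div_le_div_of_nonneg_left hl.le (by positivity)
          (mul_le_mul_of_nonneg_left (le_add_of_nonneg_right (by positivity)) hd.le)
      · exact min_le_left _ _)
    (fun a => by rw [hs]; rfl) (fun t _ a => by rw [hsucc])
    (fun t ht a ha => abs_rate_mul_exp2Estimator_le hY hν (hv t (by omega)) (hq t ht).1
      (hfb t ht) ha) hu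
  have h2 := log_card_div_exp2Rate_le hY (hv n (by omega)) (hq n le_rfl).1
  have h3 : ∀ m ≤ n + 1, ∑ t ∈ Finset.range m, 4 * (d * exp2Rate Y (s t) (q t) / q t) ≤
      8 * Real.sqrt (d * Real.log Y.card * (s m).invSum) := by
    intro m
    induction m with
    | zero => intro _; simp
    | succ k ih =>
      intro hk
      have h4 := exp2_mix_le_sqrt hY (hv k (by omega)) (hq k (by omega)).1
      rw [Finset.sum_range_succ, hsucc k]
      linarith [ih (by omega)]
  have h5 := h3 (n + 1) le_rfl
  rw [Finset.sum_add_distrib]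
  have h6 : ∀ t a, a ∈ Y → exp2Weights Y (s t) (q t) a = Real.exp (-exp2Rate Y (s t) (q t) *
      (s t).est a) / ∑ b ∈ Y, Real.exp (-exp2Rate Y (s t) (q t) * (s t).est b) := fun t a ha => by
    rw [exp2Weights, if_pos ha]
  have h7 : ∀ t, ∀ f : Vec d → ℝ, ∑ a ∈ Y, exp2Weights Y (s t) (q t) a * f a =
      ∑ a ∈ Y, Real.exp (-exp2Rate Y (s t) (q t) *
      (s t).est a) / (∑ b ∈ Y, Real.exp (-exp2Rate Y (s t) (q t) * (s t).est b)) * f a :=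
    fun t f => Finset.sum_congr rfl fun a ha => by rw [h6 t a ha]
  simp only [h7]
  rw [hsucc n] at h5 ⊢
  simp only at h5 ⊢
  linarith

/-! ### Integration against conditional expectations -/

section CondExp

variable {Ω : Type u} {m : MeasurableSpace Ω} [mΩ : MeasurableSpace Ω] {μ : Measure Ω}
  [IsProbabilityMeasure μ]

/-- Inside integrals over a set `R` of the sub-σ-algebra `m`, and against bounded `m`-measurable
factors, a function may be replaced by its conditional expectation, known only on `R`. -/
lemma setIntegral_mul_of_condExp (hm : m ≤ mΩ) {f ρ H : Ω → ℝ}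
    (hf : Integrable f μ) {R : Set Ω} (hR : MeasurableSet[m] R) (hH : Measurable[m] H) {C : ℝ}
    (hC : ∀ ω ∈ R, |H ω| ≤ C) (law : ∀ᵐ ω ∂μ, ω ∈ R → (μ[f | m]) ω = ρ ω) :
    IntegrableOn (fun ω => f ω * H ω) R μ ∧ IntegrableOn (fun ω => ρ ω * H ω) R μ ∧
      ∫ ω in R, f ω * H ω ∂μ = ∫ ω in R, ρ ω * H ω ∂μ := by
  have hR' : MeasurableSet R := hm _ hR
  have hH' : Measurable[m] (R.indicator H) := hH.indicator hR
  have hb : ∀ ω, ‖R.indicator H ω‖ ≤ |C| := fun ω => by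
    by_cases h : ω ∈ R
    · rw [Set.indicator_of_mem h]; exact (hC ω h).trans (le_abs_self C)
    · rw [Set.indicator_of_notMem h]; simp
  have hint : ∀ g : Ω → ℝ, Integrable g μ → Integrable (fun ω => g ω * R.indicator H ω) μ :=
    fun g hg => hg.mul_bdd ((hH'.mono hm le_rfl).aestronglyMeasurable) (ae_of_all _ hb)
  have hind : ∀ g : Ω → ℝ, R.indicator (fun ω => g ω * H ω) = fun ω => g ω * R.indicator H ω :=
    fun g => by
      funext ω
      by_cases h : ω ∈ R <;> simp [h]
  have h1 := hint f hf
  have h2 : Integrable (fun ω => (μ[f | m]) ω * R.indicator H ω) μ := hint _ integrable_condExp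
  have h3 : (fun ω => (μ[f | m]) ω * R.indicator H ω) =ᵐ[μ] fun ω => ρ ω * R.indicator H ω := by
    filter_upwards [law] with ω hω
    by_cases h : ω ∈ R
    · rw [hω h]
    · simp [h]
  refine ⟨?_, ?_, ?_⟩
  · rw [← integrable_indicator_iff hR', hind]; exact h1
  · rw [← integrable_indicator_iff hR', hind]; exact h2.congr h3
  · rw [← integral_indicator hR', ← integral_indicator hR', hind, hind, ← integral_congr_ae h3,
      ← integral_condExp hm]
    refine integral_congr_ae ?_
    exact condExp_mul_of_stronglyMeasurable_right hH'.stronglyMeasurable h1 hf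

end CondExp

/-! ### Measurability of EXP2 -/

section Measurability

variable {d : ℕ} {Ω : Type u} {m : MeasurableSpace Ω} {Y : Finset (Vec d)} {ν : Vec d → ℝ}
  {s : Ω → Exp2State d} {q : Ω → ℝ}

/-- The relevant components of a random EXP2 memory are measurable. -/
structure MeasurableExp2State (m : MeasurableSpace Ω) (Y : Finset (Vec d))
    (s : Ω → Exp2State d) : Prop where
  est : ∀ a ∈ Y, Measurable[m] fun ω => (s ω).est a
  invSum : Measurable[m] fun ω => (s ω).invSum
  minQ : Measurable[m] fun ω => (s ω).minQ

lemma MeasurableExp2State.rate (hs : MeasurableExp2State m Y s) (hq : Measurable q) :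
    Measurable fun ω => exp2Rate Y (s ω) (q ω) := by
  unfold exp2Rate
  exact (Measurable.sqrt (((hs.invSum.add (hq.const_div 1)).const_mul _).const_div _)).min
    ((hs.minQ.min hq).const_mul _)

lemma MeasurableExp2State.weights (hs : MeasurableExp2State m Y s) (hq : Measurable q)
    (a : Vec d) : Measurable fun ω => exp2Weights Y (s ω) (q ω) a := by
  by_cases ha : a ∈ Y
  · simp only [exp2Weights, if_pos ha]
    exact (((hs.rate hq).neg.mul (hs.est a ha)).exp).div
      (Finset.measurable_fun_sum _ fun b hb => ((hs.rate hq).neg.mul (hs.est b hb)).exp)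
  · simp only [exp2Weights, if_neg ha, measurable_const]

lemma MeasurableExp2State.dist (hs : MeasurableExp2State m Y s) (hq : Measurable q)
    (a : Vec d) : Measurable fun ω => exp2Dist Y ν (s ω) (q ω) a := by
  have h1 : Measurable fun ω => d * exp2Rate Y (s ω) (q ω) / q ω :=
    ((hs.rate hq).const_mul _).div hq
  exact ((h1.const_sub 1).mul (hs.weights hq a)).add (h1.mul_const _)

lemma MeasurableExp2State.invForm (hν : IsJohnExploration Y ν) (hv : ∀ ω, (s ω).Valid)
    (hq0 : ∀ ω, 0 < q ω) (hs : MeasurableExp2State m Y s) (hq : Measurable q)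
    {a : Vec d} (ha : a ∈ Y) (b : Vec d) :
    Measurable fun ω => BestOfBoth.invForm Y (exp2Dist Y ν (s ω) (q ω)) a b :=
  measurable_invForm (fun ω _ hb => exp2Dist_pos hν (hv ω) (hq0 ω) hb)
    (fun b _ => hs.dist hq b) ha b

end Measurability

/-- The feedback of a weighted play: the action and its loss when `obs t` occurs. -/
def feedback {d : ℕ} {Ω : Type u} (obs : ℕ → Set Ω) (a : ℕ → Ω → Vec d)
    (loss : ℕ → Ω → Vec d → ℝ) (t : ℕ) (ω : Ω) : Option (Vec d × ℝ) :=
  if ω ∈ obs t then some (a t ω, loss t ω (a t ω)) else none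

/-- The random memory of EXP2 before round `t`. -/
def exp2Run {d : ℕ} {Ω : Type u} (Y : Finset (Vec d)) (ν : Vec d → ℝ) (q : ℕ → Ω → ℝ)
    (obs : ℕ → Set Ω) (a : ℕ → Ω → Vec d) (loss : ℕ → Ω → Vec d → ℝ) (t : ℕ) (ω : Ω) :
    Exp2State d :=
  (exp2 Y ν).stateAt (fun s => q s ω) (fun s => feedback obs a loss s ω) t

/-- EXP2 over `Y` run in an environment over `X ⊇ Y` up to a stopping time `τ`: before `τ`, the
weights are bounded below by `ε`, and the action `x` is observed with conditional probability
`q t * p t x`. Nothing is assumed about the observations after `τ`. -/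
structure StoppedExp2Run {d : ℕ} {Ω : Type u} [mΩ : MeasurableSpace Ω] (μ : Measure Ω)
    (X Y : Finset (Vec d)) (ν : Vec d → ℝ) (T : ℕ) (ℱ 𝒢 : Filtration ℕ mΩ)
    (loss : ℕ → Ω → Vec d → ℝ) (q : ℕ → Ω → ℝ) (obs : ℕ → Set Ω) (a : ℕ → Ω → Vec d)
    (τ : Ω → ℕ) (ε : ℝ) : Prop where
  john : IsJohnExploration Y ν
  sub : Y ⊆ X
  env : IsLinearEnvironment μ X T ℱ 𝒢 loss
  weight_measurable : ∀ t < T, Measurable[ℱ t] (q t)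
  weight_mem : ∀ t < T, ∀ ω, q t ω ∈ Set.Ioc (0 : ℝ) 1
  obs_measurable : ∀ t < T, MeasurableSet[ℱ (t + 1)] (obs t)
  action_measurable : ∀ t < T, Measurable[ℱ (t + 1)] (a t)
  action_mem : ∀ t < T, ∀ ω, a t ω ∈ X
  stop_le : ∀ ω, τ ω ≤ T
  stop_measurable : ∀ n, MeasurableSet[ℱ n] {ω | n < τ ω}
  eps_pos : 0 < ε
  eps_le : ∀ t ω, t < τ ω → ε ≤ q t ω
  law : ∀ t < T, ∀ x ∈ X, ∀ᵐ ω ∂μ, ω ∈ {ω | t < τ ω} →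
    (μ[Set.indicator {ω | ω ∈ obs t ∧ a t ω = x} (fun _ => (1 : ℝ)) | 𝒢 t]) ω =
      q t ω * exp2Dist Y ν (exp2Run Y ν q obs a loss t ω) (q t ω) x

namespace StoppedExp2Run

variable {d : ℕ} {Ω : Type u} [mΩ : MeasurableSpace Ω] {μ : Measure Ω}
  {X Y : Finset (Vec d)} {ν : Vec d → ℝ} {T : ℕ} {ℱ 𝒢 : Filtration ℕ mΩ}
  {loss : ℕ → Ω → Vec d → ℝ} {q : ℕ → Ω → ℝ} {obs : ℕ → Set Ω} {a : ℕ → Ω → Vec d}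
  {τ : Ω → ℕ} {ε : ℝ}

lemma valid (h : StoppedExp2Run μ X Y ν T ℱ 𝒢 loss q obs a τ ε) {t : ℕ} (ht : t ≤ T) (ω : Ω) :
    (exp2Run Y ν q obs a loss t ω).Valid :=
  exp2_stateAt_valid _ _ _ _ _ fun s hs => h.weight_mem s (by omega) ω

/-- The estimator, as a sum over the possible observations, whose conditional probabilities are
known. -/
lemma estimator_eq (h : StoppedExp2Run μ X Y ν T ℱ 𝒢 loss q obs a τ ε) {t : ℕ} (ht : t < T)
    (ω : Ω) (s : Exp2State d) (r : ℝ) (x : Vec d) :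
    exp2Estimator Y ν s r (feedback obs a loss t ω) x =
      ∑ b ∈ X, Set.indicator {ω | ω ∈ obs t ∧ a t ω = b} (fun _ => (1 : ℝ)) ω *
        (1 / r * invForm Y (exp2Dist Y ν s r) x b * loss t ω b) := by
  by_cases ho : ω ∈ obs t
  · rw [feedback, if_pos ho, Finset.sum_eq_single (a t ω)]
    · rw [Set.indicator_of_mem (by exact ⟨ho, rfl⟩), one_mul]
      rfl
    · intro b _ hb
      rw [Set.indicator_of_notMem (by rintro ⟨_, h'⟩; exact hb h'.symm), zero_mul]
    · intro hb; exact absurd (h.action_mem t ht ω) hb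
  · rw [feedback, if_neg ho]
    refine (Finset.sum_eq_zero fun b _ => ?_).symm
    rw [Set.indicator_of_notMem (by rintro ⟨h', _⟩; exact ho h'), zero_mul]

lemma event_measurable (h : StoppedExp2Run μ X Y ν T ℱ 𝒢 loss q obs a τ ε) {t : ℕ} (ht : t < T)
    (b : Vec d) : MeasurableSet[ℱ (t + 1)] {ω | ω ∈ obs t ∧ a t ω = b} :=
  (h.obs_measurable t ht).inter (h.action_measurable t ht (measurableSet_singleton b))

lemma loss_measurable (h : StoppedExp2Run μ X Y ν T ℱ 𝒢 loss q obs a τ ε) {t : ℕ} (ht : t < T)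
    {b : Vec d} (hb : b ∈ X) : Measurable[ℱ (t + 1)] fun ω => loss t ω b :=
  (h.env.measurable t ht b hb).mono (h.env.env_le t) le_rfl

/-- The memory of EXP2 before round `t` is a function of the history before round `t`. -/
lemma run_measurable (h : StoppedExp2Run μ X Y ν T ℱ 𝒢 loss q obs a τ ε) :
    ∀ t ≤ T, MeasurableExp2State (ℱ t) Y (exp2Run Y ν q obs a loss t) := by
  intro t
  induction t with
  | zero => exact fun _ => ⟨fun _ _ => measurable_const, measurable_const, measurable_const⟩
  | succ t ih =>
    intro ht
    have hs := ih (by omega)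
    have hle : ℱ t ≤ ℱ (t + 1) := ℱ.mono (Nat.le_succ t)
    have hq : Measurable[ℱ t] (q t) := h.weight_measurable t ht
    refine ⟨fun x hx => ?_, ?_, ?_⟩
    · have h1 : (fun ω => (exp2Run Y ν q obs a loss (t + 1) ω).est x) = fun ω =>
          (exp2Run Y ν q obs a loss t ω).est x +
            ∑ b ∈ X, Set.indicator {ω | ω ∈ obs t ∧ a t ω = b} (fun _ => (1 : ℝ)) ω *
              (1 / q t ω * invForm Y (exp2Dist Y ν (exp2Run Y ν q obs a loss t ω) (q t ω)) x b *
                loss t ω b) := by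
        funext ω
        rw [← h.estimator_eq ht]
        rfl
      rw [h1]
      refine ((hs.est x hx).mono hle le_rfl).add (Finset.measurable_fun_sum _ fun b hb => ?_)
      refine (measurable_const.indicator (h.event_measurable ht b)).mul
        (Measurable.mul (Measurable.mono (Measurable.mul (hq.const_div 1) ?_) hle le_rfl)
          (h.loss_measurable ht hb))
      exact MeasurableExp2State.invForm h.john (h.valid (by omega))
        (fun ω => (h.weight_mem t ht ω).1) hs hq hx b
    · exact (hs.invSum.add (hq.const_div 1)).mono hle le_rfl
    · exact (hs.minQ.min hq).mono hle le_rfl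

/-- Before the stopping time, the memory stays in a compact range. -/
lemma run_bounds (h : StoppedExp2Run μ X Y ν T ℱ 𝒢 loss q obs a τ ε) {t : ℕ} {ω : Ω}
    (ht : t ≤ τ ω) : (exp2Run Y ν q obs a loss t ω).invSum ≤ t / ε ∧
      min 1 ε ≤ (exp2Run Y ν q obs a loss t ω).minQ := by
  induction t with
  | zero => exact ⟨by simp [exp2Run, IWAlgorithm.stateAt, exp2], min_le_left _ _⟩
  | succ t ih =>
    obtain ⟨h1, h2⟩ := ih (by omega)
    have h3 := h.eps_le t ω (by omega)
    have h4 : 1 / q t ω ≤ 1 / ε := one_div_le_one_div_of_le h.eps_pos h3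
    refine ⟨?_, ?_⟩
    · change (exp2Run Y ν q obs a loss t ω).invSum + 1 / q t ω ≤ _
      push_cast
      rw [add_div]
      linarith
    · exact le_min h2 ((min_le_right _ _).trans h3)

/-- Before the stopping time, the learning rates are bounded below. -/
lemma exists_rate_lower_bound (h : StoppedExp2Run μ X Y ν T ℱ 𝒢 loss q obs a τ ε)
    (hY : 2 ≤ Y.card) : ∃ c > 0, ∀ t ω, t < τ ω →
      c ≤ exp2Rate Y (exp2Run Y ν q obs a loss t ω) (q t ω) := by
  have hd : (0 : ℝ) < d := by exact_mod_cast dim_pos_of_two_le_card hY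
  have hl := log_card_pos hY
  have hε := h.eps_pos
  refine ⟨min (Real.sqrt (Real.log Y.card / (d * (T / ε + 1 / ε)))) (1 / (2 * d) * min 1 ε),
    lt_min (Real.sqrt_pos.2 (by positivity)) (mul_pos (by positivity) (lt_min one_pos hε)), ?_⟩
  intro t ω ht
  obtain ⟨h1, h2⟩ := h.run_bounds ht.le
  have h3 := h.eps_le t ω ht
  have h4 : 1 / q t ω ≤ 1 / ε := one_div_le_one_div_of_le hε h3
  have h5 : (t : ℝ) / ε ≤ T / ε := by
    have : t ≤ T := ht.le.trans (h.stop_le ω)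
    gcongr
  have h6 := (h.valid (ht.le.trans (h.stop_le ω)) ω).1
  have h7 : 0 < q t ω := hε.trans_le h3
  unfold exp2Rate
  refine min_le_min (Real.sqrt_le_sqrt ?_) (mul_le_mul_of_nonneg_left ?_ (by positivity))
  · refine div_le_div_of_nonneg_left hl.le (by positivity) (mul_le_mul_of_nonneg_left ?_ hd.le)
    linarith
  · exact le_min h2 ((min_le_right _ _).trans h3)

end StoppedExp2Run

namespace StoppedExp2Run

variable {d : ℕ} {Ω : Type u} [mΩ : MeasurableSpace Ω] {μ : Measure Ω} [IsProbabilityMeasure μ]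
  {X Y : Finset (Vec d)} {ν : Vec d → ℝ} {T : ℕ} {ℱ 𝒢 : Filtration ℕ mΩ}
  {loss : ℕ → Ω → Vec d → ℝ} {q : ℕ → Ω → ℝ} {obs : ℕ → Set Ω} {a : ℕ → Ω → Vec d}
  {τ : Ω → ℕ} {ε : ℝ}

lemma integrable_event (h : StoppedExp2Run μ X Y ν T ℱ 𝒢 loss q obs a τ ε) {t : ℕ} (ht : t < T)
    (b : Vec d) :
    Integrable (Set.indicator {ω | ω ∈ obs t ∧ a t ω = b} (fun _ => (1 : ℝ))) μ :=
  (integrable_const 1).indicator (ℱ.le (t + 1) _ (h.event_measurable ht b))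

lemma integrable_loss (h : StoppedExp2Run μ X Y ν T ℱ 𝒢 loss q obs a τ ε) {t : ℕ} (ht : t < T)
    {b : Vec d} (hb : b ∈ X) : Integrable (fun ω => loss t ω b) μ :=
  Integrable.of_bound ((h.loss_measurable ht hb).mono (ℱ.le _) le_rfl).aestronglyMeasurable 1
    (ae_of_all _ fun ω => abs_le.2 ⟨(h.env.bounded t ht b hb ω).1, (h.env.bounded t ht b hb ω).2⟩)

/-- Before the stopping time, only actions of `Y` are observed. -/
lemma obs_mem (h : StoppedExp2Run μ X Y ν T ℱ 𝒢 loss q obs a τ ε) {t : ℕ} (ht : t < T) :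
    ∀ᵐ ω ∂μ, t < τ ω → ω ∈ obs t → a t ω ∈ Y := by
  have h1 : ∀ b ∈ X, ∀ᵐ ω ∂μ, b ∉ Y → t < τ ω → ω ∈ obs t → a t ω ≠ b := by
    intro b hb
    by_cases hbY : b ∈ Y
    · exact ae_of_all _ fun _ h' => absurd hbY h'
    have hR : MeasurableSet[𝒢 t] {ω | t < τ ω} := h.env.le_env t _ (h.stop_measurable t)
    have h2 := (setIntegral_mul_of_condExp (𝒢.le t) (h.integrable_event ht b) hR
      (measurable_const (a := (1 : ℝ))) (C := 1) (fun _ _ => by simp) (h.law t ht b hb)).2.2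
    simp only [mul_one, exp2Dist_eq_zero h.john hbY, mul_zero, integral_zero] at h2
    have hE := ℱ.le (t + 1) _ (h.event_measurable ht b)
    rw [setIntegral_indicator hE, setIntegral_const, smul_eq_mul, mul_one,
      measureReal_eq_zero_iff] at h2
    filter_upwards [measure_eq_zero_iff_ae_notMem.1 h2] with ω hω _ h3 h4 h5
    exact hω ⟨h3, h4, h5⟩
  have h2 : ∀ᵐ ω ∂μ, ∀ b ∈ X, b ∉ Y → t < τ ω → ω ∈ obs t → a t ω ≠ b :=
    (Finset.eventually_all X).2 h1
  filter_upwards [h2] with ω hω h3 h4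
  by_contra h5
  exact hω _ (h.action_mem t ht ω) h5 h3 h4 rfl

/-- What EXP2 pays in round `t` in terms of its own loss estimators, see `exp2_pathwise`. -/
def exp2Excess {d : ℕ} {Ω : Type u} (Y : Finset (Vec d)) (ν : Vec d → ℝ) (q : ℕ → Ω → ℝ)
    (obs : ℕ → Set Ω) (a : ℕ → Ω → Vec d) (loss : ℕ → Ω → Vec d → ℝ) (u : Vec d) (t : ℕ)
    (ω : Ω) : ℝ :=
  let s := exp2Run Y ν q obs a loss t ω
  let fb := feedback obs a loss t ω
  ∑ x ∈ Y, exp2Weights Y s (q t ω) x * exp2Estimator Y ν s (q t ω) fb x -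
    exp2Estimator Y ν s (q t ω) fb u -
    exp2Rate Y s (q t ω) * ∑ x ∈ Y,
      exp2Weights Y s (q t ω) x * exp2Estimator Y ν s (q t ω) fb x ^ 2 +
    4 * (d * exp2Rate Y s (q t ω) / q t ω)

/-- In expectation, the regret of EXP2 in round `t` is at most its excess `exp2Excess`. This uses
that the estimators are unbiased (where linearity of the mean losses comes in), that their second
moment is at most `2 d / q`, and that the mixture costs at most `2 d η / q`. -/
lemma round_le (h : StoppedExp2Run μ X Y ν T ℱ 𝒢 loss q obs a τ ε) (hY : 2 ≤ Y.card) {u : Vec d}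
    (hu : u ∈ Y) {t : ℕ} (ht : t < T) :
    IntegrableOn (exp2Excess Y ν q obs a loss u t) {ω | t < τ ω} μ ∧
    ∫ ω in {ω | t < τ ω}, (∑ x ∈ Y, exp2Dist Y ν (exp2Run Y ν q obs a loss t ω) (q t ω) x *
        loss t ω x - loss t ω u) ∂μ ≤
      ∫ ω in {ω | t < τ ω}, exp2Excess Y ν q obs a loss u t ω ∂μ := by
  obtain ⟨c, hc, hcη⟩ := h.exists_rate_lower_bound hY
  have hYn : Y.Nonempty := ⟨u, hu⟩
  set R : Set Ω := {ω | t < τ ω} with hRdef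
  have hRF : MeasurableSet[ℱ t] R := h.stop_measurable t
  have hRG : MeasurableSet[𝒢 t] R := h.env.le_env t _ hRF
  have hR : MeasurableSet R := ℱ.le t _ hRF
  set s := exp2Run Y ν q obs a loss t with hs
  set p : Vec d → Ω → ℝ := fun b ω => exp2Dist Y ν (s ω) (q t ω) b with hp
  set P : Vec d → Ω → ℝ := fun b ω => exp2Weights Y (s ω) (q t ω) b with hP
  set η : Ω → ℝ := fun ω => exp2Rate Y (s ω) (q t ω) with hη
  set I : Vec d → Vec d → Ω → ℝ := fun x b ω => invForm Y (exp2Dist Y ν (s ω) (q t ω)) x b with hI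
  set A : Vec d → Ω → ℝ := fun b ω => ∑ x ∈ Y, P x ω * I x b ω - I u b ω with hA
  set Q : Vec d → Ω → ℝ := fun b ω => ∑ x ∈ Y, P x ω * I x b ω ^ 2 with hQ
  have hv : ∀ ω, (s ω).Valid := h.valid ht.le
  have hq : ∀ ω, q t ω ∈ Set.Ioc (0 : ℝ) 1 := h.weight_mem t ht
  have hinj : ∀ ω, Function.Injective (regMoment Y (exp2Dist Y ν (s ω) (q t ω))) := fun ω =>
    exp2_moment_injective h.john (hv ω) (hq ω).1
  -- measurability with respect to the history
  have hms := h.run_measurable t ht.le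
  have hmq : Measurable[ℱ t] (q t) := h.weight_measurable t ht
  have hmp : ∀ b, Measurable[ℱ t] (p b) := fun b => hms.dist hmq b
  have hmP : ∀ b, Measurable[ℱ t] (P b) := fun b => hms.weights hmq b
  have hmη : Measurable[ℱ t] η := hms.rate hmq
  have hmI : ∀ x ∈ Y, ∀ b, Measurable[ℱ t] (I x b) := fun x hx b =>
    MeasurableExp2State.invForm h.john hv (fun ω => (hq ω).1) hms hmq hx b
  have hmA : ∀ b, Measurable[ℱ t] (A b) := fun b =>
    (Finset.measurable_fun_sum _ fun x hx => (hmP x).mul (hmI x hx b)).sub (hmI u hu b)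
  have hmQ : ∀ b, Measurable[ℱ t] (Q b) := fun b =>
    Finset.measurable_fun_sum _ fun x hx => (hmP x).mul ((hmI x hx b).pow_const 2)
  have hml : ∀ b ∈ Y, Measurable[𝒢 t] fun ω => loss t ω b := fun b hb =>
    h.env.measurable t ht b (h.sub hb)
  -- bounds
  have hlb : ∀ b ∈ Y, ∀ ω, |loss t ω b| ≤ 1 := fun b hb ω => abs_le.2
    ⟨(h.env.bounded t ht b (h.sub hb) ω).1, (h.env.bounded t ht b (h.sub hb) ω).2⟩
  have hη0 : ∀ ω, 0 < η ω := fun ω => exp2Rate_pos hY (hv ω) (hq ω).1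
  have hP0 : ∀ b ∈ Y, ∀ ω, 0 < P b ω := fun b hb ω => exp2Weights_pos hb
  have hP1 : ∀ ω, ∑ b ∈ Y, P b ω = 1 := fun ω => sum_exp2Weights hYn
  have hp0 : ∀ b ∈ Y, ∀ ω, 0 < p b ω := fun b hb ω => exp2Dist_pos h.john (hv ω) (hq ω).1 hb
  have hp1 : ∀ ω, ∑ b ∈ Y, p b ω = 1 := fun ω => sum_exp2Dist hYn h.john
  have hple : ∀ b ∈ Y, ∀ ω, p b ω ≤ 1 := fun b hb ω => by
    rw [← hp1 ω]
    exact Finset.single_le_sum (f := fun b => p b ω) (fun b hb => (hp0 b hb ω).le) hb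
  have hPle : ∀ b ∈ Y, ∀ ω, P b ω ≤ 1 := fun b hb ω => by
    rw [← hP1 ω]
    exact Finset.single_le_sum (f := fun b => P b ω) (fun b hb => (hP0 b hb ω).le) hb
  have hIle : ∀ x ∈ Y, ∀ b ∈ Y, ∀ ω, |I x b ω| ≤ q t ω / η ω := fun x hx b hb ω =>
    abs_invForm_exp2Dist_le hY h.john (hv ω) (hq ω).1 hx hb
  have hAle : ∀ b ∈ Y, ∀ ω, |A b ω| ≤ 2 * (q t ω / η ω) := fun b hb ω => by
    have h1 : |∑ x ∈ Y, P x ω * I x b ω| ≤ q t ω / η ω := by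
      refine (Finset.abs_sum_le_sum_abs _ _).trans ?_
      calc ∑ x ∈ Y, |P x ω * I x b ω| ≤ ∑ x ∈ Y, P x ω * (q t ω / η ω) :=
            Finset.sum_le_sum fun x hx => by
              rw [abs_mul, abs_of_pos (hP0 x hx ω)]
              exact mul_le_mul_of_nonneg_left (hIle x hx b hb ω) (hP0 x hx ω).le
        _ = q t ω / η ω := by rw [← Finset.sum_mul, hP1, one_mul]
    have h2 := hIle u hu b hb ω
    calc |A b ω| ≤ |∑ x ∈ Y, P x ω * I x b ω| + |I u b ω| := abs_sub _ _
      _ ≤ _ := by linarith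
  have hQ0 : ∀ b, ∀ ω, 0 ≤ Q b ω := fun b ω =>
    Finset.sum_nonneg fun x hx => mul_nonneg (hP0 x hx ω).le (sq_nonneg _)
  have hQle : ∀ b ∈ Y, ∀ ω, Q b ω ≤ (q t ω / η ω) ^ 2 := fun b hb ω => by
    calc Q b ω ≤ ∑ x ∈ Y, P x ω * (q t ω / η ω) ^ 2 := Finset.sum_le_sum fun x hx =>
          mul_le_mul_of_nonneg_left (sq_le_sq' (abs_le.1 (hIle x hx b hb ω)).1
            (abs_le.1 (hIle x hx b hb ω)).2) (hP0 x hx ω).le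
      _ = _ := by rw [← Finset.sum_mul, hP1, one_mul]
  set H : Vec d → Ω → ℝ := fun b ω => 1 / q t ω * A b ω * loss t ω b -
    η ω * (1 / q t ω) ^ 2 * Q b ω * loss t ω b ^ 2 with hH
  have hmH : ∀ b ∈ Y, Measurable[𝒢 t] (H b) := fun b hb => by
    have hle := h.env.le_env t
    have m1 : Measurable[𝒢 t] fun ω => 1 / q t ω * A b ω :=
      ((hmq.const_div 1).mul (hmA b)).mono hle le_rfl
    have m2 : Measurable[𝒢 t] fun ω => η ω * (1 / q t ω) ^ 2 * Q b ω :=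
      ((hmη.mul ((hmq.const_div 1).pow_const 2)).mul (hmQ b)).mono hle le_rfl
    exact (m1.mul (hml b hb)).sub (m2.mul ((hml b hb).pow_const 2))
  have hHle : ∀ b ∈ Y, ∀ ω ∈ R, |H b ω| ≤ 3 / c := fun b hb ω hω => by
    have hq0 := (hq ω).1
    have e0 := hη0 ω
    have h1 : |1 / q t ω * A b ω * loss t ω b| ≤ 2 / η ω := by
      rw [abs_mul, abs_mul, abs_of_pos (by positivity : 0 < 1 / q t ω)]
      calc 1 / q t ω * |A b ω| * |loss t ω b| ≤ 1 / q t ω * (2 * (q t ω / η ω)) * 1 := by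
            gcongr
            · exact hAle b hb ω
            · exact hlb b hb ω
        _ = 2 / η ω := by field_simp
    have h2 : |η ω * (1 / q t ω) ^ 2 * Q b ω * loss t ω b ^ 2| ≤ 1 / η ω := by
      rw [abs_mul, abs_of_nonneg (by have := hQ0 b ω; positivity :
        0 ≤ η ω * (1 / q t ω) ^ 2 * Q b ω), abs_pow]
      have h3 := hlb b hb ω
      have h4 := hQ0 b ω
      calc η ω * (1 / q t ω) ^ 2 * Q b ω * |loss t ω b| ^ 2
          ≤ η ω * (1 / q t ω) ^ 2 * (q t ω / η ω) ^ 2 * 1 ^ 2 := by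
            gcongr
            exact hQle b hb ω
        _ = 1 / η ω := by field_simp
    have h5 : 1 / η ω ≤ 1 / c := one_div_le_one_div_of_le hc (hcη t ω hω)
    calc |H b ω| ≤ 2 / η ω + 1 / η ω := (abs_sub _ _).trans (add_le_add h1 h2)
      _ = 3 * (1 / η ω) := by ring
      _ ≤ 3 * (1 / c) := by linarith
      _ = 3 / c := by ring
  -- the excess, as a sum over the possible observations
  set ind : Vec d → Ω → ℝ := fun b => Set.indicator {ω | ω ∈ obs t ∧ a t ω = b} (fun _ => 1)
    with hind
  have hX : ∀ᵐ ω ∂μ, ω ∈ R → exp2Excess Y ν q obs a loss u t ω =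
      ∑ b ∈ Y, ind b ω * H b ω + 4 * (d * η ω / q t ω) := by
    filter_upwards [h.obs_mem ht] with ω hω hωR
    simp only [exp2Excess]
    refine congrArg₂ (· + ·) ?_ rfl
    by_cases ho : ω ∈ obs t
    · have hb := hω hωR ho
      have hsum : ∑ b ∈ Y, ind b ω * H b ω = H (a t ω) ω := by
        rw [Finset.sum_eq_single (a t ω)]
        · have h1 : ind (a t ω) ω = 1 := Set.indicator_of_mem (by exact ⟨ho, rfl⟩) _
          rw [h1, one_mul]
        · intro b _ hb'
          have h1 : ind b ω = 0 := Set.indicator_of_notMem (by rintro ⟨_, h'⟩; exact hb' h'.symm) _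
          rw [h1, zero_mul]
        · intro h'; exact absurd hb h'
      rw [hsum, feedback, if_pos ho]
      have e1 : ∑ x ∈ Y, P x ω * (1 / q t ω * I x (a t ω) ω * loss t ω (a t ω)) =
          1 / q t ω * (∑ x ∈ Y, P x ω * I x (a t ω) ω) * loss t ω (a t ω) := by
        rw [Finset.mul_sum, Finset.sum_mul]
        exact Finset.sum_congr rfl fun x _ => by ring
      have e2 : η ω * ∑ x ∈ Y, P x ω * (1 / q t ω * I x (a t ω) ω * loss t ω (a t ω)) ^ 2 =
          η ω * (1 / q t ω) ^ 2 * Q (a t ω) ω * loss t ω (a t ω) ^ 2 := by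
        simp only [hQ]
        rw [Finset.mul_sum, Finset.mul_sum, Finset.sum_mul]
        exact Finset.sum_congr rfl fun x _ => by ring
      change ∑ x ∈ Y, P x ω * (1 / q t ω * I x (a t ω) ω * loss t ω (a t ω)) -
        1 / q t ω * I u (a t ω) ω * loss t ω (a t ω) -
        η ω * ∑ x ∈ Y, P x ω * (1 / q t ω * I x (a t ω) ω * loss t ω (a t ω)) ^ 2 = H (a t ω) ω
      rw [e1, e2]
      simp only [hH, hA]
      ring
    · rw [feedback, if_neg ho]
      have h1 : ∀ b ∈ Y, ind b ω * H b ω = 0 := fun b _ => by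
        have h1 : ind b ω = 0 := Set.indicator_of_notMem (by rintro ⟨h', _⟩; exact ho h') _
        rw [h1, zero_mul]
      rw [Finset.sum_eq_zero h1]
      simp [exp2Estimator]
  have hmix : IntegrableOn (fun ω => 4 * (d * η ω / q t ω)) R μ := by
    refine Integrable.of_bound (C := 2) ?_ (ae_of_all _ fun ω => ?_)
    · exact (((hmη.const_mul _).div hmq).const_mul _ |>.mono (ℱ.le t) le_rfl).aestronglyMeasurable
    · have h1 := exp2_mix_le (Y := Y) (s := s ω) (hq ω).1
      have h2 := exp2_mix_nonneg (Y := Y) (hv ω) (hq ω).1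
      rw [Real.norm_of_nonneg (by simp only [hη]; linarith)]
      simp only [hη]
      linarith
  -- averaging over the observation
  have hobs : ∀ b ∈ Y, IntegrableOn (fun ω => ind b ω * H b ω) R μ ∧
      IntegrableOn (fun ω => q t ω * p b ω * H b ω) R μ ∧
      ∫ ω in R, ind b ω * H b ω ∂μ = ∫ ω in R, q t ω * p b ω * H b ω ∂μ := fun b hb =>
    setIntegral_mul_of_condExp (𝒢.le t) (h.integrable_event ht b) hRG (hmH b hb) (hHle b hb)
      (h.law t ht b (h.sub hb))
  have hXint : IntegrableOn (fun ω => ∑ b ∈ Y, ind b ω * H b ω + 4 * (d * η ω / q t ω)) R μ :=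
    (integrable_finsetSum _ fun b hb => (hobs b hb).1).add hmix
  have hXae : ∀ᵐ ω ∂μ.restrict R, exp2Excess Y ν q obs a loss u t ω =
      ∑ b ∈ Y, ind b ω * H b ω + 4 * (d * η ω / q t ω) := (ae_restrict_iff' hR).2 hX
  refine ⟨hXint.congr (by filter_upwards [hXae] with ω hω using hω.symm), ?_⟩
  rw [integral_congr_ae hXae, integral_add (integrable_finsetSum _ fun b hb => (hobs b hb).1) hmix,
    integral_finsetSum _ fun b hb => (hobs b hb).1, Finset.sum_congr rfl fun b hb => (hobs b hb).2.2,
    ← integral_finsetSum _ fun b hb => (hobs b hb).2.1]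
  -- averaging over the loss vector
  obtain ⟨θ, hθ⟩ := h.env.linear t ht
  have hbdA : ∀ b ∈ Y, ∀ ω ∈ R, |p b ω * A b ω| ≤ 2 / c := fun b hb ω hω => by
    have hq0 := (hq ω).1
    have e0 := hη0 ω
    have h5 : 1 / η ω ≤ 1 / c := one_div_le_one_div_of_le hc (hcη t ω hω)
    rw [abs_mul, abs_of_pos (hp0 b hb ω)]
    calc p b ω * |A b ω| ≤ 1 * (2 * (q t ω / η ω)) :=
          mul_le_mul (hple b hb ω) (hAle b hb ω) (abs_nonneg _) zero_le_one
      _ ≤ 1 * (2 * (1 / η ω)) := by gcongr; exact (hq ω).2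
      _ ≤ 1 * (2 * (1 / c)) := by linarith
      _ = 2 / c := by ring
  have hlin : ∀ b ∈ Y, ∀ᵐ ω ∂μ, ω ∈ R →
      (μ[fun ω => loss t ω b | ℱ t]) ω = inner ℝ b (θ ω) := fun b hb => by
    filter_upwards [hθ b (h.sub hb)] with ω hω _ using hω
  have hA1 := fun b hb => setIntegral_mul_of_condExp (ℱ.le t) (h.integrable_loss ht (h.sub hb)) hRF
    (H := fun ω => p b ω * A b ω) ((hmp b).mul (hmA b)) (hbdA b hb) (hlin b hb)
  have hP1' := fun b hb => setIntegral_mul_of_condExp (ℱ.le t) (h.integrable_loss ht (h.sub hb)) hRF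
    (hmP b) (C := 1) (fun ω _ => by rw [abs_of_pos (hP0 b hb ω)]; exact hPle b hb ω) (hlin b hb)
  have hU := setIntegral_mul_of_condExp (ℱ.le t) (h.integrable_loss ht (h.sub hu)) hRF
    (measurable_const (a := (1 : ℝ))) (C := 1) (fun ω _ => by simp) (hlin u hu)
  have hswap : ∫ ω in R, ∑ b ∈ Y, loss t ω b * (p b ω * A b ω) ∂μ =
      ∫ ω in R, (∑ b ∈ Y, loss t ω b * P b ω - loss t ω u * 1) ∂μ := by
    rw [integral_finsetSum _ fun b hb => (hA1 b hb).1,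
      integral_sub (integrable_finsetSum _ fun b hb => (hP1' b hb).1) hU.1,
      integral_finsetSum _ fun b hb => (hP1' b hb).1,
      Finset.sum_congr rfl fun b hb => (hA1 b hb).2.2,
      Finset.sum_congr rfl fun b hb => (hP1' b hb).2.2, hU.2.2,
      ← integral_finsetSum _ fun b hb => (hA1 b hb).2.1,
      ← integral_finsetSum _ fun b hb => (hP1' b hb).2.1,
      ← integral_sub (integrable_finsetSum _ fun b hb => (hP1' b hb).2.1) hU.2.1]
    congr 1
    funext ω
    calc ∑ b ∈ Y, inner ℝ b (θ ω) * (p b ω * A b ω)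
        = ∑ x ∈ Y, P x ω * ∑ b ∈ Y, p b ω * I x b ω * inner ℝ b (θ ω) -
            ∑ b ∈ Y, p b ω * I u b ω * inner ℝ b (θ ω) := by
          simp only [hA, mul_sub, Finset.mul_sum, Finset.sum_sub_distrib]
          congr 1
          · rw [Finset.sum_comm]
            exact Finset.sum_congr rfl fun x _ => Finset.sum_congr rfl fun b _ => by ring
          · exact Finset.sum_congr rfl fun b _ => by ring
      _ = _ := by
          rw [mul_one, sum_mul_invForm_mul_inner (hinj ω) hu]
          congr 1
          exact Finset.sum_congr rfl fun x hx => by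
            rw [sum_mul_invForm_mul_inner (hinj ω) hx, mul_comm]
  -- the second moment of the estimators
  have hsq : ∀ ω, ∑ b ∈ Y, loss t ω b * (p b ω * A b ω) - 2 * (d * η ω / q t ω) ≤
      ∑ b ∈ Y, q t ω * p b ω * H b ω := by
    intro ω
    have hq0 := (hq ω).1
    have e0 := hη0 ω
    have h1 : ∑ b ∈ Y, q t ω * p b ω * H b ω = ∑ b ∈ Y, loss t ω b * (p b ω * A b ω) -
        η ω / q t ω * ∑ b ∈ Y, p b ω * Q b ω * loss t ω b ^ 2 := by
      rw [Finset.mul_sum, ← Finset.sum_sub_distrib]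
      refine Finset.sum_congr rfl fun b _ => ?_
      simp only [hH]
      field_simp
    have h2 : ∑ b ∈ Y, p b ω * Q b ω * loss t ω b ^ 2 ≤ ∑ b ∈ Y, p b ω * Q b ω :=
      Finset.sum_le_sum fun b hb => by
        have h3 : loss t ω b ^ 2 ≤ 1 := by
          rw [← sq_abs]; exact pow_le_one₀ (abs_nonneg _) (hlb b hb ω)
        exact mul_le_of_le_one_right (mul_nonneg (hp0 b hb ω).le (hQ0 b ω)) h3
    have h3 : ∑ b ∈ Y, p b ω * Q b ω = ∑ x ∈ Y, P x ω * I x x ω := by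
      simp only [hQ, Finset.mul_sum]
      rw [Finset.sum_comm]
      refine Finset.sum_congr rfl fun x hx => ?_
      rw [show I x x ω = ∑ b ∈ Y, p b ω * I x b ω ^ 2 from
        (sum_mul_invForm_sq (hinj ω) hx).symm, Finset.mul_sum]
      exact Finset.sum_congr rfl fun b _ => by ring
    have h4 : ∑ x ∈ Y, P x ω * I x x ω ≤ 2 * d := by
      calc ∑ x ∈ Y, P x ω * I x x ω ≤ ∑ x ∈ Y, 2 * (p x ω * I x x ω) :=
            Finset.sum_le_sum fun x hx => by
              have h5 := exp2Dist_ge h.john (hv ω) (hq ω).1 hx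
              have h6 : 0 ≤ I x x ω := invForm_self_nonneg (hinj ω) (fun b hb => (hp0 b hb ω).le) hx
              have h7 : P x ω ≤ 2 * p x ω := by simp only [hp, hP]; linarith
              nlinarith
        _ = 2 * ∑ x ∈ Y, p x ω * I x x ω := by rw [Finset.mul_sum]
        _ ≤ 2 * d := by
            have : ∑ x ∈ Y, p x ω * I x x ω =
              Module.finrank ℝ (Submodule.span ℝ (Y : Set (Vec d))) := sum_mul_invForm_self (hinj ω)
            rw [this]
            linarith [finrank_span_le Y]
    have h5 : η ω / q t ω * ∑ b ∈ Y, p b ω * Q b ω * loss t ω b ^ 2 ≤ η ω / q t ω * (2 * d) :=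
      mul_le_mul_of_nonneg_left (h2.trans (h3.le.trans h4)) (by positivity)
    rw [h1]
    have h6 : η ω / q t ω * (2 * d) = 2 * (d * η ω / q t ω) := by ring
    linarith
  -- the cost of mixing
  have hmixcost : ∀ ω, ∑ b ∈ Y, p b ω * loss t ω b - loss t ω u ≤
      (∑ b ∈ Y, loss t ω b * P b ω - loss t ω u * 1) + 2 * (d * η ω / q t ω) := by
    intro ω
    have h1 : ∑ b ∈ Y, p b ω * loss t ω b = ∑ b ∈ Y, loss t ω b * P b ω +
        d * η ω / q t ω * (∑ b ∈ Y, ν b * loss t ω b - ∑ b ∈ Y, P b ω * loss t ω b) := by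
      rw [mul_sub, Finset.mul_sum, Finset.mul_sum, ← Finset.sum_sub_distrib,
        ← Finset.sum_add_distrib]
      refine Finset.sum_congr rfl fun b _ => ?_
      simp only [hp, exp2Dist, hP, hη]
      ring
    have h2 : ∑ b ∈ Y, ν b * loss t ω b ≤ 1 := by
      rw [← h.john.2.2.1]
      exact Finset.sum_le_sum fun b hb =>
        mul_le_of_le_one_right (h.john.1 b hb) (abs_le.1 (hlb b hb ω)).2
    have h3 : -1 ≤ ∑ b ∈ Y, P b ω * loss t ω b := by
      rw [← hP1 ω, ← Finset.sum_neg_distrib]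
      exact Finset.sum_le_sum fun b hb => by
        nlinarith [(abs_le.1 (hlb b hb ω)).1, hP0 b hb ω]
    have h4 := exp2_mix_nonneg (Y := Y) (hv ω) (hq ω).1
    have h5 : d * η ω / q t ω * (∑ b ∈ Y, ν b * loss t ω b - ∑ b ∈ Y, P b ω * loss t ω b) ≤
      d * η ω / q t ω * 2 := mul_le_mul_of_nonneg_left (by linarith) h4
    rw [h1]
    linarith
  have i1 : IntegrableOn (fun ω => ∑ b ∈ Y, loss t ω b * P b ω - loss t ω u * 1) R μ :=
    (integrable_finsetSum _ fun b hb => (hP1' b hb).1).sub hU.1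
  have i2 : IntegrableOn (fun ω => ∑ b ∈ Y, loss t ω b * (p b ω * A b ω)) R μ :=
    integrable_finsetSum _ fun b hb => (hA1 b hb).1
  have i3 : IntegrableOn (fun ω => 2 * (d * η ω / q t ω)) R μ :=
    (hmix.div_const 2).congr (ae_of_all _ fun ω => by ring)
  have i4 : IntegrableOn (fun ω => ∑ b ∈ Y, q t ω * p b ω * H b ω) R μ :=
    integrable_finsetSum _ fun b hb => (hobs b hb).2.1
  have i5 : IntegrableOn (fun ω => ∑ b ∈ Y, p b ω * loss t ω b - loss t ω u) R μ := by
    have : ∀ b ∈ Y, IntegrableOn (fun ω => p b ω * loss t ω b) R μ := fun b hb => by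
      have h1 := (h.integrable_loss ht (h.sub hb)).bdd_mul
        (((hmp b).mono (ℱ.le t) le_rfl).aestronglyMeasurable) (c := 1)
        (ae_of_all _ fun ω => by
          rw [Real.norm_of_nonneg (hp0 b hb ω).le]; exact hple b hb ω)
      exact h1.integrableOn
    exact (integrable_finsetSum _ this).sub (h.integrable_loss ht (h.sub hu)).integrableOn
  have e1 := integral_mono i5 (i1.add i3) hmixcost
  have e2 := integral_mono (i2.sub i3) i4 hsq
  simp only [Pi.sub_apply] at e2
  rw [integral_sub i2 i3] at e2
  have e3 : ∫ ω in R, (∑ b ∈ Y, loss t ω b * P b ω - loss t ω u * 1) +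
      2 * (d * η ω / q t ω) ∂μ = _ := integral_add i1 i3
  have e4 : ∫ ω in R, 4 * (d * η ω / q t ω) ∂μ = 2 * ∫ ω in R, 2 * (d * η ω / q t ω) ∂μ := by
    rw [← integral_const_mul]
    congr 1
    funext ω
    ring
  simp only [Pi.add_apply] at e1
  linarith

end StoppedExp2Run

/-! ### Sums up to a stopping time -/

/-- An initial segment of `range n`, cut out by a predicate that is inherited downwards, is again
a range. -/
lemma lt_card_filter_range {n : ℕ} {p : ℕ → Prop} [DecidablePred p]
    (hp : ∀ t, t + 1 < n → p (t + 1) → p t) (t : ℕ) :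
    t < ((Finset.range n).filter p).card ↔ t < n ∧ p t := by
  have hdown : ∀ s t, s ≤ t → t < n → p t → p s := by
    intro s t hst
    induction t, hst using Nat.le_induction with
    | base => exact fun _ h => h
    | succ t _ ih => exact fun h1 h2 => ih (by omega) (hp t h1 h2)
  have key : ∃ m, (Finset.range n).filter p = Finset.range m := by
    by_cases hall : ∀ t < n, p t
    · exact ⟨n, Finset.filter_true_of_mem fun t ht => hall t (Finset.mem_range.1 ht)⟩
    · push Not at hall
      refine ⟨Nat.find hall, ?_⟩
      obtain ⟨h1, h2⟩ := Nat.find_spec hall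
      ext t
      simp only [Finset.mem_filter, Finset.mem_range]
      constructor
      · rintro ⟨h3, h4⟩
        by_contra h5
        exact h2 (hdown _ _ (not_lt.1 h5) h3 h4)
      · intro h3
        refine ⟨h3.trans h1, ?_⟩
        have := Nat.find_min hall h3
        push Not at this
        exact this (h3.trans h1)
  obtain ⟨m, hm⟩ := key
  have h1 : t ∈ (Finset.range n).filter p ↔ t ∈ Finset.range m := by rw [hm]
  rw [hm, Finset.card_range]
  simpa [Finset.mem_filter] using h1.symm

lemma sum_range_stopTime {Ω : Type u} {T : ℕ} {τ : Ω → ℕ} {f : ℕ → Ω → ℝ} (hτ : ∀ ω, τ ω ≤ T)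
    (ω : Ω) :
    ∑ t ∈ Finset.range (τ ω), f t ω =
      ∑ t ∈ Finset.range T, Set.indicator {ω | t < τ ω} (f t) ω := by
  rw [← Finset.sum_filter_add_sum_filter_not (Finset.range T) (fun t => t < τ ω)]
  rw [Finset.sum_eq_zero (s := (Finset.range T).filter fun t => ¬ t < τ ω), add_zero]
  · rw [show (Finset.range T).filter (fun t => t < τ ω) = Finset.range (τ ω) by
      ext t; simp only [Finset.mem_filter, Finset.mem_range]; have := hτ ω; omega]
    exact Finset.sum_congr rfl fun t ht =>
      (Set.indicator_of_mem (s := {ω | t < τ ω}) (Finset.mem_range.1 ht) _).symm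
  · intro t ht
    exact Set.indicator_of_notMem (s := {ω | t < τ ω}) (Finset.mem_filter.1 ht).2 _

section Stop

variable {Ω : Type u} [mΩ : MeasurableSpace Ω] {μ : Measure Ω} {T : ℕ} {τ : Ω → ℕ}

lemma integrable_sum_range_stopTime {f : ℕ → Ω → ℝ} (hτ : ∀ ω, τ ω ≤ T)
    (hm : ∀ t, MeasurableSet {ω | t < τ ω}) (hf : ∀ t < T, IntegrableOn (f t) {ω | t < τ ω} μ) :
    Integrable (fun ω => ∑ t ∈ Finset.range (τ ω), f t ω) μ := by
  simp only [sum_range_stopTime hτ]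
  exact integrable_finsetSum _ fun t ht =>
    (integrable_indicator_iff (hm t)).2 (hf t (Finset.mem_range.1 ht))

lemma integral_sum_range_stopTime {f : ℕ → Ω → ℝ} (hτ : ∀ ω, τ ω ≤ T)
    (hm : ∀ t, MeasurableSet {ω | t < τ ω}) (hf : ∀ t < T, IntegrableOn (f t) {ω | t < τ ω} μ) :
    ∫ ω, ∑ t ∈ Finset.range (τ ω), f t ω ∂μ =
      ∑ t ∈ Finset.range T, ∫ ω in {ω | t < τ ω}, f t ω ∂μ := by
  simp only [sum_range_stopTime hτ]
  rw [integral_finsetSum _ fun t ht =>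
    (integrable_indicator_iff (hm t)).2 (hf t (Finset.mem_range.1 ht))]
  exact Finset.sum_congr rfl fun t _ => integral_indicator (hm t)

/-- A process evaluated at a stopping time is measurable. -/
lemma measurable_stopped {f : ℕ → Ω → ℝ} (hτ : ∀ ω, τ ω ≤ T)
    (hm : ∀ t, MeasurableSet {ω | t < τ ω}) (hf : ∀ t ≤ T, Measurable (f t)) :
    Measurable fun ω => f (τ ω) ω := by
  have hτm : ∀ t, MeasurableSet {ω | τ ω = t} := by
    intro t
    cases t with
    | zero =>
      convert (hm 0).compl using 1
      ext ω; simp only [Set.mem_ofPred_eq, Set.mem_compl_iff]; omega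
    | succ t =>
      convert (hm t).diff (hm (t + 1)) using 1
      ext ω; simp only [Set.mem_ofPred_eq, Set.mem_sdiff]; omega
  have h1 : (fun ω => f (τ ω) ω) =
      fun ω => ∑ t ∈ Finset.range (T + 1), Set.indicator {ω | τ ω = t} (f t) ω := by
    funext ω
    rw [Finset.sum_eq_single (τ ω)]
    · exact (Set.indicator_of_mem (by exact rfl) _).symm
    · intro t _ ht
      exact Set.indicator_of_notMem (fun h => ht h.symm) _
    · intro h'
      have := hτ ω
      rw [Finset.mem_range] at h'
      omega
  rw [h1]
  exact Finset.measurable_fun_sum _ fun t ht =>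
    (hf t (by have := Finset.mem_range.1 ht; omega)).indicator (hτm t)

end Stop

/-! ### The regret of EXP2 up to a stopping time -/

/-- The stability bound `√(c ∑ 1 / q) + c / min q`, read off the memory after `n` rounds; it vanishes
for `n = 0`. -/
def stabilityBound (c : ℝ) (n : ℕ) (invSum minQ : ℝ) : ℝ :=
  if n = 0 then 0 else Real.sqrt (c * invSum) + c / minQ

namespace StoppedExp2Run

variable {d : ℕ} {Ω : Type u} [mΩ : MeasurableSpace Ω] {μ : Measure Ω} [IsProbabilityMeasure μ]
  {X Y : Finset (Vec d)} {ν : Vec d → ℝ} {T : ℕ} {ℱ 𝒢 : Filtration ℕ mΩ}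
  {loss : ℕ → Ω → Vec d → ℝ} {q : ℕ → Ω → ℝ} {obs : ℕ → Set Ω} {a : ℕ → Ω → Vec d}
  {τ : Ω → ℕ} {ε : ℝ}

lemma integrable_stabilityBound (h : StoppedExp2Run μ X Y ν T ℱ 𝒢 loss q obs a τ ε) (c : ℝ) :
    Integrable (fun ω => stabilityBound c (τ ω) (exp2Run Y ν q obs a loss (τ ω) ω).invSum
      (exp2Run Y ν q obs a loss (τ ω) ω).minQ) μ := by
  have hmin : 0 < min 1 ε := lt_min one_pos h.eps_pos
  have hε := h.eps_pos
  refine Integrable.of_bound (C := Real.sqrt (|c| * (T / ε)) + |c| / min 1 ε) ?_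
    (ae_of_all _ fun ω => ?_)
  · refine Measurable.aestronglyMeasurable ?_
    refine measurable_stopped (f := fun n ω => stabilityBound c n
      (exp2Run Y ν q obs a loss n ω).invSum (exp2Run Y ν q obs a loss n ω).minQ)
      h.stop_le (fun t => ℱ.le t _ (h.stop_measurable t)) fun t ht => ?_
    have hs := h.run_measurable t ht
    by_cases h0 : t = 0
    · simp only [stabilityBound, if_pos h0, measurable_const]
    · simp only [stabilityBound, if_neg h0]
      exact (((hs.invSum.const_mul c).sqrt).add (hs.minQ.const_div c)).mono (ℱ.le t) le_rfl
  · obtain ⟨h1, h2⟩ := h.run_bounds (le_refl (τ ω))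
    obtain ⟨h3, h4, _⟩ := h.valid (h.stop_le ω) ω
    have h5 : (τ ω : ℝ) / ε ≤ T / ε := by
      have := h.stop_le ω
      gcongr
    unfold stabilityBound
    split_ifs
    · rw [norm_zero]; positivity
    · refine (norm_add_le _ _).trans (add_le_add ?_ ?_)
      · rw [Real.norm_of_nonneg (Real.sqrt_nonneg _)]
        refine Real.sqrt_le_sqrt ?_
        calc c * _ ≤ |c| * (exp2Run Y ν q obs a loss (τ ω) ω).invSum :=
              mul_le_mul_of_nonneg_right (le_abs_self c) h3
          _ ≤ _ := mul_le_mul_of_nonneg_left (h1.trans h5) (abs_nonneg c)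
      · rw [norm_div, Real.norm_eq_abs, Real.norm_of_nonneg h4.le]
        exact div_le_div_of_nonneg_left (abs_nonneg c) hmin h2

/-- The regret of EXP2 up to a stopping time, for the loss averaged over its own distribution. -/
theorem regret_le (h : StoppedExp2Run μ X Y ν T ℱ 𝒢 loss q obs a τ ε) {c : ℝ}
    (hc : 81 * (d * Real.log Y.card) ≤ c) {u : Vec d} (hu : u ∈ Y) :
    ∫ ω, ∑ t ∈ Finset.range (τ ω),
      (∑ x ∈ Y, exp2Dist Y ν (exp2Run Y ν q obs a loss t ω) (q t ω) x * loss t ω x - loss t ω u) ∂μ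
      ≤ ∫ ω, stabilityBound c (τ ω) (exp2Run Y ν q obs a loss (τ ω) ω).invSum
        (exp2Run Y ν q obs a loss (τ ω) ω).minQ ∂μ := by
  have hYn : Y.Nonempty := ⟨u, hu⟩
  have hl : 0 ≤ Real.log Y.card := Real.log_natCast_nonneg _
  have hD : 0 ≤ d * Real.log Y.card := by positivity
  have hc0 : 0 ≤ c := le_trans (by positivity) hc
  have hval : ∀ ω, (exp2Run Y ν q obs a loss (τ ω) ω).Valid := fun ω => h.valid (h.stop_le ω) ω
  rcases (Nat.succ_le_of_lt hYn.card_pos).eq_or_lt with h1 | hY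
  · -- with a single action there is no regret
    obtain ⟨y, rfl⟩ := Finset.card_eq_one.1 h1.symm
    rw [Finset.mem_singleton] at hu
    subst hu
    have h2 : ∀ t ω, exp2Dist {u} ν (exp2Run {u} ν q obs a loss t ω) (q t ω) u = 1 := fun t ω => by
      have := sum_exp2Dist (s := exp2Run {u} ν q obs a loss t ω) (q := q t ω) hYn h.john
      rwa [Finset.sum_singleton] at this
    simp only [Finset.sum_singleton, h2, one_mul, sub_self, Finset.sum_const_zero, integral_zero]
    refine integral_nonneg fun ω => ?_
    unfold stabilityBound
    split_ifs
    · exact le_rfl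
    · exact add_nonneg (Real.sqrt_nonneg _) (div_nonneg hc0 (hval ω).2.1.le)
  have hY : 2 ≤ Y.card := hY
  have hm : ∀ t, MeasurableSet {ω | t < τ ω} := fun t => ℱ.le t _ (h.stop_measurable t)
  have hint : ∀ t < T, IntegrableOn (fun ω => ∑ x ∈ Y,
      exp2Dist Y ν (exp2Run Y ν q obs a loss t ω) (q t ω) x * loss t ω x - loss t ω u)
      {ω | t < τ ω} μ := by
    intro t ht
    have hms := h.run_measurable t ht.le
    have hmq := h.weight_measurable t ht
    refine ((integrable_finsetSum _ fun x hx => ?_).sub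
      (h.integrable_loss ht (h.sub hu))).integrableOn
    refine (h.integrable_loss ht (h.sub hx)).bdd_mul
      (((hms.dist hmq x).mono (ℱ.le t) le_rfl).aestronglyMeasurable) (c := 1)
      (ae_of_all _ fun ω => ?_)
    have h0 : ∀ b ∈ Y, 0 ≤ exp2Dist Y ν (exp2Run Y ν q obs a loss t ω) (q t ω) b := fun b hb =>
      (exp2Dist_pos h.john (h.valid ht.le ω) (h.weight_mem t ht ω).1 hb).le
    rw [Real.norm_of_nonneg (h0 x hx), ← sum_exp2Dist hYn h.john]
    exact Finset.single_le_sum h0 hx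
  have hex : ∀ t < T, IntegrableOn (exp2Excess Y ν q obs a loss u t) {ω | t < τ ω} μ :=
    fun t ht => (h.round_le hY hu ht).1
  rw [integral_sum_range_stopTime h.stop_le hm hint]
  refine (Finset.sum_le_sum fun t ht => (h.round_le hY hu (Finset.mem_range.1 ht)).2).trans ?_
  rw [← integral_sum_range_stopTime h.stop_le hm hex]
  refine integral_mono_ae (integrable_sum_range_stopTime h.stop_le hm hex)
    (h.integrable_stabilityBound c) ?_
  have hobs : ∀ᵐ ω ∂μ, ∀ t, t < T → t < τ ω → ω ∈ obs t → a t ω ∈ Y := by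
    rw [ae_all_iff]
    intro t
    by_cases ht : t < T
    · filter_upwards [h.obs_mem ht] with ω hω _ using hω
    · exact ae_of_all _ fun ω h' => absurd h' ht
  filter_upwards [hobs] with ω hω
  rcases hn : τ ω with _ | n
  · simp [stabilityBound]
  have hnT : n + 1 ≤ T := hn ▸ h.stop_le ω
  have h1 := exp2_pathwise hY h.john (fun s => q s ω) (fun s => feedback obs a loss s ω) n
    (fun t ht => h.weight_mem t (by omega) ω)
    (fun t ht x hx => by
      by_cases ho : ω ∈ obs t
      · rw [feedback, if_pos ho, Option.mem_some_iff] at hx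
        subst hx
        have h2 := hω t (by omega) (by omega) ho
        have h3 := h.env.bounded t (by omega) _ (h.sub h2) ω
        exact ⟨h2, abs_le.2 ⟨h3.1, h3.2⟩⟩
      · rw [feedback, if_neg ho] at hx
        simp at hx)
    (fun t => exp2Run Y ν q obs a loss t ω) (fun t => rfl) hu
  refine h1.trans ?_
  obtain ⟨h3, h4, _⟩ := h.valid hnT ω
  rw [stabilityBound, if_neg (by omega)]
  refine add_le_add ?_ ?_
  · rw [show (9 : ℝ) = Real.sqrt 81 by
      rw [show (81 : ℝ) = 9 ^ 2 by norm_num, Real.sqrt_sq (by norm_num)],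
      ← Real.sqrt_mul (by norm_num)]
    refine Real.sqrt_le_sqrt ?_
    rw [← mul_assoc]
    exact mul_le_mul_of_nonneg_right hc h3
  · exact div_le_div_of_nonneg_right (by linarith) h4.le

end StoppedExp2Run

/-! ### Stability of EXP2 -/

lemma le_exp2Run_minQ {d : ℕ} {Ω : Type u} {Y : Finset (Vec d)} {ν : Vec d → ℝ} {q : ℕ → Ω → ℝ}
    {obs : ℕ → Set Ω} {a : ℕ → Ω → Vec d} {loss : ℕ → Ω → Vec d → ℝ} {n : ℕ} {ω : Ω} {x : ℝ}
    (h1 : x ≤ 1) (hx : ∀ t < n, x ≤ q t ω) : x ≤ (exp2Run Y ν q obs a loss n ω).minQ := by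
  induction n with
  | zero => exact h1
  | succ n ih => exact le_min (ih fun t ht => hx t (by omega)) (hx n (by omega))

lemma exp2Run_invSum {d : ℕ} {Ω : Type u} {Y : Finset (Vec d)} {ν : Vec d → ℝ} {q : ℕ → Ω → ℝ}
    {obs : ℕ → Set Ω} {a : ℕ → Ω → Vec d} {loss : ℕ → Ω → Vec d → ℝ} (n : ℕ) (ω : Ω) :
    (exp2Run Y ν q obs a loss n ω).invSum = ∑ t ∈ Finset.range n, 1 / q t ω := by
  induction n with
  | zero => rfl
  | succ n ih => rw [Finset.sum_range_succ, ← ih]; rfl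

/-- EXP2 is `1/2`-iw-stable. The weights of an arbitrary environment are not bounded away from zero,
so the play is first stopped before the weights fall below a threshold, which then tends to zero. -/
theorem iwStable_exp2 {d : ℕ} {Y : Finset (Vec d)} {ν : Vec d → ℝ} (hν : IsJohnExploration Y ν)
    {c : ℝ} (hc : 81 * (d * Real.log Y.card) ≤ c) : IWStable.{u} Y (exp2 Y ν) c c := by
  intro Ω mΩ μ _ T ℱ 𝒢 loss q upd a henv hint τ hτ hτm u hu
  have hl : 0 ≤ Real.log Y.card := Real.log_natCast_nonneg _
  have hc0 : 0 ≤ c := le_trans (by positivity) hc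
  set obs : ℕ → Set Ω := fun t => {ω | upd t ω = true} with hobs
  set thr : ℕ → ℝ := fun k => 1 / ((k : ℝ) + 1) with hthr
  have hthr0 : ∀ k, 0 < thr k := fun k => by simp only [hthr]; positivity
  -- the stopping times
  let σ : ℕ → Ω → ℕ := fun k ω =>
    ((Finset.range (τ ω)).filter fun t => ∀ s ≤ t, thr k ≤ q s ω).card
  have hσ : ∀ k ω t, t < σ k ω ↔ t < τ ω ∧ ∀ s ≤ t, thr k ≤ q s ω := fun k ω t =>
    lt_card_filter_range (p := fun t => ∀ s ≤ t, thr k ≤ q s ω)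
      (fun t _ h s hs => h s (by omega)) t
  have hσle : ∀ k ω, σ k ω ≤ τ ω := fun k ω => by
    by_contra h
    exact lt_irrefl _ ((hσ k ω (τ ω)).1 (not_le.1 h)).1
  have hτm' : ∀ n, MeasurableSet[ℱ n] {ω | n < τ ω} := fun n => by
    convert (hτm n).compl using 1
    ext ω; simp
  have hσm : ∀ k n, MeasurableSet[ℱ n] {ω | n < σ k ω} := by
    intro k n
    by_cases hn : n < T
    · have h1 : {ω | n < σ k ω} = {ω | n < τ ω} ∩ ⋂ s ∈ Finset.range (n + 1), {ω | thr k ≤ q s ω} := by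
        ext ω
        simp only [Set.mem_ofPred_eq, hσ, Set.mem_inter_iff, Set.mem_iInter, Finset.mem_range,
          Nat.lt_succ_iff]
      rw [h1]
      refine (hτm' n).inter (Finset.measurableSet_biInter _ fun s hs => ?_)
      have hs' : s ≤ n := by have := Finset.mem_range.1 hs; omega
      exact ℱ.mono hs' _ (measurableSet_le measurable_const (hint.weight_measurable s (by omega)))
    · have h1 : {ω | n < σ k ω} = ∅ := by
        ext ω
        have := hσle k ω
        have := hτ ω
        simp only [Set.mem_ofPred_eq, Set.mem_empty_iff_false, iff_false]
        omega
      rw [h1]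
      exact @MeasurableSet.empty _ (ℱ n)
  have hstate : ∀ t ω, (exp2 Y ν).stateAt (fun s => q s ω)
      (fun s => if upd s ω then some (a s ω, loss s ω (a s ω)) else none) t =
      exp2Run Y ν q obs a loss t ω := by
    intro t ω
    unfold exp2Run
    congr 1
    funext s
    simp only [feedback, hobs, Set.mem_ofPred_eq]
  have hlaw : ∀ t < T, ∀ b : Bool, ∀ x ∈ Y, ∀ᵐ ω ∂μ,
      (μ[Set.indicator {ω | upd t ω = b ∧ a t ω = x} (fun _ => (1 : ℝ)) | 𝒢 t]) ω =
      (if b then q t ω else 1 - q t ω) *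
        exp2Dist Y ν (exp2Run Y ν q obs a loss t ω) (q t ω) x := by
    intro t ht b x hx
    filter_upwards [hint.law t ht b x hx] with ω hω
    rw [hω, hstate]
    rfl
  have hrun : ∀ k, StoppedExp2Run μ Y Y ν T ℱ 𝒢 loss q obs a (σ k) (thr k) := fun k =>
    { john := hν
      sub := subset_rfl
      env := henv
      weight_measurable := hint.weight_measurable
      weight_mem := hint.weight_mem
      obs_measurable := fun t ht => hint.upd_measurable t ht (measurableSet_singleton true)
      action_measurable := hint.action_measurable
      action_mem := hint.action_mem
      stop_le := fun ω => (hσle k ω).trans (hτ ω)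
      stop_measurable := hσm k
      eps_pos := hthr0 k
      eps_le := fun t ω ht => ((hσ k ω t).1 ht).2 t le_rfl
      law := fun t ht x hx => by
        filter_upwards [hlaw t ht true x hx] with ω hω _
        rw [if_pos rfl] at hω
        exact hω }
  -- the played action may be averaged over its distribution
  have hlossa : ∀ t < T, ∀ ω, |loss t ω (a t ω)| ≤ 1 := fun t ht ω => abs_le.2
    ⟨(henv.bounded t ht _ (hint.action_mem t ht ω) ω).1,
      (henv.bounded t ht _ (hint.action_mem t ht ω) ω).2⟩
  have hlossu : ∀ t < T, ∀ ω, |loss t ω u| ≤ 1 := fun t ht ω => abs_le.2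
    ⟨(henv.bounded t ht _ hu ω).1, (henv.bounded t ht _ hu ω).2⟩
  have hev : ∀ t < T, ∀ b x, MeasurableSet {ω | upd t ω = b ∧ a t ω = x} := fun t ht b x =>
    (ℱ.le (t + 1) _ (hint.upd_measurable t ht (measurableSet_singleton b))).inter
      (ℱ.le (t + 1) _ (hint.action_measurable t ht (measurableSet_singleton x)))
  have hdecomp : ∀ t < T, ∀ ω, loss t ω (a t ω) = ∑ x ∈ Y, ∑ b : Bool,
      Set.indicator {ω | upd t ω = b ∧ a t ω = x} (fun _ => (1 : ℝ)) ω * loss t ω x := by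
    intro t ht ω
    rw [Finset.sum_eq_single (a t ω), Finset.sum_eq_single (upd t ω)]
    · rw [Set.indicator_of_mem (by exact ⟨rfl, rfl⟩), one_mul]
    · intro b _ hb
      rw [Set.indicator_of_notMem (by rintro ⟨h', _⟩; exact hb h'.symm), zero_mul]
    · intro h'; exact absurd (Finset.mem_univ _) h'
    · intro x _ hx
      refine Finset.sum_eq_zero fun b _ => ?_
      rw [Set.indicator_of_notMem (by rintro ⟨_, h'⟩; exact hx h'.symm), zero_mul]
    · intro h'; exact absurd (hint.action_mem t ht ω) h'
  have hround : ∀ k, ∀ t < T, IntegrableOn (fun ω => loss t ω (a t ω) - loss t ω u)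
      {ω | t < σ k ω} μ ∧ IntegrableOn (fun ω => ∑ x ∈ Y,
        exp2Dist Y ν (exp2Run Y ν q obs a loss t ω) (q t ω) x * loss t ω x - loss t ω u)
        {ω | t < σ k ω} μ ∧
      ∫ ω in {ω | t < σ k ω}, (loss t ω (a t ω) - loss t ω u) ∂μ =
        ∫ ω in {ω | t < σ k ω}, (∑ x ∈ Y,
          exp2Dist Y ν (exp2Run Y ν q obs a loss t ω) (q t ω) x * loss t ω x - loss t ω u) ∂μ := by
    intro k t ht
    have hiu : IntegrableOn (fun ω => loss t ω u) {ω | t < σ k ω} μ :=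
      ((hrun k).integrable_loss ht hu).integrableOn
    have h1 : ∀ x ∈ Y, ∀ b : Bool, _ := fun x hx b =>
      setIntegral_mul_of_condExp (𝒢.le t)
        (f := Set.indicator {ω | upd t ω = b ∧ a t ω = x} (fun _ => (1 : ℝ)))
        (ρ := fun ω => (if b then q t ω else 1 - q t ω) *
          exp2Dist Y ν (exp2Run Y ν q obs a loss t ω) (q t ω) x)
        ((integrable_const (μ := μ) (1 : ℝ)).indicator (hev t ht b x))
        (henv.le_env t _ (hσm k t)) (henv.measurable t ht x hx) (C := 1)
        (fun ω _ => abs_le.2 ⟨(henv.bounded t ht x hx ω).1, (henv.bounded t ht x hx ω).2⟩)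
        ((hlaw t ht b x hx).mono fun ω hω _ => hω)
    have i1 : IntegrableOn (fun ω => ∑ x ∈ Y, ∑ b : Bool,
        Set.indicator {ω | upd t ω = b ∧ a t ω = x} (fun _ => (1 : ℝ)) ω * loss t ω x)
        {ω | t < σ k ω} μ :=
      integrable_finsetSum _ fun x hx => integrable_finsetSum _ fun b _ => (h1 x hx b).1
    have e2 : (fun ω => ∑ x ∈ Y,
        exp2Dist Y ν (exp2Run Y ν q obs a loss t ω) (q t ω) x * loss t ω x) =
        fun ω => ∑ x ∈ Y, ∑ b : Bool, (if b then q t ω else 1 - q t ω) *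
          exp2Dist Y ν (exp2Run Y ν q obs a loss t ω) (q t ω) x * loss t ω x := by
      funext ω
      refine Finset.sum_congr rfl fun x _ => ?_
      simp only [Fintype.sum_bool, if_true, Bool.false_eq_true, if_false]
      ring
    have i2 : IntegrableOn (fun ω => ∑ x ∈ Y,
        exp2Dist Y ν (exp2Run Y ν q obs a loss t ω) (q t ω) x * loss t ω x)
        {ω | t < σ k ω} μ := by
      rw [e2]
      exact integrable_finsetSum _ fun x hx => integrable_finsetSum _ fun b _ => (h1 x hx b).2.1
    have e1 : (fun ω => loss t ω (a t ω)) = fun ω => ∑ x ∈ Y, ∑ b : Bool,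
        Set.indicator {ω | upd t ω = b ∧ a t ω = x} (fun _ => (1 : ℝ)) ω * loss t ω x :=
      funext (hdecomp t ht)
    have i3 : IntegrableOn (fun ω => loss t ω (a t ω)) {ω | t < σ k ω} μ := by rw [e1]; exact i1
    refine ⟨i3.sub hiu, i2.sub hiu, ?_⟩
    rw [integral_sub i3 hiu, integral_sub i2 hiu, e1, e2,
      integral_finsetSum _ fun x hx => integrable_finsetSum _ fun b _ => (h1 x hx b).1,
      integral_finsetSum _ fun x hx => integrable_finsetSum _ fun b _ => (h1 x hx b).2.1]
    congr 1
    refine Finset.sum_congr rfl fun x hx => ?_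
    rw [integral_finsetSum _ fun b _ => (h1 x hx b).1,
      integral_finsetSum _ fun b _ => (h1 x hx b).2.1]
    exact Finset.sum_congr rfl fun b _ => (h1 x hx b).2.2
  -- the bound for the truncated play
  have hbound : ∀ k, ENNReal.ofReal
      (∫ ω, ∑ t ∈ Finset.range (σ k ω), (loss t ω (a t ω) - loss t ω u) ∂μ) ≤
      ∫⁻ ω, ENNReal.ofReal (Real.sqrt (c * ∑ t ∈ Finset.range (τ ω), 1 / q t ω) +
        c / ⨅ t : Fin (τ ω), q t ω) ∂μ := by
    intro k
    have hm : ∀ t, MeasurableSet {ω | t < σ k ω} := fun t => ℱ.le t _ (hσm k t)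
    have h1 := (hrun k).regret_le hc hu
    rw [integral_sum_range_stopTime (hrun k).stop_le hm fun t ht => (hround k t ht).2.1,
      ← Finset.sum_congr rfl fun t ht => (hround k t (Finset.mem_range.1 ht)).2.2,
      ← integral_sum_range_stopTime (hrun k).stop_le hm fun t ht => (hround k t ht).1] at h1
    have hnn : ∀ ω, 0 ≤ stabilityBound c (σ k ω) (exp2Run Y ν q obs a loss (σ k ω) ω).invSum
        (exp2Run Y ν q obs a loss (σ k ω) ω).minQ := fun ω => by
      unfold stabilityBound
      split_ifs
      · exact le_rfl
      · exact add_nonneg (Real.sqrt_nonneg _)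
          (div_nonneg hc0 ((hrun k).valid ((hrun k).stop_le ω) ω).2.1.le)
    refine (ENNReal.ofReal_le_ofReal h1).trans ?_
    rw [ofReal_integral_eq_lintegral_ofReal ((hrun k).integrable_stabilityBound c)
      (ae_of_all _ hnn)]
    refine lintegral_mono fun ω => ENNReal.ofReal_le_ofReal ?_
    have hqpos : ∀ t < τ ω, 0 < q t ω := fun t ht =>
      (hint.weight_mem t (lt_of_lt_of_le ht (hτ ω)) ω).1
    have hinf : ∀ t < τ ω, (⨅ t : Fin (τ ω), q t ω) ≤ q t ω := fun t ht =>
      ciInf_le (Set.finite_range _).bddBelow (⟨t, ht⟩ : Fin (τ ω))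
    unfold stabilityBound
    split_ifs with h0
    · refine add_nonneg (Real.sqrt_nonneg _) (div_nonneg hc0 (Real.iInf_nonneg fun t => ?_))
      exact (hqpos t t.2).le
    · have hpos : 0 < τ ω := lt_of_lt_of_le (Nat.pos_of_ne_zero h0) (hσle k ω)
      have : Nonempty (Fin (τ ω)) := ⟨⟨0, hpos⟩⟩
      have hinf0 : 0 < ⨅ t : Fin (τ ω), q t ω := by
        obtain ⟨i, hi⟩ := exists_eq_ciInf_of_finite (f := fun t : Fin (τ ω) => q t ω)
        rw [← hi]
        exact hqpos i i.2
      refine add_le_add (Real.sqrt_le_sqrt (mul_le_mul_of_nonneg_left ?_ hc0))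
        (div_le_div_of_nonneg_left hc0 hinf0 (le_exp2Run_minQ ?_ fun t ht => ?_))
      · rw [exp2Run_invSum]
        refine Finset.sum_le_sum_of_subset_of_nonneg
          (Finset.range_subset_range.2 (hσle k ω)) fun t ht _ => ?_
        exact one_div_nonneg.2 (hqpos t (Finset.mem_range.1 ht)).le
      · exact (hinf 0 hpos).trans (hint.weight_mem 0 (lt_of_lt_of_le hpos (hτ ω)) ω).2
      · exact hinf t (lt_of_lt_of_le ht (hσle k ω))
  -- removing the truncation
  have hlim : Filter.Tendsto
      (fun k => ∫ ω, ∑ t ∈ Finset.range (σ k ω), (loss t ω (a t ω) - loss t ω u) ∂μ)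
      Filter.atTop
      (nhds (∫ ω, ∑ t ∈ Finset.range (τ ω), (loss t ω (a t ω) - loss t ω u) ∂μ)) := by
    refine tendsto_integral_of_dominated_convergence (fun _ => 2 * (T : ℝ)) (fun k => ?_)
      (integrable_const _) (fun k => ae_of_all _ fun ω => ?_) (ae_of_all _ fun ω => ?_)
    · exact (integrable_sum_range_stopTime (hrun k).stop_le (fun t => ℱ.le t _ (hσm k t))
        fun t ht => (hround k t ht).1).aestronglyMeasurable
    · calc ‖∑ t ∈ Finset.range (σ k ω), (loss t ω (a t ω) - loss t ω u)‖
          ≤ ∑ t ∈ Finset.range (σ k ω), ‖loss t ω (a t ω) - loss t ω u‖ := norm_sum_le _ _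
        _ ≤ ∑ t ∈ Finset.range (σ k ω), 2 := Finset.sum_le_sum fun t ht => by
            have ht' : t < T := lt_of_lt_of_le (Finset.mem_range.1 ht) ((hrun k).stop_le ω)
            have h1 := abs_le.1 (hlossa t ht' ω)
            have h2 := abs_le.1 (hlossu t ht' ω)
            rw [Real.norm_eq_abs, abs_le]
            constructor <;> linarith [h1.1, h1.2, h2.1, h2.2]
        _ = 2 * (σ k ω : ℝ) := by rw [Finset.sum_const, Finset.card_range, nsmul_eq_mul, mul_comm]
        _ ≤ 2 * (T : ℝ) := by
            have : (σ k ω : ℝ) ≤ T := by exact_mod_cast (hrun k).stop_le ω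
            linarith
    · have hev : ∀ t < τ ω, ∀ᶠ k in Filter.atTop, thr k ≤ q t ω := fun t ht =>
        (tendsto_one_div_add_atTop_nhds_zero_nat (𝕜 := ℝ)).eventually_le_const
          (hint.weight_mem t (lt_of_lt_of_le ht (hτ ω)) ω).1
      have hev' : ∀ᶠ k in Filter.atTop, ∀ t ∈ Finset.range (τ ω), thr k ≤ q t ω :=
        (Filter.eventually_all_finset _).2 fun t ht => hev t (Finset.mem_range.1 ht)
      refine tendsto_const_nhds.congr' ?_
      filter_upwards [hev'] with k hk
      have : σ k ω = τ ω := by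
        refine le_antisymm (hσle k ω) ?_
        by_contra h
        push Not at h
        exact lt_irrefl _ ((hσ k ω (σ k ω)).2
          ⟨h, fun s hs => hk s (Finset.mem_range.2 (lt_of_le_of_lt hs h))⟩)
      rw [this]
  exact le_of_tendsto ((ENNReal.continuous_ofReal.tendsto _).comp hlim)
    (Filter.Eventually.of_forall hbound)

/-! ### Follow the regularised leader over two arms -/

/-- The FTRL objective over two arms as a function of the probability `p` of the second arm: `W` is
the difference of the cumulative losses, `κ` weighs the Tsallis entropy and `8 c` the
log-barrier. -/
def ftrlObj (κ c W p : ℝ) : ℝ :=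
  p * W - 2 * κ * (Real.sqrt p + Real.sqrt (1 - p)) - 8 * c * (Real.log p + Real.log (1 - p))

lemma exists_isMinOn_ftrlObj {κ c : ℝ} (hκ : 0 ≤ κ) (hc : 0 < c) (W : ℝ) :
    ∃ p ∈ Set.Ioo (0 : ℝ) 1, IsMinOn (ftrlObj κ c W) (Set.Ioo 0 1) p := by
  set M := ftrlObj κ c W (1 / 2) with hM
  set δ := min (1 / 2) (Real.exp (-(M + |W| + 4 * κ) / (8 * c))) with hδ
  have hδ0 : 0 < δ := lt_min (by norm_num) (Real.exp_pos _)
  have hδ2 : δ ≤ 1 / 2 := min_le_left _ _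
  have hlog : ∀ p, 0 < p → p < δ → M + |W| + 4 * κ < -(8 * c * Real.log p) := by
    intro p hp hpδ
    have h1 : Real.log p < -(M + |W| + 4 * κ) / (8 * c) := by
      rw [Real.log_lt_iff_lt_exp hp]
      exact hpδ.trans_le (min_le_right _ _)
    rw [lt_div_iff₀ (by positivity)] at h1
    linarith
  have hlow : ∀ p ∈ Set.Ioo (0 : ℝ) 1, -|W| - 4 * κ - 8 * c * (Real.log p + Real.log (1 - p)) ≤
      ftrlObj κ c W p := by
    intro p hp
    have h1 : Real.sqrt p ≤ 1 := Real.sqrt_le_one.2 hp.2.le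
    have h2 : Real.sqrt (1 - p) ≤ 1 := Real.sqrt_le_one.2 (by linarith [hp.1])
    have h3 : -|W| ≤ p * W := by
      have := neg_abs_le (p * W)
      rw [abs_mul, abs_of_pos hp.1] at this
      nlinarith [abs_nonneg W, hp.2]
    unfold ftrlObj
    nlinarith
  have hcont : ContinuousOn (ftrlObj κ c W) (Set.Icc δ (1 - δ)) := by
    unfold ftrlObj
    have h1 : ∀ p ∈ Set.Icc δ (1 - δ), p ≠ 0 := fun p hp => (hδ0.trans_le hp.1).ne'
    have h2 : ∀ p ∈ Set.Icc δ (1 - δ), 1 - p ≠ 0 := fun p hp => by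
      have := hp.2
      exact ne_of_gt (by linarith)
    refine ContinuousOn.sub (by fun_prop) (continuousOn_const.mul (ContinuousOn.add ?_ ?_))
    · exact continuousOn_id.log h1
    · exact (continuousOn_const.sub continuousOn_id).log h2
  have hmem : (1 / 2 : ℝ) ∈ Set.Icc δ (1 - δ) := ⟨hδ2, by linarith⟩
  obtain ⟨p, hp, hmin⟩ := isCompact_Icc.exists_isMinOn ⟨_, hmem⟩ hcont
  refine ⟨p, ⟨hδ0.trans_le hp.1, by linarith [hp.2]⟩, fun r hr => ?_⟩
  have hpM : ftrlObj κ c W p ≤ M := hmin hmem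
  have hr1 := hr.1
  have hr2 := hr.2
  have hl1 : Real.log r < 0 := Real.log_neg hr.1 hr.2
  have hl2 : Real.log (1 - r) < 0 := Real.log_neg (by linarith) (by linarith)
  have h0 := hlow r hr
  change ftrlObj κ c W p ≤ ftrlObj κ c W r
  by_cases h1 : r < δ
  · have := hlog r hr.1 h1
    nlinarith
  by_cases h2 : 1 - δ < r
  · have := hlog (1 - r) (by linarith) (by linarith)
    nlinarith
  · exact hmin ⟨not_lt.1 h1, not_lt.1 h2⟩

section Argmin

variable {κ c W x : ℝ}

/-- The first-order condition for the FTRL iterate. -/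
lemma ftrl_first_order (hx : x ∈ Set.Ioo (0 : ℝ) 1)
    (hmin : IsMinOn (ftrlObj κ c W) (Set.Ioo 0 1) x) :
    W = κ * (1 / Real.sqrt x - 1 / Real.sqrt (1 - x)) + 8 * c * (1 / x - 1 / (1 - x)) := by
  have h0 : x ≠ 0 := hx.1.ne'
  have h1 : 1 - x ≠ 0 := by have := hx.2; exact ne_of_gt (by linarith)
  have hs : HasDerivAt (fun p : ℝ => 1 - p) (-1) x := by
    simpa using (hasDerivAt_id x).const_sub 1
  have hd : HasDerivAt (ftrlObj κ c W)
      (1 * W - 2 * κ * (1 / (2 * Real.sqrt x) + -1 / (2 * Real.sqrt (1 - x))) -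
        8 * c * (1 / x + -1 / (1 - x))) x :=
    (((hasDerivAt_id x).mul_const W).sub
      ((((hasDerivAt_id x).sqrt h0).add (hs.sqrt h1)).const_mul (2 * κ))).sub
      ((((hasDerivAt_id x).log h0).add (hs.log h1)).const_mul (8 * c))
  have h2 := (hmin.isLocalMin (isOpen_Ioo.mem_nhds hx)).hasDerivAt_eq_zero hd
  have h3 : Real.sqrt x ≠ 0 := (Real.sqrt_pos.2 hx.1).ne'
  have h4 : Real.sqrt (1 - x) ≠ 0 := (Real.sqrt_pos.2 (by linarith [hx.2])).ne'
  have h5 : 1 / (2 * Real.sqrt x) + -1 / (2 * Real.sqrt (1 - x)) =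
      (1 / Real.sqrt x - 1 / Real.sqrt (1 - x)) / 2 := by field_simp; ring
  rw [h5] at h2
  have h6 : -1 / (1 - x) = -(1 / (1 - x)) := by ring
  rw [h6] at h2
  linarith

/-- Since the iterate is an interior minimiser, suboptimality is the Bregman divergence. -/
lemma ftrl_bregman (hx : x ∈ Set.Ioo (0 : ℝ) 1)
    (hmin : IsMinOn (ftrlObj κ c W) (Set.Ioo 0 1) x) {p : ℝ} (hp : p ∈ Set.Ioo (0 : ℝ) 1) :
    ftrlObj κ c W p - ftrlObj κ c W x =
      κ * ((Real.sqrt p - Real.sqrt x) ^ 2 / Real.sqrt x +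
        (Real.sqrt (1 - p) - Real.sqrt (1 - x)) ^ 2 / Real.sqrt (1 - x)) +
      8 * c * ((p / x - 1 - Real.log (p / x)) +
        ((1 - p) / (1 - x) - 1 - Real.log ((1 - p) / (1 - x)))) := by
  have hW := ftrl_first_order hx hmin
  have hx1 : 0 < 1 - x := by linarith [hx.2]
  have hp1 : 0 < 1 - p := by linarith [hp.2]
  rw [Real.log_div hp.1.ne' hx.1.ne', Real.log_div hp1.ne' hx1.ne']
  have e1 := Real.sq_sqrt hx.1.le
  have e2 := Real.sq_sqrt hp.1.le
  have e3 := Real.sq_sqrt hx1.le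
  have e4 := Real.sq_sqrt hp1.le
  have s1 := Real.sqrt_pos.2 hx.1
  have s2 := Real.sqrt_pos.2 hx1
  have f1 : (Real.sqrt p - Real.sqrt x) ^ 2 / Real.sqrt x =
      (p - x) / Real.sqrt x - 2 * Real.sqrt p + 2 * Real.sqrt x := by
    rw [eq_comm, ← sub_eq_zero]
    field_simp
    nlinarith
  have f2 : (Real.sqrt (1 - p) - Real.sqrt (1 - x)) ^ 2 / Real.sqrt (1 - x) =
      -((p - x) / Real.sqrt (1 - x)) - 2 * Real.sqrt (1 - p) + 2 * Real.sqrt (1 - x) := by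
    rw [eq_comm, ← sub_eq_zero]
    field_simp
    nlinarith
  have f3 : p / x - 1 = (p - x) * (1 / x) := by
    have := hx.1.ne'
    field_simp
  have f4 : (1 - p) / (1 - x) - 1 = -((p - x) * (1 / (1 - x))) := by
    field_simp
    ring
  rw [f1, f2, f3, f4]
  unfold ftrlObj
  rw [hW]
  ring

lemma sub_one_sub_log_nonneg {r : ℝ} (hr : 0 < r) : 0 ≤ r - 1 - Real.log r := by
  linarith [Real.log_le_sub_one_of_pos hr]

lemma ftrl_argmin_unique (hκ : 0 < κ) (hc : 0 ≤ c) (hx : x ∈ Set.Ioo (0 : ℝ) 1)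
    (hmin : IsMinOn (ftrlObj κ c W) (Set.Ioo 0 1) x) {p : ℝ} (hp : p ∈ Set.Ioo (0 : ℝ) 1)
    (hminp : IsMinOn (ftrlObj κ c W) (Set.Ioo 0 1) p) : p = x := by
  have h1 := ftrl_bregman hx hmin hp
  have h2 : ftrlObj κ c W p ≤ ftrlObj κ c W x := hminp hx
  have hx1 : 0 < 1 - x := by linarith [hx.2]
  have hp1 : 0 < 1 - p := by linarith [hp.2]
  have s1 := Real.sqrt_pos.2 hx.1
  have h3 := sub_one_sub_log_nonneg (div_pos hp.1 hx.1)
  have h4 := sub_one_sub_log_nonneg (div_pos hp1 hx1)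
  have h5 : 0 ≤ (Real.sqrt (1 - p) - Real.sqrt (1 - x)) ^ 2 / Real.sqrt (1 - x) := by positivity
  have h6 : 0 ≤ (Real.sqrt p - Real.sqrt x) ^ 2 / Real.sqrt x := by positivity
  have h7 : (Real.sqrt p - Real.sqrt x) ^ 2 / Real.sqrt x = 0 := by
    by_contra hne
    have h8 : 0 < (Real.sqrt p - Real.sqrt x) ^ 2 / Real.sqrt x := lt_of_le_of_ne h6 (Ne.symm hne)
    have h9 : 0 < κ * ((Real.sqrt p - Real.sqrt x) ^ 2 / Real.sqrt x +
      (Real.sqrt (1 - p) - Real.sqrt (1 - x)) ^ 2 / Real.sqrt (1 - x)) :=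
      mul_pos hκ (by linarith)
    have h10 : 0 ≤ 8 * c * ((p / x - 1 - Real.log (p / x)) +
        ((1 - p) / (1 - x) - 1 - Real.log ((1 - p) / (1 - x)))) :=
      mul_nonneg (by linarith) (by linarith)
    linarith
  rw [div_eq_zero_iff, or_iff_left s1.ne', sq_eq_zero_iff, sub_eq_zero,
    Real.sqrt_inj hp.1.le hx.1.le] at h7
  exact h7

end Argmin

/-- The stability of one coordinate against a loss `D`, in terms of square roots of
probabilities. -/
lemma tsallis_stability {κ x y D : ℝ} (hx : 0 < x) (hx1 : x ≤ 1) (hκ : 32 ≤ κ) (hD : -8 ≤ D) :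
    (x ^ 2 - y ^ 2) * D - κ / 2 * ((y - x) ^ 2 / x) ≤ 4 * x ^ 3 * D ^ 2 / κ := by
  have hκ0 : 0 < κ := by linarith
  rw [← sub_nonneg]
  have e : 4 * x ^ 3 * D ^ 2 / κ - ((x ^ 2 - y ^ 2) * D - κ / 2 * ((y - x) ^ 2 / x)) =
      (4 * x ^ 4 * D ^ 2 - (x ^ 2 - y ^ 2) * D * κ * x + κ ^ 2 / 2 * (y - x) ^ 2) / (κ * x) := by
    field_simp
    ring
  rw [e]
  refine div_nonneg ?_ (by positivity)
  -- with `z = y - x`, the numerator is a quadratic polynomial in `z`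
  have e2 : 4 * x ^ 4 * D ^ 2 - (x ^ 2 - y ^ 2) * D * κ * x + κ ^ 2 / 2 * (y - x) ^ 2 =
      (2 * x ^ 2 * D + κ / 2 * (y - x)) ^ 2 + (κ ^ 2 / 4 + κ * x * D) * (y - x) ^ 2 := by ring
  rw [e2]
  have h1 : 0 ≤ κ / 4 + x * D := by nlinarith
  have h2 : κ ^ 2 / 4 + κ * x * D = κ * (κ / 4 + x * D) := by ring
  rw [h2]
  positivity

/-- The stability of one coordinate against a negative loss `-b` that is small compared to `κ`. -/
lemma tsallis_stability_bonus {κ x y b : ℝ} (hx : 0 < x) (hb : 0 ≤ b)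
    (hxb : x * b ≤ κ / 5) :
    (y ^ 2 - x ^ 2) * b - κ / 2 * ((y - x) ^ 2 / x) ≤ x ^ 2 * b := by
  rw [← sub_nonneg]
  have e : x ^ 2 * b - ((y ^ 2 - x ^ 2) * b - κ / 2 * ((y - x) ^ 2 / x)) =
      (x ^ 3 * b - 2 * x ^ 2 * (y - x) * b + (κ / 2 - x * b) * (y - x) ^ 2) / x := by
    field_simp
    ring
  rw [e]
  refine div_nonneg ?_ hx.le
  have h1 : 3 / 2 * (x * b) ≤ κ / 2 - x * b := by linarith
  have h2 : 3 / 2 * (x * b) * (y - x) ^ 2 ≤ (κ / 2 - x * b) * (y - x) ^ 2 :=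
    mul_le_mul_of_nonneg_right h1 (sq_nonneg _)
  have h3 : 0 ≤ x * b * ((x - (y - x)) ^ 2 + 1 / 2 * (y - x) ^ 2) := by positivity
  nlinarith

/-- The stability of the log-barrier against a negative loss. -/
lemma logBarrier_stability {c v r : ℝ} (hc : 0 < c) (hv : 0 ≤ v) (hvc : v ≤ 4 * c) (hr : 0 < r) :
    v * (r - 1) - 8 * c * (r - 1 - Real.log r) ≤ v := by
  set l := v / (8 * c) with hl
  have hvl : v = 8 * c * l := by rw [hl]; field_simp
  have hl0 : 0 ≤ l := by positivity
  have hl1 : l ≤ 1 / 2 := by rw [hl, div_le_iff₀ (by positivity)]; linarith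
  have h1 : Real.log ((1 - l) * r) ≤ (1 - l) * r - 1 :=
    Real.log_le_sub_one_of_pos (mul_pos (by linarith) hr)
  rw [Real.log_mul (by linarith) hr.ne'] at h1
  have h2 : 1 - 1 / (1 - l) ≤ Real.log (1 - l) := by
    have := Real.one_sub_inv_le_log_of_pos (show 0 < 1 - l by linarith)
    rwa [inv_eq_one_div] at this
  have h3 : 1 / (1 - l) ≤ 1 + 2 * l := by
    rw [div_le_iff₀ (by linarith)]
    nlinarith
  have h4 : l * (r - 1) - (r - 1 - Real.log r) ≤ l := by nlinarith
  rw [hvl]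
  nlinarith

/-- One step of FTRL over two arms: the stability term against the loss difference `D` and the
bonus `b' + b''` of the second arm. -/
lemma ftrl_stability {κ c W x D b' b'' p : ℝ} (hκ : 32 ≤ κ) (hc : 0 < c)
    (hx : x ∈ Set.Ioo (0 : ℝ) 1) (hmin : IsMinOn (ftrlObj κ c W) (Set.Ioo 0 1) x)
    (hD1 : x ≤ 1 / 2 → -8 ≤ D) (hD2 : 1 / 2 < x → D ≤ 8) (hb' : 0 ≤ b')
    (hb'κ : Real.sqrt x * b' ≤ κ / 5) (hb'' : 0 ≤ b'') (hb''c : x * b'' ≤ 4 * c)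
    (hp : p ∈ Set.Ioo (0 : ℝ) 1) :
    ftrlObj κ c W x + x * (D - (b' + b'')) ≤ ftrlObj κ c W p + p * (D - (b' + b'')) +
      (4 * (min x (1 - x) * Real.sqrt (min x (1 - x))) * D ^ 2 / κ + x * b' + x * b'') := by
  have hB := ftrl_bregman hx hmin hp
  have hx1 : 0 < 1 - x := by linarith [hx.2]
  have hp1 : 0 < 1 - p := by linarith [hp.2]
  have s1 := Real.sqrt_pos.2 hx.1
  have s2 := Real.sqrt_pos.2 hx1
  have e1 := Real.sq_sqrt hx.1.le
  have e2 := Real.sq_sqrt hp.1.le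
  have e3 := Real.sq_sqrt hx1.le
  have e4 := Real.sq_sqrt hp1.le
  have h4 := sub_one_sub_log_nonneg (div_pos hp1 hx1)
  have hq1 : 0 ≤ (Real.sqrt p - Real.sqrt x) ^ 2 / Real.sqrt x := by positivity
  have hq2 : 0 ≤ (Real.sqrt (1 - p) - Real.sqrt (1 - x)) ^ 2 / Real.sqrt (1 - x) := by positivity
  have t1 := tsallis_stability_bonus (y := Real.sqrt p) s1 hb' hb'κ
  rw [e1, e2] at t1
  have t2 := logBarrier_stability (v := x * b'') (r := p / x) hc (mul_nonneg hx.1.le hb'') hb''c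
    (div_pos hp.1 hx.1)
  have e5 : x * b'' * (p / x - 1) = (p - x) * b'' := by
    have := hx.1.ne'
    field_simp
  rw [e5] at t2
  have h8 : 0 ≤ 8 * c * ((1 - p) / (1 - x) - 1 - Real.log ((1 - p) / (1 - x))) := by positivity
  have t3 : (x - p) * D - κ / 2 * ((Real.sqrt p - Real.sqrt x) ^ 2 / Real.sqrt x) -
      κ * ((Real.sqrt (1 - p) - Real.sqrt (1 - x)) ^ 2 / Real.sqrt (1 - x)) ≤
      4 * (min x (1 - x) * Real.sqrt (min x (1 - x))) * D ^ 2 / κ := by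
    rcases le_or_gt x (1 / 2) with h | h
    · have t := tsallis_stability (y := Real.sqrt p) s1 (Real.sqrt_le_one.2 hx.2.le) hκ (hD1 h)
      rw [e1, e2] at t
      rw [min_eq_left (by linarith), show x * Real.sqrt x = Real.sqrt x ^ 3 by
        nth_rewrite 1 [← e1]; ring]
      nlinarith
    · have t := tsallis_stability (y := Real.sqrt (1 - p)) (D := -D) s2
        (Real.sqrt_le_one.2 (by linarith [hx.1])) hκ (by linarith [hD2 h])
      rw [e3, e4] at t
      rw [min_eq_right (by linarith), show (1 - x) * Real.sqrt (1 - x) = Real.sqrt (1 - x) ^ 3 by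
        nth_rewrite 1 [← e3]; ring]
      rw [neg_sq] at t
      have h9 : 0 ≤ κ / 2 * ((Real.sqrt p - Real.sqrt x) ^ 2 / Real.sqrt x) := by positivity
      have h10 : 0 ≤ κ / 2 * ((Real.sqrt (1 - p) - Real.sqrt (1 - x)) ^ 2 / Real.sqrt (1 - x)) := by
        positivity
      linarith
  linarith

/-- If the second arm has small probability, its cumulative loss is large. -/
lemma one_div_ftrl_argmin_le {κ c W x : ℝ} (hκ : 0 ≤ κ) (hc : 0 < c) (hx : x ∈ Set.Ioo (0 : ℝ) 1)
    (hmin : IsMinOn (ftrlObj κ c W) (Set.Ioo 0 1) x) {U : ℝ} (hU : 0 ≤ U) (hWU : W ≤ U) :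
    1 / x ≤ 2 + U / (8 * c) := by
  have hU' : 0 ≤ U / (8 * c) := by positivity
  rcases le_or_gt (1 / 2) x with h | h
  · have : 1 / x ≤ 2 := by rw [div_le_iff₀ hx.1]; linarith
    linarith
  · have hW := ftrl_first_order hx hmin
    have s1 := Real.sqrt_pos.2 hx.1
    have h1 : 1 / Real.sqrt (1 - x) ≤ 1 / Real.sqrt x :=
      one_div_le_one_div_of_le s1 (Real.sqrt_le_sqrt (by linarith))
    have h2 : 1 / (1 - x) ≤ 2 := by rw [div_le_iff₀ (by linarith)]; linarith
    have h3 : 0 ≤ κ * (1 / Real.sqrt x - 1 / Real.sqrt (1 - x)) := mul_nonneg hκ (by linarith)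
    have h4 : 8 * c * (1 / x - 1 / (1 - x)) ≤ U := by linarith
    have h5 : 1 / x - 1 / (1 - x) ≤ U / (8 * c) := by rw [le_div_iff₀ (by positivity)]; linarith
    linarith

/-- The regret of FTRL over two arms with decreasing learning rates, against any interior point,
where `x t` is the probability of the second arm, `D t` the loss difference, and `b' t + b'' t` the
bonus of the second arm. -/
lemma ftrl_regret {c : ℝ} (hc : 16 ≤ c) (N : ℕ) (κ W x D b' b'' : ℕ → ℝ)
    (hκ : ∀ t, κ t = Real.sqrt (t + 1) + 8 * Real.sqrt c)
    (hW0 : W 0 = 0) (hW : ∀ t < N + 1, W (t + 1) = W t + (D t - (b' t + b'' t)))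
    (hx : ∀ t < N + 1, x t ∈ Set.Ioo (0 : ℝ) 1)
    (hmin : ∀ t < N + 1, IsMinOn (ftrlObj (κ t) c (W t)) (Set.Ioo 0 1) (x t))
    (hD1 : ∀ t < N + 1, x t ≤ 1 / 2 → -8 ≤ D t) (hD2 : ∀ t < N + 1, 1 / 2 < x t → D t ≤ 8)
    (hb' : ∀ t < N + 1, 0 ≤ b' t) (hb'κ : ∀ t < N + 1, Real.sqrt (x t) * b' t ≤ κ t / 5)
    (hb'' : ∀ t < N + 1, 0 ≤ b'' t) (hb''c : ∀ t < N + 1, x t * b'' t ≤ 4 * c)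
    {p : ℝ} (hp : p ∈ Set.Ioo (0 : ℝ) 1) :
    ∑ t ∈ Finset.range (N + 1), (x t - p) * (D t - (b' t + b'' t)) ≤
      9 * c - 8 * c * (Real.log p + Real.log (1 - p)) + ∑ t ∈ Finset.range (N + 1),
        (2 * (Real.sqrt (x t) / Real.sqrt (t + 1)) +
          4 * (min (x t) (1 - x t) * Real.sqrt (min (x t) (1 - x t))) * D t ^ 2 / κ t +
          (x t * b' t + x t * b'' t)) := by
  have hc0 : 0 < c := by linarith
  have hsc : 4 ≤ Real.sqrt c := by
    rw [show (4 : ℝ) = Real.sqrt 16 by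
      rw [show (16 : ℝ) = 4 ^ 2 by norm_num, Real.sqrt_sq (by norm_num)]]
    exact Real.sqrt_le_sqrt hc
  have hκ32 : ∀ t, 32 ≤ κ t := fun t => by
    rw [hκ]; linarith [Real.sqrt_nonneg ((t : ℝ) + 1)]
  set st : ℕ → ℝ := fun t => 4 * (min (x t) (1 - x t) * Real.sqrt (min (x t) (1 - x t))) *
    D t ^ 2 / κ t + x t * b' t + x t * b'' t with hst
  have hstep : ∀ t < N + 1, ∀ r ∈ Set.Ioo (0 : ℝ) 1,
      ftrlObj (κ t) c (W t) (x t) + x t * (D t - (b' t + b'' t)) ≤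
        ftrlObj (κ t) c (W t) r + r * (D t - (b' t + b'' t)) + st t := fun t ht r hr =>
    ftrl_stability (hκ32 t) hc0 (hx t ht) (hmin t ht) (hD1 t ht) (hD2 t ht) (hb' t ht)
      (hb'κ t ht) (hb'' t ht) (hb''c t ht) hr
  have hchange : ∀ t < N + 1, ∀ r, ftrlObj (κ t) c (W t) r + r * (D t - (b' t + b'' t)) =
      ftrlObj (κ (t + 1)) c (W (t + 1)) r +
        2 * (κ (t + 1) - κ t) * (Real.sqrt r + Real.sqrt (1 - r)) := fun t ht r => by
    rw [hW t ht]; unfold ftrlObj; ring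
  have hκle : ∀ t : ℕ, 0 ≤ κ (t + 1) - κ t ∧ κ (t + 1) - κ t ≤ 1 / Real.sqrt ((t + 1 : ℕ) + 1) := by
    intro t
    rw [hκ, hκ]
    push_cast
    have h1 : (0 : ℝ) < t + 1 := by positivity
    have h2 := Real.sqrt_pos.2 h1
    have h3 : Real.sqrt ((t : ℝ) + 1) ≤ Real.sqrt (t + 1 + 1) := Real.sqrt_le_sqrt (by linarith)
    have h4 := Real.mul_self_sqrt h1.le
    have h5 := Real.mul_self_sqrt (show 0 ≤ (t : ℝ) + 1 + 1 by linarith)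
    refine ⟨by linarith, ?_⟩
    rw [le_div_iff₀ (by linarith)]
    nlinarith
  have key : ∀ m < N + 1, ∑ t ∈ Finset.range m, x t * (D t - (b' t + b'' t)) ≤
      ftrlObj (κ m) c (W m) (x m) - ftrlObj (κ 0) c (W 0) (x 0) + 2 * (κ m - κ 0) +
        ∑ t ∈ Finset.range m, (2 * (Real.sqrt (x (t + 1)) / Real.sqrt ((t + 1 : ℕ) + 1)) + st t) := by
    intro m
    induction m with
    | zero => intro _; simp
    | succ m ih =>
      intro hm
      have h1 := ih (by omega)
      have h2 := hstep m (by omega) (x (m + 1)) (hx (m + 1) hm)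
      rw [hchange m (by omega) (x (m + 1))] at h2
      rw [Finset.sum_range_succ, Finset.sum_range_succ]
      obtain ⟨h3, h4⟩ := hκle m
      have h5 : Real.sqrt (1 - x (m + 1)) ≤ 1 :=
        Real.sqrt_le_one.2 (by linarith [(hx (m + 1) hm).1])
      have h6 : 2 * (κ (m + 1) - κ m) * (Real.sqrt (x (m + 1)) + Real.sqrt (1 - x (m + 1))) ≤
          2 * (Real.sqrt (x (m + 1)) / Real.sqrt ((m + 1 : ℕ) + 1)) + 2 * (κ (m + 1) - κ m) := by
        have h7 : (κ (m + 1) - κ m) * Real.sqrt (x (m + 1)) ≤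
            1 / Real.sqrt ((m + 1 : ℕ) + 1) * Real.sqrt (x (m + 1)) :=
          mul_le_mul_of_nonneg_right h4 (Real.sqrt_nonneg _)
        rw [one_div_mul_eq_div] at h7
        nlinarith
      linarith
  have h1 := key N (by omega)
  have h2 := hstep N (by omega) p hp
  have hWs : ∀ m ≤ N + 1, W m = ∑ t ∈ Finset.range m, (D t - (b' t + b'' t)) := by
    intro m
    induction m with
    | zero => intro _; simp [hW0]
    | succ m ih => intro hm; rw [hW m (by omega), ih (by omega), Finset.sum_range_succ]
  have h3 : -ftrlObj (κ 0) c (W 0) (x 0) ≤ 4 * κ 0 := by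
    have hx0 := hx 0 (by omega)
    have l1 : Real.log (x 0) < 0 := Real.log_neg hx0.1 hx0.2
    have l2 : Real.log (1 - x 0) < 0 := Real.log_neg (by linarith [hx0.2]) (by linarith [hx0.1])
    have l3 : Real.sqrt (x 0) ≤ 1 := Real.sqrt_le_one.2 hx0.2.le
    have l4 : Real.sqrt (1 - x 0) ≤ 1 := Real.sqrt_le_one.2 (by linarith [hx0.1])
    have := hκ32 0
    unfold ftrlObj
    rw [hW0]
    nlinarith
  have h4 : ftrlObj (κ N) c (W N) p ≤ p * W N - 2 * κ N -
      8 * c * (Real.log p + Real.log (1 - p)) := by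
    have l1 : 1 ≤ Real.sqrt p + Real.sqrt (1 - p) := by
      have a1 : p ≤ Real.sqrt p := Real.le_sqrt_of_sq_le (by nlinarith [hp.1, hp.2])
      have a2 : 1 - p ≤ Real.sqrt (1 - p) := 
        Real.le_sqrt_of_sq_le (by nlinarith [hp.1, hp.2])
      linarith
    have := hκ32 N
    unfold ftrlObj
    nlinarith
  have h5 : 2 * κ 0 ≤ 9 * c := by
    rw [hκ]
    have := Real.mul_self_sqrt hc0.le
    norm_num
    nlinarith
  have h6 : ∑ t ∈ Finset.range N,
        (2 * (Real.sqrt (x (t + 1)) / Real.sqrt ((t + 1 : ℕ) + 1)) + st t) + st N ≤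
      ∑ t ∈ Finset.range (N + 1), (2 * (Real.sqrt (x t) / Real.sqrt (t + 1)) + st t) := by
    clear_value st
    rw [Finset.sum_add_distrib, Finset.sum_add_distrib, Finset.sum_range_succ st,
      Finset.sum_range_succ' (fun t : ℕ => 2 * (Real.sqrt (x t) / Real.sqrt ((t : ℝ) + 1)))]
    have : 0 ≤ 2 * (Real.sqrt (x 0) / Real.sqrt (((0 : ℕ) : ℝ) + 1)) := by positivity
    linarith
  have h7 : ∑ t ∈ Finset.range (N + 1), (x t - p) * (D t - (b' t + b'' t)) =
      ∑ t ∈ Finset.range N, x t * (D t - (b' t + b'' t)) + x N * (D N - (b' N + b'' N)) -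
        p * (W N + (D N - (b' N + b'' N))) := by
    rw [hWs N (by omega), ← Finset.sum_range_succ, ← Finset.sum_range_succ, Finset.mul_sum,
      ← Finset.sum_sub_distrib]
    exact Finset.sum_congr rfl fun t _ => by ring
  have h8 : ∑ t ∈ Finset.range (N + 1), (2 * (Real.sqrt (x t) / Real.sqrt (t + 1)) + st t) =
      ∑ t ∈ Finset.range (N + 1), (2 * (Real.sqrt (x t) / Real.sqrt (t + 1)) +
          4 * (min (x t) (1 - x t) * Real.sqrt (min (x t) (1 - x t))) * D t ^ 2 / κ t +
          (x t * b' t + x t * b'' t)) :=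
    Finset.sum_congr rfl fun t _ => by simp only [hst]; ring
  rw [h7, ← h8]
  linarith

/-! ### The pathwise regret of the Corral-type algorithm -/

/-- A run of the Corral-type algorithm with `c₁ = c₂ = c` over `M` rounds, as far as its two arms
are concerned: `x t` is the FTRL probability of the second arm, `p t` its mixture with the uniform
distribution, `u t` and `v t` are the importance-weighted shifted losses of the second and of the
first arm, and `S t`, `m t` the sum of `1 / p` and the minimum of `p` over the rounds before `t`. -/
structure IsCorralPath (c : ℝ) (M : ℕ) (x p u v S m : ℕ → ℝ) : Prop where
  one_le : 16 ≤ c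
  x_mem : ∀ t < M, x t ∈ Set.Ioo (0 : ℝ) 1
  p_eq : ∀ t < M, p t = (1 - 1 / (2 * ((t : ℝ) + 1) ^ 2)) * x t + 1 / (4 * ((t : ℝ) + 1) ^ 2)
  u_nonneg : ∀ t < M, 0 ≤ u t
  u_le : ∀ t < M, u t ≤ 2 / p t
  v_nonneg : ∀ t < M, 0 ≤ v t
  v_le : ∀ t < M, v t ≤ 2 / (1 - p t)
  S_zero : S 0 = 0
  S_succ : ∀ t < M, S (t + 1) = S t + 1 / p t
  m_zero : m 0 = 1
  m_succ : ∀ t < M, m (t + 1) = min (m t) (p t)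
  isMinOn : ∀ t < M, IsMinOn (ftrlObj (Real.sqrt ((t : ℝ) + 1) + 8 * Real.sqrt c) c
    (∑ r ∈ Finset.range t, (u r - v r) - stabilityBound c t (S t) (m t))) (Set.Ioo 0 1) (x t)

/-- The mixture of a probability with the uniform distribution over two arms, in round `t`. -/
lemma mixture_bounds (t : ℕ) {x p : ℝ} (hx : x ∈ Set.Ioo (0 : ℝ) 1)
    (hp : p = (1 - 1 / (2 * ((t : ℝ) + 1) ^ 2)) * x + 1 / (4 * ((t : ℝ) + 1) ^ 2)) :
    x / 2 ≤ p ∧ (1 - x) / 2 ≤ 1 - p ∧ 1 / (4 * ((t : ℝ) + 1) ^ 2) ≤ p ∧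
      1 / (4 * ((t : ℝ) + 1) ^ 2) ≤ 1 - p ∧ |p - x| ≤ 1 / (4 * ((t : ℝ) + 1) ^ 2) := by
  set g : ℝ := 1 / (4 * ((t : ℝ) + 1) ^ 2) with hg
  have hg0 : 0 < g := by positivity
  have h1 : (1 : ℝ) ≤ ((t : ℝ) + 1) ^ 2 := by
    have : (0 : ℝ) ≤ t := Nat.cast_nonneg t
    nlinarith
  have hg1 : g ≤ 1 / 4 := one_div_le_one_div_of_le (by norm_num) (by linarith)
  have h2 : 1 / (2 * ((t : ℝ) + 1) ^ 2) = 2 * g := by rw [hg]; field_simp; norm_num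
  rw [h2] at hp
  obtain ⟨hx0, hx1⟩ := hx
  refine ⟨by nlinarith, by nlinarith, by nlinarith, by nlinarith, ?_⟩
  rw [abs_le]
  constructor <;> nlinarith

namespace IsCorralPath

variable {c : ℝ} {M : ℕ} {x p u v S m : ℕ → ℝ}

lemma mixture (h : IsCorralPath c M x p u v S m) {t : ℕ} (ht : t < M) :
    x t / 2 ≤ p t ∧ (1 - x t) / 2 ≤ 1 - p t ∧ 1 / (4 * ((t : ℝ) + 1) ^ 2) ≤ p t ∧
      1 / (4 * ((t : ℝ) + 1) ^ 2) ≤ 1 - p t ∧ |p t - x t| ≤ 1 / (4 * ((t : ℝ) + 1) ^ 2) :=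
  mixture_bounds t (h.x_mem t ht) (h.p_eq t ht)

lemma p_pos (h : IsCorralPath c M x p u v S m) {t : ℕ} (ht : t < M) : 0 < p t := by
  have := (h.mixture ht).1
  have := (h.x_mem t ht).1
  linarith

lemma p_lt_one (h : IsCorralPath c M x p u v S m) {t : ℕ} (ht : t < M) : p t < 1 := by
  have := (h.mixture ht).2.1
  have := (h.x_mem t ht).2
  linarith

lemma le_S (h : IsCorralPath c M x p u v S m) : ∀ t ≤ M, (t : ℝ) ≤ S t := by
  intro t
  induction t with
  | zero => intro _; simp [h.S_zero]
  | succ t ih =>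
    intro ht
    rw [h.S_succ t ht]
    have h1 : 1 ≤ 1 / p t := by
      rw [le_div_iff₀ (h.p_pos ht)]
      linarith [h.p_lt_one ht]
    push_cast
    linarith [ih (by omega)]

lemma inv_le_S (h : IsCorralPath c M x p u v S m) {t : ℕ} (ht : t < M) : 1 / p t ≤ S (t + 1) := by
  rw [h.S_succ t ht]
  have := h.le_S t ht.le
  have : (0 : ℝ) ≤ t := Nat.cast_nonneg t
  linarith

lemma m_bounds (h : IsCorralPath c M x p u v S m) : ∀ t ≤ M, 0 < m t ∧ m t ≤ 1 := by
  intro t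
  induction t with
  | zero => intro _; simp [h.m_zero]
  | succ t ih =>
    intro ht
    rw [h.m_succ t ht]
    have := ih (by omega)
    exact ⟨lt_min this.1 (h.p_pos ht), (min_le_left _ _).trans this.2⟩

lemma inv_m_le (h : IsCorralPath c M x p u v S m) {b : ℝ} (hb : 1 ≤ b)
    (hpb : ∀ t < M, 1 / p t ≤ b) : ∀ t ≤ M, 1 / m t ≤ b := by
  intro t
  induction t with
  | zero => intro _; simpa [h.m_zero] using hb
  | succ t ih =>
    intro ht
    rw [h.m_succ t ht]
    rcases min_choice (m t) (p t) with e | e <;> rw [e]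
    · exact ih (by omega)
    · exact hpb t ht

lemma S_le (h : IsCorralPath c M x p u v S m) : ∀ t ≤ M, S t ≤ t / m t := by
  intro t
  induction t with
  | zero => intro _; simp [h.S_zero]
  | succ t ih =>
    intro ht
    have h0 := h.m_bounds (t + 1) ht
    have h1 := h.m_bounds t (by omega)
    have h2 : 1 / p t ≤ 1 / m (t + 1) := by
      apply one_div_le_one_div_of_le h0.1
      rw [h.m_succ t ht]
      exact min_le_right _ _
    have h3 : (t : ℝ) / m t ≤ t / m (t + 1) := by
      apply div_le_div_of_nonneg_left (Nat.cast_nonneg t) h0.1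
      rw [h.m_succ t ht]
      exact min_le_left _ _
    rw [h.S_succ t ht]
    push_cast
    rw [add_div]
    linarith [ih (by omega)]

/-- Increments of the part `√(c S)` of the bonus. Their total over the rounds is not small, but
the algorithm collects them only with probability `p`. -/
lemma sqrt_bonus (h : IsCorralPath c M x p u v S m) {t : ℕ} (ht : t < M) :
    0 ≤ Real.sqrt (c * S (t + 1)) - Real.sqrt (c * S t) ∧
      p t * (Real.sqrt (c * S (t + 1)) - Real.sqrt (c * S t)) ≤
        Real.sqrt c * (1 / Real.sqrt (S (t + 1))) ∧
      Real.sqrt (p t) * (Real.sqrt (c * S (t + 1)) - Real.sqrt (c * S t)) ≤ Real.sqrt c := by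
  have hc : 0 ≤ c := by linarith [h.one_le]
  have hp := h.p_pos ht
  have hS0 : 0 ≤ S t := (Nat.cast_nonneg t).trans (h.le_S t ht.le)
  have hS1 : 0 < S (t + 1) := (one_div_pos.2 hp).trans_le (h.inv_le_S ht)
  have hS := h.S_succ t ht
  have hinv := h.inv_le_S ht
  set A := Real.sqrt (S (t + 1)) with hA
  set A' := Real.sqrt (S t) with hA'
  have hA0 : 0 < A := Real.sqrt_pos.2 hS1
  have hA'0 : 0 ≤ A' := Real.sqrt_nonneg _
  have e1 : A * A = S (t + 1) := Real.mul_self_sqrt hS1.le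
  have e2 : A' * A' = S t := Real.mul_self_sqrt hS0
  have hle : A' ≤ A := Real.sqrt_le_sqrt (by rw [hS]; linarith [one_div_pos.2 hp])
  have hpe : p t * (1 / p t) = 1 := mul_one_div_cancel hp.ne'
  have hpA : p t * (A * A - A' * A') = 1 := by
    rw [e1, e2, hS]; linear_combination hpe
  have key : p t * (A - A') * A ≤ 1 := by
    have : p t * (A - A') * A' ≥ 0 := by
      have : 0 ≤ A - A' := by linarith
      positivity
    nlinarith
  rw [Real.sqrt_mul hc, Real.sqrt_mul hc]
  have hc' := Real.sqrt_nonneg c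
  have hkey : p t * (A - A') ≤ 1 / A := by rwa [le_div_iff₀ hA0]
  refine ⟨by nlinarith, ?_, ?_⟩
  · calc p t * (Real.sqrt c * A - Real.sqrt c * A') = Real.sqrt c * (p t * (A - A')) := by ring
      _ ≤ _ := mul_le_mul_of_nonneg_left hkey hc'
  · have s0 := Real.sqrt_pos.2 hp
    have s1 := Real.mul_self_sqrt hp.le
    have h5 : 1 ≤ Real.sqrt (p t) * A := by
      rw [hA, ← Real.sqrt_mul hp.le]
      apply Real.one_le_sqrt.2
      calc (1 : ℝ) = p t * (1 / p t) := hpe.symm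
        _ ≤ _ := mul_le_mul_of_nonneg_left hinv hp.le
    have h6 : Real.sqrt (p t) * (A - A') ≤ 1 := by
      have h7 : Real.sqrt (p t) * (A - A') * (Real.sqrt (p t) * A) ≤ 1 := by
        calc Real.sqrt (p t) * (A - A') * (Real.sqrt (p t) * A)
            = (Real.sqrt (p t) * Real.sqrt (p t)) * (A - A') * A := by ring
          _ ≤ 1 := by rwa [s1]
      have h8 : 0 ≤ Real.sqrt (p t) * (A - A') := mul_nonneg s0.le (by linarith)
      nlinarith
    calc Real.sqrt (p t) * (Real.sqrt c * A - Real.sqrt c * A')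
        = Real.sqrt c * (Real.sqrt (p t) * (A - A')) := by ring
      _ ≤ Real.sqrt c * 1 := mul_le_mul_of_nonneg_left h6 hc'
      _ = _ := mul_one _

/-- Increments of the part `c / m` of the bonus, which vanishes before the first round. With the
factor `p` they are dominated by the increments of a logarithm. -/
lemma inv_bonus (h : IsCorralPath c M x p u v S m) {t : ℕ} (ht : t < M) :
    0 ≤ c / m (t + 1) - (if t = 0 then 0 else c / m t) ∧
      p t * (c / m (t + 1) - (if t = 0 then 0 else c / m t)) ≤ c ∧
      p t * (c / m (t + 1) - (if t = 0 then 0 else c / m t)) ≤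
        c * (Real.log (1 / m (t + 1)) - Real.log (1 / m t)) + (if t = 0 then c else 0) := by
  have hc : 0 < c := by linarith [h.one_le]
  have hp := h.p_pos ht
  have hp1 := h.p_lt_one ht
  have hm1 := h.m_bounds (t + 1) ht
  have hm0 := h.m_bounds t (by omega)
  have hs := h.m_succ t ht
  have hle : m (t + 1) ≤ m t := by rw [hs]; exact min_le_left _ _
  have hlog : Real.log (1 / m (t + 1)) - Real.log (1 / m t) = Real.log (m t / m (t + 1)) := by
    rw [one_div, one_div, Real.log_inv, Real.log_inv, Real.log_div hm0.1.ne' hm1.1.ne']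
    ring
  rw [hlog]
  have hlog0 : 1 - m (t + 1) / m t ≤ Real.log (m t / m (t + 1)) := by
    have := Real.one_sub_inv_le_log_of_pos (div_pos hm0.1 hm1.1)
    rwa [inv_div] at this
  have hr : m (t + 1) / m t ≤ 1 := (div_le_one hm0.1).2 hle
  have hr0 : 0 < m (t + 1) / m t := div_pos hm1.1 hm0.1
  by_cases h0 : t = 0
  · have : m (t + 1) = p t := by
      rw [hs, h0, h.m_zero]; rw [h0] at hp1; exact min_eq_right hp1.le
    rw [if_pos h0, if_pos h0, sub_zero]
    have e : p t * (c / m (t + 1)) = c := by rw [this]; field_simp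
    rw [e]
    refine ⟨(div_pos hc hm1.1).le, le_rfl, ?_⟩
    nlinarith
  · rw [if_neg h0, if_neg h0, add_zero]
    rcases le_or_gt (m t) (p t) with h1 | h1
    · have : m (t + 1) = m t := by rw [hs, min_eq_left h1]
      rw [this] at hlog0 hr ⊢
      rw [sub_self, mul_zero]
      refine ⟨le_rfl, hc.le, ?_⟩
      nlinarith
    · have : m (t + 1) = p t := by rw [hs, min_eq_right h1.le]
      have e : p t * (c / m (t + 1) - c / m t) = c * (1 - m (t + 1) / m t) := by
        rw [this]; field_simp
      rw [e]
      refine ⟨?_, by nlinarith, by nlinarith⟩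
      rw [sub_nonneg]
      exact div_le_div_of_nonneg_left hc.le hm1.1 hle

/-- The logarithmic barrier keeps `p` at least of the order of `c / (c + U)`, where `U` is the total
loss of the second arm. -/
lemma inv_p_le (h : IsCorralPath c M x p u v S m) {t : ℕ} (ht : t < M) :
    1 / p t ≤ 4 + (∑ r ∈ Finset.range M, u r) / (4 * c) := by
  have hc : 0 < c := by linarith [h.one_le]
  have hx := h.x_mem t ht
  have hsub : ∑ r ∈ Finset.range t, u r ≤ ∑ r ∈ Finset.range M, u r :=
    Finset.sum_le_sum_of_subset_of_nonneg (Finset.range_mono ht.le)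
      fun r hr _ => h.u_nonneg r (Finset.mem_range.1 hr)
  have hU : 0 ≤ ∑ r ∈ Finset.range t, u r :=
    Finset.sum_nonneg fun r hr => h.u_nonneg r ((Finset.mem_range.1 hr).trans ht)
  have hV : 0 ≤ ∑ r ∈ Finset.range t, v r :=
    Finset.sum_nonneg fun r hr => h.v_nonneg r ((Finset.mem_range.1 hr).trans ht)
  have hB : 0 ≤ stabilityBound c t (S t) (m t) := by
    unfold stabilityBound
    have := (h.m_bounds t ht.le).1
    split_ifs <;> positivity
  have h1 := one_div_ftrl_argmin_le (by positivity) hc hx (h.isMinOn t ht) hU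
    (by rw [Finset.sum_sub_distrib]; linarith)
  have h2 : 1 / p t ≤ 2 * (1 / x t) := by
    rw [mul_one_div, div_le_div_iff₀ (h.p_pos ht) hx.1]
    linarith [(h.mixture ht).1]
  have h3 : (∑ r ∈ Finset.range t, u r) / (8 * c) ≤ (∑ r ∈ Finset.range M, u r) / (8 * c) := by
    gcongr
  have h4 : (∑ r ∈ Finset.range M, u r) / (4 * c) = 2 * ((∑ r ∈ Finset.range M, u r) / (8 * c)) := by
    field_simp; ring
  rw [h4]
  linarith

/-- The FTRL regret bound against an interior point `q`, with the bonuses summed up. -/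
lemma regret_interior (h : IsCorralPath c M x p u v S m) (hM : 0 < M) {q : ℝ}
    (hq : q ∈ Set.Ioo (0 : ℝ) 1) :
    ∑ t ∈ Finset.range M, (x t - q) * (u t - v t) + q * stabilityBound c M (S M) (m M) ≤
      13 * c + 4 * c * Real.log (1 / m M) - 8 * c * (Real.log q + Real.log (1 - q)) +
      ∑ t ∈ Finset.range M, (2 * (Real.sqrt (x t) / Real.sqrt (t + 1)) +
        4 * (min (x t) (1 - x t) * Real.sqrt (min (x t) (1 - x t))) * (u t - v t) ^ 2 /
          (Real.sqrt (t + 1) + 8 * Real.sqrt c) +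
        4 * (Real.sqrt c * (1 / Real.sqrt (S (t + 1))))) := by
  obtain ⟨N, rfl⟩ : ∃ N, M = N + 1 := ⟨M - 1, by omega⟩
  have hc16 := h.one_le
  have hc : 0 < c := by linarith
  have hsc : 4 ≤ Real.sqrt c := Real.le_sqrt_of_sq_le (by norm_num; linarith)
  set b' : ℕ → ℝ := fun t => Real.sqrt (c * S (t + 1)) - Real.sqrt (c * S t) with hb'
  set b'' : ℕ → ℝ := fun t => c / m (t + 1) - (if t = 0 then 0 else c / m t) with hb''
  have hB : ∀ t < N + 1, stabilityBound c (t + 1) (S (t + 1)) (m (t + 1)) =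
      stabilityBound c t (S t) (m t) + (b' t + b'' t) := by
    intro t _
    simp only [stabilityBound, hb', hb'', Nat.succ_ne_zero, if_false]
    by_cases h0 : t = 0
    · simp [h0, h.S_zero]
    · simp only [h0, if_false]; ring
  have hBsum : ∀ t ≤ N + 1, stabilityBound c t (S t) (m t) =
      ∑ r ∈ Finset.range t, (b' r + b'' r) := by
    intro t
    induction t with
    | zero => intro _; simp [stabilityBound]
    | succ t ih => intro ht; rw [hB t (by omega), ih (by omega), Finset.sum_range_succ]
  have hsx : ∀ t < N + 1, Real.sqrt (x t) ≤ 1.5 * Real.sqrt (p t) := by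
    intro t ht
    rw [show (1.5 : ℝ) = Real.sqrt (1.5 ^ 2) by rw [Real.sqrt_sq (by norm_num)],
      ← Real.sqrt_mul (by norm_num)]
    apply Real.sqrt_le_sqrt
    linarith [(h.mixture ht).1, (h.x_mem t ht).1]
  have key := ftrl_regret hc16 N (fun t => Real.sqrt ((t : ℝ) + 1) + 8 * Real.sqrt c)
    (fun t => ∑ r ∈ Finset.range t, (u r - v r) - stabilityBound c t (S t) (m t)) x
    (fun t => u t - v t) b' b'' (fun t => rfl) (by simp [stabilityBound])
    (fun t ht => by
      simp only [Finset.sum_range_succ, hB t ht]; ring)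
    h.x_mem h.isMinOn
    -- an arm of probability at least `1 / 4` has an importance-weighted loss of at most `8`
    (fun t ht hx => by
      have h1 := h.v_le t ht
      have h2 : 2 / (1 - p t) ≤ 8 := by
        rw [div_le_iff₀ (by linarith [h.p_lt_one ht])]
        linarith [(h.mixture ht).2.1]
      have := h.u_nonneg t ht
      linarith)
    (fun t ht hx => by
      have h1 := h.u_le t ht
      have h2 : 2 / p t ≤ 8 := by
        rw [div_le_iff₀ (h.p_pos ht)]
        linarith [(h.mixture ht).1]
      have := h.v_nonneg t ht
      linarith)
    (fun t ht => (h.sqrt_bonus ht).1)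
    (fun t ht => by
      have h1 := (h.sqrt_bonus ht).2.2
      have h2 := hsx t ht
      have h3 : Real.sqrt (x t) * b' t ≤ 1.5 * Real.sqrt (p t) * b' t :=
        mul_le_mul_of_nonneg_right h2 (h.sqrt_bonus ht).1
      have h4 : Real.sqrt (p t) * b' t ≤ Real.sqrt c := h1
      have := Real.sqrt_nonneg ((t : ℝ) + 1)
      nlinarith)
    (fun t ht => (h.inv_bonus ht).1)
    (fun t ht => by
      have h1 : p t * b'' t ≤ c := (h.inv_bonus ht).2.1
      have h2 := (h.mixture ht).1
      have h3 : 0 ≤ b'' t := (h.inv_bonus ht).1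
      nlinarith)
    hq
  have hlogsum : ∑ t ∈ Finset.range (N + 1), (c * (Real.log (1 / m (t + 1)) - Real.log (1 / m t)) +
      (if t = 0 then c else 0)) = c * Real.log (1 / m (N + 1)) + c := by
    rw [Finset.sum_add_distrib, ← Finset.mul_sum, Finset.sum_range_sub (fun t => Real.log (1 / m t)),
      h.m_zero]
    simp
  have hb''sum : ∑ t ∈ Finset.range (N + 1), x t * b'' t ≤ 2 * (c * Real.log (1 / m (N + 1)) + c) := by
    rw [← hlogsum, Finset.mul_sum]
    refine Finset.sum_le_sum fun t ht => ?_
    have ht := Finset.mem_range.1 ht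
    have h1 : p t * b'' t ≤ _ := (h.inv_bonus ht).2.2
    have h2 := (h.mixture ht).1
    have h3 : 0 ≤ b'' t := (h.inv_bonus ht).1
    nlinarith
  have hb'sum : ∑ t ∈ Finset.range (N + 1), x t * b' t ≤
      ∑ t ∈ Finset.range (N + 1), 2 * (Real.sqrt c * (1 / Real.sqrt (S (t + 1)))) := by
    refine Finset.sum_le_sum fun t ht => ?_
    have ht := Finset.mem_range.1 ht
    have h1 : p t * b' t ≤ _ := (h.sqrt_bonus ht).2.1
    have h2 := (h.mixture ht).1
    have h3 : 0 ≤ b' t := (h.sqrt_bonus ht).1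
    nlinarith
  have e1 : ∑ t ∈ Finset.range (N + 1), (x t - q) * (u t - v t - (b' t + b'' t)) =
      ∑ t ∈ Finset.range (N + 1), (x t - q) * (u t - v t) -
        ∑ t ∈ Finset.range (N + 1), x t * b' t - ∑ t ∈ Finset.range (N + 1), x t * b'' t +
        q * stabilityBound c (N + 1) (S (N + 1)) (m (N + 1)) := by
    rw [hBsum (N + 1) le_rfl, Finset.mul_sum, ← Finset.sum_sub_distrib, ← Finset.sum_sub_distrib,
      ← Finset.sum_add_distrib]
    exact Finset.sum_congr rfl fun t _ => by ring
  rw [e1] at key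
  simp only [Finset.sum_add_distrib, ← Finset.mul_sum] at key hb'sum ⊢
  linarith

/-- Replacing the FTRL probabilities by their mixtures costs a summable multiple of the losses. -/
lemma abs_sum_mixture_le (h : IsCorralPath c M x p u v S m) :
    |∑ t ∈ Finset.range M, (p t - x t) * (u t - v t)| ≤
      ∑ t ∈ Finset.range M, (u t + v t) / ((t : ℝ) + 1) ^ 2 := by
  refine (Finset.abs_sum_le_sum_abs _ _).trans (Finset.sum_le_sum fun t ht => ?_)
  have ht := Finset.mem_range.1 ht
  have h1 := (h.mixture ht).2.2.2.2
  have h2 := h.u_nonneg t ht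
  have h3 := h.v_nonneg t ht
  have h4 : |u t - v t| ≤ u t + v t := abs_le.2 ⟨by linarith, by linarith⟩
  have h5 : 1 / (4 * ((t : ℝ) + 1) ^ 2) ≤ 1 / ((t : ℝ) + 1) ^ 2 :=
    one_div_le_one_div_of_le (by positivity) (by nlinarith [sq_nonneg ((t : ℝ) + 1)])
  rw [abs_mul]
  calc |p t - x t| * |u t - v t| ≤ 1 / ((t : ℝ) + 1) ^ 2 * (u t + v t) :=
        mul_le_mul (h1.trans h5) h4 (abs_nonneg _) (by positivity)
    _ = _ := by ring

/-- The logarithmic barrier at the comparator `1 / (2 + z)`. -/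
lemma neg_log_comparator_le {z : ℝ} (hz : 0 ≤ z) :
    -(Real.log (1 / (2 + z)) + Real.log (1 - 1 / (2 + z))) ≤ 1 + Real.log (2 + z) := by
  have h1 : 1 / (2 + z) ≤ 1 / 2 := one_div_le_one_div_of_le (by norm_num) (by linarith)
  have h2 : Real.log (1 / 2) ≤ Real.log (1 - 1 / (2 + z)) :=
    Real.log_le_log (by norm_num) (by linarith)
  have h3 : Real.log (1 / 2) = -Real.log 2 := by rw [one_div, Real.log_inv]
  have h4 : Real.log (1 / (2 + z)) = -Real.log (2 + z) := by rw [one_div, Real.log_inv]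
  have h5 := Real.log_two_lt_d9
  linarith

/-- The regret of the Corral-type algorithm against the first arm. -/
lemma regret_first_arm (h : IsCorralPath c M x p u v S m) (hM : 0 < M) :
    ∑ t ∈ Finset.range M, p t * (u t - v t) ≤
      22 * c + 4 * c * Real.log (1 / m M) +
        8 * c * Real.log (2 + (∑ t ∈ Finset.range M, u t) / c) +
      ∑ t ∈ Finset.range M, (2 * (Real.sqrt (x t) / Real.sqrt (t + 1)) +
        4 * (min (x t) (1 - x t) * Real.sqrt (min (x t) (1 - x t))) * (u t - v t) ^ 2 /
          (Real.sqrt (t + 1) + 8 * Real.sqrt c) +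
        4 * (Real.sqrt c * (1 / Real.sqrt (S (t + 1))))) +
      ∑ t ∈ Finset.range M, (u t + v t) / ((t : ℝ) + 1) ^ 2 := by
  have hc : 0 < c := by linarith [h.one_le]
  set U := ∑ t ∈ Finset.range M, u t with hU
  have hU0 : 0 ≤ U := Finset.sum_nonneg fun r hr => h.u_nonneg r (Finset.mem_range.1 hr)
  have hV0 : 0 ≤ ∑ t ∈ Finset.range M, v t :=
    Finset.sum_nonneg fun r hr => h.v_nonneg r (Finset.mem_range.1 hr)
  have hz : 0 ≤ U / c := by positivity
  -- at the comparator `1 / (2 + U / c)`, the loss of the second arm costs at most `c`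
  have hq : 1 / (2 + U / c) ∈ Set.Ioo (0 : ℝ) 1 :=
    ⟨by positivity, by rw [div_lt_one (by positivity)]; linarith⟩
  have h1 := h.regret_interior hM hq
  have h2 := neg_log_comparator_le hz
  have h3 := (abs_le.1 h.abs_sum_mixture_le).2
  have hB : 0 ≤ stabilityBound c M (S M) (m M) := by
    unfold stabilityBound
    have := (h.m_bounds M le_rfl).1
    split_ifs <;> positivity
  have h4 : 1 / (2 + U / c) * U ≤ c := by
    rw [one_div_mul_eq_div, div_le_iff₀ (by positivity), mul_add, mul_div_cancel₀ _ hc.ne']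
    linarith
  have h5 : ∑ t ∈ Finset.range M, p t * (u t - v t) =
      ∑ t ∈ Finset.range M, (p t - x t) * (u t - v t) +
      ∑ t ∈ Finset.range M, (x t - 1 / (2 + U / c)) * (u t - v t) +
      (1 / (2 + U / c) * U - 1 / (2 + U / c) * ∑ t ∈ Finset.range M, v t) := by
    rw [hU, Finset.mul_sum, Finset.mul_sum, ← Finset.sum_sub_distrib, ← Finset.sum_add_distrib,
      ← Finset.sum_add_distrib]
    exact Finset.sum_congr rfl fun t _ => by ring
  have h6 : 0 ≤ 1 / (2 + U / c) * ∑ t ∈ Finset.range M, v t := mul_nonneg hq.1.le hV0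
  have h7 : 0 ≤ 1 / (2 + U / c) * stabilityBound c M (S M) (m M) := mul_nonneg hq.1.le hB
  have h8 := mul_le_mul_of_nonneg_left h2 (show 0 ≤ 8 * c by linarith)
  rw [h5]
  linarith

/-- The regret of the Corral-type algorithm against the second arm; the bonus on the left-hand side
pays for the regret of the base algorithm. -/
lemma regret_second_arm (h : IsCorralPath c M x p u v S m) (hM : 0 < M) :
    ∑ t ∈ Finset.range M, (p t - 1) * (u t - v t) + stabilityBound c M (S M) (m M) ≤
      22 * c + 4 * c * Real.log (1 / m M) +
        8 * c * Real.log (2 + (∑ t ∈ Finset.range M, v t + stabilityBound c M (S M) (m M)) / c) +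
      ∑ t ∈ Finset.range M, (2 * (Real.sqrt (x t) / Real.sqrt (t + 1)) +
        4 * (min (x t) (1 - x t) * Real.sqrt (min (x t) (1 - x t))) * (u t - v t) ^ 2 /
          (Real.sqrt (t + 1) + 8 * Real.sqrt c) +
        4 * (Real.sqrt c * (1 / Real.sqrt (S (t + 1))))) +
      ∑ t ∈ Finset.range M, (u t + v t) / ((t : ℝ) + 1) ^ 2 := by
  have hc : 0 < c := by linarith [h.one_le]
  set V := ∑ t ∈ Finset.range M, v t with hV
  have hU0 : 0 ≤ ∑ t ∈ Finset.range M, u t :=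
    Finset.sum_nonneg fun r hr => h.u_nonneg r (Finset.mem_range.1 hr)
  have hV0 : 0 ≤ V := Finset.sum_nonneg fun r hr => h.v_nonneg r (Finset.mem_range.1 hr)
  set B := stabilityBound c M (S M) (m M) with hBdef
  have hB : 0 ≤ B := by
    rw [hBdef]; unfold stabilityBound
    have := (h.m_bounds M le_rfl).1
    split_ifs <;> positivity
  have hz : 0 ≤ (V + B) / c := by positivity
  -- the comparator `1 - e` gives up at most `c` of the bonus and of the loss of the first arm
  set e := 1 / (2 + (V + B) / c) with he
  have he0 : 0 < e := by positivity
  have he1 : e < 1 := by rw [he, div_lt_one (by positivity)]; linarith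
  have h1 := h.regret_interior hM (q := 1 - e) ⟨by linarith, by linarith⟩
  rw [← hBdef, show 1 - (1 - e) = e by ring] at h1
  have h2 := neg_log_comparator_le hz
  rw [← he] at h2
  have h3 := (abs_le.1 h.abs_sum_mixture_le).2
  have h4 : e * (V + B) ≤ c := by
    rw [he, one_div_mul_eq_div, div_le_iff₀ (by positivity), mul_add, mul_div_cancel₀ _ hc.ne']
    linarith
  have h5 : ∑ t ∈ Finset.range M, (p t - 1) * (u t - v t) =
      ∑ t ∈ Finset.range M, (p t - x t) * (u t - v t) +
      ∑ t ∈ Finset.range M, (x t - (1 - e)) * (u t - v t) +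
      (e * V - e * ∑ t ∈ Finset.range M, u t) := by
    rw [hV, Finset.mul_sum, Finset.mul_sum, ← Finset.sum_sub_distrib, ← Finset.sum_add_distrib,
      ← Finset.sum_add_distrib]
    exact Finset.sum_congr rfl fun t _ => by ring
  have h6 : 0 ≤ e * ∑ t ∈ Finset.range M, u t := mul_nonneg he0.le hU0
  have h8 := mul_le_mul_of_nonneg_left h2 (show 0 ≤ 8 * c by linarith)
  rw [h5]
  linarith

end IsCorralPath

/-! ### Summing up the pathwise bounds -/

lemma log_le_two_mul_sqrt {w : ℝ} (hw : 0 < w) : Real.log w ≤ 2 * (Real.sqrt w - 1) := by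
  have h1 := Real.log_le_sub_one_of_pos (Real.sqrt_pos.2 hw)
  rw [Real.log_sqrt hw.le] at h1
  linarith

lemma sqrt_add_le_add_sqrt {a b : ℝ} (ha : 0 ≤ a) (hb : 0 ≤ b) :
    Real.sqrt (a + b) ≤ Real.sqrt a + Real.sqrt b := by
  apply Real.sqrt_le_iff.2 ⟨by positivity, ?_⟩
  have h1 := Real.mul_self_sqrt ha
  have h2 := Real.mul_self_sqrt hb
  nlinarith [Real.sqrt_nonneg a, Real.sqrt_nonneg b,
    mul_nonneg (Real.sqrt_nonneg a) (Real.sqrt_nonneg b)]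

/-- Logarithmic costs are dominated by roots. -/
lemma mul_log_le {c z : ℝ} (hc : 0 < c) (hz : 0 ≤ z) :
    c * Real.log (2 + z / c) ≤ c + 2 * Real.sqrt (c * z) := by
  have h0 : 0 ≤ z / c := by positivity
  have h1 := log_le_two_mul_sqrt (show 0 < 2 + z / c by linarith)
  have h2 := sqrt_add_le_add_sqrt (show (0 : ℝ) ≤ 2 by norm_num) h0
  have h3 : Real.sqrt 2 ≤ 1.5 := Real.sqrt_le_iff.2 ⟨by norm_num, by norm_num⟩
  have h4 : Real.sqrt (c * z) = c * Real.sqrt (z / c) := by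
    rw [show c * z = c ^ 2 * (z / c) by field_simp, Real.sqrt_mul (by positivity),
      Real.sqrt_sq hc.le]
  rw [h4]
  nlinarith

/-- By the inequality of arithmetic and geometric means, the root of a sum is at most a sum whose
expectation is easily controlled. -/
lemma sqrt_sum_le_sum_div_sqrt {M : ℕ} {w : ℕ → ℝ} (hw : ∀ t < M, 0 ≤ w t) :
    Real.sqrt (∑ t ∈ Finset.range M, w t) ≤
      ∑ t ∈ Finset.range M, (1 + w t) / Real.sqrt ((t : ℝ) + 1) := by
  rcases Nat.eq_zero_or_pos M with rfl | hM
  · simp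
  have hM' : (0 : ℝ) < M := Nat.cast_pos.2 hM
  have hs := Real.sqrt_pos.2 hM'
  set W := ∑ t ∈ Finset.range M, w t with hW
  have hW0 : 0 ≤ W := Finset.sum_nonneg fun t ht => hw t (Finset.mem_range.1 ht)
  have h1 : ∑ t ∈ Finset.range M, (1 + w t) / Real.sqrt M ≤
      ∑ t ∈ Finset.range M, (1 + w t) / Real.sqrt ((t : ℝ) + 1) := by
    refine Finset.sum_le_sum fun t ht => ?_
    have ht := Finset.mem_range.1 ht
    have := hw t ht
    apply div_le_div_of_nonneg_left (by linarith) (by positivity)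
    apply Real.sqrt_le_sqrt
    exact_mod_cast ht
  refine le_trans ?_ h1
  rw [← Finset.sum_div, Finset.sum_add_distrib, ← hW, le_div_iff₀ hs]
  simp only [Finset.sum_const, Finset.card_range, nsmul_eq_mul, mul_one]
  have h2 := Real.mul_self_sqrt hM'.le
  have h3 := Real.mul_self_sqrt hW0
  nlinarith [sq_nonneg (Real.sqrt W - Real.sqrt M), Real.sqrt_nonneg W]

lemma sqrt_card_le_sum_div_sqrt (M : ℕ) :
    Real.sqrt M ≤ ∑ t ∈ Finset.range M, 1 / Real.sqrt ((t : ℝ) + 1) := by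
  rcases Nat.eq_zero_or_pos M with rfl | hM
  · simp
  have hM' : (0 : ℝ) < M := Nat.cast_pos.2 hM
  have h1 : ∑ t ∈ Finset.range M, 1 / Real.sqrt M ≤
      ∑ t ∈ Finset.range M, 1 / Real.sqrt ((t : ℝ) + 1) := by
    refine Finset.sum_le_sum fun t ht => ?_
    have ht := Finset.mem_range.1 ht
    apply one_div_le_one_div_of_le (by positivity)
    apply Real.sqrt_le_sqrt
    exact_mod_cast ht
  refine le_trans ?_ h1
  rw [Finset.sum_const, Finset.card_range, nsmul_eq_mul, mul_one_div, Real.div_sqrt]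

/-- The sum of `(S t - S (t - 1)) / S t` is logarithmic. -/
lemma sum_div_cumsum_le {M : ℕ} {S w : ℕ → ℝ} (hM : 0 < M) (h0 : S 0 = 0)
    (hS : ∀ t < M, S (t + 1) = S t + w t) (hw : ∀ t < M, 0 < w t) :
    ∑ t ∈ Finset.range M, w t / S (t + 1) ≤ 1 + Real.log (S M / w 0) := by
  have hpos : ∀ t < M, 0 < S (t + 1) := by
    intro t
    induction t with
    | zero => intro ht; rw [hS 0 ht, h0, zero_add]; exact hw 0 ht
    | succ t ih => intro ht; rw [hS _ ht]; linarith [ih (by omega), hw _ ht]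
  obtain ⟨N, rfl⟩ : ∃ N, M = N + 1 := ⟨M - 1, by omega⟩
  have hw0 := hw 0 hM
  have key : ∀ n < N + 1, ∑ t ∈ Finset.range (n + 1), w t / S (t + 1) ≤
      1 + Real.log (S (n + 1) / w 0) := by
    intro n
    induction n with
    | zero =>
      intro _
      rw [zero_add, Finset.sum_range_one, zero_add, show S 1 = w 0 by rw [hS 0 hM, h0, zero_add],
        div_self hw0.ne', Real.log_one, add_zero]
    | succ n ih =>
      intro hn
      rw [Finset.sum_range_succ]
      have h1 := hpos n (by omega)
      have h2 := hpos (n + 1) hn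
      have h3 := Real.one_sub_inv_le_log_of_pos (div_pos h2 h1)
      rw [inv_div, Real.log_div h2.ne' h1.ne'] at h3
      have h4 : w (n + 1) / S (n + 1 + 1) = 1 - S (n + 1) / S (n + 1 + 1) := by
        rw [eq_sub_iff_add_eq, ← add_div, add_comm, ← hS _ hn, div_self h2.ne']
      have h5 := ih (by omega)
      rw [Real.log_div h1.ne' hw0.ne'] at h5
      rw [Real.log_div h2.ne' hw0.ne', h4]
      linarith
  exact key N (by omega)

namespace IsCorralPath

variable {c : ℝ} {M : ℕ} {x p u v S m : ℕ → ℝ}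

lemma stability_terms_le (h : IsCorralPath c M x p u v S m) :
    ∑ t ∈ Finset.range M, (2 * (Real.sqrt (x t) / Real.sqrt (t + 1)) +
        4 * (min (x t) (1 - x t) * Real.sqrt (min (x t) (1 - x t))) * (u t - v t) ^ 2 /
          (Real.sqrt (t + 1) + 8 * Real.sqrt c) +
        4 * (Real.sqrt c * (1 / Real.sqrt (S (t + 1))))) +
      ∑ t ∈ Finset.range M, (u t + v t) / ((t : ℝ) + 1) ^ 2 ≤ 7 * ∑ t ∈ Finset.range M,
        Real.sqrt c * ((1 + u t + v t) / Real.sqrt ((t : ℝ) + 1)) +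
      4 * ∑ t ∈ Finset.range M,
        min (x t) (1 - x t) * (u t - v t) ^ 2 / Real.sqrt ((t : ℝ) + 1) := by
  have hc16 := h.one_le
  have hsc : 4 ≤ Real.sqrt c := Real.le_sqrt_of_sq_le (by norm_num; linarith)
  rw [Finset.mul_sum, Finset.mul_sum, ← Finset.sum_add_distrib, ← Finset.sum_add_distrib]
  refine Finset.sum_le_sum fun t ht => ?_
  have ht := Finset.mem_range.1 ht
  have hxm := h.x_mem t ht
  have hu := h.u_nonneg t ht
  have hv := h.v_nonneg t ht
  have ht0 : (0 : ℝ) ≤ t := Nat.cast_nonneg t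
  have hr : 1 ≤ Real.sqrt ((t : ℝ) + 1) := Real.one_le_sqrt.2 (by linarith)
  have hr2 := Real.mul_self_sqrt (show 0 ≤ (t : ℝ) + 1 by linarith)
  set r := Real.sqrt ((t : ℝ) + 1) with hrdef
  have hr0 : 0 < r := by linarith
  set n := min (x t) (1 - x t) with hn
  have hn0 : 0 ≤ n := le_min hxm.1.le (by linarith [hxm.2])
  have hn1 : n ≤ 1 := (min_le_left _ _).trans hxm.2.le
  have a1 : Real.sqrt (x t) / r ≤ 1 / r := by
    gcongr; exact Real.sqrt_le_one.2 hxm.2.le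
  have a2 : 4 * (n * Real.sqrt n) * (u t - v t) ^ 2 / (r + 8 * Real.sqrt c) ≤
      4 * (n * (u t - v t) ^ 2 / r) := by
    rw [← mul_div_assoc]
    have : n * Real.sqrt n ≤ n * 1 := mul_le_mul_of_nonneg_left (Real.sqrt_le_one.2 hn1) hn0
    apply div_le_div₀ (by positivity) _ hr0 (by linarith)
    have h9 := mul_le_mul_of_nonneg_right this (sq_nonneg (u t - v t))
    linarith
  have a3 : 1 / Real.sqrt (S (t + 1)) ≤ 1 / r := by
    apply one_div_le_one_div_of_le hr0
    apply Real.sqrt_le_sqrt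
    have := h.le_S (t + 1) ht
    push_cast at this
    exact this
  have a4 : (u t + v t) / ((t : ℝ) + 1) ^ 2 ≤ (u t + v t) / r := by
    apply div_le_div_of_nonneg_left (by linarith) hr0
    have b1 : r ≤ (t : ℝ) + 1 := by rw [← hr2]; exact le_mul_of_one_le_left hr0.le hr
    have b2 : (t : ℝ) + 1 ≤ ((t : ℝ) + 1) ^ 2 := le_self_pow₀ (by linarith) two_ne_zero
    exact b1.trans b2
  have a5 : (1 + u t + v t) / r = 1 / r + (u t + v t) / r := by rw [← add_div, add_assoc]
  have a6 : 0 ≤ 1 / r := by positivity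
  have a7 : 0 ≤ (u t + v t) / r := by positivity
  rw [a5]
  have a8 := mul_le_mul_of_nonneg_left a3 (Real.sqrt_nonneg c)
  have a9 := mul_le_mul_of_nonneg_right hsc a6
  have a10 := mul_le_mul_of_nonneg_right hsc a7
  rw [mul_add]
  linarith

/-- The bound on the regret of the Corral-type algorithm, against both arms, that holds in every
environment. -/
lemma regret_le_sqrt (h : IsCorralPath c M x p u v S m) (hM : 0 < M) :
    (∑ t ∈ Finset.range M, p t * (u t - v t) ≤
      86 * c + 59 * ∑ t ∈ Finset.range M,
        Real.sqrt c * ((1 + u t + v t) / Real.sqrt ((t : ℝ) + 1)) +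
      4 * ∑ t ∈ Finset.range M, min (x t) (1 - x t) * (u t - v t) ^ 2 / Real.sqrt ((t : ℝ) + 1)) ∧
    ∑ t ∈ Finset.range M, (p t - 1) * (u t - v t) + stabilityBound c M (S M) (m M) ≤
      86 * c + 59 * ∑ t ∈ Finset.range M,
        Real.sqrt c * ((1 + u t + v t) / Real.sqrt ((t : ℝ) + 1)) +
      4 * ∑ t ∈ Finset.range M, min (x t) (1 - x t) * (u t - v t) ^ 2 / Real.sqrt ((t : ℝ) + 1) := by
  have hc16 := h.one_le
  have hc : 0 < c := by linarith
  have hsc : 4 ≤ Real.sqrt c := Real.le_sqrt_of_sq_le (by norm_num; linarith)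
  set U := ∑ t ∈ Finset.range M, u t with hU
  set V := ∑ t ∈ Finset.range M, v t with hV
  set s := ∑ t ∈ Finset.range M, Real.sqrt c * ((1 + u t + v t) / Real.sqrt ((t : ℝ) + 1)) with hs
  set B := stabilityBound c M (S M) (m M) with hB
  have hU0 : 0 ≤ U := Finset.sum_nonneg fun r hr => h.u_nonneg r (Finset.mem_range.1 hr)
  have hV0 : 0 ≤ V := Finset.sum_nonneg fun r hr => h.v_nonneg r (Finset.mem_range.1 hr)
  have hm := h.m_bounds M le_rfl
  have hS0 : 0 ≤ S M := (Nat.cast_nonneg M).trans (h.le_S M le_rfl)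
  have hB0 : 0 ≤ B := by
    rw [hB, stabilityBound, if_neg hM.ne']
    exact add_nonneg (Real.sqrt_nonneg _) (div_nonneg hc.le hm.1.le)
  have hcU : Real.sqrt (c * U) ≤ s := by
    rw [Real.sqrt_mul hc.le, hs, ← Finset.mul_sum]
    refine mul_le_mul_of_nonneg_left ((sqrt_sum_le_sum_div_sqrt h.u_nonneg).trans ?_)
      (Real.sqrt_nonneg c)
    refine Finset.sum_le_sum fun t ht => div_le_div_of_nonneg_right ?_ (Real.sqrt_nonneg _)
    linarith [h.v_nonneg t (Finset.mem_range.1 ht)]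
  have hcV : Real.sqrt (c * V) ≤ s := by
    rw [Real.sqrt_mul hc.le, hs, ← Finset.mul_sum]
    refine mul_le_mul_of_nonneg_left ((sqrt_sum_le_sum_div_sqrt h.v_nonneg).trans ?_)
      (Real.sqrt_nonneg c)
    refine Finset.sum_le_sum fun t ht => div_le_div_of_nonneg_right ?_ (Real.sqrt_nonneg _)
    linarith [h.u_nonneg t (Finset.mem_range.1 ht)]
  have hcM : Real.sqrt (c * M) ≤ s := by
    rw [Real.sqrt_mul hc.le, hs, ← Finset.mul_sum]
    refine mul_le_mul_of_nonneg_left ((sqrt_card_le_sum_div_sqrt M).trans ?_) (Real.sqrt_nonneg c)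
    refine Finset.sum_le_sum fun t ht => div_le_div_of_nonneg_right ?_ (Real.sqrt_nonneg _)
    linarith [h.u_nonneg t (Finset.mem_range.1 ht), h.v_nonneg t (Finset.mem_range.1 ht)]
  have hminv : 1 / m M ≤ 4 + U / (4 * c) := by
    refine h.inv_m_le ?_ (fun t ht => h.inv_p_le ht) M le_rfl
    have : 0 ≤ U / (4 * c) := by positivity
    linarith
  have hlogm : c * Real.log (1 / m M) ≤ 2 * c + s := by
    have h1 : Real.log (1 / m M) ≤ Real.log (4 + U / (4 * c)) :=
      Real.log_le_log (one_div_pos.2 hm.1) hminv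
    have h2 : 4 + U / (4 * c) ≤ 2 * (2 + U / c) := by
      have : U / (4 * c) ≤ 2 * (U / c) := by
        rw [← mul_div_assoc, div_le_div_iff₀ (by positivity) hc]
        nlinarith
      linarith
    have h0 : 0 ≤ U / (4 * c) := by positivity
    have h3 := log_le_two_mul_sqrt (show 0 < 4 + U / (4 * c) by linarith)
    have h4 := sqrt_add_le_add_sqrt (show (0 : ℝ) ≤ 4 by norm_num) h0
    have h5 : Real.sqrt 4 = 2 := by
      rw [show (4 : ℝ) = 2 ^ 2 by norm_num, Real.sqrt_sq (by norm_num)]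
    have h6 : Real.sqrt (c * U) = 2 * (c * Real.sqrt (U / (4 * c))) := by
      rw [show c * U = (2 * c) ^ 2 * (U / (4 * c)) by field_simp; ring,
        Real.sqrt_mul (by positivity), Real.sqrt_sq (by linarith)]
      ring
    nlinarith
  have hcB : Real.sqrt (c * B) ≤ 2 * s + 3 * c := by
    have h1 : S M ≤ M * (1 / m M) := by rw [mul_one_div]; exact h.S_le M le_rfl
    have hi0 : 0 ≤ 1 / m M := (one_div_pos.2 hm.1).le
    have hB' : B = Real.sqrt (c * S M) + c * (1 / m M) := by
      rw [hB, stabilityBound, if_neg hM.ne', mul_one_div]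
    have h2 : Real.sqrt (c * S M) ≤ M + c * (1 / m M) := by
      apply Real.sqrt_le_iff.2 ⟨by positivity, ?_⟩
      have h3 : c * S M ≤ M * (c * (1 / m M)) := by nlinarith
      nlinarith [sq_nonneg ((M : ℝ) - c * (1 / m M)), mul_nonneg (Nat.cast_nonneg (α := ℝ) M)
        (mul_nonneg hc.le hi0)]
    have h3 : c * (1 / m M) ≤ 4 * c + U / 4 := by
      calc c * (1 / m M) ≤ c * (4 + U / (4 * c)) := mul_le_mul_of_nonneg_left hminv hc.le
        _ = _ := by field_simp
    have h4 : c * B ≤ c * M + (8 * c ^ 2 + c * U) := by nlinarith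
    calc Real.sqrt (c * B) ≤ Real.sqrt (c * M + ((3 * c) ^ 2 + c * U)) :=
          Real.sqrt_le_sqrt (by nlinarith)
      _ ≤ Real.sqrt (c * M) + (Real.sqrt ((3 * c) ^ 2) + Real.sqrt (c * U)) :=
          (sqrt_add_le_add_sqrt (by positivity) (by positivity)).trans
            (by gcongr; exact sqrt_add_le_add_sqrt (by positivity) (by positivity))
      _ ≤ _ := by rw [Real.sqrt_sq (by linarith)]; linarith
  have hlogU := mul_log_le hc hU0
  have hlogV := mul_log_le hc (add_nonneg hV0 hB0)
  have hVB : Real.sqrt (c * (V + B)) ≤ 3 * s + 3 * c := by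
    rw [mul_add]
    exact (sqrt_add_le_add_sqrt (by positivity) (by positivity)).trans (by linarith)
  have hterms := h.stability_terms_le
  rw [← hs] at hterms
  have h1 := h.regret_first_arm hM
  rw [← hU] at h1
  have h2 := h.regret_second_arm hM
  rw [← hV, ← hB] at h2
  have hs0 : 0 ≤ s := (Real.sqrt_nonneg _).trans hcU
  constructor <;> linarith

/-- The sum of the adaptive terms `1 / √S` in terms of the total probability of the second arm. -/
lemma sum_inv_sqrt_le (h : IsCorralPath c M x p u v S m) (hM : 0 < M) :
    ∑ t ∈ Finset.range M, 1 / Real.sqrt (S (t + 1)) ≤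
      Real.sqrt (∑ t ∈ Finset.range M, p t) * Real.sqrt (1 + Real.log (S M)) := by
  have hSpos : ∀ t < M, 0 < S (t + 1) := fun t ht =>
    (one_div_pos.2 (h.p_pos ht)).trans_le (h.inv_le_S ht)
  have h1 := Real.sum_mul_le_sqrt_mul_sqrt (Finset.range M) (fun t => Real.sqrt (p t))
    (fun t => Real.sqrt (1 / p t / S (t + 1)))
  have e1 : ∑ t ∈ Finset.range M, Real.sqrt (p t) * Real.sqrt (1 / p t / S (t + 1)) =
      ∑ t ∈ Finset.range M, 1 / Real.sqrt (S (t + 1)) := by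
    refine Finset.sum_congr rfl fun t ht => ?_
    have ht := Finset.mem_range.1 ht
    have hp := h.p_pos ht
    rw [← Real.sqrt_mul hp.le, ← mul_div_assoc, mul_one_div_cancel hp.ne', Real.sqrt_div zero_le_one,
      Real.sqrt_one]
  have e2 : ∑ t ∈ Finset.range M, Real.sqrt (p t) ^ 2 = ∑ t ∈ Finset.range M, p t :=
    Finset.sum_congr rfl fun t ht => Real.sq_sqrt (h.p_pos (Finset.mem_range.1 ht)).le
  have e3 : ∑ t ∈ Finset.range M, Real.sqrt (1 / p t / S (t + 1)) ^ 2 =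
      ∑ t ∈ Finset.range M, 1 / p t / S (t + 1) :=
    Finset.sum_congr rfl fun t ht => by
      have ht := Finset.mem_range.1 ht
      exact Real.sq_sqrt (div_nonneg (one_div_pos.2 (h.p_pos ht)).le (hSpos t ht).le)
  rw [e1, e2, e3] at h1
  refine h1.trans (mul_le_mul_of_nonneg_left (Real.sqrt_le_sqrt ?_) (Real.sqrt_nonneg _))
  refine (sum_div_cumsum_le hM h.S_zero h.S_succ fun t ht => one_div_pos.2 (h.p_pos ht)).trans ?_
  have hp0 := h.p_pos hM
  have hSM : 0 < S M := by
    have := h.le_S M le_rfl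
    have : (0 : ℝ) < M := Nat.cast_pos.2 hM
    linarith
  rw [div_div_eq_mul_div, div_one]
  gcongr
  nlinarith [h.p_lt_one hM]

/-- The bound on the regret of the Corral-type algorithm against the candidate that adapts to the
total probability of the second arm. -/
lemma regret_le_sqrt_sum (h : IsCorralPath c M x p u v S m) (hM : 0 < M) {T : ℕ} (hMT : M ≤ T)
    (hT : 2 ≤ T) :
    ∑ t ∈ Finset.range M, p t * (u t - v t) ≤
      72 * (c * Real.log T) + 12 * Real.sqrt (c * Real.log T) *
        Real.sqrt (∑ t ∈ Finset.range M, p t) +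
      ∑ t ∈ Finset.range M, (2 * (Real.sqrt (x t) / Real.sqrt ((t : ℝ) + 1)) +
        4 * (min (x t) (1 - x t) * Real.sqrt (min (x t) (1 - x t))) * (u t - v t) ^ 2 /
          Real.sqrt ((t : ℝ) + 1) + (u t + v t) / ((t : ℝ) + 1) ^ 2) := by
  have hc16 := h.one_le
  have hc : 0 < c := by linarith
  have hT2 : (2 : ℝ) ≤ T := by exact_mod_cast hT
  have hMT' : (M : ℝ) ≤ T := by exact_mod_cast hMT
  have hlg : 0.69 ≤ Real.log T := by
    have := Real.log_le_log (by norm_num) hT2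
    linarith [Real.log_two_gt_d9]
  have hp4 : ∀ t < M, 1 / p t ≤ 4 * (T : ℝ) ^ 2 := by
    intro t ht
    have h1 := (h.mixture ht).2.2.1
    have h2 : (t : ℝ) + 1 ≤ T := by exact_mod_cast (Nat.succ_le_of_lt ht).trans hMT
    have h3 : 1 / p t ≤ 1 / (1 / (4 * ((t : ℝ) + 1) ^ 2)) :=
      one_div_le_one_div_of_le (by positivity) h1
    rw [one_div_one_div] at h3
    refine h3.trans ?_
    gcongr
  have hm := h.m_bounds M le_rfl
  have hminv : 1 / m M ≤ 4 * (T : ℝ) ^ 2 := h.inv_m_le (by nlinarith) hp4 M le_rfl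
  have hlogm : Real.log (1 / m M) ≤ 4 * Real.log T := by
    rw [show 4 * Real.log T = Real.log ((T : ℝ) ^ 4) by rw [Real.log_pow]; norm_num]
    apply Real.log_le_log (one_div_pos.2 hm.1) (hminv.trans _)
    have h4 : (4 : ℝ) ≤ (T : ℝ) ^ 2 := by nlinarith
    nlinarith
  have hlogS : 1 + Real.log (S M) ≤ 9 * Real.log T := by
    have hSM : (1 : ℝ) ≤ S M := by
      have := h.le_S M le_rfl
      have : (1 : ℝ) ≤ M := by exact_mod_cast hM
      linarith
    have h1 : S M ≤ M * (1 / m M) := by rw [mul_one_div]; exact h.S_le M le_rfl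
    have h2 : S M ≤ T * (4 * (T : ℝ) ^ 2) :=
      h1.trans (mul_le_mul hMT' hminv (one_div_pos.2 hm.1).le (by linarith))
    have h3 : Real.log (S M) ≤ 5 * Real.log T := by
      rw [show 5 * Real.log T = Real.log ((T : ℝ) ^ 5) by rw [Real.log_pow]; norm_num]
      apply Real.log_le_log (by linarith) (h2.trans _)
      have h4 : (4 : ℝ) ≤ (T : ℝ) ^ 2 := by nlinarith
      have h5 : 0 ≤ (T : ℝ) ^ 3 := by positivity
      nlinarith
    linarith
  have hlogU : Real.log (2 + (∑ t ∈ Finset.range M, u t) / c) ≤ 3 * Real.log T := by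
    have h1 : ∑ t ∈ Finset.range M, u t ≤ ∑ t ∈ Finset.range M, 2 * (4 * (T : ℝ) ^ 2) :=
      Finset.sum_le_sum fun t ht => by
        have ht := Finset.mem_range.1 ht
        have h2 := h.u_le t ht
        rw [← mul_one_div] at h2
        linarith [hp4 t ht]
    rw [Finset.sum_const, Finset.card_range, nsmul_eq_mul] at h1
    have hU0 : 0 ≤ ∑ t ∈ Finset.range M, u t :=
      Finset.sum_nonneg fun r hr => h.u_nonneg r (Finset.mem_range.1 hr)
    have h2 : (M : ℝ) * (2 * (4 * (T : ℝ) ^ 2)) ≤ T * (2 * (4 * (T : ℝ) ^ 2)) := by gcongr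
    rw [show 3 * Real.log T = Real.log ((T : ℝ) ^ 3) by rw [Real.log_pow]; norm_num]
    apply Real.log_le_log (by positivity)
    have h3 : (∑ t ∈ Finset.range M, u t) / c ≤ (T : ℝ) ^ 3 / 2 := by
      rw [div_le_iff₀ hc]
      have : (0 : ℝ) ≤ (T : ℝ) ^ 3 := by positivity
      nlinarith
    have h4 : (8 : ℝ) ≤ (T : ℝ) ^ 3 := by
      calc (8 : ℝ) = 2 ^ 3 := by norm_num
        _ ≤ _ := by gcongr
    linarith
  have hQ : Real.sqrt c * ∑ t ∈ Finset.range M, 1 / Real.sqrt (S (t + 1)) ≤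
      3 * Real.sqrt (c * Real.log T) * Real.sqrt (∑ t ∈ Finset.range M, p t) := by
    have h1 := h.sum_inv_sqrt_le hM
    have h2 : Real.sqrt (1 + Real.log (S M)) ≤ 3 * Real.sqrt (Real.log T) := by
      rw [show (3 : ℝ) = Real.sqrt 9 by
        rw [show (9 : ℝ) = 3 ^ 2 by norm_num, Real.sqrt_sq (by norm_num)],
        ← Real.sqrt_mul (by norm_num)]
      exact Real.sqrt_le_sqrt hlogS
    rw [Real.sqrt_mul hc.le]
    have h3 := mul_le_mul_of_nonneg_left h2 (Real.sqrt_nonneg (∑ t ∈ Finset.range M, p t))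
    have h4 := mul_le_mul_of_nonneg_left (h1.trans h3) (Real.sqrt_nonneg c)
    linarith
  have hD : ∑ t ∈ Finset.range M,
        4 * (min (x t) (1 - x t) * Real.sqrt (min (x t) (1 - x t))) * (u t - v t) ^ 2 /
          (Real.sqrt (t + 1) + 8 * Real.sqrt c) ≤ ∑ t ∈ Finset.range M,
        4 * (min (x t) (1 - x t) * Real.sqrt (min (x t) (1 - x t))) * (u t - v t) ^ 2 /
          Real.sqrt ((t : ℝ) + 1) := by
    refine Finset.sum_le_sum fun t ht => ?_
    have hxm := h.x_mem t (Finset.mem_range.1 ht)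
    have hn0 : 0 ≤ min (x t) (1 - x t) := le_min hxm.1.le (by linarith [hxm.2])
    apply div_le_div_of_nonneg_left (by positivity) (by positivity)
    linarith [Real.sqrt_nonneg c]
  have h1 := h.regret_first_arm hM
  have h2 := mul_le_mul_of_nonneg_left hlogm hc.le
  have h3 := mul_le_mul_of_nonneg_left hlogU hc.le
  have h4 := mul_le_mul_of_nonneg_left hlg hc.le
  simp only [Finset.sum_add_distrib, ← Finset.mul_sum] at h1 hD hQ ⊢
  linarith

end IsCorralPath

/-! ### The sampling distribution of the Corral-type algorithm -/

/-- The minimiser of the FTRL objective over two arms. -/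
def ftrlArgmin (κ c W : ℝ) : ℝ :=
  Classical.epsilon fun p => p ∈ Set.Ioo (0 : ℝ) 1 ∧ IsMinOn (ftrlObj κ c W) (Set.Ioo 0 1) p

lemma ftrlArgmin_spec {κ c : ℝ} (hκ : 0 ≤ κ) (hc : 0 < c) (W : ℝ) :
    ftrlArgmin κ c W ∈ Set.Ioo (0 : ℝ) 1 ∧
      IsMinOn (ftrlObj κ c W) (Set.Ioo 0 1) (ftrlArgmin κ c W) := by
  obtain ⟨p, hp⟩ := exists_isMinOn_ftrlObj hκ hc W
  exact Classical.epsilon_spec (p := fun p => p ∈ Set.Ioo (0 : ℝ) 1 ∧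
    IsMinOn (ftrlObj κ c W) (Set.Ioo 0 1) p) ⟨p, hp⟩

lemma antitone_ftrlArgmin {κ c : ℝ} (hκ : 0 ≤ κ) (hc : 0 < c) : Antitone (ftrlArgmin κ c) := by
  intro W W' hW
  rcases hW.eq_or_lt with rfl | hlt
  · exact le_rfl
  obtain ⟨h1, h2⟩ := ftrlArgmin_spec hκ hc W
  obtain ⟨h3, h4⟩ := ftrlArgmin_spec hκ hc W'
  have h5 : ftrlObj κ c W (ftrlArgmin κ c W) ≤ ftrlObj κ c W (ftrlArgmin κ c W') := h2 h3
  have h6 : ftrlObj κ c W' (ftrlArgmin κ c W') ≤ ftrlObj κ c W' (ftrlArgmin κ c W) := h4 h1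
  unfold ftrlObj at h5 h6
  nlinarith

section State

variable {α : Type} {B : IWAlgorithm α} {c : ℝ}

lemma CorralState.objective_eq (s : CorralState B) {q : Fin 2 → ℝ} (hq : q ∈ openSimplex) :
    s.objective c c q = s.Z 0 + ftrlObj (Real.sqrt (s.n + 1) + 8 * Real.sqrt c) c
      (s.Z 1 - s.Z 0 - stabilityBound c s.n s.invSum s.minQ) (q 1) := by
  have h1 : q 0 + q 1 = 1 := by simpa [Fin.sum_univ_two] using hq.1.2
  have h2 : q 0 = 1 - q 1 := by linarith
  have hb : s.bonus c c = stabilityBound c s.n s.invSum s.minQ := rfl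
  unfold objective ftrlObj
  rw [hb]
  simp only [Fin.sum_univ_two, one_div, Real.log_inv, div_inv_eq_mul, h2]
  ring

/-- The probability of the second arm before the mixture is the minimiser of a function of one
variable. -/
lemma CorralState.qbar_eq (hc : 0 < c) (s : CorralState B) :
    s.qbar c c 1 = ftrlArgmin (Real.sqrt (s.n + 1) + 8 * Real.sqrt c) c
      (s.Z 1 - s.Z 0 - stabilityBound c s.n s.invSum s.minQ) ∧
      s.qbar c c 0 = 1 - s.qbar c c 1 := by
  set κ := Real.sqrt ((s.n : ℝ) + 1) + 8 * Real.sqrt c with hκdef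
  have hκ : 0 < κ := by
    have : 0 < Real.sqrt c := Real.sqrt_pos.2 hc
    positivity
  set W := s.Z 1 - s.Z 0 - stabilityBound c s.n s.invSum s.minQ with hW
  obtain ⟨h1, h2⟩ := ftrlArgmin_spec hκ.le hc W
  have hmem : ∀ p ∈ Set.Ioo (0 : ℝ) 1, (![1 - p, p] : Fin 2 → ℝ) ∈ openSimplex := by
    intro p hp
    refine ⟨⟨fun i => ?_, by simp [Fin.sum_univ_two]⟩, fun i => ?_⟩ <;> fin_cases i <;>
      simp [hp.1, hp.2, hp.1.le, hp.2.le]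
  have hIoo : ∀ q ∈ openSimplex, q 1 ∈ Set.Ioo (0 : ℝ) 1 := by
    intro q hq
    have h3 : q 0 + q 1 = 1 := by simpa [Fin.sum_univ_two] using hq.1.2
    exact ⟨hq.2 1, by linarith [hq.2 0]⟩
  have hex : ∃ q : Fin 2 → ℝ, q ∈ openSimplex ∧ IsMinOn (s.objective c c) openSimplex q := by
    refine ⟨_, hmem _ h1, fun q hq => ?_⟩
    have h3 : ftrlObj κ c W (ftrlArgmin κ c W) ≤ ftrlObj κ c W (q 1) := h2 (hIoo q hq)
    change s.objective c c _ ≤ s.objective c c q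
    rw [s.objective_eq hq, s.objective_eq (hmem _ h1)]
    exact add_le_add_right h3 _
  obtain ⟨h3, h4⟩ : s.qbar c c ∈ openSimplex ∧ IsMinOn (s.objective c c) openSimplex (s.qbar c c) :=
    Classical.epsilon_spec (p := fun q : Fin 2 → ℝ => q ∈ openSimplex ∧
      IsMinOn (s.objective c c) openSimplex q) hex
  refine ⟨ftrl_argmin_unique hκ hc.le h1 h2 (hIoo _ h3) fun p hp => ?_, ?_⟩
  · have h5 : s.objective c c (s.qbar c c) ≤ s.objective c c ![1 - p, p] := h4 (hmem p hp)
    rw [s.objective_eq h3, s.objective_eq (hmem p hp)] at h5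
    have h6 : (![1 - p, p] : Fin 2 → ℝ) 1 = p := rfl
    rw [h6] at h5
    exact le_of_add_le_add_left h5
  · have h5 : s.qbar c c 0 + s.qbar c c 1 = 1 := by simpa [Fin.sum_univ_two] using h3.1.2
    linarith

lemma CorralState.qbar_mem (hc : 0 < c) (s : CorralState B) :
    s.qbar c c 1 ∈ Set.Ioo (0 : ℝ) 1 := by
  rw [(s.qbar_eq hc).1]
  exact (ftrlArgmin_spec (by positivity) hc _).1

lemma CorralState.q_zero (hc : 0 < c) (s : CorralState B) : s.q c c 0 = 1 - s.q c c 1 := by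
  unfold CorralState.q
  rw [(s.qbar_eq hc).2]
  field_simp
  ring

lemma CorralState.q_bounds (hc : 0 < c) (s : CorralState B) :
    s.qbar c c 1 / 2 ≤ s.q c c 1 ∧ (1 - s.qbar c c 1) / 2 ≤ 1 - s.q c c 1 ∧
      1 / (4 * ((s.n : ℝ) + 1) ^ 2) ≤ s.q c c 1 ∧ 1 / (4 * ((s.n : ℝ) + 1) ^ 2) ≤ 1 - s.q c c 1 := by
  obtain ⟨h1, h2, h3, h4, -⟩ := mixture_bounds s.n (s.qbar_mem hc) (p := s.q c c 1) rfl
  exact ⟨h1, h2, h3, h4⟩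

lemma CorralState.q_mem (hc : 0 < c) (s : CorralState B) : s.q c c 1 ∈ Set.Ioo (0 : ℝ) 1 := by
  obtain ⟨-, -, h3, h4⟩ := s.q_bounds hc
  have : 0 < 1 / (4 * ((s.n : ℝ) + 1) ^ 2) := by positivity
  exact ⟨by linarith, by linarith⟩

end State

/-! ### A stopped run of the Corral-type algorithm -/

/-- The random memory of the Corral-type algorithm, run on EXP2, before round `t`. -/
def corralRun {d : ℕ} {Ω : Type u} (Y : Finset (Vec d)) (ν : Vec d → ℝ) (cand : Vec d) (c : ℝ)
    (i : ℕ → Ω → Fin 2) (a : ℕ → Ω → Vec d) (loss : ℕ → Ω → Vec d → ℝ) (t : ℕ) (ω : Ω) :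
    CorralState (exp2 Y ν) :=
  (corral cand (exp2 Y ν) c c).stateAt (fun r => i r ω) (fun r => a r ω)
    (fun r => loss r ω (a r ω)) t

section RunDefs

variable {d : ℕ} {Ω : Type u} (Y : Finset (Vec d)) (ν : Vec d → ℝ) (cand : Vec d) (c : ℝ)
  (i : ℕ → Ω → Fin 2) (a : ℕ → Ω → Vec d) (loss : ℕ → Ω → Vec d → ℝ)

/-- The probability with which the base algorithm is followed in round `t`. -/
def baseProb (t : ℕ) (ω : Ω) : ℝ := (corralRun Y ν cand c i a loss t ω).q c c 1

/-- The FTRL probability of the base algorithm in round `t`, before the mixture. -/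
def baseProbBar (t : ℕ) (ω : Ω) : ℝ := (corralRun Y ν cand c i a loss t ω).qbar c c 1

/-- The importance-weighted shifted loss of the base algorithm. -/
def baseLoss (t : ℕ) (ω : Ω) : ℝ :=
  (loss t ω (a t ω) + 1) * (if i t ω = 1 then 1 else 0) / baseProb Y ν cand c i a loss t ω

/-- The importance-weighted shifted loss of the candidate. -/
def candLoss (t : ℕ) (ω : Ω) : ℝ :=
  (loss t ω (a t ω) + 1) * (if i t ω = 0 then 1 else 0) / (1 - baseProb Y ν cand c i a loss t ω)

end RunDefs

section Run

variable {d : ℕ} {Ω : Type u} {Y : Finset (Vec d)} {ν : Vec d → ℝ} {cand : Vec d} {c : ℝ}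
  {i : ℕ → Ω → Fin 2} {a : ℕ → Ω → Vec d} {loss : ℕ → Ω → Vec d → ℝ}

lemma corralRun_n (t : ℕ) (ω : Ω) : (corralRun Y ν cand c i a loss t ω).n = t := by
  induction t with
  | zero => rfl
  | succ t ih => exact congrArg (· + 1) ih

/-- The base algorithm inside the Corral-type algorithm runs under the weights `baseProb`. -/
lemma corralRun_base (t : ℕ) (ω : Ω) : (corralRun Y ν cand c i a loss t ω).base =
    exp2Run Y ν (baseProb Y ν cand c i a loss) (fun t => {ω | i t ω = 1}) a loss t ω := by
  induction t with
  | zero => rfl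
  | succ t ih =>
    have h1 : feedback (fun t => {ω | i t ω = 1}) a loss t ω =
        if i t ω = 1 then some (a t ω, loss t ω (a t ω)) else none := by
      unfold feedback
      by_cases h : i t ω = 1
      · rw [if_pos h, if_pos (by exact h)]
      · rw [if_neg h, if_neg (by exact h)]
    change (exp2 Y ν).update (corralRun Y ν cand c i a loss t ω).base
      (baseProb Y ν cand c i a loss t ω) _ = (exp2 Y ν).update (exp2Run Y ν _ _ a loss t ω)
      (baseProb Y ν cand c i a loss t ω) (feedback _ a loss t ω)
    rw [ih, h1]

lemma corralRun_sums (t : ℕ) (ω : Ω) :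
    (corralRun Y ν cand c i a loss t ω).invSum =
      (exp2Run Y ν (baseProb Y ν cand c i a loss) (fun t => {ω | i t ω = 1}) a loss t ω).invSum ∧
    (corralRun Y ν cand c i a loss t ω).minQ =
      (exp2Run Y ν (baseProb Y ν cand c i a loss) (fun t => {ω | i t ω = 1}) a loss t ω).minQ := by
  induction t with
  | zero => exact ⟨rfl, rfl⟩
  | succ t ih =>
    constructor
    · change (corralRun Y ν cand c i a loss t ω).invSum + 1 / baseProb Y ν cand c i a loss t ω =
        (exp2Run Y ν (baseProb Y ν cand c i a loss) _ a loss t ω).invSum +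
          1 / baseProb Y ν cand c i a loss t ω
      rw [ih.1]
    · change min (corralRun Y ν cand c i a loss t ω).minQ (baseProb Y ν cand c i a loss t ω) =
        min (exp2Run Y ν (baseProb Y ν cand c i a loss) _ a loss t ω).minQ
          (baseProb Y ν cand c i a loss t ω)
      rw [ih.2]

lemma corralRun_Z (hc : 0 < c) (t : ℕ) (ω : Ω) :
    (corralRun Y ν cand c i a loss t ω).Z 1 - (corralRun Y ν cand c i a loss t ω).Z 0 =
      ∑ r ∈ Finset.range t,
        (baseLoss Y ν cand c i a loss r ω - candLoss Y ν cand c i a loss r ω) := by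
  induction t with
  | zero => rw [Finset.sum_range_zero]; exact sub_self _
  | succ t ih =>
    rw [Finset.sum_range_succ, ← ih]
    have h1 : ∀ j, (corralRun Y ν cand c i a loss (t + 1) ω).Z j =
        (corralRun Y ν cand c i a loss t ω).Z j + ((loss t ω (a t ω) + 1) *
          (if i t ω = j then 1 else 0) / (corralRun Y ν cand c i a loss t ω).q c c j - 1) :=
      fun j => rfl
    rw [h1, h1, CorralState.q_zero hc]
    unfold baseLoss candLoss baseProb
    ring

/-- Every realisation of the algorithm with losses in `[-1, 1]` obeys the pathwise bounds. -/
lemma isCorralPath_corralRun (hc : 16 ≤ c) {M : ℕ} {ω : Ω}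
    (hy : ∀ t < M, loss t ω (a t ω) ∈ Set.Icc (-1 : ℝ) 1) :
    IsCorralPath c M (fun t => baseProbBar Y ν cand c i a loss t ω)
      (fun t => baseProb Y ν cand c i a loss t ω) (fun t => baseLoss Y ν cand c i a loss t ω)
      (fun t => candLoss Y ν cand c i a loss t ω)
      (fun t => (corralRun Y ν cand c i a loss t ω).invSum)
      (fun t => (corralRun Y ν cand c i a loss t ω).minQ) := by
  have hc0 : 0 < c := by linarith
  have hmem : ∀ t, baseProb Y ν cand c i a loss t ω ∈ Set.Ioo (0 : ℝ) 1 := fun t =>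
    CorralState.q_mem hc0 _
  have hnum : ∀ t < M, ∀ j : Fin 2,
      0 ≤ (loss t ω (a t ω) + 1) * (if i t ω = j then 1 else 0) ∧
      (loss t ω (a t ω) + 1) * (if i t ω = j then 1 else 0) ≤ 2 := by
    intro t ht j
    obtain ⟨h1, h2⟩ := hy t ht
    split_ifs <;> constructor <;> linarith
  have hZ := fun t => corralRun_Z (Y := Y) (ν := ν) (cand := cand) (i := i) (a := a) (loss := loss)
    hc0 t ω
  refine ⟨hc, fun t _ => CorralState.qbar_mem hc0 _, fun t _ => ?_, fun t ht => ?_, fun t ht => ?_,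
    fun t ht => ?_, fun t ht => ?_, rfl, fun t _ => rfl, rfl, fun t _ => rfl, fun t _ => ?_⟩
  · simp only [baseProb, baseProbBar, CorralState.q, corralRun_n]
  · exact div_nonneg (hnum t ht 1).1 (hmem t).1.le
  · exact div_le_div_of_nonneg_right (hnum t ht 1).2 (hmem t).1.le
  · exact div_nonneg (hnum t ht 0).1 (by linarith [(hmem t).2])
  · exact div_le_div_of_nonneg_right (hnum t ht 0).2 (by linarith [(hmem t).2])
  · simp only [baseProbBar]
    rw [((corralRun Y ν cand c i a loss t ω).qbar_eq hc0).1, corralRun_n, hZ]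
    exact (ftrlArgmin_spec (by positivity) hc0 _).2

end Run

lemma corral_dist_zero {α : Type} (cand : α) (B : IWAlgorithm α) (c : ℝ) (s : CorralState B)
    (x : α) : (corral cand B c c).dist s 0 x = if x = cand then s.q c c 0 else 0 := by
  simp [corral]

lemma corral_dist_one {α : Type} (cand : α) (B : IWAlgorithm α) (c : ℝ) (s : CorralState B)
    (x : α) : (corral cand B c c).dist s 1 x = s.q c c 1 * B.dist s.base (s.q c c 1) x := by
  simp [corral]

/-- The conditional mean loss of the base algorithm in round `t`. -/
def baseMean {d : ℕ} {Ω : Type u} (Y : Finset (Vec d)) (ν : Vec d → ℝ) (cand : Vec d) (c : ℝ)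
    (i : ℕ → Ω → Fin 2) (a : ℕ → Ω → Vec d) (loss : ℕ → Ω → Vec d → ℝ) (t : ℕ) (ω : Ω) : ℝ :=
  ∑ x ∈ Y, exp2Dist Y ν (corralRun Y ν cand c i a loss t ω).base
    (baseProb Y ν cand c i a loss t ω) x * loss t ω x

/-- The Corral-type algorithm with candidate `cand`, run on EXP2 over `X \ {cand}`, in an
environment over `X` up to a stopping time `τ`. Nothing is assumed about the actions after `τ`. -/
structure StoppedCorralRun {d : ℕ} {Ω : Type u} [mΩ : MeasurableSpace Ω] (μ : Measure Ω)
    (X : Finset (Vec d)) (ν : Vec d → ℝ) (T : ℕ) (ℱ 𝒢 : Filtration ℕ mΩ)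
    (loss : ℕ → Ω → Vec d → ℝ) (cand : Vec d) (c : ℝ) (i : ℕ → Ω → Fin 2) (a : ℕ → Ω → Vec d)
    (τ : Ω → ℕ) : Prop where
  john : IsJohnExploration (X.erase cand) ν
  cand_mem : cand ∈ X
  nonempty : (X.erase cand).Nonempty
  env : IsLinearEnvironment μ X T ℱ 𝒢 loss
  one_le : 16 ≤ c
  const_le : 81 * (d * Real.log (X.erase cand).card) ≤ c
  symbol_measurable : ∀ t < T, ∀ j, MeasurableSet[ℱ (t + 1)] {ω | i t ω = j}
  action_measurable : ∀ t < T, Measurable[ℱ (t + 1)] (a t)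
  action_mem : ∀ t < T, ∀ ω, a t ω ∈ X
  stop_le : ∀ ω, τ ω ≤ T
  stop_measurable : ∀ n, MeasurableSet[ℱ n] {ω | n < τ ω}
  law : ∀ t < T, ∀ j, ∀ x ∈ X, ∀ᵐ ω ∂μ, ω ∈ {ω | t < τ ω} →
    (μ[Set.indicator {ω | i t ω = j ∧ a t ω = x} (fun _ => (1 : ℝ)) | 𝒢 t]) ω =
      (corral cand (exp2 (X.erase cand) ν) c c).dist
        (corralRun (X.erase cand) ν cand c i a loss t ω) j x

/-- The FTRL probability of a measurable memory is measurable, since it is a monotone function of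
the cumulative loss difference. -/
lemma measurable_corral_prob {Ω : Type u} {m : MeasurableSpace Ω} {α : Type} {B : IWAlgorithm α}
    {c : ℝ} (hc : 0 < c) {s : Ω → CorralState B} {n : ℕ} (hn : ∀ ω, (s ω).n = n)
    (hZ : ∀ j, Measurable[m] fun ω => (s ω).Z j) (hS : Measurable[m] fun ω => (s ω).invSum)
    (hm : Measurable[m] fun ω => (s ω).minQ) :
    (Measurable[m] fun ω => (s ω).qbar c c 1) ∧ ∀ j, Measurable[m] fun ω => (s ω).q c c j := by
  have h1 : Measurable[m] fun ω => (s ω).qbar c c 1 := by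
    simp only [fun ω => ((s ω).qbar_eq hc).1, hn]
    refine (antitone_ftrlArgmin (κ := Real.sqrt ((n : ℝ) + 1) + 8 * Real.sqrt c)
      (by positivity) hc).measurable.comp (((hZ 1).sub (hZ 0)).sub ?_)
    unfold stabilityBound
    by_cases h0 : n = 0
    · simp only [if_pos h0, measurable_const]
    · simp only [if_neg h0]
      exact (hS.const_mul c).sqrt.add (hm.const_div c)
  have h2 : Measurable[m] fun ω => (s ω).q c c 1 := by
    simp only [CorralState.q, hn]
    exact (h1.const_mul _).add_const _
  refine ⟨h1, fun j => ?_⟩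
  fin_cases j
  · simp only [Fin.zero_eta, fun ω => (s ω).q_zero hc]
    exact h2.const_sub 1
  · exact h2

namespace StoppedCorralRun

variable {d : ℕ} {Ω : Type u} [mΩ : MeasurableSpace Ω] {μ : Measure Ω}
  {X : Finset (Vec d)} {ν : Vec d → ℝ} {T : ℕ} {ℱ 𝒢 : Filtration ℕ mΩ}
  {loss : ℕ → Ω → Vec d → ℝ} {cand : Vec d} {c : ℝ} {i : ℕ → Ω → Fin 2} {a : ℕ → Ω → Vec d}
  {τ : Ω → ℕ}

lemma pos (h : StoppedCorralRun μ X ν T ℱ 𝒢 loss cand c i a τ) : 0 < c := by linarith [h.one_le]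

lemma loss_mem (h : StoppedCorralRun μ X ν T ℱ 𝒢 loss cand c i a τ) {t : ℕ} (ht : t < T) (ω : Ω) :
    loss t ω (a t ω) ∈ Set.Icc (-1 : ℝ) 1 :=
  h.env.bounded t ht _ (h.action_mem t ht ω) ω

lemma loss_measurable (h : StoppedCorralRun μ X ν T ℱ 𝒢 loss cand c i a τ) {t : ℕ} (ht : t < T) :
    Measurable[ℱ (t + 1)] fun ω => loss t ω (a t ω) := by
  have h1 : (fun ω => loss t ω (a t ω)) = fun ω =>
      ∑ x ∈ X, Set.indicator {ω | a t ω = x} (fun ω => loss t ω x) ω := by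
    funext ω
    rw [Finset.sum_eq_single (a t ω)]
    · rw [Set.indicator_of_mem (by exact rfl)]
    · intro b _ hb
      rw [Set.indicator_of_notMem (by exact fun h' => hb (Eq.symm h'))]
    · intro hb; exact absurd (h.action_mem t ht ω) hb
  rw [h1]
  refine Finset.measurable_fun_sum _ fun x hx => Measurable.indicator ?_
    (h.action_measurable t ht (measurableSet_singleton x))
  exact (h.env.measurable t ht x hx).mono (h.env.env_le t) le_rfl

lemma run_measurable (h : StoppedCorralRun μ X ν T ℱ 𝒢 loss cand c i a τ) : ∀ t ≤ T,
    (∀ j, Measurable[ℱ t] fun ω => (corralRun (X.erase cand) ν cand c i a loss t ω).Z j) ∧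
    (Measurable[ℱ t] fun ω => (corralRun (X.erase cand) ν cand c i a loss t ω).invSum) ∧
    Measurable[ℱ t] fun ω => (corralRun (X.erase cand) ν cand c i a loss t ω).minQ := by
  intro t
  induction t with
  | zero => exact fun _ => ⟨fun _ => measurable_const, measurable_const, measurable_const⟩
  | succ t ih =>
    intro ht
    obtain ⟨hZ, hS, hm⟩ := ih (by omega)
    have hle : ℱ t ≤ ℱ (t + 1) := ℱ.mono (Nat.le_succ t)
    have hq := (measurable_corral_prob h.pos (fun ω => corralRun_n t ω) hZ hS hm).2
    refine ⟨fun j => ?_, (hS.add ((hq 1).const_div 1)).mono hle le_rfl,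
      (hm.min (hq 1)).mono hle le_rfl⟩
    refine ((hZ j).mono hle le_rfl).add (Measurable.sub_const ?_ 1)
    refine Measurable.div (Measurable.mul ((h.loss_measurable (by omega)).add_const 1)
      (Measurable.ite (h.symbol_measurable t (by omega) j) measurable_const measurable_const))
      ((hq j).mono hle le_rfl)

lemma prob_measurable (h : StoppedCorralRun μ X ν T ℱ 𝒢 loss cand c i a τ) {t : ℕ} (ht : t ≤ T) :
    Measurable[ℱ t] (baseProb (X.erase cand) ν cand c i a loss t) := by
  obtain ⟨hZ, hS, hm⟩ := h.run_measurable t ht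
  exact (measurable_corral_prob h.pos (fun ω => corralRun_n t ω) hZ hS hm).2 1

lemma probBar_measurable (h : StoppedCorralRun μ X ν T ℱ 𝒢 loss cand c i a τ) {t : ℕ}
    (ht : t ≤ T) : Measurable[ℱ t] (baseProbBar (X.erase cand) ν cand c i a loss t) := by
  obtain ⟨hZ, hS, hm⟩ := h.run_measurable t ht
  exact (measurable_corral_prob h.pos (fun ω => corralRun_n t ω) hZ hS hm).1

lemma prob_bounds (h : StoppedCorralRun μ X ν T ℱ 𝒢 loss cand c i a τ) {t : ℕ} (ht : t < T)
    (ω : Ω) : 1 / (4 * ((T : ℝ) + 1) ^ 2) ≤ baseProb (X.erase cand) ν cand c i a loss t ω ∧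
      1 / (4 * ((T : ℝ) + 1) ^ 2) ≤ 1 - baseProb (X.erase cand) ν cand c i a loss t ω := by
  obtain ⟨-, -, h3, h4⟩ :=
    CorralState.q_bounds h.pos (corralRun (X.erase cand) ν cand c i a loss t ω)
  rw [corralRun_n] at h3 h4
  have h5 : 1 / (4 * ((T : ℝ) + 1) ^ 2) ≤ 1 / (4 * ((t : ℝ) + 1) ^ 2) := by
    have : (t : ℝ) ≤ T := by exact_mod_cast ht.le
    gcongr
  exact ⟨h5.trans h3, h5.trans h4⟩

/-- The base algorithm inside the Corral-type algorithm is a stopped run of EXP2. -/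
lemma toExp2Run (h : StoppedCorralRun μ X ν T ℱ 𝒢 loss cand c i a τ) :
    StoppedExp2Run μ X (X.erase cand) ν T ℱ 𝒢 loss (baseProb (X.erase cand) ν cand c i a loss)
      (fun t => {ω | i t ω = 1}) a τ (1 / (4 * ((T : ℝ) + 1) ^ 2)) where
  john := h.john
  sub := Finset.erase_subset _ _
  env := h.env
  weight_measurable t ht := h.prob_measurable ht.le
  weight_mem t _ ω := by
    have := CorralState.q_mem h.pos (corralRun (X.erase cand) ν cand c i a loss t ω)
    exact ⟨this.1, this.2.le⟩
  obs_measurable t ht := h.symbol_measurable t ht 1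
  action_measurable := h.action_measurable
  action_mem := h.action_mem
  stop_le := h.stop_le
  stop_measurable := h.stop_measurable
  eps_pos := by positivity
  eps_le t ω ht := (h.prob_bounds (ht.trans_le (h.stop_le ω)) ω).1
  law t ht x hx := by
    filter_upwards [h.law t ht 1 x hx] with ω hω hτ
    rw [← corralRun_base]
    exact hω hτ

/-- One round of the algorithm: the expectation of a function of the arm and the action. -/
lemma integral_round [IsProbabilityMeasure μ]
    (h : StoppedCorralRun μ X ν T ℱ 𝒢 loss cand c i a τ) {t : ℕ} (ht : t < T)
    {G : Fin 2 → Vec d → Ω → ℝ} (hG : ∀ j, ∀ x ∈ X, Measurable[𝒢 t] (G j x)) {C : ℝ}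
    (hC : ∀ j, ∀ x ∈ X, ∀ ω, |G j x ω| ≤ C) :
    IntegrableOn (fun ω => G (i t ω) (a t ω) ω) {ω | t < τ ω} μ ∧
    IntegrableOn (fun ω => baseProb (X.erase cand) ν cand c i a loss t ω *
      ∑ x ∈ X.erase cand, exp2Dist (X.erase cand) ν
        (corralRun (X.erase cand) ν cand c i a loss t ω).base
        (baseProb (X.erase cand) ν cand c i a loss t ω) x * G 1 x ω +
      (1 - baseProb (X.erase cand) ν cand c i a loss t ω) * G 0 cand ω) {ω | t < τ ω} μ ∧
    ∫ ω in {ω | t < τ ω}, G (i t ω) (a t ω) ω ∂μ =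
      ∫ ω in {ω | t < τ ω}, (baseProb (X.erase cand) ν cand c i a loss t ω *
      ∑ x ∈ X.erase cand, exp2Dist (X.erase cand) ν
        (corralRun (X.erase cand) ν cand c i a loss t ω).base
        (baseProb (X.erase cand) ν cand c i a loss t ω) x * G 1 x ω +
      (1 - baseProb (X.erase cand) ν cand c i a loss t ω) * G 0 cand ω) ∂μ := by
  have hR : MeasurableSet[𝒢 t] {ω | t < τ ω} := h.env.le_env t _ (h.stop_measurable t)
  have hE : ∀ j, ∀ x, Integrable (Set.indicator {ω | i t ω = j ∧ a t ω = x} (fun _ => (1 : ℝ))) μ :=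
    fun j x => (integrable_const 1).indicator (ℱ.le (t + 1) _
      ((h.symbol_measurable t ht j).inter
        (h.action_measurable t ht (measurableSet_singleton x))))
  have key := fun j x (hx : x ∈ X) => setIntegral_mul_of_condExp (𝒢.le t) (hE j x) hR (hG j x hx)
    (fun ω _ => hC j x hx ω) (h.law t ht j x hx)
  have e1 : (fun ω => G (i t ω) (a t ω) ω) = fun ω => ∑ j, ∑ x ∈ X,
      Set.indicator {ω | i t ω = j ∧ a t ω = x} (fun _ => (1 : ℝ)) ω * G j x ω := by
    funext ω
    rw [Finset.sum_eq_single (i t ω), Finset.sum_eq_single (a t ω)]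
    · rw [Set.indicator_of_mem (by exact ⟨rfl, rfl⟩), one_mul]
    · intro b _ hb
      rw [Set.indicator_of_notMem (by rintro ⟨_, h'⟩; exact hb h'.symm), zero_mul]
    · intro hb; exact absurd (h.action_mem t ht ω) hb
    · intro j _ hj
      refine Finset.sum_eq_zero fun x _ => ?_
      rw [Set.indicator_of_notMem (by rintro ⟨h', _⟩; exact hj h'.symm), zero_mul]
    · intro hj; exact absurd (Finset.mem_univ _) hj
  have e2 : (fun ω => baseProb (X.erase cand) ν cand c i a loss t ω *
      ∑ x ∈ X.erase cand, exp2Dist (X.erase cand) ν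
        (corralRun (X.erase cand) ν cand c i a loss t ω).base
        (baseProb (X.erase cand) ν cand c i a loss t ω) x * G 1 x ω +
      (1 - baseProb (X.erase cand) ν cand c i a loss t ω) * G 0 cand ω) = fun ω => ∑ j, ∑ x ∈ X,
      (corral cand (exp2 (X.erase cand) ν) c c).dist
        (corralRun (X.erase cand) ν cand c i a loss t ω) j x * G j x ω := by
    funext ω
    rw [Fin.sum_univ_two, add_comm]
    congr 1
    · rw [Finset.sum_eq_single cand]
      · rw [corral_dist_zero, if_pos rfl, CorralState.q_zero h.pos]
        rfl
      · intro b _ hb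
        rw [corral_dist_zero, if_neg hb, zero_mul]
      · intro hb; exact absurd h.cand_mem hb
    · rw [← Finset.add_sum_erase X _ h.cand_mem, Finset.mul_sum]
      have h0 : exp2Dist (X.erase cand) ν (corralRun (X.erase cand) ν cand c i a loss t ω).base
          (baseProb (X.erase cand) ν cand c i a loss t ω) cand = 0 :=
        exp2Dist_eq_zero h.john (Finset.notMem_erase cand X)
      have hc1 : (corral cand (exp2 (X.erase cand) ν) c c).dist
          (corralRun (X.erase cand) ν cand c i a loss t ω) 1 cand = 0 := by
        rw [corral_dist_one]
        exact mul_eq_zero_of_right _ h0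
      rw [hc1, zero_mul, zero_add]
      simp only [corral_dist_one]
      refine Finset.sum_congr rfl fun x _ => ?_
      rw [← mul_assoc]
      rfl
  rw [e1, e2]
  refine ⟨integrable_finsetSum _ fun j _ => integrable_finsetSum _ fun x hx => (key j x hx).1,
    integrable_finsetSum _ fun j _ => integrable_finsetSum _ fun x hx => (key j x hx).2.1, ?_⟩
  rw [integral_finsetSum _ fun j _ => integrable_finsetSum _ fun x hx => (key j x hx).1,
    integral_finsetSum _ fun j _ => integrable_finsetSum _ fun x hx => (key j x hx).2.1]
  refine Finset.sum_congr rfl fun j _ => ?_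
  rw [integral_finsetSum _ fun x hx => (key j x hx).1,
    integral_finsetSum _ fun x hx => (key j x hx).2.1]
  exact Finset.sum_congr rfl fun x hx => (key j x hx).2.2

end StoppedCorralRun

/-! ### The expected regret of the Corral-type algorithm -/

namespace StoppedCorralRun

variable {d : ℕ} {Ω : Type u} [mΩ : MeasurableSpace Ω] {μ : Measure Ω}
  {X : Finset (Vec d)} {ν : Vec d → ℝ} {T : ℕ} {ℱ 𝒢 : Filtration ℕ mΩ}
  {loss : ℕ → Ω → Vec d → ℝ} {cand : Vec d} {c : ℝ} {i : ℕ → Ω → Fin 2} {a : ℕ → Ω → Vec d}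
  {τ : Ω → ℕ}

lemma dist_nonneg (h : StoppedCorralRun μ X ν T ℱ 𝒢 loss cand c i a τ) {t : ℕ} (ht : t < T)
    (ω : Ω) {x : Vec d} (hx : x ∈ X.erase cand) :
    0 ≤ exp2Dist (X.erase cand) ν (corralRun (X.erase cand) ν cand c i a loss t ω).base
      (baseProb (X.erase cand) ν cand c i a loss t ω) x := by
  rw [corralRun_base]
  exact (exp2Dist_pos h.john (h.toExp2Run.valid ht.le ω) (h.toExp2Run.weight_mem t ht ω).1 hx).le

lemma sum_dist (h : StoppedCorralRun μ X ν T ℱ 𝒢 loss cand c i a τ) (t : ℕ) (ω : Ω) :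
    ∑ x ∈ X.erase cand, exp2Dist (X.erase cand) ν
      (corralRun (X.erase cand) ν cand c i a loss t ω).base
      (baseProb (X.erase cand) ν cand c i a loss t ω) x = 1 :=
  sum_exp2Dist h.nonempty h.john

lemma abs_loss_add_one (h : StoppedCorralRun μ X ν T ℱ 𝒢 loss cand c i a τ) {t : ℕ} (ht : t < T)
    {x : Vec d} (hx : x ∈ X) (ω : Ω) : 0 ≤ loss t ω x + 1 ∧ loss t ω x + 1 ≤ 2 := by
  have := h.env.bounded t ht x hx ω
  exact ⟨by linarith [this.1], by linarith [this.2]⟩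

/-- The expected regret of a round against the fixed action `u`. -/
lemma integral_regret [IsProbabilityMeasure μ]
    (h : StoppedCorralRun μ X ν T ℱ 𝒢 loss cand c i a τ) {t : ℕ} (ht : t < T) {u : Vec d}
    (hu : u ∈ X) :
    IntegrableOn (fun ω => loss t ω (a t ω) - loss t ω u) {ω | t < τ ω} μ ∧
    IntegrableOn (fun ω => baseProb (X.erase cand) ν cand c i a loss t ω *
      (baseMean (X.erase cand) ν cand c i a loss t ω - loss t ω cand) +
      (loss t ω cand - loss t ω u)) {ω | t < τ ω} μ ∧
    ∫ ω in {ω | t < τ ω}, (loss t ω (a t ω) - loss t ω u) ∂μ =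
      ∫ ω in {ω | t < τ ω}, (baseProb (X.erase cand) ν cand c i a loss t ω *
      (baseMean (X.erase cand) ν cand c i a loss t ω - loss t ω cand) +
      (loss t ω cand - loss t ω u)) ∂μ := by
  have key := h.integral_round ht (G := fun _ x ω => loss t ω x - loss t ω u)
    (fun _ x hx => (h.env.measurable t ht x hx).sub (h.env.measurable t ht u hu)) (C := 2)
    (fun _ x hx ω => by
      have h1 := h.abs_loss_add_one ht hx ω
      have h2 := h.abs_loss_add_one ht hu ω
      exact abs_le.2 ⟨by linarith, by linarith⟩)
  have e : (fun ω => baseProb (X.erase cand) ν cand c i a loss t ω *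
      ∑ x ∈ X.erase cand, exp2Dist (X.erase cand) ν
        (corralRun (X.erase cand) ν cand c i a loss t ω).base
        (baseProb (X.erase cand) ν cand c i a loss t ω) x * (loss t ω x - loss t ω u) +
      (1 - baseProb (X.erase cand) ν cand c i a loss t ω) * (loss t ω cand - loss t ω u)) =
      fun ω => baseProb (X.erase cand) ν cand c i a loss t ω *
      (baseMean (X.erase cand) ν cand c i a loss t ω - loss t ω cand) +
      (loss t ω cand - loss t ω u) := by
    funext ω
    have e0 : ∑ x ∈ X.erase cand, exp2Dist (X.erase cand) ν
        (corralRun (X.erase cand) ν cand c i a loss t ω).base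
        (baseProb (X.erase cand) ν cand c i a loss t ω) x * (loss t ω x - loss t ω u) =
        baseMean (X.erase cand) ν cand c i a loss t ω - loss t ω u := by
      rw [Finset.sum_congr rfl fun x _ => mul_sub _ _ _, Finset.sum_sub_distrib, ← Finset.sum_mul,
        h.sum_dist, one_mul]
      rfl
    rw [e0]
    ring
  rw [e] at key
  exact key

/-- The importance-weighted estimators are unbiased. -/
lemma integral_estimator [IsProbabilityMeasure μ]
    (h : StoppedCorralRun μ X ν T ℱ 𝒢 loss cand c i a τ) {t : ℕ} (ht : t < T) {H : Ω → ℝ}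
    (hH : Measurable[𝒢 t] H) (hH1 : ∀ ω, |H ω| ≤ 1) (s : ℝ) (hs : |s| ≤ 1) :
    IntegrableOn (fun ω => H ω * (baseLoss (X.erase cand) ν cand c i a loss t ω +
      s * candLoss (X.erase cand) ν cand c i a loss t ω)) {ω | t < τ ω} μ ∧
    IntegrableOn (fun ω => H ω * (baseMean (X.erase cand) ν cand c i a loss t ω + 1 +
      s * (loss t ω cand + 1))) {ω | t < τ ω} μ ∧
    ∫ ω in {ω | t < τ ω}, H ω * (baseLoss (X.erase cand) ν cand c i a loss t ω +
      s * candLoss (X.erase cand) ν cand c i a loss t ω) ∂μ =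
    ∫ ω in {ω | t < τ ω}, H ω * (baseMean (X.erase cand) ν cand c i a loss t ω + 1 +
      s * (loss t ω cand + 1)) ∂μ := by
  set P := baseProb (X.erase cand) ν cand c i a loss t with hP
  have hPm : Measurable[𝒢 t] P := (h.prob_measurable ht.le).mono (h.env.le_env t) le_rfl
  have hPmem : ∀ ω, 0 < P ω ∧ 0 < 1 - P ω := fun ω => by
    have := CorralState.q_mem h.pos (corralRun (X.erase cand) ν cand c i a loss t ω)
    exact ⟨this.1, sub_pos.2 this.2⟩
  have hε : (0 : ℝ) < 1 / (4 * ((T : ℝ) + 1) ^ 2) := by positivity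
  set C : ℝ := 2 / (1 / (4 * ((T : ℝ) + 1) ^ 2)) with hC
  have hb : ∀ r, 1 / (4 * ((T : ℝ) + 1) ^ 2) ≤ r → ∀ x ∈ X, ∀ ω,
      |(loss t ω x + 1) / r| ≤ C := by
    intro r hr x hx ω
    have h1 := h.abs_loss_add_one ht hx ω
    rw [abs_of_nonneg (div_nonneg h1.1 (hε.le.trans hr))]
    exact div_le_div₀ (by norm_num) h1.2 hε hr
  have key := h.integral_round ht (G := fun j x ω => H ω * (if j = 1 then (loss t ω x + 1) / P ω
      else s * ((loss t ω x + 1) / (1 - P ω))))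
    (fun j x hx => by
      have hl := (h.env.measurable t ht x hx).add_const 1
      split_ifs
      · exact hH.mul (hl.div hPm)
      · exact hH.mul ((hl.div (hPm.const_sub 1)).const_mul s)) (C := C)
    (fun j x hx ω => by
      have hp := h.prob_bounds ht ω
      have hC0 : 0 ≤ C := by positivity
      rw [abs_mul]
      split_ifs
      · have := hb _ hp.1 x hx ω
        calc |H ω| * |(loss t ω x + 1) / P ω| ≤ 1 * C :=
              mul_le_mul (hH1 ω) this (abs_nonneg _) zero_le_one
          _ = C := one_mul C
      · have := hb _ hp.2 x hx ω
        rw [abs_mul]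
        calc |H ω| * (|s| * |(loss t ω x + 1) / (1 - P ω)|) ≤ 1 * (1 * C) :=
              mul_le_mul (hH1 ω) (mul_le_mul hs this (abs_nonneg _) zero_le_one)
                (by positivity) zero_le_one
          _ = C := by ring)
  have e1 : (fun ω => H ω * (if i t ω = 1 then (loss t ω (a t ω) + 1) / P ω
      else s * ((loss t ω (a t ω) + 1) / (1 - P ω)))) = fun ω =>
      H ω * (baseLoss (X.erase cand) ν cand c i a loss t ω +
        s * candLoss (X.erase cand) ν cand c i a loss t ω) := by
    funext ω
    unfold baseLoss candLoss
    rw [← hP]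
    rcases (by have := (i t ω).isLt; omega : (i t ω).val = 0 ∨ (i t ω).val = 1) with hi | hi
    · have hi' : i t ω = 0 := Fin.ext hi
      simp [hi']
    · have hi' : i t ω = 1 := Fin.ext hi
      simp [hi']
  have e2 : (fun ω => P ω * ∑ x ∈ X.erase cand, exp2Dist (X.erase cand) ν
        (corralRun (X.erase cand) ν cand c i a loss t ω).base (P ω) x *
        (H ω * (if (1 : Fin 2) = 1 then (loss t ω x + 1) / P ω
          else s * ((loss t ω x + 1) / (1 - P ω)))) +
      (1 - P ω) * (H ω * (if (0 : Fin 2) = 1 then (loss t ω cand + 1) / P ω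
          else s * ((loss t ω cand + 1) / (1 - P ω))))) = fun ω =>
      H ω * (baseMean (X.erase cand) ν cand c i a loss t ω + 1 + s * (loss t ω cand + 1)) := by
    funext ω
    obtain ⟨h1, h2⟩ := hPmem ω
    have h3 : baseMean (X.erase cand) ν cand c i a loss t ω + 1 = ∑ x ∈ X.erase cand,
        exp2Dist (X.erase cand) ν (corralRun (X.erase cand) ν cand c i a loss t ω).base (P ω) x *
          (loss t ω x + 1) := by
      simp only [mul_add, Finset.sum_add_distrib, mul_one]
      rw [h.sum_dist]
      rfl
    have f01 : ((0 : Fin 2) = 1) = False := eq_false (by decide)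
    simp only [f01, if_true, if_false]
    rw [h3, mul_add]
    congr 1
    · rw [Finset.mul_sum, Finset.mul_sum]
      refine Finset.sum_congr rfl fun x _ => ?_
      field_simp
    · field_simp
  rw [← hP, e1, e2] at key
  exact key

/-- The second moment of the loss difference, damped by the probability of the rarer arm. -/
lemma integral_sq_le [IsProbabilityMeasure μ]
    (h : StoppedCorralRun μ X ν T ℱ 𝒢 loss cand c i a τ) {t : ℕ} (ht : t < T) {H : Ω → ℝ}
    (hH : Measurable[𝒢 t] H) (hH1 : ∀ ω, 0 ≤ H ω ∧ H ω ≤ 1) :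
    IntegrableOn (fun ω => min (baseProbBar (X.erase cand) ν cand c i a loss t ω)
        (1 - baseProbBar (X.erase cand) ν cand c i a loss t ω) * H ω *
      (baseLoss (X.erase cand) ν cand c i a loss t ω -
        candLoss (X.erase cand) ν cand c i a loss t ω) ^ 2) {ω | t < τ ω} μ ∧
    ∫ ω in {ω | t < τ ω}, min (baseProbBar (X.erase cand) ν cand c i a loss t ω)
        (1 - baseProbBar (X.erase cand) ν cand c i a loss t ω) * H ω *
      (baseLoss (X.erase cand) ν cand c i a loss t ω -
        candLoss (X.erase cand) ν cand c i a loss t ω) ^ 2 ∂μ ≤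
      ∫ ω in {ω | t < τ ω}, 16 * H ω ∂μ := by
  set P := baseProb (X.erase cand) ν cand c i a loss t with hP
  set Q := baseProbBar (X.erase cand) ν cand c i a loss t with hQ
  have hPm : Measurable[𝒢 t] P := (h.prob_measurable ht.le).mono (h.env.le_env t) le_rfl
  have hQm : Measurable[𝒢 t] Q := (h.probBar_measurable ht.le).mono (h.env.le_env t) le_rfl
  have hQmem : ∀ ω, 0 < Q ω ∧ 0 < 1 - Q ω := fun ω => by
    have := CorralState.qbar_mem h.pos (corralRun (X.erase cand) ν cand c i a loss t ω)
    exact ⟨this.1, sub_pos.2 this.2⟩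
  have hPQ : ∀ ω, Q ω / 2 ≤ P ω ∧ (1 - Q ω) / 2 ≤ 1 - P ω := fun ω => by
    obtain ⟨h1, h2, -, -⟩ :=
      CorralState.q_bounds h.pos (corralRun (X.erase cand) ν cand c i a loss t ω)
    exact ⟨h1, h2⟩
  have hn0 : ∀ ω, 0 < min (Q ω) (1 - Q ω) := fun ω => lt_min (hQmem ω).1 (hQmem ω).2
  have hn1 : ∀ ω, min (Q ω) (1 - Q ω) ≤ 1 := fun ω =>
    (min_le_left _ _).trans (by linarith [(hQmem ω).2])
  have hε : (0 : ℝ) < 1 / (4 * ((T : ℝ) + 1) ^ 2) := by positivity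
  set C : ℝ := (2 / (1 / (4 * ((T : ℝ) + 1) ^ 2))) ^ 2 with hC
  have hb : ∀ r, 1 / (4 * ((T : ℝ) + 1) ^ 2) ≤ r → ∀ x ∈ X, ∀ ω,
      ((loss t ω x + 1) / r) ^ 2 ≤ C := by
    intro r hr x hx ω
    have h1 := h.abs_loss_add_one ht hx ω
    exact pow_le_pow_left₀ (div_nonneg h1.1 (hε.le.trans hr))
      (div_le_div₀ (by norm_num) h1.2 hε hr) 2
  have key := h.integral_round ht (G := fun j x ω => min (Q ω) (1 - Q ω) * H ω *
      (if j = 1 then ((loss t ω x + 1) / P ω) ^ 2 else ((loss t ω x + 1) / (1 - P ω)) ^ 2))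
    (fun j x hx => by
      have hl := (h.env.measurable t ht x hx).add_const 1
      have hnm : Measurable[𝒢 t] fun ω => min (Q ω) (1 - Q ω) := hQm.min (hQm.const_sub 1)
      split_ifs
      · exact (hnm.mul hH).mul ((hl.div hPm).pow_const 2)
      · exact (hnm.mul hH).mul ((hl.div (hPm.const_sub 1)).pow_const 2)) (C := C)
    (fun j x hx ω => by
      have hp := h.prob_bounds ht ω
      have h1 : min (Q ω) (1 - Q ω) * H ω ≤ 1 := by nlinarith [hn0 ω, hn1 ω, hH1 ω]
      have h2 : 0 ≤ min (Q ω) (1 - Q ω) * H ω := mul_nonneg (hn0 ω).le (hH1 ω).1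
      rw [abs_mul, abs_of_nonneg h2]
      split_ifs
      · rw [abs_of_nonneg (sq_nonneg _)]
        have := hb _ hp.1 x hx ω
        calc _ ≤ 1 * C := mul_le_mul h1 this (sq_nonneg _) zero_le_one
          _ = C := one_mul C
      · rw [abs_of_nonneg (sq_nonneg _)]
        have := hb _ hp.2 x hx ω
        calc _ ≤ 1 * C := mul_le_mul h1 this (sq_nonneg _) zero_le_one
          _ = C := one_mul C)
  have e1 : (fun ω => min (Q ω) (1 - Q ω) * H ω * (if i t ω = 1 then
      ((loss t ω (a t ω) + 1) / P ω) ^ 2 else ((loss t ω (a t ω) + 1) / (1 - P ω)) ^ 2)) =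
      fun ω => min (Q ω) (1 - Q ω) * H ω * (baseLoss (X.erase cand) ν cand c i a loss t ω -
        candLoss (X.erase cand) ν cand c i a loss t ω) ^ 2 := by
    funext ω
    unfold baseLoss candLoss
    rw [← hP]
    rcases (by have := (i t ω).isLt; omega : (i t ω).val = 0 ∨ (i t ω).val = 1) with hi | hi
    · have hi' : i t ω = 0 := Fin.ext hi
      simp [hi']
    · have hi' : i t ω = 1 := Fin.ext hi
      simp [hi']
  rw [← hP, e1] at key
  refine ⟨key.1, ?_⟩
  rw [key.2.2]
  have hR : MeasurableSet {ω | t < τ ω} := ℱ.le t _ (h.stop_measurable t)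
  have hHint : Integrable H μ := Integrable.of_bound
    ((hH.mono (𝒢.le t) le_rfl).aestronglyMeasurable) 1
    (ae_of_all _ fun ω => abs_le.2 ⟨by linarith [(hH1 ω).1], (hH1 ω).2⟩)
  refine setIntegral_mono_on key.2.1 ((hHint.const_mul 16).integrableOn) hR fun ω _ => ?_
  have h1 := hPQ ω
  have h2 := hQmem ω
  have hP0 : 0 < P ω := by linarith
  have hP1 : 0 < 1 - P ω := by linarith
  set n := min (Q ω) (1 - Q ω) with hn
  have hnQ : n ≤ Q ω := min_le_left _ _
  have hnQ' : n ≤ 1 - Q ω := min_le_right _ _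
  have f01 : ((0 : Fin 2) = 1) = False := eq_false (by decide)
  simp only [f01, if_true, if_false]
  have hsq : ∀ x ∈ X, (loss t ω x + 1) ^ 2 ≤ 4 := fun x hx => by
    have := h.abs_loss_add_one ht hx ω
    nlinarith
  have a1 : ∀ x ∈ X, P ω * (n * H ω * ((loss t ω x + 1) / P ω) ^ 2) ≤ 8 * H ω := by
    intro x hx
    have e : P ω * (n * H ω * ((loss t ω x + 1) / P ω) ^ 2) =
        (n / P ω) * H ω * (loss t ω x + 1) ^ 2 := by field_simp
    have b1 : n / P ω ≤ 2 := by rw [div_le_iff₀ hP0]; linarith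
    have b2 : n / P ω * H ω ≤ 2 * H ω := mul_le_mul_of_nonneg_right b1 (hH1 ω).1
    rw [e]
    calc _ ≤ 2 * H ω * 4 := mul_le_mul b2 (hsq x hx) (sq_nonneg _) (by linarith [(hH1 ω).1])
      _ = _ := by ring
  have a2 : (1 - P ω) * (n * H ω * ((loss t ω cand + 1) / (1 - P ω)) ^ 2) ≤ 8 * H ω := by
    have e : (1 - P ω) * (n * H ω * ((loss t ω cand + 1) / (1 - P ω)) ^ 2) =
        (n / (1 - P ω)) * H ω * (loss t ω cand + 1) ^ 2 := by field_simp
    have b1 : n / (1 - P ω) ≤ 2 := by rw [div_le_iff₀ hP1]; linarith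
    have b2 : n / (1 - P ω) * H ω ≤ 2 * H ω := mul_le_mul_of_nonneg_right b1 (hH1 ω).1
    rw [e]
    calc _ ≤ 2 * H ω * 4 :=
          mul_le_mul b2 (hsq cand h.cand_mem) (sq_nonneg _) (by linarith [(hH1 ω).1])
      _ = _ := by ring
  have a3 : P ω * ∑ x ∈ X.erase cand, exp2Dist (X.erase cand) ν
        (corralRun (X.erase cand) ν cand c i a loss t ω).base (P ω) x *
        (n * H ω * ((loss t ω x + 1) / P ω) ^ 2) ≤ 8 * H ω := by
    have b1 := h.sum_dist t ω
    rw [← hP] at b1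
    have b2 := Finset.sum_mul (X.erase cand) (fun x => exp2Dist (X.erase cand) ν
      (corralRun (X.erase cand) ν cand c i a loss t ω).base (P ω) x) (8 * H ω)
    rw [b1, one_mul] at b2
    rw [Finset.mul_sum, b2]
    refine Finset.sum_le_sum fun x hx => ?_
    rw [mul_left_comm]
    exact mul_le_mul_of_nonneg_left (a1 x (Finset.mem_of_mem_erase hx)) (h.dist_nonneg ht ω hx)
  linarith

end StoppedCorralRun

lemma integral_sum_range_stopTime_le {Ω : Type u} [mΩ : MeasurableSpace Ω] {μ : Measure Ω} {T : ℕ}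
    {τ : Ω → ℕ} {f g : ℕ → Ω → ℝ} (hτ : ∀ ω, τ ω ≤ T) (hm : ∀ t, MeasurableSet {ω | t < τ ω})
    (hfg : ∀ t < T, IntegrableOn (f t) {ω | t < τ ω} μ ∧ IntegrableOn (g t) {ω | t < τ ω} μ ∧
      ∫ ω in {ω | t < τ ω}, f t ω ∂μ ≤ ∫ ω in {ω | t < τ ω}, g t ω ∂μ) :
    ∫ ω, ∑ t ∈ Finset.range (τ ω), f t ω ∂μ ≤ ∫ ω, ∑ t ∈ Finset.range (τ ω), g t ω ∂μ := by
  rw [integral_sum_range_stopTime hτ hm fun t ht => (hfg t ht).1,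
    integral_sum_range_stopTime hτ hm fun t ht => (hfg t ht).2.1]
  exact Finset.sum_le_sum fun t ht => (hfg t (Finset.mem_range.1 ht)).2.2

namespace StoppedCorralRun

variable {d : ℕ} {Ω : Type u} [mΩ : MeasurableSpace Ω] {μ : Measure Ω}
  {X : Finset (Vec d)} {ν : Vec d → ℝ} {T : ℕ} {ℱ 𝒢 : Filtration ℕ mΩ}
  {loss : ℕ → Ω → Vec d → ℝ} {cand : Vec d} {c : ℝ} {i : ℕ → Ω → Fin 2} {a : ℕ → Ω → Vec d}
  {τ : Ω → ℕ}

lemma measurableSet_stopTime (h : StoppedCorralRun μ X ν T ℱ 𝒢 loss cand c i a τ) (t : ℕ) :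
    MeasurableSet {ω | t < τ ω} := ℱ.le t _ (h.stop_measurable t)

lemma baseMean_mem (h : StoppedCorralRun μ X ν T ℱ 𝒢 loss cand c i a τ) {t : ℕ} (ht : t < T)
    (ω : Ω) : |baseMean (X.erase cand) ν cand c i a loss t ω| ≤ 1 := by
  unfold baseMean
  refine (Finset.abs_sum_le_sum_abs _ _).trans ?_
  rw [← h.sum_dist t ω]
  refine Finset.sum_le_sum fun x hx => ?_
  have h1 := h.env.bounded t ht x (Finset.mem_of_mem_erase hx) ω
  rw [abs_mul, abs_of_nonneg (h.dist_nonneg ht ω hx)]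
  exact mul_le_of_le_one_right (h.dist_nonneg ht ω hx) (abs_le.2 h1)

lemma integrableOn_const [IsProbabilityMeasure μ] (s : Set Ω) (r : ℝ) :
    IntegrableOn (fun _ : Ω => r) s μ := (integrable_const r).integrableOn

/-- In expectation, each of the two importance-weighted losses is at most two. -/
lemma integral_sum_losses_le [IsProbabilityMeasure μ]
    (h : StoppedCorralRun μ X ν T ℱ 𝒢 loss cand c i a τ) {t : ℕ} (ht : t < T) :
    IntegrableOn (fun ω => baseLoss (X.erase cand) ν cand c i a loss t ω +
      candLoss (X.erase cand) ν cand c i a loss t ω) {ω | t < τ ω} μ ∧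
    ∫ ω in {ω | t < τ ω}, (baseLoss (X.erase cand) ν cand c i a loss t ω +
      candLoss (X.erase cand) ν cand c i a loss t ω) ∂μ ≤ ∫ _ in {ω | t < τ ω}, (4 : ℝ) ∂μ := by
  have key := h.integral_estimator ht (H := fun _ => 1) measurable_const (by simp) 1 (by simp)
  simp only [one_mul] at key
  refine ⟨key.1, ?_⟩
  rw [key.2.2]
  refine setIntegral_mono_on key.2.1 (integrableOn_const _ _) (h.measurableSet_stopTime t)
    fun ω _ => ?_
  have h1 := abs_le.1 (h.baseMean_mem ht ω)
  have h2 := h.abs_loss_add_one ht h.cand_mem ω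
  linarith

/-- The expected excess of the learner over one of its arms, in terms of the unbiased
estimators. -/
lemma integral_arm [IsProbabilityMeasure μ]
    (h : StoppedCorralRun μ X ν T ℱ 𝒢 loss cand c i a τ) {t : ℕ} (ht : t < T) :
    (IntegrableOn (fun ω => baseProb (X.erase cand) ν cand c i a loss t ω *
      (baseLoss (X.erase cand) ν cand c i a loss t ω -
        candLoss (X.erase cand) ν cand c i a loss t ω)) {ω | t < τ ω} μ ∧
    IntegrableOn (fun ω => baseProb (X.erase cand) ν cand c i a loss t ω *
      (baseMean (X.erase cand) ν cand c i a loss t ω - loss t ω cand)) {ω | t < τ ω} μ ∧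
    ∫ ω in {ω | t < τ ω}, baseProb (X.erase cand) ν cand c i a loss t ω *
      (baseMean (X.erase cand) ν cand c i a loss t ω - loss t ω cand) ∂μ =
    ∫ ω in {ω | t < τ ω}, baseProb (X.erase cand) ν cand c i a loss t ω *
      (baseLoss (X.erase cand) ν cand c i a loss t ω -
        candLoss (X.erase cand) ν cand c i a loss t ω) ∂μ) ∧
    (IntegrableOn (fun ω => (baseProb (X.erase cand) ν cand c i a loss t ω - 1) *
      (baseLoss (X.erase cand) ν cand c i a loss t ω -
        candLoss (X.erase cand) ν cand c i a loss t ω)) {ω | t < τ ω} μ ∧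
    IntegrableOn (fun ω => (baseProb (X.erase cand) ν cand c i a loss t ω - 1) *
      (baseMean (X.erase cand) ν cand c i a loss t ω - loss t ω cand)) {ω | t < τ ω} μ ∧
    ∫ ω in {ω | t < τ ω}, (baseProb (X.erase cand) ν cand c i a loss t ω - 1) *
      (baseMean (X.erase cand) ν cand c i a loss t ω - loss t ω cand) ∂μ =
    ∫ ω in {ω | t < τ ω}, (baseProb (X.erase cand) ν cand c i a loss t ω - 1) *
      (baseLoss (X.erase cand) ν cand c i a loss t ω -
        candLoss (X.erase cand) ν cand c i a loss t ω) ∂μ) := by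
  have hPm : Measurable[𝒢 t] (baseProb (X.erase cand) ν cand c i a loss t) :=
    (h.prob_measurable ht.le).mono (h.env.le_env t) le_rfl
  have hPmem : ∀ ω, 0 < baseProb (X.erase cand) ν cand c i a loss t ω ∧
      baseProb (X.erase cand) ν cand c i a loss t ω < 1 := fun ω =>
    CorralState.q_mem h.pos (corralRun (X.erase cand) ν cand c i a loss t ω)
  have k1 := h.integral_estimator ht hPm
    (fun ω => abs_le.2 ⟨by linarith [hPmem ω], (hPmem ω).2.le⟩) (-1) (by simp)
  have k2 := h.integral_estimator ht (hPm.sub_const 1)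
    (fun ω => abs_le.2 ⟨by linarith [hPmem ω], by linarith [hPmem ω]⟩) (-1) (by simp)
  have e1 : ∀ x y : ℝ, x + -1 * y = x - y := fun x y => by ring
  simp only [e1, add_sub_add_right_eq_sub] at k1 k2
  exact ⟨⟨k1.1, k1.2.1, k1.2.2.symm⟩, ⟨k2.1, k2.2.1, k2.2.2.symm⟩⟩

lemma isCorralPath (h : StoppedCorralRun μ X ν T ℱ 𝒢 loss cand c i a τ) (ω : Ω) :
    IsCorralPath c (τ ω) (fun t => baseProbBar (X.erase cand) ν cand c i a loss t ω)
      (fun t => baseProb (X.erase cand) ν cand c i a loss t ω)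
      (fun t => baseLoss (X.erase cand) ν cand c i a loss t ω)
      (fun t => candLoss (X.erase cand) ν cand c i a loss t ω)
      (fun t => (corralRun (X.erase cand) ν cand c i a loss t ω).invSum)
      (fun t => (corralRun (X.erase cand) ν cand c i a loss t ω).minQ) :=
  isCorralPath_corralRun h.one_le fun _ ht => h.loss_mem (ht.trans_le (h.stop_le ω)) ω

lemma bar_mem (h : StoppedCorralRun μ X ν T ℱ 𝒢 loss cand c i a τ) (t : ℕ) (ω : Ω) :
    0 < baseProbBar (X.erase cand) ν cand c i a loss t ω ∧
      baseProbBar (X.erase cand) ν cand c i a loss t ω < 1 :=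
  CorralState.qbar_mem h.pos (corralRun (X.erase cand) ν cand c i a loss t ω)

/-- The integrand of the pathwise bound that holds in every environment. -/
lemma integrableOn_bound [IsProbabilityMeasure μ]
    (h : StoppedCorralRun μ X ν T ℱ 𝒢 loss cand c i a τ) {t : ℕ} (ht : t < T) :
    IntegrableOn (fun ω => (if t = 0 then 86 * c else 0) + (59 * (Real.sqrt c *
        ((1 + baseLoss (X.erase cand) ν cand c i a loss t ω +
          candLoss (X.erase cand) ν cand c i a loss t ω) / Real.sqrt ((t : ℝ) + 1))) +
      4 * (min (baseProbBar (X.erase cand) ν cand c i a loss t ω)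
        (1 - baseProbBar (X.erase cand) ν cand c i a loss t ω) *
        (baseLoss (X.erase cand) ν cand c i a loss t ω -
          candLoss (X.erase cand) ν cand c i a loss t ω) ^ 2 / Real.sqrt ((t : ℝ) + 1))))
      {ω | t < τ ω} μ ∧
    ∫ ω in {ω | t < τ ω}, ((if t = 0 then 86 * c else 0) + (59 * (Real.sqrt c *
        ((1 + baseLoss (X.erase cand) ν cand c i a loss t ω +
          candLoss (X.erase cand) ν cand c i a loss t ω) / Real.sqrt ((t : ℝ) + 1))) +
      4 * (min (baseProbBar (X.erase cand) ν cand c i a loss t ω)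
        (1 - baseProbBar (X.erase cand) ν cand c i a loss t ω) *
        (baseLoss (X.erase cand) ν cand c i a loss t ω -
          candLoss (X.erase cand) ν cand c i a loss t ω) ^ 2 / Real.sqrt ((t : ℝ) + 1)))) ∂μ ≤
    ∫ _ in {ω | t < τ ω}, 311 * (Real.sqrt c / Real.sqrt ((t : ℝ) + 1) +
      (if t = 0 then c else 0)) ∂μ := by
  have k1 := h.integral_sum_losses_le ht
  have k2 := h.integral_sq_le ht (H := fun _ => 1) measurable_const (by simp)
  simp only [mul_one] at k2
  have hc16 := h.one_le
  have hsc : 4 ≤ Real.sqrt c := Real.le_sqrt_of_sq_le (by norm_num; linarith)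
  set u := baseLoss (X.erase cand) ν cand c i a loss t
  set v := candLoss (X.erase cand) ν cand c i a loss t
  set x := baseProbBar (X.erase cand) ν cand c i a loss t
  set R := {ω | t < τ ω}
  set r := Real.sqrt ((t : ℝ) + 1) with hr
  have hr0 : 0 < r := Real.sqrt_pos.2 (by positivity)
  set A : ℝ := if t = 0 then c else 0 with hA
  have hA' : (if t = 0 then 86 * c else 0) = 86 * A := by
    rw [hA]; split_ifs <;> simp
  have hA0 : 0 ≤ A := by rw [hA]; split_ifs <;> linarith
  have e : (fun ω => (if t = 0 then 86 * c else 0) + (59 * (Real.sqrt c * ((1 + u ω + v ω) / r)) +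
      4 * (min (x ω) (1 - x ω) * (u ω - v ω) ^ 2 / r))) = fun ω =>
      (86 * A + 59 * (Real.sqrt c / r)) + (59 * (Real.sqrt c / r) * (u ω + v ω) +
      4 / r * (min (x ω) (1 - x ω) * (u ω - v ω) ^ 2)) := by
    funext ω; rw [hA']; ring
  have i1 : IntegrableOn (fun ω => 59 * (Real.sqrt c / r) * (u ω + v ω)) R μ := k1.1.const_mul _
  have i2 : IntegrableOn (fun ω => 4 / r * (min (x ω) (1 - x ω) * (u ω - v ω) ^ 2)) R μ :=
    k2.1.const_mul _
  rw [e]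
  refine ⟨(integrableOn_const _ _).add (i1.add i2), ?_⟩
  have i3 : IntegrableOn (fun ω => 59 * (Real.sqrt c / r) * (u ω + v ω) +
      4 / r * (min (x ω) (1 - x ω) * (u ω - v ω) ^ 2)) R μ := i1.add i2
  rw [integral_add (integrableOn_const _ _) i3, integral_add i1 i2, integral_const_mul,
    integral_const_mul]
  have m1 := mul_le_mul_of_nonneg_left k1.2 (show 0 ≤ 59 * (Real.sqrt c / r) by positivity)
  have m2 := mul_le_mul_of_nonneg_left k2.2 (show 0 ≤ 4 / r by positivity)
  simp only [integral_const, smul_eq_mul] at m1 m2 ⊢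
  set w := (μ.restrict R).real Set.univ
  have hw : 0 ≤ w := measureReal_nonneg
  have h4 : 4 / r ≤ Real.sqrt c / r := by gcongr
  have h5 : w * (4 / r) ≤ w * (Real.sqrt c / r) := mul_le_mul_of_nonneg_left h4 hw
  have h6 := mul_nonneg hw hA0
  nlinarith

/-- In every environment, the expected regret of the Corral-type algorithm up to a stopping time is
of the order of `√c` times the expected sum of `1 / √t`, plus `c`. -/
theorem regret_le [IsProbabilityMeasure μ]
    (h : StoppedCorralRun μ X ν T ℱ 𝒢 loss cand c i a τ) {u : Vec d} (hu : u ∈ X) :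
    ∫ ω, ∑ t ∈ Finset.range (τ ω), (loss t ω (a t ω) - loss t ω u) ∂μ ≤
      ∫ ω, ∑ t ∈ Finset.range (τ ω), 311 * (Real.sqrt c / Real.sqrt ((t : ℝ) + 1) +
        (if t = 0 then c else 0)) ∂μ := by
  set F : ℕ → Ω → ℝ := fun t ω => (if t = 0 then 86 * c else 0) + (59 * (Real.sqrt c *
        ((1 + baseLoss (X.erase cand) ν cand c i a loss t ω +
          candLoss (X.erase cand) ν cand c i a loss t ω) / Real.sqrt ((t : ℝ) + 1))) +
      4 * (min (baseProbBar (X.erase cand) ν cand c i a loss t ω)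
        (1 - baseProbBar (X.erase cand) ν cand c i a loss t ω) *
        (baseLoss (X.erase cand) ν cand c i a loss t ω -
          candLoss (X.erase cand) ν cand c i a loss t ω) ^ 2 / Real.sqrt ((t : ℝ) + 1))) with hF
  have hm := h.measurableSet_stopTime
  have hFle : ∫ ω, ∑ t ∈ Finset.range (τ ω), F t ω ∂μ ≤
      ∫ ω, ∑ t ∈ Finset.range (τ ω), 311 * (Real.sqrt c / Real.sqrt ((t : ℝ) + 1) +
        (if t = 0 then c else 0)) ∂μ :=
    integral_sum_range_stopTime_le h.stop_le hm fun t ht =>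
      ⟨(h.integrableOn_bound ht).1, integrableOn_const _ _, (h.integrableOn_bound ht).2⟩
  have hFint : Integrable (fun ω => ∑ t ∈ Finset.range (τ ω), F t ω) μ :=
    integrable_sum_range_stopTime h.stop_le hm fun t ht => (h.integrableOn_bound ht).1
  have hFsum : ∀ ω, 0 < τ ω → ∑ t ∈ Finset.range (τ ω), F t ω = 86 * c +
      59 * ∑ t ∈ Finset.range (τ ω), Real.sqrt c *
        ((1 + baseLoss (X.erase cand) ν cand c i a loss t ω +
          candLoss (X.erase cand) ν cand c i a loss t ω) / Real.sqrt ((t : ℝ) + 1)) +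
      4 * ∑ t ∈ Finset.range (τ ω), min (baseProbBar (X.erase cand) ν cand c i a loss t ω)
        (1 - baseProbBar (X.erase cand) ν cand c i a loss t ω) *
        (baseLoss (X.erase cand) ν cand c i a loss t ω -
          candLoss (X.erase cand) ν cand c i a loss t ω) ^ 2 / Real.sqrt ((t : ℝ) + 1) := by
    intro ω hω
    simp only [hF, Finset.sum_add_distrib, ← Finset.mul_sum, Finset.sum_ite_eq',
      Finset.mem_range, if_pos hω, add_assoc]
  refine le_trans ?_ hFle
  by_cases huc : u = cand
  · -- the regret against the candidate is that against the first arm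
    have e : ∫ ω, ∑ t ∈ Finset.range (τ ω), (loss t ω (a t ω) - loss t ω u) ∂μ =
        ∫ ω, ∑ t ∈ Finset.range (τ ω), baseProb (X.erase cand) ν cand c i a loss t ω *
          (baseLoss (X.erase cand) ν cand c i a loss t ω -
            candLoss (X.erase cand) ν cand c i a loss t ω) ∂μ := by
      rw [integral_sum_range_stopTime h.stop_le hm fun t ht => (h.integral_regret ht hu).1,
        integral_sum_range_stopTime h.stop_le hm fun t ht => (h.integral_arm ht).1.1]
      refine Finset.sum_congr rfl fun t ht => ?_
      have ht := Finset.mem_range.1 ht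
      rw [(h.integral_regret ht hu).2.2, ← (h.integral_arm ht).1.2.2]
      simp only [huc, sub_self, add_zero]
    rw [e]
    refine integral_mono (integrable_sum_range_stopTime h.stop_le hm
      fun t ht => (h.integral_arm ht).1.1) hFint fun ω => ?_
    rcases Nat.eq_zero_or_pos (τ ω) with h0 | h0
    · simp [h0]
    · change _ ≤ ∑ t ∈ Finset.range (τ ω), F t ω
      rw [hFsum ω h0]
      exact ((h.isCorralPath ω).regret_le_sqrt h0).1
  · -- otherwise it is the sum of the regrets of the FTRL step against the second arm and of EXP2
    -- against `u`
    have huY : u ∈ X.erase cand := Finset.mem_erase.2 ⟨huc, hu⟩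
    have hbase := h.toExp2Run.regret_le h.const_le huY
    have hB := h.toExp2Run.integrable_stabilityBound c
    have hmean : ∀ t < T, IntegrableOn (fun ω =>
        baseMean (X.erase cand) ν cand c i a loss t ω - loss t ω u) {ω | t < τ ω} μ := fun t ht => by
      have h1 := ((h.integral_regret ht hu).2.1).sub (h.integral_arm ht).2.2.1
      refine h1.congr (ae_of_all _ fun ω => ?_)
      simp only [Pi.sub_apply]
      ring
    have e : ∫ ω, ∑ t ∈ Finset.range (τ ω), (loss t ω (a t ω) - loss t ω u) ∂μ =
        ∫ ω, ∑ t ∈ Finset.range (τ ω), (baseProb (X.erase cand) ν cand c i a loss t ω - 1) *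
          (baseLoss (X.erase cand) ν cand c i a loss t ω -
            candLoss (X.erase cand) ν cand c i a loss t ω) ∂μ +
        ∫ ω, ∑ t ∈ Finset.range (τ ω),
          (baseMean (X.erase cand) ν cand c i a loss t ω - loss t ω u) ∂μ := by
      rw [integral_sum_range_stopTime h.stop_le hm fun t ht => (h.integral_regret ht hu).1,
        integral_sum_range_stopTime h.stop_le hm fun t ht => (h.integral_arm ht).2.1,
        integral_sum_range_stopTime h.stop_le hm hmean, ← Finset.sum_add_distrib]
      refine Finset.sum_congr rfl fun t ht => ?_
      have ht := Finset.mem_range.1 ht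
      rw [(h.integral_regret ht hu).2.2, ← (h.integral_arm ht).2.2.2,
        ← integral_add (h.integral_arm ht).2.2.1 (hmean t ht)]
      refine integral_congr_ae (ae_of_all _ fun ω => ?_)
      simp only
      ring
    have e2 : ∫ ω, ∑ t ∈ Finset.range (τ ω),
        (baseMean (X.erase cand) ν cand c i a loss t ω - loss t ω u) ∂μ ≤
        ∫ ω, stabilityBound c (τ ω) (corralRun (X.erase cand) ν cand c i a loss (τ ω) ω).invSum
          (corralRun (X.erase cand) ν cand c i a loss (τ ω) ω).minQ ∂μ := by
      simp only [fun t ω => (corralRun_sums (Y := X.erase cand) (ν := ν) (cand := cand) (c := c)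
        (i := i) (a := a) (loss := loss) t ω).1, fun t ω => (corralRun_sums (Y := X.erase cand)
        (ν := ν) (cand := cand) (c := c) (i := i) (a := a) (loss := loss) t ω).2]
      refine le_trans (le_of_eq ?_) hbase
      simp only [baseMean, corralRun_base]
    have hB' : Integrable (fun ω => stabilityBound c (τ ω)
        (corralRun (X.erase cand) ν cand c i a loss (τ ω) ω).invSum
        (corralRun (X.erase cand) ν cand c i a loss (τ ω) ω).minQ) μ := by
      simp only [fun t ω => (corralRun_sums (Y := X.erase cand) (ν := ν) (cand := cand) (c := c)
        (i := i) (a := a) (loss := loss) t ω).1, fun t ω => (corralRun_sums (Y := X.erase cand)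
        (ν := ν) (cand := cand) (c := c) (i := i) (a := a) (loss := loss) t ω).2]
      exact hB
    have hA : Integrable (fun ω => ∑ t ∈ Finset.range (τ ω),
        (baseProb (X.erase cand) ν cand c i a loss t ω - 1) *
          (baseLoss (X.erase cand) ν cand c i a loss t ω -
            candLoss (X.erase cand) ν cand c i a loss t ω)) μ :=
      integrable_sum_range_stopTime h.stop_le hm fun t ht => (h.integral_arm ht).2.1
    rw [e]
    refine (add_le_add_right e2 _).trans ?_
    rw [← integral_add hA hB']
    refine integral_mono (hA.add hB') hFint fun ω => ?_
    rcases Nat.eq_zero_or_pos (τ ω) with h0 | h0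
    · simp [h0, stabilityBound]
    · change _ ≤ ∑ t ∈ Finset.range (τ ω), F t ω
      rw [hFsum ω h0]
      exact ((h.isCorralPath ω).regret_le_sqrt h0).2

end StoppedCorralRun

lemma sum_one_div_add_one_sq_le (M : ℕ) :
    ∑ t ∈ Finset.range M, 1 / ((t : ℝ) + 1) ^ 2 ≤ 2 := by
  have key : ∑ t ∈ Finset.range M, 1 / ((t : ℝ) + 1) ^ 2 ≤ 2 - 1 / ((M : ℝ) + 1 / 2) := by
    induction M with
    | zero => norm_num
    | succ M ih =>
      rw [Finset.sum_range_succ]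
      have h0 : (0 : ℝ) ≤ M := Nat.cast_nonneg M
      have h1 : 1 / ((M : ℝ) + 1 / 2) - 1 / (((M + 1 : ℕ) : ℝ) + 1 / 2) =
          1 / (((M : ℝ) + 1) ^ 2 - 1 / 4) := by
        push_cast
        rw [div_sub_div _ _ (by positivity) (by positivity)]
        congr 1
        · ring
        · ring
      have h2 : 1 / ((M : ℝ) + 1) ^ 2 ≤ 1 / (((M : ℝ) + 1) ^ 2 - 1 / 4) :=
        one_div_le_one_div_of_le (by nlinarith) (by linarith)
      linarith
  have : 0 ≤ 1 / ((M : ℝ) + 1 / 2) := by positivity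
  linarith

/-- The Tsallis terms are controlled by the total probability of the second arm, at the price of the
root of a logarithm. -/
lemma IsCorralPath.sum_sqrt_div_sqrt_le {c : ℝ} {M : ℕ} {x p u v S m : ℕ → ℝ}
    (h : IsCorralPath c M x p u v S m) (hM : 0 < M) {T : ℕ} (hMT : M ≤ T) (hT : 2 ≤ T) :
    66 * ∑ t ∈ Finset.range M, Real.sqrt (x t) / Real.sqrt ((t : ℝ) + 1) ≤
      40 * Real.sqrt (c * Real.log T) * Real.sqrt (∑ t ∈ Finset.range M, p t) := by
  have hc16 := h.one_le
  have hT2 : (2 : ℝ) ≤ T := by exact_mod_cast hT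
  have hlg : 0.69 ≤ Real.log T := by
    have := Real.log_le_log (by norm_num) hT2
    linarith [Real.log_two_gt_d9]
  have h1 := Real.sum_mul_le_sqrt_mul_sqrt (Finset.range M) (fun t => Real.sqrt (p t))
    (fun t => 1 / Real.sqrt ((t : ℝ) + 1))
  have e2 : ∑ t ∈ Finset.range M, Real.sqrt (p t) ^ 2 = ∑ t ∈ Finset.range M, p t :=
    Finset.sum_congr rfl fun t ht => Real.sq_sqrt (h.p_pos (Finset.mem_range.1 ht)).le
  have e3 : ∑ t ∈ Finset.range M, (1 / Real.sqrt ((t : ℝ) + 1)) ^ 2 =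
      ∑ t ∈ Finset.range M, 1 / (((t + 1 : ℕ) : ℝ)) :=
    Finset.sum_congr rfl fun t _ => by
      rw [div_pow, one_pow, Real.sq_sqrt (by positivity)]
      push_cast
      rfl
  have h2 := sum_div_cumsum_le (S := fun t => (t : ℝ)) (w := fun _ => 1) hM (by simp)
    (fun t _ => by push_cast; rfl) (fun _ _ => one_pos)
  simp only [div_one] at h2
  have h3 : Real.log M ≤ Real.log T :=
    Real.log_le_log (Nat.cast_pos.2 hM) (by exact_mod_cast hMT)
  rw [e2, e3] at h1
  have h4 : Real.sqrt (∑ t ∈ Finset.range M, 1 / (((t + 1 : ℕ) : ℝ))) ≤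
      1.6 * Real.sqrt (Real.log T) := by
    rw [show (1.6 : ℝ) = Real.sqrt (1.6 ^ 2) by rw [Real.sqrt_sq (by norm_num)],
      ← Real.sqrt_mul (by norm_num)]
    exact Real.sqrt_le_sqrt (by linarith)
  have h5 : ∑ t ∈ Finset.range M, Real.sqrt (x t) / Real.sqrt ((t : ℝ) + 1) ≤
      1.5 * ∑ t ∈ Finset.range M, Real.sqrt (p t) * (1 / Real.sqrt ((t : ℝ) + 1)) := by
    rw [Finset.mul_sum]
    refine Finset.sum_le_sum fun t ht => ?_
    have ht := Finset.mem_range.1 ht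
    have h6 : Real.sqrt (x t) ≤ 1.5 * Real.sqrt (p t) := by
      rw [show (1.5 : ℝ) = Real.sqrt (1.5 ^ 2) by rw [Real.sqrt_sq (by norm_num)],
        ← Real.sqrt_mul (by norm_num)]
      apply Real.sqrt_le_sqrt
      linarith [(h.mixture ht).1, (h.x_mem t ht).1]
    rw [mul_one_div, ← mul_div_assoc]
    gcongr
  have hsc : 4 ≤ Real.sqrt c := Real.le_sqrt_of_sq_le (by norm_num; linarith)
  rw [Real.sqrt_mul (by linarith)]
  set q := Real.sqrt (∑ t ∈ Finset.range M, p t)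
  set l := Real.sqrt (Real.log T)
  have hq0 : 0 ≤ q := Real.sqrt_nonneg _
  have hl0 : 0 ≤ l := Real.sqrt_nonneg _
  have h7 : q * Real.sqrt (∑ t ∈ Finset.range M, 1 / (((t + 1 : ℕ) : ℝ))) ≤ q * (1.6 * l) :=
    mul_le_mul_of_nonneg_left h4 hq0
  have h8 : 4 * (l * q) ≤ Real.sqrt c * (l * q) := by gcongr
  have h9 : 0 ≤ l * q := by positivity
  linarith

namespace StoppedCorralRun

variable {d : ℕ} {Ω : Type u} [mΩ : MeasurableSpace Ω] {μ : Measure Ω}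
  {X : Finset (Vec d)} {ν : Vec d → ℝ} {T : ℕ} {ℱ 𝒢 : Filtration ℕ mΩ}
  {loss : ℕ → Ω → Vec d → ℝ} {cand : Vec d} {c : ℝ} {i : ℕ → Ω → Fin 2} {a : ℕ → Ω → Vec d}
  {τ : Ω → ℕ}

lemma prob_mem (h : StoppedCorralRun μ X ν T ℱ 𝒢 loss cand c i a τ) (t : ℕ) (ω : Ω) :
    0 < baseProb (X.erase cand) ν cand c i a loss t ω ∧
      baseProb (X.erase cand) ν cand c i a loss t ω < 1 :=
  CorralState.q_mem h.pos (corralRun (X.erase cand) ν cand c i a loss t ω)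

lemma integrableOn_sqrt_diff [IsProbabilityMeasure μ]
    (h : StoppedCorralRun μ X ν T ℱ 𝒢 loss cand c i a τ) {t : ℕ} (ht : t < T) :
    IntegrableOn (fun ω =>
      Real.sqrt (∑ r ∈ Finset.range (t + 1), baseProb (X.erase cand) ν cand c i a loss r ω) -
      Real.sqrt (∑ r ∈ Finset.range t, baseProb (X.erase cand) ν cand c i a loss r ω))
      {ω | t < τ ω} μ := by
  have hint : ∀ n ≤ T, Integrable (fun ω =>
      Real.sqrt (∑ r ∈ Finset.range n, baseProb (X.erase cand) ν cand c i a loss r ω)) μ := by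
    intro n hn
    refine Integrable.of_bound (C := Real.sqrt n) ?_ (ae_of_all _ fun ω => ?_)
    · refine (Measurable.sqrt (Finset.measurable_fun_sum _ fun r hr => ?_)).aestronglyMeasurable
      exact (h.prob_measurable ((Finset.mem_range.1 hr).le.trans hn)).mono (ℱ.le r) le_rfl
    · rw [Real.norm_of_nonneg (Real.sqrt_nonneg _)]
      apply Real.sqrt_le_sqrt
      calc _ ≤ ∑ r ∈ Finset.range n, (1 : ℝ) :=
            Finset.sum_le_sum fun r _ => (h.prob_mem r ω).2.le
        _ = n := by simp
  exact ((hint (t + 1) ht).sub (hint t ht.le)).integrableOn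

/-- The expected regret of the Corral-type algorithm against its candidate adapts to the total
probability `Q` with which it follows its base algorithm: it is of the order of
`√(c log T) √Q + c log T`. The root is written as a telescoping sum over the rounds. -/
theorem regret_cand_le [IsProbabilityMeasure μ]
    (h : StoppedCorralRun μ X ν T ℱ 𝒢 loss cand c i a τ) {T' : ℕ} (hTT' : T ≤ T') (hT' : 2 ≤ T') :
    ∫ ω, ∑ t ∈ Finset.range (τ ω), (loss t ω (a t ω) - loss t ω cand) ∂μ ≤
      ∫ ω, ∑ t ∈ Finset.range (τ ω), ((if t = 0 then 73 * (c * Real.log T') else 0) +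
        52 * Real.sqrt (c * Real.log T') * (Real.sqrt (∑ r ∈ Finset.range (t + 1),
          baseProb (X.erase cand) ν cand c i a loss r ω) -
        Real.sqrt (∑ r ∈ Finset.range t, baseProb (X.erase cand) ν cand c i a loss r ω))) ∂μ := by
  have hm := h.measurableSet_stopTime
  have hc16 := h.one_le
  have hT2 : (2 : ℝ) ≤ T' := by exact_mod_cast hT'
  have hlg : 0.69 ≤ Real.log T' := by
    have := Real.log_le_log (by norm_num) hT2
    linarith [Real.log_two_gt_d9]
  set L := c * Real.log T' with hL
  have hL0 : 11 ≤ L := by nlinarith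
  set p := baseProb (X.erase cand) ν cand c i a loss with hp
  set x := baseProbBar (X.erase cand) ν cand c i a loss with hx
  set u := baseLoss (X.erase cand) ν cand c i a loss with hu
  set v := candLoss (X.erase cand) ν cand c i a loss with hv
  set g : ℕ → Ω → ℝ := fun t ω => Real.sqrt (∑ r ∈ Finset.range (t + 1), p r ω) -
    Real.sqrt (∑ r ∈ Finset.range t, p r ω) with hg
  have hgi : ∀ t < T, IntegrableOn (g t) {ω | t < τ ω} μ := fun t ht => h.integrableOn_sqrt_diff ht
  set F1 : ℕ → Ω → ℝ := fun t ω => (if t = 0 then 72 * L else 0) + 12 * Real.sqrt L * g t ω +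
    2 * (Real.sqrt (x t ω) / Real.sqrt ((t : ℝ) + 1)) with hF1
  set F2 : ℕ → Ω → ℝ := fun t ω => 4 / Real.sqrt ((t : ℝ) + 1) *
    (min (x t ω) (1 - x t ω) * Real.sqrt (min (x t ω) (1 - x t ω)) * (u t ω - v t ω) ^ 2) with hF2
  set F3 : ℕ → Ω → ℝ := fun t ω => 1 / ((t : ℝ) + 1) ^ 2 * (u t ω + v t ω) with hF3
  set G2 : ℕ → Ω → ℝ := fun t ω => 64 * (Real.sqrt (x t ω) / Real.sqrt ((t : ℝ) + 1)) with hG2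
  set G3 : ℕ → Ω → ℝ := fun t ω => 1 / ((t : ℝ) + 1) ^ 2 * 4 with hG3
  have hxm : ∀ t < T, Measurable (x t) := fun t ht =>
    (h.probBar_measurable ht.le).mono (ℱ.le t) le_rfl
  have hsqi : ∀ t < T, Integrable (fun ω => Real.sqrt (x t ω) / Real.sqrt ((t : ℝ) + 1)) μ := by
    intro t ht
    refine Integrable.div_const (Integrable.of_bound (C := 1)
      ((hxm t ht).sqrt.aestronglyMeasurable) (ae_of_all _ fun ω => ?_)) _
    rw [Real.norm_of_nonneg (Real.sqrt_nonneg _)]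
    exact Real.sqrt_le_one.2 (h.bar_mem t ω).2.le
  have hF1i : ∀ t < T, IntegrableOn (F1 t) {ω | t < τ ω} μ := fun t ht =>
    ((integrableOn_const _ _).add ((hgi t ht).const_mul _)).add
      ((hsqi t ht).const_mul 2).integrableOn
  have hF2le : ∀ t < T, IntegrableOn (F2 t) {ω | t < τ ω} μ ∧
      ∫ ω in {ω | t < τ ω}, F2 t ω ∂μ ≤ ∫ ω in {ω | t < τ ω}, G2 t ω ∂μ := by
    intro t ht
    have hs : 0 < Real.sqrt ((t : ℝ) + 1) := Real.sqrt_pos.2 (by positivity)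
    have hxm' : Measurable[𝒢 t] (x t) := (h.probBar_measurable ht.le).mono (h.env.le_env t) le_rfl
    have hH : Measurable[𝒢 t] fun ω => Real.sqrt (min (x t ω) (1 - x t ω)) :=
      (hxm'.min (hxm'.const_sub 1)).sqrt
    have k := h.integral_sq_le ht hH fun ω => ⟨Real.sqrt_nonneg _, Real.sqrt_le_one.2
      ((min_le_left _ _).trans (h.bar_mem t ω).2.le)⟩
    refine ⟨k.1.const_mul _, ?_⟩
    simp only [hF2]
    rw [integral_const_mul]
    refine (mul_le_mul_of_nonneg_left k.2 (by positivity)).trans ?_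
    rw [← integral_const_mul]
    refine setIntegral_mono_on (Integrable.integrableOn (Integrable.const_mul
      (Integrable.const_mul (Integrable.of_bound (C := 1)
        ((hH.mono (𝒢.le t) le_rfl).aestronglyMeasurable) (ae_of_all _ fun ω => ?_)) _) _))
      ((hsqi t ht).const_mul 64).integrableOn (hm t) fun ω _ => ?_
    · rw [Real.norm_of_nonneg (Real.sqrt_nonneg _)]
      exact Real.sqrt_le_one.2 ((min_le_left _ _).trans (h.bar_mem t ω).2.le)
    · simp only [hG2]
      have h1 : Real.sqrt (min (x t ω) (1 - x t ω)) ≤ Real.sqrt (x t ω) :=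
        Real.sqrt_le_sqrt (min_le_left _ _)
      rw [show 4 / Real.sqrt ((t : ℝ) + 1) * (16 * Real.sqrt (min (x t ω) (1 - x t ω))) =
        64 * (Real.sqrt (min (x t ω) (1 - x t ω)) / Real.sqrt ((t : ℝ) + 1)) by ring]
      gcongr
  have hF3le : ∀ t < T, IntegrableOn (F3 t) {ω | t < τ ω} μ ∧
      ∫ ω in {ω | t < τ ω}, F3 t ω ∂μ ≤ ∫ ω in {ω | t < τ ω}, G3 t ω ∂μ := by
    intro t ht
    have k := h.integral_sum_losses_le ht
    refine ⟨k.1.const_mul _, ?_⟩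
    simp only [hF3, hG3]
    rw [integral_const_mul, integral_const_mul]
    exact mul_le_mul_of_nonneg_left k.2 (by positivity)
  have e : ∫ ω, ∑ t ∈ Finset.range (τ ω), (loss t ω (a t ω) - loss t ω cand) ∂μ =
      ∫ ω, ∑ t ∈ Finset.range (τ ω), p t ω * (u t ω - v t ω) ∂μ := by
    rw [integral_sum_range_stopTime h.stop_le hm fun t ht => (h.integral_regret ht h.cand_mem).1,
      integral_sum_range_stopTime h.stop_le hm fun t ht => (h.integral_arm ht).1.1]
    refine Finset.sum_congr rfl fun t ht => ?_
    have ht := Finset.mem_range.1 ht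
    rw [(h.integral_regret ht h.cand_mem).2.2, ← (h.integral_arm ht).1.2.2]
    simp only [sub_self, add_zero]
  have hFi : ∀ t < T, IntegrableOn (fun ω => F1 t ω + (F2 t ω + F3 t ω)) {ω | t < τ ω} μ :=
    fun t ht => (hF1i t ht).add ((hF2le t ht).1.add (hF3le t ht).1)
  have hG2i : ∀ t < T, IntegrableOn (G2 t) {ω | t < τ ω} μ := fun t ht =>
    ((hsqi t ht).const_mul 64).integrableOn
  have hG3i : ∀ t < T, IntegrableOn (G3 t) {ω | t < τ ω} μ := fun t _ => integrableOn_const _ _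
  have hGi : ∀ t < T, IntegrableOn (fun ω => F1 t ω + (G2 t ω + G3 t ω)) {ω | t < τ ω} μ :=
    fun t ht => (hF1i t ht).add ((hG2i t ht).add (hG3i t ht))
  have hgtel : ∀ (M : ℕ) (ω : Ω), ∑ t ∈ Finset.range M, g t ω =
      Real.sqrt (∑ r ∈ Finset.range M, p r ω) := by
    intro M ω
    simp only [hg]
    rw [Finset.sum_range_sub (fun t => Real.sqrt (∑ r ∈ Finset.range t, p r ω))]
    simp
  have hif : ∀ (M : ℕ) (b : ℝ), 0 < M → ∑ t ∈ Finset.range M, (if t = 0 then b else 0) = b := by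
    intro M b hM
    rw [Finset.sum_ite_eq', if_pos (Finset.mem_range.2 hM)]
  rw [e]
  calc ∫ ω, ∑ t ∈ Finset.range (τ ω), p t ω * (u t ω - v t ω) ∂μ
      ≤ ∫ ω, ∑ t ∈ Finset.range (τ ω), (F1 t ω + (F2 t ω + F3 t ω)) ∂μ := by
        refine integral_mono (integrable_sum_range_stopTime h.stop_le hm
          fun t ht => (h.integral_arm ht).1.1) (integrable_sum_range_stopTime h.stop_le hm hFi)
          fun ω => ?_
        rcases Nat.eq_zero_or_pos (τ ω) with h0 | h0
        · simp [h0]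
        · have k := (h.isCorralPath ω).regret_le_sqrt_sum h0 ((h.stop_le ω).trans hTT') hT'
          refine k.trans (le_of_eq ?_)
          simp only [hF1, hF2, hF3, Finset.sum_add_distrib, hif _ _ h0]
          rw [← Finset.mul_sum _ (fun t => g t ω), hgtel]
          simp only [← hp, ← hx, ← hu, ← hv, ← hL]
          have e1 : ∀ t : ℕ, 4 * (min (x t ω) (1 - x t ω) * Real.sqrt (min (x t ω) (1 - x t ω))) *
              (u t ω - v t ω) ^ 2 / Real.sqrt ((t : ℝ) + 1) = 4 / Real.sqrt ((t : ℝ) + 1) *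
              (min (x t ω) (1 - x t ω) * Real.sqrt (min (x t ω) (1 - x t ω)) *
                (u t ω - v t ω) ^ 2) := fun t => by ring
          have e2 : ∀ t : ℕ, (u t ω + v t ω) / ((t : ℝ) + 1) ^ 2 =
              1 / ((t : ℝ) + 1) ^ 2 * (u t ω + v t ω) := fun t => by ring
          simp only [e1, e2]
          ring
    _ ≤ ∫ ω, ∑ t ∈ Finset.range (τ ω), (F1 t ω + (G2 t ω + G3 t ω)) ∂μ := by
        refine integral_sum_range_stopTime_le h.stop_le hm fun t ht => ⟨hFi t ht, hGi t ht, ?_⟩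
        have i2 : IntegrableOn (fun ω => F2 t ω + F3 t ω) {ω | t < τ ω} μ :=
          (hF2le t ht).1.add (hF3le t ht).1
        have i3 : IntegrableOn (fun ω => G2 t ω + G3 t ω) {ω | t < τ ω} μ :=
          (hG2i t ht).add (hG3i t ht)
        rw [integral_add (hF1i t ht) i2, integral_add (hF1i t ht) i3,
          integral_add (hF2le t ht).1 (hF3le t ht).1, integral_add (hG2i t ht) (hG3i t ht)]
        linarith [(hF2le t ht).2, (hF3le t ht).2]
    _ ≤ ∫ ω, ∑ t ∈ Finset.range (τ ω), ((if t = 0 then 73 * L else 0) +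
        52 * Real.sqrt L * g t ω) ∂μ := by
        refine integral_mono (integrable_sum_range_stopTime h.stop_le hm hGi)
          (integrable_sum_range_stopTime h.stop_le hm fun t ht =>
            (integrableOn_const _ _).add ((hgi t ht).const_mul _)) fun ω => ?_
        rcases Nat.eq_zero_or_pos (τ ω) with h0 | h0
        · simp [h0]
        · have k1 := (h.isCorralPath ω).sum_sqrt_div_sqrt_le h0 ((h.stop_le ω).trans hTT') hT'
          have k2 := sum_one_div_add_one_sq_le (τ ω)
          simp only [hF1, hG2, hG3, Finset.sum_add_distrib, hif _ _ h0, ← Finset.mul_sum,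
            ← Finset.sum_mul, hgtel]
          rw [← hp, ← hx, ← hL] at k1
          linarith

end StoppedCorralRun

/-! ### The epochs as a function of the actions -/

/-- The part of the memory of the epoch algorithm that does not involve the base algorithm. It is a
function of the first candidate and of the actions alone. -/
structure EpochCore (α : Type) where
  cand : α
  prevLen : ℝ
  n : ℕ
  count : α → ℕ

section Core

variable {ι α : Type}

/-- The memory without the state of the base algorithm. -/
def EpochState.core {A : α → BanditAlgorithm ι α} (s : EpochState A) : EpochCore α :=
  ⟨s.cand, s.prevLen, s.n, s.count⟩

/-- One more round in the current epoch. -/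
def EpochCore.advance (s : EpochCore α) (a : α) : EpochCore α :=
  ⟨s.cand, s.prevLen, s.n + 1, fun x => s.count x + (if a = x then 1 else 0)⟩

/-- The actions that qualify as the next candidate. -/
def EpochCore.frequent (X : Finset α) (s : EpochCore α) : Finset α :=
  (X.erase s.cand).filter fun x => (s.n : ℝ) / 2 ≤ (s.count x : ℝ)

/-- The condition for the end of an epoch. -/
def EpochCore.Ends (X : Finset α) (s : EpochCore α) : Prop :=
  2 * s.prevLen ≤ (s.n : ℝ) ∧ (s.frequent X).Nonempty

/-- The memory after a round in which `a` was played. -/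
def EpochCore.next (X : Finset α) (sel : Finset α → α) (s : EpochCore α) (a : α) : EpochCore α :=
  if (s.advance a).Ends X then
    ⟨sel ((s.advance a).frequent X), (s.n + 1 : ℕ), 0, fun _ => 0⟩
  else s.advance a

/-- The memory before round `t`, given the actions. -/
def epochCore (X : Finset α) (sel : Finset α → α) (len₀ : ℝ) (x₁ : α) (a : ℕ → α) :
    ℕ → EpochCore α
  | 0 => ⟨x₁, len₀, 0, fun _ => 0⟩
  | t + 1 => (epochCore X sel len₀ x₁ a t).next X sel (a t)

/-- The discrete part of the memory of the epoch algorithm does not depend on its base algorithm. -/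
lemma core_stateAt {A : α → BanditAlgorithm ι α} (X : Finset α) (sel : Finset α → α) (len₀ : ℝ)
    (x₁ : α) (i : ℕ → ι) (a : ℕ → α) (y : ℕ → ℝ) (t : ℕ) :
    EpochState.core (A := A) ((epochAlgorithm X A sel len₀ x₁).stateAt i a y t) =
      epochCore X sel len₀ x₁ a t := by
  induction t with
  | zero => rfl
  | succ t ih =>
    rw [epochCore, ← ih]
    simp only [BanditAlgorithm.stateAt, epochAlgorithm]
    unfold EpochCore.next
    split_ifs with h1 h2 h2
    · rfl
    · exact absurd h1 h2
    · exact absurd h2 h1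
    · rfl

variable {X : Finset α} {sel : Finset α → α} {len₀ : ℝ} {x₁ : α} {a : ℕ → α}

lemma epochCore_n_le (t : ℕ) : (epochCore X sel len₀ x₁ a t).n ≤ t := by
  induction t with
  | zero => exact le_rfl
  | succ t ih =>
    rw [epochCore, EpochCore.next]
    split_ifs
    · exact Nat.zero_le _
    · exact Nat.succ_le_succ ih

/-- A positive number of rounds in the current epoch means that the epoch did not end in the last
round. -/
lemma epochCore_of_n_succ {t r : ℕ} (h : (epochCore X sel len₀ x₁ a (t + 1)).n = r + 1) :
    (epochCore X sel len₀ x₁ a t).n = r ∧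
      (epochCore X sel len₀ x₁ a (t + 1)).cand = (epochCore X sel len₀ x₁ a t).cand := by
  by_cases h1 : ((epochCore X sel len₀ x₁ a t).advance (a t)).Ends X
  · rw [epochCore, EpochCore.next, if_pos h1] at h
    exact absurd h (Nat.succ_ne_zero r).symm
  · rw [epochCore, EpochCore.next, if_neg h1] at h ⊢
    exact ⟨Nat.succ_injective h, rfl⟩

lemma epochCore_cand_mem (hsel : ∀ s : Finset α, s.Nonempty → sel s ∈ s) (hx₁ : x₁ ∈ X) (t : ℕ) :
    (epochCore X sel len₀ x₁ a t).cand ∈ X := by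
  induction t with
  | zero => exact hx₁
  | succ t ih =>
    rw [epochCore, EpochCore.next]
    split_ifs with h
    · exact Finset.mem_of_mem_erase (Finset.mem_filter.1 (hsel _ h.2)).1
    · exact ih

/-- The memory depends only on the past actions. -/
lemma epochCore_eq_shift (s r : ℕ) (h : (epochCore X sel len₀ x₁ a (s + r)).n = r) (k : ℕ)
    (hk : k ≤ r) : (epochCore X sel len₀ x₁ a (s + k)).n = k ∧
      (epochCore X sel len₀ x₁ a (s + k)).cand = (epochCore X sel len₀ x₁ a (s + r)).cand := by
  induction r with
  | zero =>
    obtain rfl : k = 0 := by omega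
    exact ⟨h, rfl⟩
  | succ r ih =>
    rcases hk.eq_or_lt with rfl | hlt
    · exact ⟨h, rfl⟩
    · obtain ⟨h1, h2⟩ := epochCore_of_n_succ (t := s + r) h
      obtain ⟨h3, h4⟩ := ih h1 (by omega)
      exact ⟨h3, h4.trans h2.symm⟩

/-- The state of the base algorithm is that of a run which started at the beginning of the current
epoch. -/
lemma base_stateAt {A : α → BanditAlgorithm ι α} (X : Finset α) (sel : Finset α → α) (len₀ : ℝ)
    (x₁ : α) (i : ℕ → ι) (a : ℕ → α) (y : ℕ → ℝ) (t : ℕ) :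
    ∀ E : EpochState A, E = (epochAlgorithm X A sel len₀ x₁).stateAt i a y t →
      E.base = (A E.cand).stateAt (fun r => i (t - E.n + r)) (fun r => a (t - E.n + r))
        (fun r => y (t - E.n + r)) E.n := by
  induction t with
  | zero => rintro E rfl; rfl
  | succ t ih =>
    set E₀ : EpochState A := (epochAlgorithm X A sel len₀ x₁).stateAt i a y t with hE₀
    have h0 := ih E₀ rfl
    have hn : E₀.n ≤ t := by
      have h1 := core_stateAt (A := A) X sel len₀ x₁ i a y t
      have h2 : E₀.n = (epochCore X sel len₀ x₁ a t).n := congrArg EpochCore.n h1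
      rw [h2]
      exact epochCore_n_le t
    intro E hE
    have hE' : E = if 2 * (E₀.advance (i t) (a t) (y t)).prevLen ≤
          ((E₀.advance (i t) (a t) (y t)).n : ℝ) ∧
          ((E₀.advance (i t) (a t) (y t)).frequent X).Nonempty then
        EpochState.fresh A (sel ((E₀.advance (i t) (a t) (y t)).frequent X))
          ((E₀.advance (i t) (a t) (y t)).n : ℝ)
      else E₀.advance (i t) (a t) (y t) := hE
    split_ifs at hE' with h
    · subst hE'; rfl
    · subst hE'
      change (A E₀.cand).update E₀.base (i t) (a t) (y t) = (A E₀.cand).update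
        ((A E₀.cand).stateAt (fun r => i (t + 1 - (E₀.n + 1) + r))
          (fun r => a (t + 1 - (E₀.n + 1) + r)) (fun r => y (t + 1 - (E₀.n + 1) + r)) E₀.n)
        (i (t + 1 - (E₀.n + 1) + E₀.n)) (a (t + 1 - (E₀.n + 1) + E₀.n))
        (y (t + 1 - (E₀.n + 1) + E₀.n))
      rw [Nat.add_sub_add_right, Nat.sub_add_cancel hn, ← h0]

/-! ### The lengths of the epochs -/

/-- The length of the previous epoch, with the convention that it is `0` in the first epoch. -/
def epochPrev (X : Finset α) (sel : Finset α → α) (len₀ : ℝ) (x₁ : α) (a : ℕ → α) (t : ℕ) : ℝ :=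
  if (epochCore X sel len₀ x₁ a t).n = t then 0 else (epochCore X sel len₀ x₁ a t).prevLen

lemma epochPrev_bounds (h0 : 0 ≤ len₀) (t : ℕ) :
    0 ≤ epochPrev X sel len₀ x₁ a t ∧ epochPrev X sel len₀ x₁ a t ≤ t ∧
    epochPrev X sel len₀ x₁ a t ≤ (epochCore X sel len₀ x₁ a t).prevLen ∧
    len₀ ≤ (epochCore X sel len₀ x₁ a t).prevLen ∧
    (epochCore X sel len₀ x₁ a t).prevLen ≤ len₀ + epochPrev X sel len₀ x₁ a t := by
  induction t with
  | zero => simp [epochPrev, epochCore, h0]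
  | succ t ih =>
    obtain ⟨h1, h2, h3, h4, h5⟩ := ih
    have hn : ((epochCore X sel len₀ x₁ a t).n : ℝ) ≤ t := by exact_mod_cast epochCore_n_le t
    by_cases h : ((epochCore X sel len₀ x₁ a t).advance (a t)).Ends X
    · have e : epochCore X sel len₀ x₁ a (t + 1) = _ := if_pos h
      have h6 : 2 * (epochCore X sel len₀ x₁ a t).prevLen ≤
        (((epochCore X sel len₀ x₁ a t).n + 1 : ℕ) : ℝ) := h.1
      have e2 : epochPrev X sel len₀ x₁ a (t + 1) =
          (((epochCore X sel len₀ x₁ a t).n + 1 : ℕ) : ℝ) := by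
        rw [epochPrev, e]; exact if_neg (Nat.succ_ne_zero t).symm
      rw [e2, e]
      push_cast at h6 ⊢
      refine ⟨by positivity, by linarith, le_rfl, by linarith, by linarith⟩
    · have e : epochCore X sel len₀ x₁ a (t + 1) = _ := if_neg h
      have e2 : epochPrev X sel len₀ x₁ a (t + 1) = epochPrev X sel len₀ x₁ a t := by
        rw [epochPrev, epochPrev, e]
        change (if (epochCore X sel len₀ x₁ a t).n + 1 = t + 1 then _ else _) = _
        simp only [Nat.succ_inj, EpochCore.advance]
      rw [e2, e]
      exact ⟨h1, h2.trans (by exact_mod_cast Nat.le_succ t), h3, h4, h5⟩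

/-- Since the lengths of the epochs grow geometrically, the costs of all epochs are dominated by the
costs of the last two. Here `φ t` is the cost so far of the current epoch, `φ' t` its value after
round `t`, and `√G * √G` is the cost of starting an epoch. -/
lemma epoch_potential {G : ℝ} (hG : 0 ≤ G) (hG2 : G ≤ 2 * len₀) {φ φ' : ℕ → ℝ}
    (hφ0 : ∀ t, (epochCore X sel len₀ x₁ a t).n = 0 → φ t = 0)
    (hφ : ∀ t, φ' t ≤ 2 * Real.sqrt ((epochCore X sel len₀ x₁ a t).n + 1))
    (hφs : ∀ t, (epochCore X sel len₀ x₁ a (t + 1)).n ≠ 0 → φ (t + 1) = φ' t) (t : ℕ) :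
    ∑ r ∈ Finset.range t, ((if (epochCore X sel len₀ x₁ a r).n = 0 then G else 0) +
        Real.sqrt G * (φ' r - φ r)) +
      (if (epochCore X sel len₀ x₁ a t).n = 0 then G else 0) ≤
      G + Real.sqrt G * (φ t + 11 * Real.sqrt (epochPrev X sel len₀ x₁ a t)) := by
  have hlen : 0 ≤ len₀ := by linarith
  have hs := Real.sqrt_nonneg G
  induction t with
  | zero =>
    have h0 : (epochCore X sel len₀ x₁ a 0).n = 0 := rfl
    have h1 : epochPrev X sel len₀ x₁ a 0 = 0 := if_pos rfl
    rw [Finset.sum_range_zero, if_pos h0, hφ0 0 h0, h1, Real.sqrt_zero]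
    simp
  | succ t ih =>
    rw [Finset.sum_range_succ]
    by_cases h : ((epochCore X sel len₀ x₁ a t).advance (a t)).Ends X
    · have e : epochCore X sel len₀ x₁ a (t + 1) = _ := if_pos h
      have en : (epochCore X sel len₀ x₁ a (t + 1)).n = 0 := by rw [e]
      have h6 : 2 * (epochCore X sel len₀ x₁ a t).prevLen ≤
        (((epochCore X sel len₀ x₁ a t).n + 1 : ℕ) : ℝ) := h.1
      have e2 : epochPrev X sel len₀ x₁ a (t + 1) =
          (((epochCore X sel len₀ x₁ a t).n + 1 : ℕ) : ℝ) := by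
        rw [epochPrev, e]; exact if_neg (Nat.succ_ne_zero t).symm
      obtain ⟨b1, b2, b3, b4, -⟩ :=
        epochPrev_bounds (X := X) (sel := sel) (x₁ := x₁) (a := a) hlen t
      rw [if_pos en, hφ0 _ en, e2]
      have h7 := hφ t
      push_cast at h6 ⊢
      set L : ℝ := ((epochCore X sel len₀ x₁ a t).n : ℝ) + 1 with hL
      have hL0 : 0 ≤ L := by positivity
      have h8 : Real.sqrt G ≤ Real.sqrt L := Real.sqrt_le_sqrt (by linarith)
      have h9 : Real.sqrt (epochPrev X sel len₀ x₁ a t) ≤ 0.708 * Real.sqrt L := by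
        rw [show (0.708 : ℝ) = Real.sqrt (0.708 ^ 2) by rw [Real.sqrt_sq (by norm_num)],
          ← Real.sqrt_mul (by norm_num)]
        exact Real.sqrt_le_sqrt (by linarith)
      have h10 := Real.mul_self_sqrt hG
      have h11 : Real.sqrt G * (φ' t + Real.sqrt G + 11 * Real.sqrt (epochPrev X sel len₀ x₁ a t)) ≤
          Real.sqrt G * (11 * Real.sqrt L) := by
        -- the lengths at least double, and `2 + 1 + 11 * 0.708 ≤ 11`
        apply mul_le_mul_of_nonneg_left _ hs
        linarith [Real.sqrt_nonneg L]
      linarith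
    · have e : epochCore X sel len₀ x₁ a (t + 1) = _ := if_neg h
      have en : (epochCore X sel len₀ x₁ a (t + 1)).n ≠ 0 := by
        rw [e]; exact Nat.succ_ne_zero _
      have e2 : epochPrev X sel len₀ x₁ a (t + 1) = epochPrev X sel len₀ x₁ a t := by
        rw [epochPrev, epochPrev, e]
        change (if (epochCore X sel len₀ x₁ a t).n + 1 = t + 1 then _ else _) = _
        simp only [Nat.succ_inj, EpochCore.advance]
      rw [if_neg en, hφs t en, e2]
      linarith

/-- If an action other than `xs` has become the candidate, it was played in half of the rounds of
the previous epoch, and if `xs` has become the candidate, then the previous epoch, whose candidate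
was another one, ended as soon as it was long enough or `xs` was played in half of its rounds. So
up to the length `len₀`, the lengths of the previous epoch, and of the current one if `xs` is not
its candidate, are bounded by the number of rounds in which `xs` was not played. -/
lemma epoch_misses (hsel : ∀ s : Finset α, s.Nonempty → sel s ∈ s) (hlen : 1 ≤ len₀) {xs : α}
    (hxs : xs ∈ X) (t : ℕ) :
    ((epochCore X sel len₀ x₁ a t).cand ≠ xs →
      epochPrev X sel len₀ x₁ a t ≤ 2 * ∑ r ∈ Finset.range t, (if a r = xs then 0 else 1) ∧
      ((epochCore X sel len₀ x₁ a t).n : ℝ) ≤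
        2 * len₀ + 4 * ∑ r ∈ Finset.range t, (if a r = xs then 0 else 1)) ∧
    ((epochCore X sel len₀ x₁ a t).cand = xs →
      epochPrev X sel len₀ x₁ a t ≤
        3 * len₀ + 4 * ∑ r ∈ Finset.range t, (if a r = xs then 0 else 1)) := by
  set N : ℕ → ℝ := fun t => ∑ r ∈ Finset.range t, (if a r = xs then 0 else 1) with hN
  -- the misses before the current epoch are `N t - (n - count xs)`
  have key : ∀ t, (0 : ℝ) ≤ N t -
        ((epochCore X sel len₀ x₁ a t).n - (epochCore X sel len₀ x₁ a t).count xs) ∧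
      (epochCore X sel len₀ x₁ a t).count xs ≤ (epochCore X sel len₀ x₁ a t).n ∧
      (∀ x, x ≠ xs → (epochCore X sel len₀ x₁ a t).count x +
        (epochCore X sel len₀ x₁ a t).count xs ≤ (epochCore X sel len₀ x₁ a t).n) ∧
      ((epochCore X sel len₀ x₁ a t).cand ≠ xs → epochPrev X sel len₀ x₁ a t ≤ 2 * (N t -
        ((epochCore X sel len₀ x₁ a t).n - (epochCore X sel len₀ x₁ a t).count xs)) ∧
        (((epochCore X sel len₀ x₁ a t).n : ℝ) < 2 * (epochCore X sel len₀ x₁ a t).prevLen ∨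
          2 * (epochCore X sel len₀ x₁ a t).count xs < (epochCore X sel len₀ x₁ a t).n)) ∧
      ((epochCore X sel len₀ x₁ a t).cand = xs → epochPrev X sel len₀ x₁ a t ≤ 3 * len₀ +
        4 * (N t - ((epochCore X sel len₀ x₁ a t).n -
          (epochCore X sel len₀ x₁ a t).count xs))) := by
    intro t
    induction t with
    | zero =>
      have e : epochCore X sel len₀ x₁ a 0 = ⟨x₁, len₀, 0, fun _ => 0⟩ := rfl
      have e2 : epochPrev X sel len₀ x₁ a 0 = 0 := if_pos rfl
      rw [e2, e]
      simp only [hN, Finset.sum_range_zero, Nat.cast_zero, sub_self, le_refl, mul_zero, add_zero,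
        true_and, implies_true]
      exact ⟨fun _ => Or.inl (by linarith), fun _ => by linarith⟩
    | succ t ih =>
      obtain ⟨i1, i2, i3, i4, i5⟩ := ih
      obtain ⟨b1, b2, b3, b4, b5⟩ := epochPrev_bounds (X := X) (sel := sel) (x₁ := x₁) (a := a)
        (show 0 ≤ len₀ by linarith) t
      have hNs : N (t + 1) = N t + (if a t = xs then 0 else 1) := Finset.sum_range_succ _ _
      have hmiss : N (t + 1) = (N t -
          ((epochCore X sel len₀ x₁ a t).n - (epochCore X sel len₀ x₁ a t).count xs)) +
          (((epochCore X sel len₀ x₁ a t).n + 1 : ℕ) -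
            (((epochCore X sel len₀ x₁ a t).count xs + (if a t = xs then 1 else 0) : ℕ) : ℝ)) := by
        rw [hNs]
        split_ifs <;> push_cast <;> ring
      have j2 : (epochCore X sel len₀ x₁ a t).count xs + (if a t = xs then 1 else 0) ≤
          (epochCore X sel len₀ x₁ a t).n + 1 := by split_ifs <;> omega
      have j3 : ∀ x, x ≠ xs → ((epochCore X sel len₀ x₁ a t).count x +
          (if a t = x then 1 else 0)) + ((epochCore X sel len₀ x₁ a t).count xs +
          (if a t = xs then 1 else 0)) ≤ (epochCore X sel len₀ x₁ a t).n + 1 := by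
        intro x hx
        have := i3 x hx
        by_cases h1 : a t = x
        · have h2 : a t ≠ xs := fun h2 => hx (h1.symm.trans h2)
          rw [if_pos h1, if_neg h2]; omega
        · rw [if_neg h1]; split_ifs <;> omega
      by_cases h : ((epochCore X sel len₀ x₁ a t).advance (a t)).Ends X
      · have e : epochCore X sel len₀ x₁ a (t + 1) = _ := if_pos h
        have e2 : epochPrev X sel len₀ x₁ a (t + 1) =
            (((epochCore X sel len₀ x₁ a t).n + 1 : ℕ) : ℝ) := by
          rw [epochPrev, e]; exact if_neg (Nat.succ_ne_zero t).symm
        have hmem := Finset.mem_filter.1 (hsel _ h.2)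
        have hfreq : (((epochCore X sel len₀ x₁ a t).n + 1 : ℕ) : ℝ) / 2 ≤
            (((epochCore X sel len₀ x₁ a t).count
                (sel (((epochCore X sel len₀ x₁ a t).advance (a t)).frequent X)) +
              (if a t = sel (((epochCore X sel len₀ x₁ a t).advance (a t)).frequent X)
                then 1 else 0) : ℕ) : ℝ) := hmem.2
        have hne : sel (((epochCore X sel len₀ x₁ a t).advance (a t)).frequent X) ≠
            (epochCore X sel len₀ x₁ a t).cand := (Finset.mem_erase.1 hmem.1).1
        have j2' : (((epochCore X sel len₀ x₁ a t).count xs + (if a t = xs then 1 else 0) : ℕ) : ℝ)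
            ≤ (((epochCore X sel len₀ x₁ a t).n + 1 : ℕ) : ℝ) := by exact_mod_cast j2
        rw [e2, e]
        simp only [Nat.cast_zero, sub_zero, le_refl, add_zero, implies_true, true_and]
        refine ⟨by linarith, fun hw => ⟨?_, Or.inl (by positivity)⟩, fun hr => ?_⟩
        · have j3' : (((epochCore X sel len₀ x₁ a t).count
                (sel (((epochCore X sel len₀ x₁ a t).advance (a t)).frequent X)) +
              (if a t = sel (((epochCore X sel len₀ x₁ a t).advance (a t)).frequent X)
                then 1 else 0) : ℕ) : ℝ) + (((epochCore X sel len₀ x₁ a t).count xs +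
                (if a t = xs then 1 else 0) : ℕ) : ℝ) ≤
                (((epochCore X sel len₀ x₁ a t).n + 1 : ℕ) : ℝ) := by exact_mod_cast j3 _ hw
          linarith
        · rw [hr] at hne
          obtain ⟨k1, k2⟩ := i4 hne.symm
          rcases k2 with k2 | k2
          · push_cast at hmiss j2' ⊢
            linarith
          · have k3 : 2 * ((epochCore X sel len₀ x₁ a t).count xs : ℝ) <
              (epochCore X sel len₀ x₁ a t).n := by exact_mod_cast k2
            have k4 : N t ≤ N (t + 1) := by rw [hNs]; split_ifs <;> linarith
            push_cast
            linarith
      · have e : epochCore X sel len₀ x₁ a (t + 1) = _ := if_neg h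
        have e2 : epochPrev X sel len₀ x₁ a (t + 1) = epochPrev X sel len₀ x₁ a t := by
          rw [epochPrev, epochPrev, e]
          change (if (epochCore X sel len₀ x₁ a t).n + 1 = t + 1 then _ else _) = _
          simp only [Nat.succ_inj, EpochCore.advance]
        have e3 : N (t + 1) - ((((epochCore X sel len₀ x₁ a t).n + 1 : ℕ) : ℝ) -
            (((epochCore X sel len₀ x₁ a t).count xs + (if a t = xs then 1 else 0) : ℕ) : ℝ)) =
            N t -
          ((epochCore X sel len₀ x₁ a t).n - (epochCore X sel len₀ x₁ a t).count xs) := by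
          rw [hmiss]; ring
        rw [e2, e]
        simp only [EpochCore.advance]
        rw [e3]
        refine ⟨i1, j2, j3, fun hw => ⟨(i4 hw).1, ?_⟩, i5⟩
        by_cases h1 : 2 * (epochCore X sel len₀ x₁ a t).prevLen ≤
            (((epochCore X sel len₀ x₁ a t).n + 1 : ℕ) : ℝ)
        · -- otherwise `xs` itself would have qualified, and the epoch would have ended
          right
          by_contra h2
          refine h ⟨h1, xs, Finset.mem_filter.2 ⟨Finset.mem_erase.2 ⟨hw.symm, hxs⟩, ?_⟩⟩
          have h3 := not_lt.1 h2
          have h4 : (((epochCore X sel len₀ x₁ a t).n + 1 : ℕ) : ℝ) ≤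
              2 * (((epochCore X sel len₀ x₁ a t).count xs + (if a t = xs then 1 else 0) : ℕ) : ℝ) :=
            by exact_mod_cast h3
          change (((epochCore X sel len₀ x₁ a t).n + 1 : ℕ) : ℝ) / 2 ≤
            (((epochCore X sel len₀ x₁ a t).count xs + (if a t = xs then 1 else 0) : ℕ) : ℝ)
          linarith
        · exact Or.inl (not_le.1 h1)
  obtain ⟨i1, i2, -, i4, i5⟩ := key t
  have i2' : ((epochCore X sel len₀ x₁ a t).count xs : ℝ) ≤ (epochCore X sel len₀ x₁ a t).n := by
    exact_mod_cast i2
  obtain ⟨b1, b2, b3, b4, b5⟩ := epochPrev_bounds (X := X) (sel := sel) (x₁ := x₁) (a := a)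
    (show 0 ≤ len₀ by linarith) t
  refine ⟨fun hw => ?_, fun hr => ?_⟩
  · obtain ⟨k1, k2⟩ := i4 hw
    change _ ≤ 2 * N t ∧ _ ≤ 2 * len₀ + 4 * N t
    refine ⟨by linarith, ?_⟩
    rcases k2 with k2 | k2
    · linarith
    · have k3 : 2 * ((epochCore X sel len₀ x₁ a t).count xs : ℝ) <
        (epochCore X sel len₀ x₁ a t).n := by exact_mod_cast k2
      linarith
  · have := i5 hr
    change _ ≤ 3 * len₀ + 4 * N t
    linarith

end Core

section EpochCosts

variable {α : Type} {X : Finset α} {sel : Finset α → α} {len₀ : ℝ} {x₁ : α} {a : ℕ → α}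

lemma one_div_sqrt_le (n : ℕ) :
    1 / Real.sqrt ((n : ℝ) + 1) ≤ 2 * (Real.sqrt ((n : ℝ) + 1) - Real.sqrt n) :=
  div_sqrt_add_le (Nat.cast_nonneg n) zero_le_one

/-- The total cost of all epochs when the cost of each is the root of its length. -/
lemma epoch_cost_le {c : ℝ} (hc : 0 ≤ c) (hc2 : c ≤ 2 * len₀) {T : ℕ} (hcT : c ≤ T) :
    ∑ r ∈ Finset.range T, (Real.sqrt c / Real.sqrt ((epochCore X sel len₀ x₁ a r).n + 1) +
      (if (epochCore X sel len₀ x₁ a r).n = 0 then c else 0)) ≤ 14 * Real.sqrt (c * T) := by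
  have key := epoch_potential (X := X) (sel := sel) (len₀ := len₀) (x₁ := x₁) (a := a) hc hc2
    (φ := fun t => 2 * Real.sqrt (epochCore X sel len₀ x₁ a t).n)
    (φ' := fun t => 2 * Real.sqrt ((epochCore X sel len₀ x₁ a t).n + 1))
    (fun t ht => by simp [ht]) (fun t => le_rfl) (fun t ht => by
      obtain ⟨m, hm⟩ := Nat.exists_eq_succ_of_ne_zero ht
      obtain ⟨h1, -⟩ := epochCore_of_n_succ hm
      simp only [hm, h1, Nat.succ_eq_add_one]
      push_cast
      rfl) T
  obtain ⟨b1, b2, -, -, -⟩ := epochPrev_bounds (X := X) (sel := sel) (x₁ := x₁) (a := a)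
    (show 0 ≤ len₀ by linarith) T
  have hn : ((epochCore X sel len₀ x₁ a T).n : ℝ) ≤ T := by exact_mod_cast epochCore_n_le T
  have hs := Real.sqrt_nonneg c
  have h1 : ∑ r ∈ Finset.range T, (Real.sqrt c / Real.sqrt ((epochCore X sel len₀ x₁ a r).n + 1) +
      (if (epochCore X sel len₀ x₁ a r).n = 0 then c else 0)) ≤
      ∑ r ∈ Finset.range T, ((if (epochCore X sel len₀ x₁ a r).n = 0 then c else 0) +
        Real.sqrt c * (2 * Real.sqrt ((epochCore X sel len₀ x₁ a r).n + 1) -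
          2 * Real.sqrt (epochCore X sel len₀ x₁ a r).n)) := by
    refine Finset.sum_le_sum fun r _ => ?_
    have h2 := mul_le_mul_of_nonneg_left (one_div_sqrt_le (epochCore X sel len₀ x₁ a r).n) hs
    rw [mul_one_div] at h2
    linarith
  have h2 : 0 ≤ (if (epochCore X sel len₀ x₁ a T).n = 0 then c else 0) := by
    split_ifs <;> linarith
  have h3 : Real.sqrt (epochCore X sel len₀ x₁ a T).n ≤ Real.sqrt T := Real.sqrt_le_sqrt hn
  have h4 : Real.sqrt (epochPrev X sel len₀ x₁ a T) ≤ Real.sqrt T := Real.sqrt_le_sqrt b2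
  have h5 : Real.sqrt c * (2 * Real.sqrt (epochCore X sel len₀ x₁ a T).n +
      11 * Real.sqrt (epochPrev X sel len₀ x₁ a T)) ≤ Real.sqrt c * (13 * Real.sqrt T) :=
    mul_le_mul_of_nonneg_left (by linarith) hs
  have h6 : c ≤ Real.sqrt c * Real.sqrt T := by
    calc c = Real.sqrt c * Real.sqrt c := (Real.mul_self_sqrt hc).symm
      _ ≤ _ := mul_le_mul_of_nonneg_left (Real.sqrt_le_sqrt hcT) hs
  rw [Real.sqrt_mul hc]
  linarith

/-- The cost of round `t`, for an action `xs`: an epoch with another candidate pays the root of its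
length, and an epoch with candidate `xs` pays the root of the total probability `p` of its base
algorithm. -/
def roundCost (X : Finset α) (sel : Finset α → α) (len₀ : ℝ) (x₁ : α) (a : ℕ → α) (xs : α)
    (p : ℕ → ℝ) (t : ℕ) : ℝ :=
  (if (epochCore X sel len₀ x₁ a t).n = 0 then len₀ else 0) + Real.sqrt len₀ *
    (if (epochCore X sel len₀ x₁ a t).cand = xs then
      Real.sqrt (∑ k ∈ Finset.range ((epochCore X sel len₀ x₁ a t).n + 1),
        p (t - (epochCore X sel len₀ x₁ a t).n + k)) -
      Real.sqrt (∑ k ∈ Finset.range (epochCore X sel len₀ x₁ a t).n,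
        p (t - (epochCore X sel len₀ x₁ a t).n + k))
    else 1 / Real.sqrt ((epochCore X sel len₀ x₁ a t).n + 1))

/-- The total cost of all epochs in terms of the number of rounds in which `xs` was not played and
of the total probability with which the base algorithm was followed while `xs` was the
candidate. -/
lemma sum_roundCost_le (hsel : ∀ s : Finset α, s.Nonempty → sel s ∈ s) (hlen : 1 ≤ len₀) {xs : α}
    (hxs : xs ∈ X) {p : ℕ → ℝ} (hp0 : ∀ t, 0 ≤ p t) (hp1 : ∀ t, p t ≤ 1) (T : ℕ) :
    ∑ t ∈ Finset.range T, roundCost X sel len₀ x₁ a xs p t ≤ len₀ + 27 * Real.sqrt len₀ *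
      Real.sqrt (len₀ + ∑ t ∈ Finset.range T, (if a t = xs then 0 else 1) +
        ∑ t ∈ Finset.range T, (if (epochCore X sel len₀ x₁ a t).cand = xs then p t else 0)) := by
  set E := epochCore X sel len₀ x₁ a with hE
  set Q : ℕ → ℕ → ℝ := fun t m => ∑ k ∈ Finset.range m, p (t - (E t).n + k) with hQ
  have hQn : ∀ t m, Q t m ≤ m := fun t m => by
    calc Q t m ≤ ∑ k ∈ Finset.range m, (1 : ℝ) := Finset.sum_le_sum fun k _ => hp1 _
      _ = m := by simp
  have hQ0 : ∀ t m, 0 ≤ Q t m := fun t m => Finset.sum_nonneg fun k _ => hp0 _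
  have hlen0 : 0 ≤ len₀ := by linarith
  have key := epoch_potential (X := X) (sel := sel) (len₀ := len₀) (x₁ := x₁) (a := a) hlen0
    (show len₀ ≤ 2 * len₀ by linarith)
    (φ := fun t => if (E t).cand = xs then Real.sqrt (Q t (E t).n) else 2 * Real.sqrt (E t).n)
    (φ' := fun t => if (E t).cand = xs then Real.sqrt (Q t ((E t).n + 1))
      else 2 * Real.sqrt ((E t).n + 1))
    (fun t ht => by
      simp only [← hE] at ht
      simp [hQ, ht])
    (fun t => by
      simp only [← hE]
      split_ifs
      · have h1 := Real.sqrt_le_sqrt (hQn t ((E t).n + 1))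
        push_cast at h1
        linarith [Real.sqrt_nonneg (((E t).n : ℝ) + 1)]
      · exact le_rfl)
    (fun t ht => by
      obtain ⟨m, hm⟩ := Nat.exists_eq_succ_of_ne_zero ht
      obtain ⟨h1, h2⟩ := epochCore_of_n_succ hm
      simp only [← hE] at hm h1 h2
      simp only [hQ, hm, h1, h2, Nat.succ_eq_add_one, Nat.add_sub_add_right]
      push_cast
      rfl) T
  simp only [← hE] at key
  have h1 : ∑ t ∈ Finset.range T, roundCost X sel len₀ x₁ a xs p t ≤
      ∑ t ∈ Finset.range T, ((if (E t).n = 0 then len₀ else 0) + Real.sqrt len₀ *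
        ((if (E t).cand = xs then Real.sqrt (Q t ((E t).n + 1))
          else 2 * Real.sqrt ((E t).n + 1)) -
        (if (E t).cand = xs then Real.sqrt (Q t (E t).n) else 2 * Real.sqrt (E t).n))) := by
    refine Finset.sum_le_sum fun t _ => ?_
    unfold roundCost
    rw [← hE]
    refine add_le_add le_rfl (mul_le_mul_of_nonneg_left ?_ (Real.sqrt_nonneg _))
    split_ifs
    · exact le_rfl
    · linarith [one_div_sqrt_le (E t).n]
  have h2 : 0 ≤ (if (E T).n = 0 then len₀ else 0) := by split_ifs <;> linarith
  obtain ⟨m1, m2⟩ := epoch_misses (x₁ := x₁) (a := a) hsel hlen hxs T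
  rw [← hE] at m1 m2
  set N : ℝ := ∑ t ∈ Finset.range T, (if a t = xs then 0 else 1) with hN
  set M : ℝ := ∑ t ∈ Finset.range T, (if (E t).cand = xs then p t else 0) with hM
  have hN0 : 0 ≤ N := Finset.sum_nonneg fun t _ => by split_ifs <;> norm_num
  have hM0 : 0 ≤ M := Finset.sum_nonneg fun t _ => by split_ifs; exacts [hp0 t, le_rfl]
  set Z := Real.sqrt (len₀ + N + M) with hZ
  have hZ0 : 0 ≤ Z := Real.sqrt_nonneg _
  have hroot : ∀ y, y ≤ 4 * (len₀ + N + M) → Real.sqrt y ≤ 2 * Z := fun y hy => by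
    rw [hZ, show (2 : ℝ) = Real.sqrt (2 ^ 2) by rw [Real.sqrt_sq (by norm_num)],
      ← Real.sqrt_mul (by norm_num)]
    exact Real.sqrt_le_sqrt (by linarith)
  have h3 : (if (E T).cand = xs then Real.sqrt (Q T (E T).n) else 2 * Real.sqrt (E T).n) +
      11 * Real.sqrt (epochPrev X sel len₀ x₁ a T) ≤ 27 * Z := by
    split_ifs with h
    · have h4 := hroot _ ((m2 h).trans (by linarith))
      have hQM : Q T (E T).n ≤ M := by
        have hnT : (E T).n ≤ T := epochCore_n_le T
        have hsplit : T - (E T).n + (E T).n = T := Nat.sub_add_cancel hnT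
        have h5 : ∑ k ∈ Finset.range (E T).n, (if (E (T - (E T).n + k)).cand = xs then
            p (T - (E T).n + k) else 0) = Q T (E T).n := by
          refine Finset.sum_congr rfl fun k hk => ?_
          have h6 := epochCore_eq_shift (X := X) (sel := sel) (len₀ := len₀) (x₁ := x₁) (a := a)
            (T - (E T).n) (E T).n (by rw [hsplit]) k (Finset.mem_range.1 hk).le
          rw [hsplit] at h6
          rw [if_pos (h6.2.trans h)]
        have h7 := Finset.sum_range_add (fun t => if (E t).cand = xs then p t else 0)
          (T - (E T).n) (E T).n
        rw [hsplit, h5] at h7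
        rw [hM, h7]
        have : 0 ≤ ∑ t ∈ Finset.range (T - (E T).n), (if (E t).cand = xs then p t else 0) :=
          Finset.sum_nonneg fun t _ => by split_ifs; exacts [hp0 t, le_rfl]
        linarith
      have h5 := hroot _ (hQM.trans (by linarith))
      linarith
    · obtain ⟨k1, k2⟩ := m1 h
      have h4 := hroot _ (k1.trans (by linarith))
      have h5 := hroot _ (k2.trans (by linarith))
      linarith
  have h4 := mul_le_mul_of_nonneg_left h3 (Real.sqrt_nonneg len₀)
  linarith

end EpochCosts

/-! ### The epochs of the cascade as stopped runs -/

/-- The filtration that starts at time `s`. -/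
def shiftFiltration {Ω : Type u} {mΩ : MeasurableSpace Ω} (ℱ : Filtration ℕ mΩ) (s : ℕ) :
    Filtration ℕ mΩ where
  seq t := ℱ (s + t)
  mono' _ _ h := ℱ.mono (Nat.add_le_add_left h s)
  le' t := ℱ.le (s + t)

lemma IsLinearEnvironment.shift {d : ℕ} {Ω : Type u} [mΩ : MeasurableSpace Ω] {μ : Measure Ω}
    {X : Finset (Vec d)} {T : ℕ} {ℱ 𝒢 : Filtration ℕ mΩ} {loss : ℕ → Ω → Vec d → ℝ}
    (h : IsLinearEnvironment μ X T ℱ 𝒢 loss) (s : ℕ) :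
    IsLinearEnvironment μ X (T - s) (shiftFiltration ℱ s) (shiftFiltration 𝒢 s)
      (fun t => loss (s + t)) where
  le_env t := h.le_env (s + t)
  env_le t := h.env_le (s + t)
  measurable t ht := h.measurable (s + t) (by omega)
  bounded t ht := h.bounded (s + t) (by omega)
  linear t ht := h.linear (s + t) (by omega)

/-- The cascade of the three algorithms, run in an environment, with constants that are large enough
for its analysis. -/
structure IsCascadeRun {d : ℕ} {Ω : Type u} [mΩ : MeasurableSpace Ω] (μ : Measure Ω)
    (X : Finset (Vec d)) (ν : Vec d → Vec d → ℝ) (T : ℕ) (ℱ 𝒢 : Filtration ℕ mΩ)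
    (loss : ℕ → Ω → Vec d → ℝ) (c len₀ : ℝ) (sel : Finset (Vec d) → Vec d) (x₁ : Ω → Vec d)
    (i : ℕ → Ω → Fin 2) (a : ℕ → Ω → Vec d) : Prop where
  two_le : 2 ≤ X.card
  john : ∀ x ∈ X, IsJohnExploration (X.erase x) (ν x)
  sel_mem : ∀ s : Finset (Vec d), s.Nonempty → sel s ∈ s
  one_le : 16 ≤ c
  const_le : 81 * (d * Real.log X.card) ≤ c
  env : IsLinearEnvironment μ X T ℱ 𝒢 loss
  int : IsInteraction μ X T ℱ 𝒢 loss (cascade X ν c len₀ sel) x₁ i a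

/-- The random discrete memory of the cascade. -/
def coreRun {d : ℕ} {Ω : Type u} (X : Finset (Vec d)) (sel : Finset (Vec d) → Vec d) (len₀ : ℝ)
    (x₁ : Ω → Vec d) (a : ℕ → Ω → Vec d) (t : ℕ) (ω : Ω) : EpochCore (Vec d) :=
  epochCore X sel len₀ (x₁ ω) (fun r => a r ω) t

/-- The length, up to the horizon `T`, of the epoch with candidate `x` that starts at time `s`; it
is `0` if there is no such epoch. -/
def epochLength {d : ℕ} {Ω : Type u} (X : Finset (Vec d)) (sel : Finset (Vec d) → Vec d)
    (len₀ : ℝ) (x₁ : Ω → Vec d) (a : ℕ → Ω → Vec d) (T s : ℕ) (x : Vec d) (ω : Ω) : ℕ :=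
  ((Finset.range (T - s)).filter fun r => (coreRun X sel len₀ x₁ a (s + r) ω).n = r ∧
    (coreRun X sel len₀ x₁ a (s + r) ω).cand = x).card

section Lengths

variable {d : ℕ} {Ω : Type u} {X : Finset (Vec d)} {sel : Finset (Vec d) → Vec d}
  {len₀ : ℝ} {x₁ : Ω → Vec d} {a : ℕ → Ω → Vec d} {T : ℕ}

lemma lt_epochLength {s : ℕ} {x : Vec d} {ω : Ω} {r : ℕ} :
    r < epochLength X sel len₀ x₁ a T s x ω ↔ r < T - s ∧
      (coreRun X sel len₀ x₁ a (s + r) ω).n = r ∧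
      (coreRun X sel len₀ x₁ a (s + r) ω).cand = x := by
  refine lt_card_filter_range (p := fun r => (coreRun X sel len₀ x₁ a (s + r) ω).n = r ∧
    (coreRun X sel len₀ x₁ a (s + r) ω).cand = x) (fun t _ ht => ?_) r
  obtain ⟨h1, h2⟩ := epochCore_of_n_succ (t := s + t) ht.1
  exact ⟨h1, h2.symm.trans ht.2⟩

/-- A sum over all epochs, and over the rounds of each, is a sum over all rounds. -/
lemma sum_epochs (hsel : ∀ s : Finset (Vec d), s.Nonempty → sel s ∈ s) {ω : Ω} (hx : x₁ ω ∈ X)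
    (f : ℕ → Vec d → ℕ → ℝ) :
    ∑ s ∈ Finset.range T, ∑ x ∈ X, ∑ r ∈ Finset.range (epochLength X sel len₀ x₁ a T s x ω),
      f s x r = ∑ t ∈ Finset.range T, f (t - (coreRun X sel len₀ x₁ a t ω).n)
        (coreRun X sel len₀ x₁ a t ω).cand (coreRun X sel len₀ x₁ a t ω).n := by
  have h1 : ∀ s x, ∑ r ∈ Finset.range (epochLength X sel len₀ x₁ a T s x ω), f s x r =
      ∑ r ∈ Finset.range (T - s), if (coreRun X sel len₀ x₁ a (s + r) ω).n = r ∧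
        (coreRun X sel len₀ x₁ a (s + r) ω).cand = x then f s x r else 0 := by
    intro s x
    rw [← Finset.sum_filter]
    refine Finset.sum_congr ?_ fun _ _ => rfl
    ext r
    rw [Finset.mem_range, lt_epochLength, Finset.mem_filter, Finset.mem_range]
  have h2 : ∀ s, ∑ x ∈ X, ∑ r ∈ Finset.range (epochLength X sel len₀ x₁ a T s x ω), f s x r =
      ∑ r ∈ Finset.range (T - s), if (coreRun X sel len₀ x₁ a (s + r) ω).n = r then
        f s (coreRun X sel len₀ x₁ a (s + r) ω).cand r else 0 := by
    intro s
    simp only [h1]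
    rw [Finset.sum_comm]
    refine Finset.sum_congr rfl fun r _ => ?_
    by_cases hn : (coreRun X sel len₀ x₁ a (s + r) ω).n = r
    · have hmem : (coreRun X sel len₀ x₁ a (s + r) ω).cand ∈ X := epochCore_cand_mem hsel hx _
      simp only [hn, true_and, if_true]
      rw [Finset.sum_ite_eq, if_pos hmem]
    · simp only [hn, false_and, if_false, Finset.sum_const_zero]
  simp only [h2]
  have h3 := Finset.sum_range_diag_flip T fun s r =>
    if (coreRun X sel len₀ x₁ a (s + r) ω).n = r then
      f s (coreRun X sel len₀ x₁ a (s + r) ω).cand r else 0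
  rw [← h3]
  refine Finset.sum_congr rfl fun t _ => ?_
  have hn : (coreRun X sel len₀ x₁ a t ω).n ≤ t := epochCore_n_le t
  rw [Finset.sum_eq_single (t - (coreRun X sel len₀ x₁ a t ω).n)]
  · rw [Nat.add_sub_cancel' (Nat.sub_le _ _), if_pos (Nat.sub_sub_self hn).symm,
      Nat.sub_sub_self hn]
  · intro s hs hne
    have hs := Finset.mem_range.1 hs
    rw [Nat.add_sub_cancel' (by omega), if_neg]
    omega
  · intro h
    exact absurd (Finset.mem_range.2 (by omega)) h

/-- In the epoch with candidate `x` that starts at time `s`, the cascade follows a fresh run of the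
Corral-type algorithm. -/
lemma cascade_dist_eq {ν : Vec d → Vec d → ℝ} {c : ℝ} {i : ℕ → Ω → Fin 2}
    {loss : ℕ → Ω → Vec d → ℝ} {s r : ℕ} {x : Vec d} {ω : Ω}
    (hr : r < epochLength X sel len₀ x₁ a T s x ω) (j : Fin 2) (y : Vec d) :
    (cascade X ν c len₀ sel (x₁ ω)).dist ((cascade X ν c len₀ sel (x₁ ω)).stateAt
      (fun t => i t ω) (fun t => a t ω) (fun t => loss t ω (a t ω)) (s + r)) j y =
    (corral x (exp2 (X.erase x) (ν x)) c c).dist (corralRun (X.erase x) (ν x) x c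
      (fun t => i (s + t)) (fun t => a (s + t)) (fun t => loss (s + t)) r ω) j y := by
  obtain ⟨-, h1, h2⟩ := lt_epochLength.1 hr
  set A : Vec d → BanditAlgorithm (Fin 2) (Vec d) :=
    fun x => corral x (exp2 (X.erase x) (ν x)) c c with hA
  set E : EpochState A := (epochAlgorithm X A sel len₀ (x₁ ω)).stateAt (fun t => i t ω)
    (fun t => a t ω) (fun t => loss t ω (a t ω)) (s + r) with hE
  have hcore : E.core = coreRun X sel len₀ x₁ a (s + r) ω := core_stateAt _ _ _ _ _ _ _ _
  have hn : E.n = r := (congrArg EpochCore.n hcore).trans h1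
  have hc : E.cand = x := (congrArg EpochCore.cand hcore).trans h2
  have hb := base_stateAt X sel len₀ (x₁ ω) (fun t => i t ω) (fun t => a t ω)
    (fun t => loss t ω (a t ω)) (s + r) E hE
  change (A E.cand).dist E.base j y = (A x).dist ((A x).stateAt (fun t => i (s + t) ω)
    (fun t => a (s + t) ω) (fun t => loss (s + t) ω (a (s + t) ω)) r) j y
  rw [hb, hn, Nat.add_sub_cancel, hc]

end Lengths

namespace IsCascadeRun

variable {d : ℕ} {Ω : Type u} [mΩ : MeasurableSpace Ω] {μ : Measure Ω}
  {X : Finset (Vec d)} {ν : Vec d → Vec d → ℝ} {T : ℕ} {ℱ 𝒢 : Filtration ℕ mΩ}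
  {loss : ℕ → Ω → Vec d → ℝ} {c len₀ : ℝ} {sel : Finset (Vec d) → Vec d} {x₁ : Ω → Vec d}
  {i : ℕ → Ω → Fin 2} {a : ℕ → Ω → Vec d}

/-- The discrete memory takes finitely many values, and is a function of the history. -/
lemma core_measurable (h : IsCascadeRun μ X ν T ℱ 𝒢 loss c len₀ sel x₁ i a) : ∀ t ≤ T,
    ∃ S : Set (EpochCore (Vec d)), S.Finite ∧ (∀ ω, coreRun X sel len₀ x₁ a t ω ∈ S) ∧
      ∀ σ, MeasurableSet[ℱ t] {ω | coreRun X sel len₀ x₁ a t ω = σ} := by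
  intro t
  induction t with
  | zero =>
    intro _
    refine ⟨(fun x => (⟨x, len₀, 0, fun _ => 0⟩ : EpochCore (Vec d))) '' (X : Set (Vec d)),
      X.finite_toSet.image _, fun ω => ⟨x₁ ω, h.int.first_mem ω, rfl⟩, fun σ => ?_⟩
    by_cases hσ : σ = ⟨σ.cand, len₀, 0, fun _ => 0⟩
    · convert h.int.first_measurable (measurableSet_singleton σ.cand) using 1
      ext ω
      constructor
      · rintro rfl; rfl
      · intro hω
        have hω' : x₁ ω = σ.cand := hω
        change (⟨x₁ ω, len₀, 0, fun _ => 0⟩ : EpochCore (Vec d)) = σ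
        rw [hω', ← hσ]
    · convert @MeasurableSet.empty _ (ℱ 0) using 1
      ext ω
      refine ⟨?_, fun h' => h'.elim⟩
      rintro rfl
      exact hσ rfl
  | succ t ih =>
    intro ht
    obtain ⟨S, hS, hmem, hmeas⟩ := ih (by omega)
    refine ⟨(fun z : EpochCore (Vec d) × Vec d => z.1.next X sel z.2) '' (S ×ˢ (X : Set (Vec d))),
      (hS.prod X.finite_toSet).image _,
      fun ω => ⟨(coreRun X sel len₀ x₁ a t ω, a t ω), ⟨hmem ω, h.int.action_mem t ht ω⟩, rfl⟩,
      fun σ => ?_⟩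
    have e : {ω | coreRun X sel len₀ x₁ a (t + 1) ω = σ} =
        ⋃ z ∈ {z ∈ S ×ˢ (X : Set (Vec d)) | z.1.next X sel z.2 = σ},
          ({ω | coreRun X sel len₀ x₁ a t ω = z.1} ∩ {ω | a t ω = z.2}) := by
      ext ω
      simp only [Set.mem_iUnion]
      constructor
      · intro hω
        exact ⟨(coreRun X sel len₀ x₁ a t ω, a t ω),
          ⟨⟨hmem ω, h.int.action_mem t ht ω⟩, hω⟩, rfl, rfl⟩
      · rintro ⟨z, ⟨-, hz⟩, h1, h2⟩
        have h1' : coreRun X sel len₀ x₁ a t ω = z.1 := h1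
        have h2' : a t ω = z.2 := h2
        change (coreRun X sel len₀ x₁ a t ω).next X sel (a t ω) = σ
        rw [h1', h2', hz]
    rw [e]
    refine ((hS.prod X.finite_toSet).subset (Set.sep_subset _ _)).measurableSet_biUnion
      fun z _ => ?_
    exact (ℱ.mono (Nat.le_succ t) _ (hmeas z.1)).inter
      (h.int.action_measurable t ht (measurableSet_singleton z.2))

lemma measurableSet_core (h : IsCascadeRun μ X ν T ℱ 𝒢 loss c len₀ sel x₁ i a) {t : ℕ}
    (ht : t ≤ T) (P : EpochCore (Vec d) → Prop) :
    MeasurableSet[ℱ t] {ω | P (coreRun X sel len₀ x₁ a t ω)} := by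
  obtain ⟨S, hS, hmem, hmeas⟩ := h.core_measurable t ht
  have e : {ω | P (coreRun X sel len₀ x₁ a t ω)} =
      ⋃ σ ∈ {σ ∈ S | P σ}, {ω | coreRun X sel len₀ x₁ a t ω = σ} := by
    ext ω
    simp only [Set.mem_iUnion]
    constructor
    · intro hω
      exact ⟨_, ⟨hmem ω, hω⟩, rfl⟩
    · rintro ⟨σ, ⟨-, hσ⟩, h1⟩
      have h1' : coreRun X sel len₀ x₁ a t ω = σ := h1
      change P (coreRun X sel len₀ x₁ a t ω)
      rwa [h1']
  rw [e]
  exact (hS.subset (Set.sep_subset _ _)).measurableSet_biUnion fun σ _ => hmeas σ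

/-- The epoch with candidate `x` that starts at time `s` is a stopped run of the Corral-type
algorithm. -/
lemma toCorralRun (h : IsCascadeRun μ X ν T ℱ 𝒢 loss c len₀ sel x₁ i a) (s : ℕ) {x : Vec d}
    (hx : x ∈ X) :
    StoppedCorralRun μ X (ν x) (T - s) (shiftFiltration ℱ s) (shiftFiltration 𝒢 s)
      (fun t => loss (s + t)) x c (fun t => i (s + t)) (fun t => a (s + t))
      (epochLength X sel len₀ x₁ a T s x) where
  john := h.john x hx
  cand_mem := hx
  nonempty := by
    rw [← Finset.card_pos, Finset.card_erase_of_mem hx]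
    have := h.two_le
    omega
  env := h.env.shift s
  one_le := h.one_le
  const_le := by
    refine le_trans ?_ h.const_le
    have h1 : ((X.erase x).card : ℝ) ≤ X.card := by
      exact_mod_cast Finset.card_le_card (Finset.erase_subset x X)
    have h2 : (0 : ℝ) < (X.erase x).card := by
      rw [Finset.card_erase_of_mem hx]
      have := h.two_le
      exact_mod_cast (by omega : 0 < X.card - 1)
    gcongr
  symbol_measurable t ht := h.int.symbol_measurable (s + t) (by omega)
  action_measurable t ht := h.int.action_measurable (s + t) (by omega)
  action_mem t ht := h.int.action_mem (s + t) (by omega)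
  stop_le ω := by
    by_contra hlt
    exact absurd (lt_epochLength.1 (not_le.1 hlt)).1 (lt_irrefl _)
  stop_measurable n := by
    by_cases hn : n < T - s
    · have e : {ω | n < epochLength X sel len₀ x₁ a T s x ω} =
          {ω | (fun σ : EpochCore (Vec d) => σ.n = n ∧ σ.cand = x)
            (coreRun X sel len₀ x₁ a (s + n) ω)} := by
        ext ω
        change n < epochLength X sel len₀ x₁ a T s x ω ↔ _
        rw [lt_epochLength, and_iff_right hn]
        rfl
      rw [e]
      exact h.measurableSet_core (t := s + n) (by omega)
        (fun σ : EpochCore (Vec d) => σ.n = n ∧ σ.cand = x)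
    · convert @MeasurableSet.empty _ (shiftFiltration ℱ s n) using 1
      ext ω
      refine ⟨fun h' => absurd (lt_epochLength.1 h').1 hn, fun h' => h'.elim⟩
  law t ht j y hy := by
    filter_upwards [h.int.law (s + t) (by omega) j y hy] with ω hω hτ
    rw [← cascade_dist_eq hτ]
    exact hω

/-- Comparing two costs of rounds by comparing them over each epoch separately. -/
lemma integral_le_of_epochs (h : IsCascadeRun μ X ν T ℱ 𝒢 loss c len₀ sel x₁ i a)
    {f g : ℕ → Vec d → ℕ → Ω → ℝ}
    (hf : ∀ s < T, ∀ x ∈ X, Integrable (fun ω =>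
      ∑ r ∈ Finset.range (epochLength X sel len₀ x₁ a T s x ω), f s x r ω) μ)
    (hg : ∀ s < T, ∀ x ∈ X, Integrable (fun ω =>
      ∑ r ∈ Finset.range (epochLength X sel len₀ x₁ a T s x ω), g s x r ω) μ)
    (hfg : ∀ s < T, ∀ x ∈ X,
      ∫ ω, ∑ r ∈ Finset.range (epochLength X sel len₀ x₁ a T s x ω), f s x r ω ∂μ ≤
      ∫ ω, ∑ r ∈ Finset.range (epochLength X sel len₀ x₁ a T s x ω), g s x r ω ∂μ) :
    Integrable (fun ω => ∑ t ∈ Finset.range T, f (t - (coreRun X sel len₀ x₁ a t ω).n)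
      (coreRun X sel len₀ x₁ a t ω).cand (coreRun X sel len₀ x₁ a t ω).n ω) μ ∧
    Integrable (fun ω => ∑ t ∈ Finset.range T, g (t - (coreRun X sel len₀ x₁ a t ω).n)
      (coreRun X sel len₀ x₁ a t ω).cand (coreRun X sel len₀ x₁ a t ω).n ω) μ ∧
    ∫ ω, ∑ t ∈ Finset.range T, f (t - (coreRun X sel len₀ x₁ a t ω).n)
      (coreRun X sel len₀ x₁ a t ω).cand (coreRun X sel len₀ x₁ a t ω).n ω ∂μ ≤
    ∫ ω, ∑ t ∈ Finset.range T, g (t - (coreRun X sel len₀ x₁ a t ω).n)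
      (coreRun X sel len₀ x₁ a t ω).cand (coreRun X sel len₀ x₁ a t ω).n ω ∂μ := by
  have e : ∀ f : ℕ → Vec d → ℕ → Ω → ℝ, (fun ω => ∑ t ∈ Finset.range T,
      f (t - (coreRun X sel len₀ x₁ a t ω).n) (coreRun X sel len₀ x₁ a t ω).cand
        (coreRun X sel len₀ x₁ a t ω).n ω) = fun ω => ∑ s ∈ Finset.range T, ∑ x ∈ X,
      ∑ r ∈ Finset.range (epochLength X sel len₀ x₁ a T s x ω), f s x r ω := fun f => by
    funext ω
    exact (sum_epochs h.sel_mem (h.int.first_mem ω) (fun s x r => f s x r ω)).symm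
  have hi : ∀ {f : ℕ → Vec d → ℕ → Ω → ℝ}, (∀ s < T, ∀ x ∈ X, Integrable (fun ω =>
      ∑ r ∈ Finset.range (epochLength X sel len₀ x₁ a T s x ω), f s x r ω) μ) →
      ∀ s ∈ Finset.range T, Integrable (fun ω => ∑ x ∈ X,
        ∑ r ∈ Finset.range (epochLength X sel len₀ x₁ a T s x ω), f s x r ω) μ :=
    fun hf s hs => integrable_finsetSum _ fun x hx => hf s (Finset.mem_range.1 hs) x hx
  rw [e f, e g]
  refine ⟨integrable_finsetSum _ (hi hf), integrable_finsetSum _ (hi hg), ?_⟩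
  rw [integral_finsetSum _ (hi hf), integral_finsetSum _ (hi hg)]
  refine Finset.sum_le_sum fun s hs => ?_
  have hs := Finset.mem_range.1 hs
  rw [integral_finsetSum _ fun x hx => hf s hs x hx, integral_finsetSum _ fun x hx => hg s hs x hx]
  exact Finset.sum_le_sum fun x hx => hfg s hs x hx

end IsCascadeRun

/-! ### Rounds in a corrupted stochastic environment -/

lemma setIntegral_mul_nonneg_of_condExp {Ω : Type*} {m mΩ : MeasurableSpace Ω} {μ : Measure Ω}
    [IsProbabilityMeasure μ] (hm : m ≤ mΩ) {f W : Ω → ℝ} (hf : Integrable f μ) {R : Set Ω}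
    (hR : MeasurableSet[m] R) (hW : Measurable[m] W) (hW0 : ∀ ω, 0 ≤ W ω) (hW1 : ∀ ω, W ω ≤ 1)
    (hf0 : 0 ≤ᵐ[μ] μ[f | m]) :
    IntegrableOn (fun ω => W ω * f ω) R μ ∧ 0 ≤ ∫ ω in R, W ω * f ω ∂μ := by
  obtain ⟨h1, -, h3⟩ := setIntegral_mul_of_condExp hm hf hR hW (C := 1)
    (fun ω _ => abs_le.2 ⟨by linarith [hW0 ω], hW1 ω⟩)
    (ae_of_all μ fun ω _ => (rfl : (μ[f | m]) ω = (μ[f | m]) ω))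
  simp only [mul_comm (W _)]
  refine ⟨h1, ?_⟩
  rw [h3]
  refine setIntegral_nonneg_of_ae ?_
  filter_upwards [hf0] with ω hω
  exact mul_nonneg hω (hW0 ω)

namespace StoppedCorralRun

variable {d : ℕ} {Ω : Type u} [mΩ : MeasurableSpace Ω] {μ : Measure Ω}
  {X : Finset (Vec d)} {ν : Vec d → ℝ} {T : ℕ} {ℱ 𝒢 : Filtration ℕ mΩ}
  {loss : ℕ → Ω → Vec d → ℝ} {cand : Vec d} {c : ℝ} {i : ℕ → Ω → Fin 2} {a : ℕ → Ω → Vec d}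
  {τ : Ω → ℕ}

/-- The base algorithm never plays the candidate, so that the candidate is missed exactly when the
base algorithm is followed. -/
lemma integral_prob [IsProbabilityMeasure μ]
    (h : StoppedCorralRun μ X ν T ℱ 𝒢 loss cand c i a τ) {t : ℕ} (ht : t < T) :
    IntegrableOn (baseProb (X.erase cand) ν cand c i a loss t) {ω | t < τ ω} μ ∧
    IntegrableOn (fun ω => if a t ω = cand then (0 : ℝ) else 1) {ω | t < τ ω} μ ∧
    ∫ ω in {ω | t < τ ω}, baseProb (X.erase cand) ν cand c i a loss t ω ∂μ =
      ∫ ω in {ω | t < τ ω}, (if a t ω = cand then (0 : ℝ) else 1) ∂μ := by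
  obtain ⟨h1, h2, h3⟩ := h.integral_round ht
    (G := fun _ x _ => if x = cand then (0 : ℝ) else 1) (fun _ _ _ => measurable_const) (C := 1)
    (fun _ x _ _ => by split_ifs <;> simp)
  have e : (fun ω => baseProb (X.erase cand) ν cand c i a loss t ω *
      ∑ x ∈ X.erase cand, exp2Dist (X.erase cand) ν
        (corralRun (X.erase cand) ν cand c i a loss t ω).base
        (baseProb (X.erase cand) ν cand c i a loss t ω) x * (if x = cand then (0 : ℝ) else 1) +
      (1 - baseProb (X.erase cand) ν cand c i a loss t ω) * (if cand = cand then (0 : ℝ) else 1)) =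
      baseProb (X.erase cand) ν cand c i a loss t := by
    funext ω
    rw [Finset.sum_congr rfl fun x hx => by
      rw [if_neg (Finset.ne_of_mem_erase hx), mul_one], h.sum_dist, if_pos rfl]
    ring
  rw [e] at h2 h3
  exact ⟨h2, h1, h3.symm⟩

/-- The conditional probability of playing `x` in round `t`, given the history. -/
def playProb {d : ℕ} {Ω : Type u} (X : Finset (Vec d)) (ν : Vec d → ℝ) (cand : Vec d) (c : ℝ)
    (i : ℕ → Ω → Fin 2) (a : ℕ → Ω → Vec d) (loss : ℕ → Ω → Vec d → ℝ) (t : ℕ) (x : Vec d)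
    (ω : Ω) : ℝ :=
  if x = cand then 1 - baseProb (X.erase cand) ν cand c i a loss t ω
  else baseProb (X.erase cand) ν cand c i a loss t ω * exp2Dist (X.erase cand) ν
    (corralRun (X.erase cand) ν cand c i a loss t ω).base
    (baseProb (X.erase cand) ν cand c i a loss t ω) x

lemma playProb_mem (h : StoppedCorralRun μ X ν T ℱ 𝒢 loss cand c i a τ) {t : ℕ} (ht : t < T)
    {x : Vec d} (hx : x ∈ X) (ω : Ω) :
    0 ≤ playProb X ν cand c i a loss t x ω ∧ playProb X ν cand c i a loss t x ω ≤ 1 := by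
  obtain ⟨h1, h2⟩ := h.prob_mem t ω
  unfold playProb
  split_ifs with hc
  · exact ⟨by linarith, by linarith⟩
  · have hx' : x ∈ X.erase cand := Finset.mem_erase.2 ⟨hc, hx⟩
    have h3 := h.dist_nonneg ht ω hx'
    have h4 := Finset.single_le_sum (fun y hy => h.dist_nonneg ht ω hy) hx'
    rw [h.sum_dist] at h4
    exact ⟨mul_nonneg h1.le h3, mul_le_one₀ h2.le h3 h4⟩

lemma playProb_measurable (h : StoppedCorralRun μ X ν T ℱ 𝒢 loss cand c i a τ) {t : ℕ}
    (ht : t < T) (x : Vec d) : Measurable[ℱ t] (playProb X ν cand c i a loss t x) := by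
  have hp := h.prob_measurable ht.le
  unfold playProb
  split_ifs with hc
  · exact hp.const_sub 1
  · refine hp.mul ?_
    simp only [corralRun_base]
    exact (h.toExp2Run.run_measurable t ht.le).dist hp x

/-- When all other actions are worse than `xs` by `Δ`, up to a corruption `C`, the regret of a round
is at least `Δ` times the probability of not playing `xs`, up to `C`. -/
lemma integral_gap_le [IsProbabilityMeasure μ]
    (h : StoppedCorralRun μ X ν T ℱ 𝒢 loss cand c i a τ) {t : ℕ} (ht : t < T) {xs : Vec d}
    (hxs : xs ∈ X) {Δ C : ℝ} (hC : 0 ≤ C)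
    (hgap : ∀ x ∈ X, x ≠ xs → (fun _ => Δ - C) ≤ᵐ[μ] μ[fun ω => loss t ω x - loss t ω xs | ℱ t]) :
    IntegrableOn (fun ω => (if a t ω = xs then 0 else Δ) - C) {ω | t < τ ω} μ ∧
    ∫ ω in {ω | t < τ ω}, ((if a t ω = xs then 0 else Δ) - C) ∂μ ≤
      ∫ ω in {ω | t < τ ω}, (loss t ω (a t ω) - loss t ω xs) ∂μ := by
  have hl : ∀ x ∈ X, Measurable[𝒢 t] fun ω => loss t ω x - loss t ω xs := fun x hx =>
    (h.env.measurable t ht x hx).sub (h.env.measurable t ht xs hxs)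
  have hli : ∀ x ∈ X, Integrable (fun ω => loss t ω x - loss t ω xs) μ := fun x hx => by
    refine Integrable.of_bound (C := 2) ((hl x hx).mono (𝒢.le t) le_rfl).aestronglyMeasurable
      (ae_of_all _ fun ω => ?_)
    have h1 := h.abs_loss_add_one ht hx ω
    have h2 := h.abs_loss_add_one ht hxs ω
    exact abs_le.2 ⟨by linarith, by linarith⟩
  set G : Vec d → Ω → ℝ := fun x ω =>
    loss t ω x - loss t ω xs - (if x = xs then 0 else Δ - C) with hG
  have hGi : ∀ x ∈ X, Integrable (G x) μ := fun x hx => (hli x hx).sub (integrable_const _)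
  have hG0 : ∀ x ∈ X, 0 ≤ᵐ[μ] μ[G x | ℱ t] := by
    intro x hx
    by_cases hxe : x = xs
    · have e : G x = 0 := by funext ω; simp [hG, hxe]
      rw [e, condExp_zero]
    · have e : G x = (fun ω => loss t ω x - loss t ω xs) - fun _ => Δ - C := by
        funext ω; simp [hG, hxe]
      rw [e]
      filter_upwards [hgap x hx hxe, condExp_sub (hli x hx) (integrable_const (Δ - C)) (ℱ t)]
        with ω h1 h2
      rw [h2, condExp_const (ℱ.le t), Pi.sub_apply]
      exact sub_nonneg.2 h1
  obtain ⟨k1, -, k3⟩ := h.integral_round ht (G := fun _ => G)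
    (fun _ x hx => (hl x hx).sub measurable_const) (C := 2 + |Δ - C|) (fun _ x hx ω => by
      have h1 := h.abs_loss_add_one ht hx ω
      have h2 := h.abs_loss_add_one ht hxs ω
      have h3 := abs_le.1 (le_refl |Δ - C|)
      simp only [hG]
      split_ifs
      · exact abs_le.2 ⟨by linarith [abs_nonneg (Δ - C)], by linarith [abs_nonneg (Δ - C)]⟩
      · exact abs_le.2 ⟨by linarith, by linarith⟩)
  have e : (fun ω => baseProb (X.erase cand) ν cand c i a loss t ω *
      ∑ x ∈ X.erase cand, exp2Dist (X.erase cand) ν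
        (corralRun (X.erase cand) ν cand c i a loss t ω).base
        (baseProb (X.erase cand) ν cand c i a loss t ω) x * G x ω +
      (1 - baseProb (X.erase cand) ν cand c i a loss t ω) * G cand ω) = fun ω =>
      ∑ x ∈ X, playProb X ν cand c i a loss t x ω * G x ω := by
    funext ω
    rw [← Finset.sum_erase_add _ _ h.cand_mem, Finset.mul_sum]
    congr 1
    · refine Finset.sum_congr rfl fun x hx => ?_
      rw [playProb, if_neg (Finset.ne_of_mem_erase hx), mul_assoc]
    · rw [playProb, if_pos rfl]
  have key := fun x hx => setIntegral_mul_nonneg_of_condExp (ℱ.le t) (hGi x hx)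
    (h.stop_measurable t) (h.playProb_measurable ht x) (fun ω => (h.playProb_mem ht hx ω).1)
    (fun ω => (h.playProb_mem ht hx ω).2) (hG0 x hx)
  rw [e, integral_finsetSum _ fun x hx => (key x hx).1] at k3
  have k4 : 0 ≤ ∫ ω in {ω | t < τ ω}, G (a t ω) ω ∂μ := by
    rw [k3]
    exact Finset.sum_nonneg fun x hx => (key x hx).2
  obtain ⟨l1, -, -⟩ := h.integral_regret ht hxs
  have hA : Measurable fun ω => (if a t ω = xs then 0 else Δ) - C :=
    (Measurable.ite ((h.action_measurable t ht).mono (ℱ.le (t + 1)) le_rfl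
      (measurableSet_singleton xs)) measurable_const measurable_const).sub_const C
  have hAi : IntegrableOn (fun ω => (if a t ω = xs then 0 else Δ) - C) {ω | t < τ ω} μ := by
    refine (Integrable.of_bound (C := |Δ| + |C|) hA.aestronglyMeasurable
      (ae_of_all _ fun ω => ?_)).integrableOn
    refine (norm_sub_le _ _).trans (add_le_add ?_ le_rfl)
    split_ifs <;> simp
  refine ⟨hAi, ?_⟩
  have k5 : ∫ ω in {ω | t < τ ω}, G (a t ω) ω ∂μ ≤
      ∫ ω in {ω | t < τ ω}, ((loss t ω (a t ω) - loss t ω xs) -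
        ((if a t ω = xs then 0 else Δ) - C)) ∂μ := by
    refine setIntegral_mono_on k1 (l1.sub hAi) (h.measurableSet_stopTime t) fun ω _ => ?_
    simp only [hG]
    split_ifs <;> linarith
  rw [integral_sub l1 hAi] at k5
  linarith

end StoppedCorralRun

/-! ### The regret of the cascade -/

/-- The probability with which the cascade follows its base algorithm in round `t`. -/
def followProb {d : ℕ} {Ω : Type u} (X : Finset (Vec d)) (ν : Vec d → Vec d → ℝ) (c len₀ : ℝ)
    (sel : Finset (Vec d) → Vec d) (x₁ : Ω → Vec d) (i : ℕ → Ω → Fin 2) (a : ℕ → Ω → Vec d)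
    (loss : ℕ → Ω → Vec d → ℝ) (t : ℕ) (ω : Ω) : ℝ :=
  let σ := coreRun X sel len₀ x₁ a t ω
  baseProb (X.erase σ.cand) (ν σ.cand) σ.cand c (fun k => i (t - σ.n + k))
    (fun k => a (t - σ.n + k)) (fun k => loss (t - σ.n + k)) σ.n ω

namespace IsCascadeRun

variable {d : ℕ} {Ω : Type u} [mΩ : MeasurableSpace Ω] {μ : Measure Ω}
  {X : Finset (Vec d)} {ν : Vec d → Vec d → ℝ} {T : ℕ} {ℱ 𝒢 : Filtration ℕ mΩ}
  {loss : ℕ → Ω → Vec d → ℝ} {c len₀ : ℝ} {sel : Finset (Vec d) → Vec d} {x₁ : Ω → Vec d}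
  {i : ℕ → Ω → Fin 2} {a : ℕ → Ω → Vec d}

lemma core_eq (h : IsCascadeRun μ X ν T ℱ 𝒢 loss c len₀ sel x₁ i a) (t : ℕ) (ω : Ω) :
    (coreRun X sel len₀ x₁ a t ω).n ≤ t ∧ (coreRun X sel len₀ x₁ a t ω).cand ∈ X :=
  ⟨epochCore_n_le t, epochCore_cand_mem h.sel_mem (h.int.first_mem ω) t⟩

lemma followProb_mem (h : IsCascadeRun μ X ν T ℱ 𝒢 loss c len₀ sel x₁ i a) (t : ℕ) (ω : Ω) :
    0 ≤ followProb X ν c len₀ sel x₁ i a loss t ω ∧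
      followProb X ν c len₀ sel x₁ i a loss t ω ≤ 1 := by
  have h1 := (h.toCorralRun (t - (coreRun X sel len₀ x₁ a t ω).n) (h.core_eq t ω).2).prob_mem
    (coreRun X sel len₀ x₁ a t ω).n ω
  exact ⟨h1.1.le, h1.2.le⟩

lemma integrable_epoch_regret [IsProbabilityMeasure μ]
    (h : IsCascadeRun μ X ν T ℱ 𝒢 loss c len₀ sel x₁ i a) {u : Vec d} (hu : u ∈ X) (s : ℕ)
    {x : Vec d} (hx : x ∈ X) : Integrable (fun ω =>
      ∑ r ∈ Finset.range (epochLength X sel len₀ x₁ a T s x ω),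
        (loss (s + r) ω (a (s + r) ω) - loss (s + r) ω u)) μ :=
  integrable_sum_range_stopTime (h.toCorralRun s hx).stop_le
    (h.toCorralRun s hx).measurableSet_stopTime
    fun _ ht => ((h.toCorralRun s hx).integral_regret ht hu).1

lemma integrable_regret [IsProbabilityMeasure μ]
    (h : IsCascadeRun μ X ν T ℱ 𝒢 loss c len₀ sel x₁ i a) {u : Vec d} (hu : u ∈ X) :
    Integrable (fun ω => ∑ t ∈ Finset.range T, (loss t ω (a t ω) - loss t ω u)) μ := by
  have key := (h.integral_le_of_epochs
    (f := fun s _ r ω => loss (s + r) ω (a (s + r) ω) - loss (s + r) ω u)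
    (fun s _ x hx => h.integrable_epoch_regret hu s hx)
    (fun s _ x hx => h.integrable_epoch_regret hu s hx) fun _ _ _ _ => le_rfl).1
  simpa only [Nat.sub_add_cancel (h.core_eq _ _).1] using key

/-- The regret of the cascade, when the horizon is not shorter than the constant of the
algorithms. -/
lemma pseudoRegret_le_sqrt [IsProbabilityMeasure μ]
    (h : IsCascadeRun μ X ν T ℱ 𝒢 loss c len₀ sel x₁ i a) (hc2 : c ≤ 2 * len₀) (hcT : c ≤ T)
    {u : Vec d} (hu : u ∈ X) : pseudoRegret μ T loss a u ≤ 4354 * Real.sqrt (c * T) := by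
  have hc : 0 ≤ c := by linarith [h.one_le]
  obtain ⟨-, k2, k3⟩ := h.integral_le_of_epochs
    (f := fun s _ r ω => loss (s + r) ω (a (s + r) ω) - loss (s + r) ω u)
    (g := fun _ _ r _ => 311 * (Real.sqrt c / Real.sqrt ((r : ℝ) + 1) + (if r = 0 then c else 0)))
    (fun s _ x hx => h.integrable_epoch_regret hu s hx)
    (fun s _ x hx => integrable_sum_range_stopTime (h.toCorralRun s hx).stop_le
      (h.toCorralRun s hx).measurableSet_stopTime
      fun t _ => StoppedCorralRun.integrableOn_const _ _)
    (fun s _ x hx => (h.toCorralRun s hx).regret_le hu)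
  simp only [Nat.sub_add_cancel (h.core_eq _ _).1] at k3
  refine k3.trans ?_
  calc _ ≤ ∫ _, 4354 * Real.sqrt (c * T) ∂μ := by
        refine integral_mono k2 (integrable_const _) fun ω => ?_
        have h1 := epoch_cost_le (X := X) (sel := sel) (x₁ := x₁ ω) (a := fun r => a r ω)
          hc hc2 hcT
        simp only [← Finset.mul_sum]
        refine (mul_le_mul_of_nonneg_left h1 (by norm_num)).trans (le_of_eq ?_)
        ring
    _ = _ := by simp

/-- The regret of the cascade against an action `xs`, in terms of the expected number of rounds in
which `xs` is not played. The parameter `y` linearises a square root. -/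
lemma pseudoRegret_le_misses [IsProbabilityMeasure μ]
    (h : IsCascadeRun μ X ν T ℱ 𝒢 loss c len₀ sel x₁ i a) (hT : 2 ≤ T)
    (hlen : len₀ = c * Real.log T) {xs : Vec d} (hxs : xs ∈ X) {y : ℝ} (hy : 0 < y) :
    pseudoRegret μ T loss a xs ≤ 451 * (len₀ + 14 * (len₀ / y + y * (len₀ + 2 *
      ∫ ω, ∑ t ∈ Finset.range T, (if a t ω = xs then (0 : ℝ) else 1) ∂μ))) := by
  have hc16 := h.one_le
  have hT2 : (2 : ℝ) ≤ T := by exact_mod_cast hT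
  have hlg : 0.69 ≤ Real.log T := by
    have := Real.log_le_log (by norm_num) hT2
    linarith [Real.log_two_gt_d9]
  have hlen1 : 1 ≤ len₀ := by rw [hlen]; nlinarith
  have hcl : c ≤ 1.45 * len₀ := by rw [hlen]; nlinarith
  have hsl := Real.sqrt_nonneg len₀
  have hscl : Real.sqrt c ≤ 1.45 * Real.sqrt len₀ := by
    refine Real.sqrt_le_iff.2 ⟨by positivity, ?_⟩
    rw [mul_pow, Real.sq_sqrt (by linarith)]
    linarith
  set P := followProb X ν c len₀ sel x₁ i a loss with hP
  -- the cost of a round in terms of the beginning and the candidate of its epoch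
  set q : ℕ → Vec d → ℕ → Ω → ℝ := fun s x => baseProb (X.erase x) (ν x) x c
    (fun k => i (s + k)) (fun k => a (s + k)) (fun k => loss (s + k)) with hq
  set g : ℕ → Vec d → ℕ → Ω → ℝ := fun s x r ω => 451 * ((if r = 0 then len₀ else 0) +
    Real.sqrt len₀ * (if x = xs then Real.sqrt (∑ k ∈ Finset.range (r + 1), q s x k ω) -
      Real.sqrt (∑ k ∈ Finset.range r, q s x k ω) else 1 / Real.sqrt ((r : ℝ) + 1))) with hg
  have hgi : ∀ s, ∀ x ∈ X, ∀ r < T - s,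
      IntegrableOn (g s x r) {ω | r < epochLength X sel len₀ x₁ a T s x ω} μ := by
    intro s x hx r hr
    simp only [hg]
    refine ((StoppedCorralRun.integrableOn_const _ _).add (Integrable.const_mul ?_ _)).const_mul _
    split_ifs
    · exact (h.toCorralRun s hx).integrableOn_sqrt_diff hr
    · exact StoppedCorralRun.integrableOn_const _ _
  obtain ⟨-, k2, k3⟩ := h.integral_le_of_epochs
    (f := fun s _ r ω => loss (s + r) ω (a (s + r) ω) - loss (s + r) ω xs) (g := g)
    (fun s _ x hx => h.integrable_epoch_regret hxs s hx)
    (fun s _ x hx => integrable_sum_range_stopTime (h.toCorralRun s hx).stop_le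
      (h.toCorralRun s hx).measurableSet_stopTime (hgi s x hx))
    (fun s _ x hx => by
      have hr := h.toCorralRun s hx
      have hm := hr.measurableSet_stopTime
      by_cases hxe : x = xs
      · subst hxe
        refine (hr.regret_cand_le (Nat.sub_le T s) hT).trans ?_
        refine integral_sum_range_stopTime_le hr.stop_le hm fun r hrT => ?_
        have h1 : IntegrableOn (fun ω => (if r = 0 then 73 * (c * Real.log T) else 0) +
            52 * Real.sqrt (c * Real.log T) * (Real.sqrt (∑ k ∈ Finset.range (r + 1), q s x k ω) -
              Real.sqrt (∑ k ∈ Finset.range r, q s x k ω)))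
            {ω | r < epochLength X sel len₀ x₁ a T s x ω} μ :=
          (StoppedCorralRun.integrableOn_const _ _).add
            (Integrable.const_mul (hr.integrableOn_sqrt_diff hrT) _)
        refine ⟨h1, hgi s x hx r hrT, setIntegral_mono_on h1 (hgi s x hx r hrT) (hm r)
          fun ω _ => ?_⟩
        have h2 : 0 ≤ Real.sqrt (∑ k ∈ Finset.range (r + 1), q s x k ω) -
            Real.sqrt (∑ k ∈ Finset.range r, q s x k ω) := by
          refine sub_nonneg.2 (Real.sqrt_le_sqrt ?_)
          rw [Finset.sum_range_succ]
          linarith [(hr.prob_mem r ω).1]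
        have h3 := mul_nonneg hsl h2
        simp only [hg, if_true, ← hlen]
        split_ifs <;> linarith
      · refine (hr.regret_le hxs).trans ?_
        refine integral_sum_range_stopTime_le hr.stop_le hm fun r hrT => ?_
        refine ⟨StoppedCorralRun.integrableOn_const _ _, hgi s x hx r hrT,
          setIntegral_mono_on (StoppedCorralRun.integrableOn_const _ _) (hgi s x hx r hrT) (hm r)
          fun ω _ => ?_⟩
        have h2 : Real.sqrt c / Real.sqrt ((r : ℝ) + 1) ≤
            1.45 * (Real.sqrt len₀ * (1 / Real.sqrt ((r : ℝ) + 1))) := by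
          rw [← mul_assoc, mul_one_div]
          gcongr
        have h3 : 0 ≤ Real.sqrt len₀ * (1 / Real.sqrt ((r : ℝ) + 1)) := by positivity
        simp only [hg, if_neg hxe]
        split_ifs <;> linarith)
  simp only [Nat.sub_add_cancel (h.core_eq _ _).1] at k3
  -- the total probability of following the base algorithm during epochs with candidate `xs`
  obtain ⟨m1, m2, m3⟩ := h.integral_le_of_epochs
    (f := fun s x r ω => if x = xs then q s x r ω else 0)
    (g := fun s x r ω => if x = xs then (if a (s + r) ω = x then (0 : ℝ) else 1) else 0)
    (fun s _ x hx => integrable_sum_range_stopTime (h.toCorralRun s hx).stop_le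
      (h.toCorralRun s hx).measurableSet_stopTime fun t ht => by
        split_ifs
        · exact ((h.toCorralRun s hx).integral_prob ht).1
        · exact StoppedCorralRun.integrableOn_const _ _)
    (fun s _ x hx => integrable_sum_range_stopTime (h.toCorralRun s hx).stop_le
      (h.toCorralRun s hx).measurableSet_stopTime fun t ht => by
        split_ifs
        · exact ((h.toCorralRun s hx).integral_prob ht).2.1
        · exact StoppedCorralRun.integrableOn_const _ _)
    (fun s _ x hx => by
      by_cases hxe : x = xs
      · simp only [if_pos hxe]
        refine integral_sum_range_stopTime_le (h.toCorralRun s hx).stop_le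
          (h.toCorralRun s hx).measurableSet_stopTime fun r hr => ?_
        obtain ⟨n1, n2, n3⟩ := (h.toCorralRun s hx).integral_prob hr
        exact ⟨n1, n2, n3.le⟩
      · simp only [if_neg hxe, le_refl])
  simp only [Nat.sub_add_cancel (h.core_eq _ _).1] at m2 m3
  have hNi : Integrable
      (fun ω => ∑ t ∈ Finset.range T, (if a t ω = xs then (0 : ℝ) else 1)) μ := by
    refine integrable_finsetSum _ fun t ht => Integrable.of_bound (C := 1) ?_
      (ae_of_all _ fun ω => by split_ifs <;> simp)
    exact (Measurable.ite ((h.int.action_measurable t (Finset.mem_range.1 ht)).mono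
      (ℱ.le (t + 1)) le_rfl (measurableSet_singleton xs)) measurable_const
      measurable_const).aestronglyMeasurable
  set N : Ω → ℝ := fun ω => ∑ t ∈ Finset.range T, (if a t ω = xs then (0 : ℝ) else 1) with hN
  set M : Ω → ℝ := fun ω => ∑ t ∈ Finset.range T,
    (if (coreRun X sel len₀ x₁ a t ω).cand = xs then P t ω else 0) with hM
  have hMi : Integrable M μ := m1
  have hMN : ∫ ω, M ω ∂μ ≤ ∫ ω, N ω ∂μ := by
    refine le_trans m3 (integral_mono m2 hNi fun ω => Finset.sum_le_sum fun t _ => ?_)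
    dsimp only
    by_cases hcx : (coreRun X sel len₀ x₁ a t ω).cand = xs
    · rw [if_pos hcx, hcx]
    · rw [if_neg hcx]
      split_ifs <;> norm_num
  have hpath : ∀ ω, ∑ t ∈ Finset.range T, g (t - (coreRun X sel len₀ x₁ a t ω).n)
      (coreRun X sel len₀ x₁ a t ω).cand (coreRun X sel len₀ x₁ a t ω).n ω ≤
      451 * (len₀ + 14 * (len₀ / y + y * (len₀ + N ω + M ω))) := by
    intro ω
    have e : ∀ t, g (t - (coreRun X sel len₀ x₁ a t ω).n) (coreRun X sel len₀ x₁ a t ω).cand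
        (coreRun X sel len₀ x₁ a t ω).n ω =
        451 * roundCost X sel len₀ (x₁ ω) (fun r => a r ω) xs (fun t => P t ω) t := by
      intro t
      set σ := coreRun X sel len₀ x₁ a t ω with hσ
      have hnt : t - σ.n + σ.n = t := Nat.sub_add_cancel (h.core_eq t ω).1
      -- within an epoch, the beginning and the candidate do not change
      have e1 : ∀ k ≤ σ.n, P (t - σ.n + k) ω = q (t - σ.n) σ.cand k ω := by
        intro k hk
        obtain ⟨e2, e3⟩ := epochCore_eq_shift (X := X) (sel := sel) (len₀ := len₀) (x₁ := x₁ ω)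
          (a := fun r => a r ω) (t - σ.n) σ.n (by rw [hnt]; rfl) k hk
        rw [hnt] at e3
        have e2' : (coreRun X sel len₀ x₁ a (t - σ.n + k) ω).n = k := e2
        have e3' : (coreRun X sel len₀ x₁ a (t - σ.n + k) ω).cand = σ.cand := e3
        simp only [hP, followProb, e2', e3', Nat.add_sub_cancel]
        rfl
      have e4 : ∀ m ≤ σ.n + 1, ∑ k ∈ Finset.range m, q (t - σ.n) σ.cand k ω =
          ∑ k ∈ Finset.range m, P (t - σ.n + k) ω := fun m hm =>
        Finset.sum_congr rfl fun k hk => (e1 k (by have := Finset.mem_range.1 hk; omega)).symm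
      simp only [hg]
      rw [e4 _ le_rfl, e4 _ (Nat.le_succ _), roundCost]
      congr!
    simp only [e, ← Finset.mul_sum]
    refine mul_le_mul_of_nonneg_left ?_ (by norm_num)
    refine (sum_roundCost_le h.sel_mem hlen1 hxs (fun t => (h.followProb_mem t ω).1)
      (fun t => (h.followProb_mem t ω).2) T).trans ?_
    set S := len₀ + ∑ t ∈ Finset.range T, (if a t ω = xs then (0 : ℝ) else 1) + M ω with hS
    have hS0 : 0 ≤ S := by
      have h1 : 0 ≤ ∑ t ∈ Finset.range T, (if a t ω = xs then (0 : ℝ) else 1) :=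
        Finset.sum_nonneg fun t _ => by split_ifs <;> norm_num
      have h2 : 0 ≤ M ω := Finset.sum_nonneg fun t _ => by
        split_ifs
        exacts [(h.followProb_mem t ω).1, le_rfl]
      linarith
    have h1 : 2 * (Real.sqrt len₀ * Real.sqrt S) ≤ len₀ / y + y * S := by
      have h2 : len₀ / y + y * S - 2 * (Real.sqrt len₀ * Real.sqrt S) =
          (Real.sqrt len₀ - y * Real.sqrt S) ^ 2 / y := by
        rw [sub_sq, mul_pow, Real.sq_sqrt hS0, Real.sq_sqrt (by linarith)]
        field_simp
        ring
      have h3 : 0 ≤ (Real.sqrt len₀ - y * Real.sqrt S) ^ 2 / y := by positivity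
      linarith
    have h3 : 0 ≤ Real.sqrt len₀ * Real.sqrt S := by positivity
    have h4 : len₀ + 27 * Real.sqrt len₀ * Real.sqrt S ≤ len₀ + 14 * (len₀ / y + y * S) := by
      rw [mul_assoc]; linarith
    refine le_trans (le_of_eq ?_) h4
    congr!
  have hLN : Integrable (fun ω => len₀ + N ω) μ := (integrable_const _).add hNi
  have hLi : Integrable (fun ω => len₀ + N ω + M ω) μ := hLN.add hMi
  have hLi' : Integrable (fun ω => len₀ / y + y * (len₀ + N ω + M ω)) μ :=
    (integrable_const _).add (hLi.const_mul y)
  have hLi'' : Integrable (fun ω => len₀ + 14 * (len₀ / y + y * (len₀ + N ω + M ω))) μ :=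
    (integrable_const _).add (hLi'.const_mul 14)
  refine (k3.trans (integral_mono k2 (hLi''.const_mul 451) hpath)).trans ?_
  rw [integral_const_mul, integral_add (integrable_const _) (hLi'.const_mul 14),
    integral_const_mul, integral_add (integrable_const _) (hLi.const_mul y), integral_const_mul,
    integral_add hLN hMi, integral_add (integrable_const _) hNi]
  simp only [integral_const, probReal_univ, one_smul]
  have hfin : y * (len₀ + ∫ ω, N ω ∂μ + ∫ ω, M ω ∂μ) ≤ y * (len₀ + 2 * ∫ ω, N ω ∂μ) :=
    mul_le_mul_of_nonneg_left (by linarith) hy.le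
  linarith

/-- The regret against the best action of a corrupted stochastic environment bounds the number of
rounds in which it is not played. -/
lemma gap_mul_misses_le [IsProbabilityMeasure μ]
    (h : IsCascadeRun μ X ν T ℱ 𝒢 loss c len₀ sel x₁ i a) {xs : Vec d} {Δ : ℝ} {C : ℕ → ℝ}
    (hs : IsCorruptedStochastic μ X T ℱ loss xs Δ C) :
    Δ * ∫ ω, ∑ t ∈ Finset.range T, (if a t ω = xs then (0 : ℝ) else 1) ∂μ ≤
      pseudoRegret μ T loss a xs + ∑ t ∈ Finset.range T, C t := by
  obtain ⟨hxs, -, hC, hgap⟩ := hs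
  have key := fun s x (hx : x ∈ X) r (hr : r < T - s) =>
    (h.toCorralRun s hx).integral_gap_le hr hxs (hC (s + r) (by omega))
      (hgap (s + r) (by omega))
  obtain ⟨k1, -, k3⟩ := h.integral_le_of_epochs
    (f := fun s _ r ω => (if a (s + r) ω = xs then 0 else Δ) - C (s + r))
    (g := fun s _ r ω => loss (s + r) ω (a (s + r) ω) - loss (s + r) ω xs)
    (fun s _ x hx => integrable_sum_range_stopTime (h.toCorralRun s hx).stop_le
      (h.toCorralRun s hx).measurableSet_stopTime fun r hr => (key s x hx r hr).1)
    (fun s _ x hx => h.integrable_epoch_regret hxs s hx)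
    (fun s _ x hx => integral_sum_range_stopTime_le (h.toCorralRun s hx).stop_le
      (h.toCorralRun s hx).measurableSet_stopTime fun r hr => ⟨(key s x hx r hr).1,
        ((h.toCorralRun s hx).integral_regret hr hxs).1, (key s x hx r hr).2⟩)
  simp only [Nat.sub_add_cancel (h.core_eq _ _).1] at k1 k3
  have e : (fun ω => ∑ t ∈ Finset.range T, (if a t ω = xs then 0 else Δ)) = fun ω =>
      ∑ t ∈ Finset.range T, ((if a t ω = xs then 0 else Δ) - C t) +
        ∑ t ∈ Finset.range T, C t := by
    funext ω
    rw [Finset.sum_sub_distrib, sub_add_cancel]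
  have e2 : ∫ ω, ∑ t ∈ Finset.range T, (if a t ω = xs then 0 else Δ) ∂μ =
      ∫ ω, ∑ t ∈ Finset.range T, ((if a t ω = xs then 0 else Δ) - C t) ∂μ +
        ∑ t ∈ Finset.range T, C t := by
    rw [e, integral_add k1 (integrable_const _)]
    simp
  rw [← integral_const_mul]
  simp only [Finset.mul_sum, mul_ite, mul_zero, mul_one]
  rw [e2]
  exact add_le_add k3 le_rfl

end IsCascadeRun

/-! ### The two regimes -/

lemma IsLinearEnvironment.integrable_sub {d : ℕ} {Ω : Type u} [mΩ : MeasurableSpace Ω]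
    {μ : Measure Ω} [IsProbabilityMeasure μ] {X : Finset (Vec d)} {T : ℕ} {ℱ 𝒢 : Filtration ℕ mΩ}
    {loss : ℕ → Ω → Vec d → ℝ} (h : IsLinearEnvironment μ X T ℱ 𝒢 loss) {t : ℕ} (ht : t < T)
    {x u : Vec d} (hx : x ∈ X) (hu : u ∈ X) :
    Integrable (fun ω => loss t ω x - loss t ω u) μ := by
  have key : ∀ y ∈ X, Integrable (fun ω => loss t ω y) μ := fun y hy =>
    Integrable.of_bound (C := 1)
      ((h.measurable t ht y hy).mono (𝒢.le t) le_rfl).aestronglyMeasurable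
      (ae_of_all _ fun ω => abs_le.2 (h.bounded t ht y hy ω))
  exact (key x hx).sub (key u hu)

/-- The expected total gap of an action `u ≠ xs` in a corrupted stochastic environment. -/
lemma IsCorruptedStochastic.gap_le {d : ℕ} {Ω : Type u} [mΩ : MeasurableSpace Ω]
    {μ : Measure Ω} [IsProbabilityMeasure μ] {X : Finset (Vec d)} {T : ℕ} {ℱ 𝒢 : Filtration ℕ mΩ}
    {loss : ℕ → Ω → Vec d → ℝ} {xs : Vec d} {Δ : ℝ} {C : ℕ → ℝ}
    (hs : IsCorruptedStochastic μ X T ℱ loss xs Δ C) (h : IsLinearEnvironment μ X T ℱ 𝒢 loss)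
    {u : Vec d} (hu : u ∈ X) (hne : u ≠ xs) :
    Δ * T - ∑ t ∈ Finset.range T, C t ≤
      ∫ ω, ∑ t ∈ Finset.range T, (loss t ω u - loss t ω xs) ∂μ := by
  obtain ⟨hxs, -, -, hgap⟩ := hs
  have hi := fun t ht => h.integrable_sub (t := t) (Finset.mem_range.1 ht) hu hxs
  rw [integral_finsetSum _ hi]
  have e : Δ * T - ∑ t ∈ Finset.range T, C t = ∑ t ∈ Finset.range T, (Δ - C t) := by
    simp [mul_comm]
  rw [e]
  refine Finset.sum_le_sum fun t ht => ?_
  rw [← integral_condExp (ℱ.le t)]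
  calc Δ - C t = ∫ _, (Δ - C t) ∂μ := by simp
    _ ≤ _ := integral_mono_ae (integrable_const _) integrable_condExp
      (hgap t (Finset.mem_range.1 ht) u hu hne)

/-- Losses differ by at most two. -/
lemma integral_sum_sub_le {Ω : Type u} [MeasurableSpace Ω]
    {μ : Measure Ω} [IsProbabilityMeasure μ] {T : ℕ} {f g : ℕ → Ω → ℝ}
    (hf : ∀ t < T, ∀ ω, f t ω ∈ Set.Icc (-1 : ℝ) 1)
    (hg : ∀ t < T, ∀ ω, g t ω ∈ Set.Icc (-1 : ℝ) 1) :
    ∫ ω, ∑ t ∈ Finset.range T, (f t ω - g t ω) ∂μ ≤ 2 * T := by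
  have hb : ∀ ω, ‖∑ t ∈ Finset.range T, (f t ω - g t ω)‖ ≤ 2 * T := fun ω => by
    refine (norm_sum_le_of_le _ fun t ht => ?_ : _ ≤ ∑ t ∈ Finset.range T, (2 : ℝ)).trans
      (by simp [mul_comm])
    have h1 := hf t (Finset.mem_range.1 ht) ω
    have h2 := hg t (Finset.mem_range.1 ht) ω
    exact abs_le.2 ⟨by linarith [h1.1, h2.2], by linarith [h1.2, h2.1]⟩
  have := norm_integral_le_of_norm_le_const (μ := μ) (ae_of_all μ hb)
  rw [probReal_univ, mul_one] at this
  exact (le_abs_self _).trans this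

/-- If the regret `R` is of the order of `√(G N)` and at least `Δ N - C`, then it is of the order of
`G / Δ + √(G C / Δ)`. -/
lemma self_bounding {R G N Δ C : ℝ} (hG : 0 < G) (hΔ : 0 < Δ) (hΔ4 : Δ ≤ 4) (hC : 0 ≤ C)
    (hR : ∀ y, 0 < y → R ≤ 451 * (G + 14 * (G / y + y * (G + 2 * N)))) (hN : Δ * N ≤ R + C) :
    R ≤ 400000000 * (G / Δ + Real.sqrt (G / Δ * C)) := by
  have hGΔ : 0 < G / Δ := div_pos hG hΔ
  have hG4 : G ≤ 4 * (G / Δ) := by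
    rw [mul_div_assoc', le_div_iff₀ hΔ]
    nlinarith
  have key : ∀ ρ, 0 < ρ → ρ ≤ 1 / 2 →
      R ≤ 2 * (1808 * (G / Δ) + 80000000 * (G / Δ) / ρ + ρ * C) := by
    intro ρ hρ hρ2
    -- as `12628 = 451 * 28`, the term in `N` becomes `ρ * (Δ * N)`
    have h1 := hR (Δ * ρ / 12628) (by positivity)
    have e1 : G / (Δ * ρ / 12628) = 12628 * ((G / Δ) / ρ) := by field_simp
    have e2 : Δ * ρ / 12628 * (G + 2 * N) = ρ * (Δ * G) / 12628 + ρ * (Δ * N) / 6314 := by ring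
    rw [e1, e2] at h1
    have h2 : ρ * (Δ * N) ≤ ρ * (R + C) := mul_le_mul_of_nonneg_left hN hρ.le
    have h3 : ρ * (Δ * G) ≤ 1 / 2 * (4 * (4 * (G / Δ))) := by
      refine mul_le_mul hρ2 ?_ (by positivity) (by norm_num)
      exact mul_le_mul hΔ4 hG4 hG.le (by norm_num)
    have h4 : 0 < G / Δ / ρ := div_pos hGΔ hρ
    rw [mul_div_assoc]
    have h5 : 0 ≤ ρ * C := by positivity
    rcases le_or_gt R 0 with hR0 | hR0
    · refine hR0.trans ?_
      positivity
    · have h6 : ρ * R ≤ 1 / 2 * R := mul_le_mul_of_nonneg_right hρ2 hR0.le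
      linarith
  set s := Real.sqrt (G / Δ * C) with hs
  have hs0 : 0 ≤ s := Real.sqrt_nonneg _
  have hss : s * s = G / Δ * C := Real.mul_self_sqrt (by positivity)
  rcases le_or_gt C (4 * (G / Δ)) with h1 | h1
  · have h2 := key (1 / 2) (by norm_num) le_rfl
    have h3 : C ≤ 2 * s := by
      refine abs_le_of_sq_le_sq' ?_ (by positivity) |>.2
      nlinarith
    linarith
  · -- the best choice of `ρ` balances the last two terms
    have hCp : 0 < C := by linarith
    have hsp : 0 < s := Real.sqrt_pos.2 (by positivity)
    have h2 := key (s / C) (by positivity) (by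
      rw [div_le_iff₀ hCp]
      refine abs_le_of_sq_le_sq' ?_ (by positivity) |>.2
      nlinarith)
    have e1 : G / Δ / (s / C) = s := by
      rw [div_div_eq_mul_div, ← hss, mul_div_assoc, div_self hsp.ne', mul_one]
    rw [mul_div_assoc, e1, div_mul_cancel₀ _ hCp.ne'] at h2
    linarith

namespace IsCascadeRun

variable {d : ℕ} {Ω : Type u} [mΩ : MeasurableSpace Ω] {μ : Measure Ω}
  {X : Finset (Vec d)} {ν : Vec d → Vec d → ℝ} {T : ℕ} {ℱ 𝒢 : Filtration ℕ mΩ}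
  {loss : ℕ → Ω → Vec d → ℝ} {c len₀ : ℝ} {sel : Finset (Vec d) → Vec d} {x₁ : Ω → Vec d}
  {i : ℕ → Ω → Fin 2} {a : ℕ → Ω → Vec d}

/-- The regret in an arbitrary environment. -/
theorem adversarial_regret_le [IsProbabilityMeasure μ]
    (h : IsCascadeRun μ X ν T ℱ 𝒢 loss c len₀ sel x₁ i a) (hlen : len₀ = c * Real.log T)
    {u : Vec d} (hu : u ∈ X) : pseudoRegret μ T loss a u ≤ 4354 * Real.sqrt (c * T) := by
  have hc16 := h.one_le
  -- horizons shorter than `c` are covered by the trivial bound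
  rcases le_or_gt (T : ℝ) c with hT | hT
  · refine (integral_sum_sub_le
      (fun t ht ω => h.env.bounded t ht _ (h.int.action_mem t ht ω) ω)
      fun t ht ω => h.env.bounded t ht u hu ω).trans ?_
    have h1 : (T : ℝ) ≤ Real.sqrt (c * T) := by
      refine Real.le_sqrt_of_sq_le ?_
      rw [sq]
      exact mul_le_mul_of_nonneg_right hT (Nat.cast_nonneg T)
    linarith [Real.sqrt_nonneg (c * T)]
  · refine h.pseudoRegret_le_sqrt ?_ hT.le hu
    have h1 : 1 / 2 ≤ Real.log T := by
      have := Real.log_le_log (by norm_num) (show (2 : ℝ) ≤ T by linarith)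
      linarith [Real.log_two_gt_d9]
    rw [hlen]
    nlinarith

/-- The regret in a corrupted stochastic environment. If the corruption is at least half of the
total gap, then this follows from the bound for arbitrary environments. -/
theorem stochastic_regret_le [IsProbabilityMeasure μ]
    (h : IsCascadeRun μ X ν T ℱ 𝒢 loss c len₀ sel x₁ i a) (hT : 2 ≤ T)
    (hlen : len₀ = c * Real.log T) {xs : Vec d} {Δ : ℝ} {C : ℕ → ℝ}
    (hs : IsCorruptedStochastic μ X T ℱ loss xs Δ C) {u : Vec d} (hu : u ∈ X) :
    pseudoRegret μ T loss a u ≤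
      400000000 * (len₀ / Δ + Real.sqrt (len₀ / Δ * ∑ t ∈ Finset.range T, C t)) := by
  have hc16 := h.one_le
  have hT2 : (2 : ℝ) ≤ T := by exact_mod_cast hT
  have hlg : 0.69 ≤ Real.log T := by
    have := Real.log_le_log (by norm_num) hT2
    linarith [Real.log_two_gt_d9]
  have hlen0 : 0 < len₀ := by rw [hlen]; positivity
  have hcl : c ≤ 1.45 * len₀ := by rw [hlen]; nlinarith
  have ⟨hxs, hΔ, hC, _⟩ := hs
  set S := ∑ t ∈ Finset.range T, C t with hS
  have hS0 : 0 ≤ S := Finset.sum_nonneg fun t ht => hC t (Finset.mem_range.1 ht)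
  rcases le_or_gt (Δ * T / 2) S with h1 | h1
  · refine (h.adversarial_regret_le hlen hu).trans ?_
    have h2 : Real.sqrt (c * T) ≤ 2 * Real.sqrt (len₀ / Δ * S) := by
      refine Real.sqrt_le_iff.2 ⟨by positivity, ?_⟩
      rw [mul_pow, Real.sq_sqrt (by positivity)]
      have h3 : (T : ℝ) ≤ 2 * (S / Δ) := by
        rw [mul_div_assoc', le_div_iff₀ hΔ]
        linarith
      have h4 : c * T ≤ 1.45 * len₀ * (2 * (S / Δ)) :=
        mul_le_mul hcl h3 (by positivity) (by positivity)
      have h5 : 0 ≤ len₀ * (S / Δ) := by positivity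
      have e : len₀ / Δ * S = len₀ * (S / Δ) := by ring
      rw [e]
      linarith
    have h6 : 0 < len₀ / Δ := by positivity
    linarith [Real.sqrt_nonneg (len₀ / Δ * S)]
  · obtain ⟨v, hv, hvne⟩ := Finset.exists_mem_ne (by have := h.two_le; omega : 1 < X.card) xs
    have hΔ4 : Δ ≤ 4 := by
      have h2 := (hs.gap_le h.env hv hvne).trans (integral_sum_sub_le
        (fun t ht ω => h.env.bounded t ht v hv ω) fun t ht ω => h.env.bounded t ht xs hxs ω)
      by_contra hlt
      push Not at hlt
      nlinarith
    have hreg := self_bounding hlen0 hΔ hΔ4 hS0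
      (fun y hy => h.pseudoRegret_le_misses hT hlen hxs hy) (h.gap_mul_misses_le hs)
    by_cases hue : u = xs
    · rw [hue]; exact hreg
    refine le_trans ?_ hreg
    -- `u` is worse than `xs`, so that the regret against `u` is smaller
    have h2 := hs.gap_le h.env hu hue
    have hint : ∀ v ∈ X, Integrable
        (fun ω => ∑ t ∈ Finset.range T, (loss t ω (a t ω) - loss t ω v)) μ := fun v hv =>
      h.integrable_regret hv
    have e : pseudoRegret μ T loss a xs = pseudoRegret μ T loss a u +
        ∫ ω, ∑ t ∈ Finset.range T, (loss t ω u - loss t ω xs) ∂μ := by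
      unfold pseudoRegret
      rw [← integral_add (hint u hu) (integrable_finsetSum _ fun t ht =>
        h.env.integrable_sub (Finset.mem_range.1 ht) hu hxs)]
      simp only [← Finset.sum_add_distrib, sub_add_sub_cancel]
    rw [e]
    linarith

end IsCascadeRun

end

end BestOfBoth

theorem mainTheorem4 :
    ∃ κ κ' K : ℝ, 0 < κ ∧ 0 < κ' ∧ 0 < K ∧
      ∀ (d : ℕ) (X : Finset (Vec d)), 2 ≤ X.card →
        (∀ x ∈ X, ∃ ν : Vec d → ℝ, IsJohnExploration (X.erase x) ν) ∧
        ∀ ν : Vec d → Vec d → ℝ, (∀ x ∈ X, IsJohnExploration (X.erase x) (ν x)) →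
          (∀ x ∈ X, IWStable.{u} (X.erase x) (exp2 (X.erase x) (ν x))
            (κ * (d * Real.log X.card)) (κ * (d * Real.log X.card))) ∧
          ∀ sel : Finset (Vec d) → Vec d, (∀ s : Finset (Vec d), s.Nonempty → sel s ∈ s) →
            ∀ (T : ℕ) (Ω : Type u) [mΩ : MeasurableSpace Ω] (μ : Measure Ω)
              [IsProbabilityMeasure μ] (ℱ 𝒢 : Filtration ℕ mΩ) (loss : ℕ → Ω → Vec d → ℝ)
              (x₁ : Ω → Vec d) (i : ℕ → Ω → Fin 2) (a : ℕ → Ω → Vec d),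
              IsLinearEnvironment μ X T ℱ 𝒢 loss →
              IsInteraction μ X T ℱ 𝒢 loss
                (cascade X ν (κ * (d * Real.log X.card))
                  (κ' * (d * Real.log X.card) * Real.log T) sel) x₁ i a →
              (∀ u ∈ X, pseudoRegret μ T loss a u ≤ K * Real.sqrt (d * T * Real.log X.card)) ∧
              (2 ≤ T → ∀ (xs : Vec d) (Δ : ℝ) (C : ℕ → ℝ),
                IsCorruptedStochastic μ X T ℱ loss xs Δ C →
                ∀ u ∈ X, pseudoRegret μ T loss a u ≤
                  K * (d * Real.log X.card * Real.log T / Δ +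
                    Real.sqrt (d * Real.log X.card * Real.log T / Δ *
                      ∑ t ∈ Finset.range T, C t))) := by
  -- `32400000000 = 81 * 400000000`, the constants of `iwStable_exp2` and `self_bounding`
  refine ⟨81, 81, 32400000000, by norm_num, by norm_num, by norm_num, fun d X hX => ?_⟩
  have hne : ∀ x ∈ X, (X.erase x).Nonempty := fun x hx => by
    rw [← Finset.card_pos, Finset.card_erase_of_mem hx]
    omega
  refine ⟨fun x hx => exists_isJohnExploration (hne x hx), fun ν hν => ⟨fun x hx => ?_, ?_⟩⟩
  · refine iwStable_exp2 (hν x hx) ?_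
    have h1 : (0 : ℝ) < (X.erase x).card := by exact_mod_cast (hne x hx).card_pos
    have h2 : ((X.erase x).card : ℝ) ≤ X.card := by
      exact_mod_cast Finset.card_le_card (Finset.erase_subset x X)
    gcongr
  intro sel hsel T Ω mΩ μ _ ℱ 𝒢 loss x₁ i a henv hint
  set D : ℝ := d * Real.log X.card with hD
  have hd : (1 : ℝ) ≤ d := by exact_mod_cast dim_pos_of_two_le_card hX
  have hl : Real.log 2 ≤ Real.log X.card :=
    Real.log_le_log (by norm_num) (by exact_mod_cast hX)
  have hD0 : 0.69 ≤ D := by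
    have h1 := mul_le_mul hd hl (Real.log_nonneg (by norm_num)) (by linarith)
    linarith [Real.log_two_gt_d9]
  have h : IsCascadeRun μ X ν T ℱ 𝒢 loss (81 * D) (81 * D * Real.log T) sel x₁ i a :=
    { two_le := hX, john := hν, sel_mem := hsel, one_le := by linarith, const_le := le_rfl,
      env := henv, int := hint }
  have hD' : 0 ≤ D := by linarith
  refine ⟨fun u hu => (h.adversarial_regret_le rfl hu).trans ?_, fun hT xs Δ C hs u hu =>
    (h.stochastic_regret_le hT rfl hs hu).trans ?_⟩
  · have e : Real.sqrt (81 * D * T) = 9 * Real.sqrt (d * T * Real.log X.card) := by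
      rw [show 81 * D * T = 9 ^ 2 * (d * T * Real.log X.card) by rw [hD]; ring,
        Real.sqrt_mul (by norm_num), Real.sqrt_sq (by norm_num)]
    rw [e]
    linarith [Real.sqrt_nonneg (d * T * Real.log X.card)]
  · have hS : 0 ≤ ∑ t ∈ Finset.range T, C t :=
      Finset.sum_nonneg fun t ht => hs.2.2.1 t (Finset.mem_range.1 ht)
    have hΔ := hs.2.1
    have hlg : 0 ≤ Real.log T := Real.log_natCast_nonneg T
    have hR : 0 ≤ Real.sqrt (D * Real.log T / Δ * ∑ t ∈ Finset.range T, C t) :=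
      Real.sqrt_nonneg _
    have e : 81 * D * Real.log T / Δ = 9 ^ 2 * (D * Real.log T / Δ) := by ring
    rw [e, mul_assoc (9 ^ 2 : ℝ), Real.sqrt_mul (by norm_num), Real.sqrt_sq (by norm_num)]
    linarith
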